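/- **Extended Gottesman–Knill Theorem.** *Conventions.* An adaptive Clifford circuit on $N$ qubits is a sequence of steps, each of which is a gate $H$, $S$ or $CX$ (or the identity) or a non-destructive $Z$ measurement of one line (with outcome $\pm1$). The $i$-th step is a function of $i$, of the outcomes of the previous measurements and of a uniformly random bit string. Each measurement is an output measurement, or internal (its outcome may be used for adaptation but is not output), or postselected to outcome $+1$. The output distribution is the joint distribution of the outcomes of the output measurements, conditioned on all postselected measurements giving $+1$. The circuit is *non-adaptive* if no step depends on previous outcomes, and *unitary* if it is a fixed list of gates followed by $Z$ measurements of distinct lines, each of them an output or a postselected measurement. A (mixed or pure) $n$-qubit stabiliser state is $\sigma=2^{-(n-s)}\prod_{i=1}^s\frac{I+S_i}{2}$, where $S_1,\dots,S_s$ are independent generators of a stabiliser group, i.e. of a commuting group of $n$-qubit Pauli operators that does not contain $-I$. Consider adaptive Clifford circuits $\mathcal C$ on $n+t$ qubits with input $\sigma\otimes\rho$, where $\sigma$ is a stabiliser state of $n$ qubits, given by generators, and $\rho$ is an arbitrary state of $t$ qubits. Suppose that they are uniformly described: there are one fixed program and one polynomial $p$ such that each circuit has at most $p(n+t)$ steps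 and random bits and a description of size at most $p(n+t)$, from which the program computes each step, given its index, the previous outcomes and the random bits, in time at most $p(n+t)$. Then, in each of the cases below, there are fixed classical programs that do the following within time polynomial in $n+t$, for a uniformly random bit string $r$ of length polynomial in $n+t$. From the description of $\mathcal C$ and $\sigma$, and from $r$, one program computes a description of an adaptive Clifford circuit $\mathcal C^*_r$ on $t$ qubits, whose steps are again computed within this time from that description by a fixed program, and which has at most $t$ (intermediate or final) measurements in every run. A further program computes a string $\mathrm{post}(r,m)$ from the same data and from an output $m$ of $\mathcal C^*_r$. Neither $\mathcal C^*_r$ nor $\mathrm{post}$ depends on $\rho$. (i) If $\mathcal C$ has no postselection then neither has $\mathcal C^*_r$, and for every state $\rho$, if $r$ is chosen uniformly at random and $\mathcal C^*_r$ is run on input $\rho$ with output $m$, then $\mathrm{post}(r,m)$ is distributed exactly as the output of $\mathcal C$ on $\sigma\otimes\rho$. (ii) If moreover $\mathcal C$ is non-adaptive, then (i) holds with all $\mathcal C^*_r$ unitary (with $Z$ measurements only for outputs, at the end). (iii) Suppose that some of the $Z$ measurements of $\mathcal C$ are postselected to outcome $+1$, and let $\rho$ be any state for which this postselection has positive probability.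 Then, with some of the $Z$ measurements of $\mathcal C^*_r$ postselected to outcome $+1$, the following holds. The hybrid process (choose $r$ uniformly at random, run $\mathcal C^*_r$ on $\rho$, output $\mathrm{post}(r,m)$), conditioned as a whole on all postselected measurements of $\mathcal C^*_r$ giving $+1$, an event of positive probability, has exactly the output distribution of $\mathcal C$ on $\sigma\otimes\rho$. Only if $t\le1$ may $\mathrm{post}$ also reject a run, and then the conditioning is also on the run not being rejected. If $\mathcal C$ is non-adaptive and uses no random bits, then, for every $t$, all $\mathcal C^*_r$ can be taken to be unitary, with no rejection and without conditioning $r$: for every $r$ the postselection in $\mathcal C^*_r$ has positive probability, and if $r$ is chosen uniformly and $m$ is drawn from the (postselected) output distribution of $\mathcal C^*_r$ on $\rho$, then $\mathrm{post}(r,m)$ has exactly the output distribution of $\mathcal C$ on $\sigma\otimes\rho$. -/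

import Mathlib

open scoped Matrix ComplexOrder

noncomputable section

namespace EGK

/-! ### Classical computation with a step count

A structured programming language over binary trees.  Every elementary operation is charged at
least the full size of the data it is applied to (as if it were copied on the tape of a
machine), so the cost of a run bounds the size of all the data that occur in it, and the cost
is polynomially related to the running time of a multi-tape Turing machine. -/

/-- Binary trees, the data on which programs work. -/
inductive Data : Type
  | nil : Data
  | cons : Data → Data → Data

/-- The number of nodes. -/
def Data.size : Data → ℕ
  | .nil => 1
  | .cons a b => a.size + b.size + 1

/-- First component (`nil` has none, and gives `nil`). -/
def Data.hd : Data → Data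
  | .nil => .nil
  | .cons a _ => a

/-- Second component (`nil` has none, and gives `nil`). -/
def Data.tl : Data → Data
  | .nil => .nil
  | .cons _ b => b

/-- Programs; each one transforms a datum into a datum. -/
inductive Prog : Type
  | nil : Prog
  | skip : Prog
  | hd : Prog
  | tl : Prog
  | pair : Prog → Prog → Prog
  | comp : Prog → Prog → Prog
  | cond : Prog → Prog → Prog → Prog
  | loop : Prog → Prog → Prog

/-- `Runs P x y k`: on input `x` the program `P` halts with output `y` at cost `k`.
`nil` is the value "false" of a test, everything else is "true"; `comp f g` is `f` after `g`;
`loop c f` applies `f` as long as the test `c` is true. -/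
inductive Runs : Prog → Data → Data → ℕ → Prop
  | nil (x : Data) : Runs .nil x .nil (x.size + 1)
  | skip (x : Data) : Runs .skip x x (x.size + 1)
  | hd (x : Data) : Runs .hd x x.hd (x.size + 1)
  | tl (x : Data) : Runs .tl x x.tl (x.size + 1)
  | pair {f g : Prog} {x a b : Data} {k l : ℕ} :
      Runs f x a k → Runs g x b l → Runs (.pair f g) x (.cons a b) (x.size + k + l + 1)
  | comp {f g : Prog} {x y z : Data} {k l : ℕ} :
      Runs g x y k → Runs f y z l → Runs (.comp f g) x z (k + l + 1)
  | cond_false {c f g : Prog} {x y : Data} {k l : ℕ} :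
      Runs c x .nil k → Runs g x y l → Runs (.cond c f g) x y (x.size + k + l + 1)
  | cond_true {c f g : Prog} {x a b y : Data} {k l : ℕ} :
      Runs c x (.cons a b) k → Runs f x y l → Runs (.cond c f g) x y (x.size + k + l + 1)
  | loop_false {c f : Prog} {x : Data} {k : ℕ} :
      Runs c x .nil k → Runs (.loop c f) x x (x.size + k + 1)
  | loop_true {c f : Prog} {x a b y z : Data} {k l m : ℕ} :
      Runs c x (.cons a b) k → Runs f x y l → Runs (.loop c f) y z m →
      Runs (.loop c f) x z (x.size + k + l + m + 1)

/-- Types whose elements are coded as data. -/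
class Encode (α : Type) where
  enc : α → Data

/-! ### Pauli operators, Clifford gates and stabiliser states

The computational basis of `N` qubits is `Fin N → Bool`, with `false` for 0 and `true` for 1.
A Pauli measurement outcome is a `Bool`: `false` stands for `+1` and `true` for `-1`. -/

/-- Operators on `N` qubits. -/
abbrev Op (N : ℕ) : Type := Matrix (Fin N → Bool) (Fin N → Bool) ℂ

/-- A density operator. -/
def IsState {N : ℕ} (ρ : Op N) : Prop := ρ.PosSemidef ∧ ρ.trace = 1

inductive Pauli : Type
  | I | X | Y | Z

def Pauli.mat : Pauli → Matrix Bool Bool ℂ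
  | .I => 1
  | .X => fun a b => if a = b then 0 else 1
  | .Y => fun a b => if a = b then 0 else if a then Complex.I else -Complex.I
  | .Z => fun a b => if a = b then (if a then -1 else 1) else 0

/-- A Pauli string with a sign, `-` if `neg` is true. -/
structure SPauli (N : ℕ) where
  neg : Bool
  letter : Fin N → Pauli

def SPauli.op {N : ℕ} (S : SPauli N) : Op N :=
  fun x y => (if S.neg then -1 else 1) * ∏ i, (S.letter i).mat (x i) (y i)

/-- The list consists of independent generators of a stabiliser group: they commute, and no
product of a nonempty set of them is the identity (independence) or minus the identity. -/
def IsStabGens {N : ℕ} (g : List (SPauli N)) : Prop :=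
  (∀ S ∈ g, ∀ S' ∈ g, S.op * S'.op = S'.op * S.op) ∧
  ∀ l : List (SPauli N), l.Sublist g → l ≠ [] →
    (l.map SPauli.op).prod ≠ 1 ∧ (l.map SPauli.op).prod ≠ -1

/-- The stabiliser state `2 ^ (-(N - s)) ∏ (1 + S_i) / 2` of the generators `S_1, …, S_s`,
which is pure for `s = N` and mixed for `s < N`. -/
def stabState {N : ℕ} (g : List (SPauli N)) : Op N :=
  ((2 : ℂ) ^ (N - g.length))⁻¹ • (g.map fun S => (2 : ℂ)⁻¹ • (1 + S.op)).prod

/-- `σ ⊗ ρ`, with `σ` on the first `n` lines and `ρ` on the last `t` lines. -/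
def tensor {n t : ℕ} (σ : Op n) (ρ : Op t) : Op (n + t) := fun x y =>
  σ (fun i => x (Fin.castAdd t i)) (fun i => y (Fin.castAdd t i)) *
    ρ (fun i => x (Fin.natAdd n i)) (fun i => y (Fin.natAdd n i))

/-- The basic Clifford gates. -/
inductive Gate (N : ℕ) : Type
  | H (q : Fin N) : Gate N
  | S (q : Fin N) : Gate N
  | CX (control target : Fin N) (hne : control ≠ target) : Gate N

/-- The one-qubit operator `u` on line `q`. -/
def onLine {N : ℕ} (q : Fin N) (u : Matrix Bool Bool ℂ) : Op N :=
  fun x y => if ∀ j, j ≠ q → x j = y j then u (x q) (y q) else 0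

def Gate.op {N : ℕ} : Gate N → Op N
  | .H q => onLine q fun a b => ((Real.sqrt 2 : ℝ) : ℂ)⁻¹ * (if a && b then -1 else 1)
  | .S q => onLine q fun a b => if a = b then (if a then Complex.I else 1) else 0
  | .CX c q _ => fun x y => if x = Function.update y q (xor (y q) (y c)) then 1 else 0

/-- The projector of the outcome `b` of the measurement of `Z` on line `q`. -/
def projZ {N : ℕ} (q : Fin N) (b : Bool) : Op N :=
  onLine q fun a a' => if a = b ∧ a' = b then 1 else 0

/-! ### Adaptive Clifford circuits -/

/-- The role of a measurement: its outcome is part of the output, or it is not part of the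
output (but may still be used for adaptation), or it is postselected to outcome `+1`. -/
inductive Role : Type
  | output | internal | postselected

/-- A step of a circuit: a gate, or a nondestructive `Z` measurement, or the identity. -/
inductive Instr (N : ℕ) : Type
  | idle : Instr N
  | gate (u : Gate N) : Instr N
  | meas (q : Fin N) (role : Role) : Instr N

/-- An adaptive Clifford circuit on `N` qubits.  Its `i`-th step is a function of the outcomes
of the previous measurements (`history`, in order of time) and of a uniformly random string of
`coins` bits. -/
structure Circuit (N : ℕ) where
  length : ℕ
  coins : ℕ
  step : (i : ℕ) → (history : List Bool) → (random : List Bool) → Instr N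

/-- The measurements made so far, in order of time, with their roles and outcomes. -/
abbrev Record : Type := List (Role × Bool)

def Record.history (m : Record) : List Bool := m.map Prod.snd

open Classical in
/-- The outcomes of the output measurements. -/
def Record.output (m : Record) : List Bool :=
  (m.filter fun e => e.1 = Role.output).map Prod.snd

/-- All postselected measurements have given `+1`. -/
def Record.Accepted (m : Record) : Prop := ∀ e ∈ m, e.1 = Role.postselected → e.2 = false

/-- The possible successors of a record with its (unnormalised) state, for one step. -/
def Instr.apply {N : ℕ} (s : Instr N) (m : Record) (α : Op N) : List (Record × Op N) :=
  match s with
  | .idle => [(m, α)]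
  | .gate u => [(m, u.op * α * (u.op)ᴴ)]
  | .meas q role => [false, true].map fun b => (m ++ [(role, b)], projZ q b * α * projZ q b)

/-- The branches after `i` steps: every possible record, with the unnormalised state whose
trace is its probability. -/
def Circuit.branches {N : ℕ} (C : Circuit N) (random : List Bool) (α : Op N) :
    ℕ → List (Record × Op N)
  | 0 => [([], α)]
  | i + 1 => (C.branches random α i).flatMap fun b =>
      (C.step i b.1.history random).apply b.1 b.2

open Classical in
/-- The probability that all postselected measurements give `+1` and the output is in `E`. -/
def Circuit.weight {N : ℕ} (C : Circuit N) (α : Op N) (E : Set (List Bool)) : ℝ :=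
  (2 ^ C.coins : ℝ)⁻¹ * ∑ r : Fin C.coins → Bool,
    ((C.branches (List.ofFn r) α C.length).map fun b =>
      if b.1.Accepted ∧ b.1.output ∈ E then b.2.trace.re else 0).sum

/-- The output distribution: the probability that the output is in `E`, given that all
postselected measurements give `+1`.  Without postselection it is just `C.weight α E`. -/
def Circuit.outProb {N : ℕ} (C : Circuit N) (α : Op N) (E : Set (List Bool)) : ℝ :=
  C.weight α E / C.weight α Set.univ

/-- No measurement is postselected. -/
def Circuit.NoPost {N : ℕ} (C : Circuit N) : Prop :=
  ∀ i < C.length, ∀ h r : List Bool, h.length ≤ i → r.length = C.coins →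
    ∀ q, C.step i h r ≠ .meas q .postselected

/-- No step depends on previous measurement outcomes. -/
def Circuit.NonAdaptive {N : ℕ} (C : Circuit N) : Prop :=
  ∀ i < C.length, ∀ h₁ h₂ r : List Bool, h₁.length ≤ i → h₂.length ≤ i → r.length = C.coins →
    C.step i h₁ r = C.step i h₂ r

/-- In no run of the circuit are there more than `k` measurements, of whatever role. -/
def Circuit.AtMostMeas {N : ℕ} (C : Circuit N) (k : ℕ) : Prop :=
  ∀ (r : Fin C.coins → Bool) (α : Op N),
    ∀ b ∈ C.branches (List.ofFn r) α C.length, b.1.length ≤ k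

/-- The circuit of the given gates followed by `Z` measurements of the given lines. -/
def Circuit.ofUnitary {N : ℕ} (gates : List (Gate N)) (final : List (Fin N × Role)) :
    Circuit N where
  length := gates.length + final.length
  coins := 0
  step i _ _ :=
    ((gates.map Instr.gate ++ final.map fun e => Instr.meas e.1 e.2)[i]?).getD .idle

/-- A unitary circuit, with `Z` measurements of distinct lines only at the end, none of them
with an outcome that is discarded. -/
def Circuit.IsUnitary {N : ℕ} (C : Circuit N) : Prop :=
  ∃ (gates : List (Gate N)) (final : List (Fin N × Role)),
    (final.map Prod.fst).Nodup ∧ (∀ e ∈ final, e.2 ≠ Role.internal) ∧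
    C = Circuit.ofUnitary gates final

/-! ### Descriptions of circuits, and simulation -/

def encList : List Data → Data
  | [] => .nil
  | a :: l => .cons a (encList l)

/-- The natural number `k` in unary. -/
def encNat (k : ℕ) : Data := encList (List.replicate k .nil)

instance : Encode Data := ⟨fun a => a⟩
instance : Encode Bool := ⟨fun b => if b then .cons .nil .nil else .nil⟩
instance : Encode ℕ := ⟨encNat⟩
instance (N : ℕ) : Encode (Fin N) := ⟨fun i => encNat i⟩
instance {α β : Type} [Encode α] [Encode β] : Encode (α × β) :=
  ⟨fun a => .cons (Encode.enc a.1) (Encode.enc a.2)⟩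
instance {α : Type} [Encode α] : Encode (List α) := ⟨fun l => encList (l.map Encode.enc)⟩
instance {α : Type} [Encode α] : Encode (Option α) :=
  ⟨fun a => a.elim .nil fun v => .cons .nil (Encode.enc v)⟩
instance : Encode Pauli := ⟨fun
  | .I => encNat 0
  | .X => encNat 1
  | .Y => encNat 2
  | .Z => encNat 3⟩
instance (N : ℕ) : Encode (SPauli N) :=
  ⟨fun S => Encode.enc (S.neg, List.ofFn S.letter)⟩
instance : Encode Role := ⟨fun
  | .output => encNat 0
  | .internal => encNat 1
  | .postselected => encNat 2⟩
instance (N : ℕ) : Encode (Gate N) := ⟨fun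
  | .H q => .cons (encNat 0) (Encode.enc q)
  | .S q => .cons (encNat 1) (Encode.enc q)
  | .CX c q _ => .cons (encNat 2) (Encode.enc (c, q))⟩
instance (N : ℕ) : Encode (Instr N) := ⟨fun
  | .idle => .nil
  | .gate u => .cons (encNat 0) (Encode.enc u)
  | .meas q role => .cons (encNat 1) (Encode.enc (q, role))⟩

/-- On the input `a` the program `P` gives the output `b`, at a cost of at most `T`. -/
def Prog.Computes {α β : Type} [Encode α] [Encode β] (P : Prog) (a : α) (b : β) (T : ℕ) : Prop :=
  ∃ k ≤ T, Runs P (Encode.enc a) (Encode.enc b) k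

/-- The description of a circuit: its numbers of qubits, of steps and of random bits, and a
datum `d` from which a fixed program (see `DescribedBy`) determines the steps. -/
def Circuit.code {N : ℕ} (C : Circuit N) (d : Data) : ℕ × ℕ × ℕ × Data :=
  (N, C.length, C.coins, d)

/-- The program `P` interprets `C.code d` as the circuit `C`, with bound `T`: the number of
steps, the number of random bits and the size of `d` are at most `T`, and each step is computed
by `P` from the description, the index of the step, the previous outcomes and the random bits,
in time at most `T`.  A uniform family of adaptive circuits is thus given by one program `P`,
with one polynomial in the number of qubits as the bound `T`. -/
def Circuit.DescribedBy {N : ℕ} (C : Circuit N) (P : Prog) (d : Data) (T : ℕ) : Prop :=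
  C.length ≤ T ∧ C.coins ≤ T ∧ d.size ≤ T ∧
  ∀ i < C.length, ∀ h r : List Bool, h.length ≤ i → r.length = C.coins →
    P.Computes (C.code d, i, h, r) (C.step i h r) T

/-- The classical side of a simulation of the circuit `C`, with stabiliser input generated by
`g`, by circuits on `t` qubits with at most `t` measurements, in time `T` and with `l` random
bits.  From the description of `C` and its stabiliser input and the random string `r`,
the program `Tr` computes a description of the circuit `D r`, which the program `Ctl`
interprets; from the same data and an output `m` of `D r`, the program `Post` computes
`post r m`. -/
def Compiles {n t : ℕ} {β : Type} [Encode β] (Tr Ctl Post : Prog) (T l : ℕ)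
    (g : List (SPauli n)) (C : Circuit (n + t)) (d : Data)
    (D : (Fin l → Bool) → Circuit t) (post : (Fin l → Bool) → List Bool → β) : Prop :=
  ∀ r : Fin l → Bool,
    (∃ d' : Data, Tr.Computes ((n, g, C.code d), List.ofFn r) ((D r).code d') T ∧
      (D r).DescribedBy Ctl d' T) ∧
    (D r).AtMostMeas t ∧
    ∀ m : List Bool, m.length ≤ t →
      Post.Computes ((n, g, C.code d), List.ofFn r, m) (post r m) T

/-- The output of `C` on the input `α` is distributed as the output of the following process:
choose `r` uniformly at random, run `D r` on `ρ` to get `m`, and output `post r m`. -/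
def SameOutput {N t l : ℕ} (C : Circuit N) (α : Op N) (D : (Fin l → Bool) → Circuit t)
    (ρ : Op t) (post : (Fin l → Bool) → List Bool → List Bool) : Prop :=
  ∀ y : List Bool, C.outProb α {y} =
    (2 ^ l : ℝ)⁻¹ * ∑ r : Fin l → Bool, (D r).outProb ρ {m | post r m = y}

/-- The same for a process that is postselected as a whole: choose `r` uniformly at random and
run `D r` on `ρ` to get `m`; then condition on the event that all postselected measurements of
`D r` give `+1` and `post r m` is not `none` (which means that the run is rejected). -/
def SamePostselectedOutput {N t l : ℕ} (C : Circuit N) (α : Op N)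
    (D : (Fin l → Bool) → Circuit t) (ρ : Op t)
    (post : (Fin l → Bool) → List Bool → Option (List Bool)) : Prop :=
  0 < ∑ r : Fin l → Bool, (D r).weight ρ {m | post r m ≠ none} ∧
  ∀ y : List Bool, C.outProb α {y} =
    (∑ r : Fin l → Bool, (D r).weight ρ {m | post r m = some y}) /
      ∑ r : Fin l → Bool, (D r).weight ρ {m | post r m ≠ none}

end EGK

end

noncomputable section
set_option linter.unusedSimpArgs false
namespace EGK

/-! ### Polynomial-time computation -/

/-! At every time the simulated state is `U B Uᴴ`. The Clifford unitary `U` is known classically, as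
a product of quarter turns `exp (i π/4 T)` about Pauli strings `T` (`frame`); `B` is held by the
real device. On some lines, the known ones, `B` is supported on recorded values. At the start the
known lines are those of the stabiliser state, which is a uniform mixture of states `U |v⟩`
(`absorbAll_repr`, `tensor_stabState`), and the `t` lines of `ρ` are unknown.

A gate is multiplied into `U`. A measurement of `Z` on line `q` is a measurement of the Pauli
operator `Q = Uᴴ Z U` on `B`, and three cases occur. If `Q` anticommutes with the `Z` of a known
line, both outcomes have probability 1/2, and on `B` the projector acts as a quarter turn divided by
`√2`: a coin is tossed and `U` is extended (`coin_sound`). If `Q` is a product of `Z` on known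
lines, the outcome is computed (`det_sound`). Otherwise gates on unknown lines turn `Q` into the `Z`
of one unknown line `j` times `Z` of known lines; the device applies these gates and measures `j`,
and `j` becomes known (`real_sound`). Each real measurement uses up an unknown line, so there are at
most `t`. `run_eq_avgL_sim` combines the cases: a run of the circuit is the mean of runs of the
engine over its coins.

For adaptive circuits the device consists of `t` blocks with one real measurement each, and the
outcomes so far determine the next block (`run_device`). Under postselection the acceptance of a run
is known for both values of the last outcome before it is measured, so rejection can be moved into a
postselection of the last measurement. If both values lead to rejection, an impossible outcome of
the line measured first is postselected; this needs an earlier measurement, hence `2 ≤ t`.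

For non-adaptive circuits every measurement is deferred: its result is copied to a fresh ancilla,
and the ancillas are measured at the end, the postselected ones first and the internal ones not at
all (`run_defer`). The engine then has to deal with a fixed Clifford frame and a list of
measurements. Which gates and lines the real device uses depends only on the Pauli strings up to
sign and on which lines are known, not on outcomes (`plans_congr`); later gates avoid measured
lines, so all gates can come first. Postselections that are not real contribute a constant factor
(`exists_avgL_sim_eq`, `value_eq`), which does not depend on the random string. This gives a unitary
circuit (`exists_run_eq_fixed`).

Polynomial time rests on the relation `PT` and its instance `FP`, closed under composition and under
loops with polynomially bounded accumulators. The engine qualifies because each step enlarges its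
state by at most `growth N` (`sz_step`). -/

theorem Data.size_pos (x : Data) : 0 < x.size := by
  cases x <;> simp [Data.size]

theorem Data.size_hd_le (x : Data) : x.hd.size ≤ x.size := by
  cases x <;> simp [Data.size, Data.hd]; omega

theorem Data.size_tl_le (x : Data) : x.tl.size ≤ x.size := by
  cases x <;> simp [Data.size, Data.tl]; omega

/-- Every rule charges at least the size of its input, and an output is built from outputs of
subruns or parts of the input. A time bound is thus also a bound on the sizes of input and output.
-/
theorem Runs.size_le {P : Prog} {x y : Data} {k : ℕ} (h : Runs P x y k) :
    x.size ≤ k ∧ y.size ≤ k := by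
  induction h with
  | hd x => have := x.size_hd_le; omega
  | tl x => have := x.size_tl_le; omega
  | nil x => simp [Data.size]
  | pair _ _ h1 h2 => simp only [Data.size]; omega
  | _ => omega

theorem eval_mono (q : Polynomial ℕ) {a b : ℕ} (h : a ≤ b) : q.eval a ≤ q.eval b := by
  simp only [Polynomial.eval_eq_sum_range]
  gcongr

/-- `f` is bounded by a polynomial in `s`. -/
def PolyBdd {ι : Type*} (s f : ι → ℕ) : Prop := ∃ q : Polynomial ℕ, ∀ i, f i ≤ q.eval (s i)

section PolyBdd
variable {ι : Type*} {s f g : ι → ℕ}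

theorem PolyBdd.mono (h : PolyBdd s g) (hf : ∀ i, f i ≤ g i) : PolyBdd s f :=
  h.imp fun _ hq i => (hf i).trans (hq i)

theorem PolyBdd.const (c : ℕ) : PolyBdd s fun _ => c := ⟨.C c, fun i => by simp⟩

theorem PolyBdd.self : PolyBdd s s := ⟨.X, fun i => by simp⟩

theorem PolyBdd.add (hf : PolyBdd s f) (hg : PolyBdd s g) : PolyBdd s fun i => f i + g i := by
  obtain ⟨p, hp⟩ := hf
  obtain ⟨q, hq⟩ := hg
  exact ⟨p + q, fun i => by simpa using Nat.add_le_add (hp i) (hq i)⟩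

theorem PolyBdd.mul (hf : PolyBdd s f) (hg : PolyBdd s g) : PolyBdd s fun i => f i * g i := by
  obtain ⟨p, hp⟩ := hf
  obtain ⟨q, hq⟩ := hg
  exact ⟨p * q, fun i => by simpa using Nat.mul_le_mul (hp i) (hq i)⟩

theorem PolyBdd.eval (hf : PolyBdd s f) (q : Polynomial ℕ) : PolyBdd s fun i => q.eval (f i) := by
  obtain ⟨p, hp⟩ := hf
  exact ⟨q.comp p, fun i => by simpa using eval_mono q (hp i)⟩

theorem PolyBdd.comap {κ : Type*} (h : PolyBdd s f) (φ : κ → ι) :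
    PolyBdd (fun k => s (φ k)) fun k => f (φ k) := h.imp fun _ hq k => hq (φ k)

end PolyBdd

def sz {α : Type} [Encode α] (a : α) : ℕ := (Encode.enc a).size

/-- One program computes `b i` from `a i` for all `i`, in time polynomial in `s i`. -/
def PT {ι : Type*} {α β : Type} [Encode α] [Encode β] (s : ι → ℕ) (a : ι → α) (b : ι → β) : Prop :=
  ∃ (P : Prog) (q : Polynomial ℕ), ∀ i, P.Computes (a i) (b i) (q.eval (s i))

/-- `f` is computable in polynomial time. -/
@[fun_prop] def FP {α β : Type} [Encode α] [Encode β] (f : α → β) : Prop := PT sz id f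

/-! ### Closure of polynomial time under composition, pairing and conditionals -/

section PT
variable {ι : Type*} {α β γ δ : Type} [Encode α] [Encode β] [Encode γ] [Encode δ] {s : ι → ℕ}
  {a : ι → α} {b : ι → β} {c : ι → γ}

theorem PT.of_bdd (P : Prog) (h : ∃ T : ι → ℕ, PolyBdd s T ∧ ∀ i, P.Computes (a i) (b i) (T i)) :
    PT s a b := by
  obtain ⟨T, ⟨q, hq⟩, h⟩ := h
  exact ⟨P, q, fun i => (h i).imp fun k hk => ⟨hk.1.trans (hq i), hk.2⟩⟩

theorem PT.bdd_left (h : PT s a b) : PolyBdd s fun i => sz (a i) := by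
  obtain ⟨P, q, h⟩ := h
  exact ⟨q, fun i => by obtain ⟨k, hk, hr⟩ := h i; exact hr.size_le.1.trans hk⟩

theorem PT.bdd_right (h : PT s a b) : PolyBdd s fun i => sz (b i) := by
  obtain ⟨P, q, h⟩ := h
  exact ⟨q, fun i => by obtain ⟨k, hk, hr⟩ := h i; exact hr.size_le.2.trans hk⟩

theorem PT.comp (h : PT s a b) (h' : PT s b c) : PT s a c := by
  obtain ⟨P, p, h⟩ := h
  obtain ⟨Q, q, h'⟩ := h'
  refine ⟨.comp Q P, p + q + 1, fun i => ?_⟩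
  obtain ⟨k, hk, hr⟩ := h i
  obtain ⟨l, hl, hr'⟩ := h' i
  exact ⟨k + l + 1, by simp; omega, .comp hr hr'⟩

theorem PT.refl (h : PolyBdd s fun i => sz (a i)) : PT s a a :=
  .of_bdd .skip ⟨_, h.add (.const 1), fun _ => ⟨_, le_rfl, .skip _⟩⟩

theorem PT.pair (h : PT s a b) (h' : PT s a c) : PT s a fun i => (b i, c i) := by
  obtain ⟨r, hr⟩ := h.bdd_left
  obtain ⟨P, p, h⟩ := h
  obtain ⟨Q, q, h'⟩ := h'
  refine ⟨.pair P Q, r + p + q + 1, fun i => ?_⟩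
  obtain ⟨k, hk, h1⟩ := h i
  obtain ⟨l, hl, h2⟩ := h' i
  have := hr i
  exact ⟨_, by simp [sz] at *; omega, .pair h1 h2⟩

theorem PT.comap {κ : Type*} (h : PT s a b) (φ : κ → ι) :
    PT (fun k => s (φ k)) (fun k => a (φ k)) fun k => b (φ k) := by
  obtain ⟨P, q, h⟩ := h
  exact ⟨P, q, fun i => h _⟩

theorem PT.mono {s' : ι → ℕ} (h : PT s a b) (hs : PolyBdd s' s) : PT s' a b := by
  obtain ⟨P, q, h⟩ := h
  exact .of_bdd P ⟨_, hs.eval q, h⟩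

/-- The time of `f` is polynomial in the size of `b i`, which is polynomial in `s i` since `b i` has
been computed within such a time. -/
theorem PT.fp {f : β → γ} (h : PT s a b) (hf : FP f) : PT s a fun i => f (b i) := by
  exact h.comp ((PT.comap hf b).mono h.bdd_right)

/-- Programs see encodings only. A structure can thus be exchanged for the tuple of its fields, and
an element of a dependent type for an untyped code. -/
theorem PT.congr {α' β' : Type} [Encode α'] [Encode β'] {a' : ι → α'} {b' : ι → β'}
    (h : PT s a b) (ha : ∀ i, Encode.enc (a' i) = Encode.enc (a i))
    (hb : ∀ i, Encode.enc (b' i) = Encode.enc (b i)) : PT s a' b' := by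
  obtain ⟨P, q, h⟩ := h
  exact ⟨P, q, fun i => by simpa [Prog.Computes, ha, hb] using h i⟩

theorem FP.bdd {f : α → β} (h : FP f) : PolyBdd sz fun a => sz (f a) := PT.bdd_right h

theorem FP.of_enc {f : α → β} (hf : ∀ a, Encode.enc (f a) = Encode.enc a) : FP f :=
  ⟨.skip, .X + 1, fun i => ⟨sz i + 1, by simp, by rw [hf]; exact .skip _⟩⟩

@[fun_prop] theorem FP.self : FP fun a : α => a := .of_enc fun _ => rfl

@[fun_prop] theorem FP.comp {f : β → γ} {g : α → β} (hf : FP f) (hg : FP g) :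
    FP fun a => f (g a) := PT.fp hg hf

theorem FP.comp' {f : β → γ} {g : α → β} (hg : FP g) (hf : FP f) : FP fun a => f (g a) := PT.fp hg hf

@[fun_prop] theorem FP.prodMk {f : α → β} {g : α → γ} (hf : FP f) (hg : FP g) :
    FP fun a => (f a, g a) := PT.pair hf hg

theorem FP.congr {f g : α → β} (h : FP f) (hg : ∀ a, g a = f a) : FP g := by
  rwa [show g = f from funext hg]

def Prog.const : Data → Prog
  | .nil => .nil
  | .cons a b => .pair (.const a) (.const b)

theorem Prog.runs_const (d x : Data) : ∃ k ≤ d.size * (x.size + 1), Runs (.const d) x d k := by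
  induction d with
  | nil => exact ⟨_, by simp [Data.size], .nil x⟩
  | cons a b ha hb =>
    obtain ⟨k, hk, ha⟩ := ha
    obtain ⟨l, hl, hb⟩ := hb
    exact ⟨_, by simp only [Data.size]; nlinarith, .pair ha hb⟩

@[fun_prop] theorem FP.const (b : β) : FP fun _ : α => b := PT.of_bdd (.const (Encode.enc b)) ⟨fun a =>
  (Encode.enc b).size * (sz a + 1), .mul (.const _) (.add .self (.const _)), fun _ => Prog.runs_const _ _⟩

theorem FP.fst' : FP (Prod.fst : α × β → α) :=
  ⟨.hd, .X + 1, fun i => ⟨_, by simp [sz], .hd _⟩⟩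

theorem FP.snd' : FP (Prod.snd : α × β → β) :=
  ⟨.tl, .X + 1, fun i => ⟨_, by simp [sz], .tl _⟩⟩

@[fun_prop] theorem FP.fst {f : α → β × γ} (hf : FP f) : FP fun a => (f a).1 := hf.comp' FP.fst'

@[fun_prop] theorem FP.snd {f : α → β × γ} (hf : FP f) : FP fun a => (f a).2 := hf.comp' FP.snd'

theorem FP.hd' : FP Data.hd := ⟨.hd, .X + 1, fun i => ⟨_, by simp [sz], .hd _⟩⟩

theorem FP.tl' : FP Data.tl := ⟨.tl, .X + 1, fun i => ⟨_, by simp [sz], .tl _⟩⟩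

@[fun_prop] theorem FP.hd {f : α → Data} (hf : FP f) : FP fun a => (f a).hd := hf.comp' FP.hd'

@[fun_prop] theorem FP.tl {f : α → Data} (hf : FP f) : FP fun a => (f a).tl := hf.comp' FP.tl'

@[fun_prop] theorem FP.cond {t : α → Bool} {f g : α → β} (ht : FP t) (hf : FP f) (hg : FP g) :
    FP fun a => cond (t a) (f a) (g a) := by
  obtain ⟨P, p, ht⟩ := ht
  obtain ⟨Q, q, hf⟩ := hf
  obtain ⟨R, r, hg⟩ := hg
  refine PT.of_bdd (.cond P Q R) ⟨fun a => sz a + p.eval (sz a) + q.eval (sz a) + r.eval (sz a) + 1, .add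
    (.add (.add (.add .self ⟨p, fun _ => le_rfl⟩) ⟨q, fun _ => le_rfl⟩) ⟨r, fun _ => le_rfl⟩) (.const 1), fun
    a => ?_⟩
  obtain ⟨k, hk, ht⟩ := ht a
  obtain ⟨l, hl, hf⟩ := hf a
  obtain ⟨m, hm, hg⟩ := hg a
  cases h : t a
  · rw [h] at ht
    exact ⟨_, by simp only [sz, id_eq] at *; omega, .cond_false ht hg⟩
  · rw [h] at ht
    exact ⟨_, by simp only [sz, id_eq] at *; omega, .cond_true ht hf⟩

theorem FP.finite_bool {f : Bool → β} : FP f :=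
  (FP.cond (.self (α := Bool)) (.const (f true)) (.const (f false))).congr fun a => by cases a <;> rfl

end PT

/-! ### Loops -/

/-- The program which folds `F` over a list. -/
def Prog.fold (F : Prog) : Prog :=
  .loop .hd (.pair (.comp .tl .hd) (.pair (.comp .hd .tl)
    (.comp F (.pair (.comp .hd .tl) (.pair (.comp .hd .hd) (.comp .tl .tl))))))

/-- The datum consists of the remaining list, the environment and the accumulator. One pass is a run
of `F` and a fixed number of projections and pairings of data of size at most `M`, whence the
constants. -/
theorem Runs.fold {F : Prog} {env : Data} {B M : ℕ} (l : List Data) (acc : ℕ → Data) (hM : ∀ k ≤ l.length,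
    (encList l).size + env.size + (acc k).size + 3 ≤ M) (h : ∀ k (hk : k < l.length), ∃ c ≤ B, Runs F (.cons
    env (.cons l[k] (acc k))) (acc (k + 1)) c) : ∃ c ≤ (l.length + 1) * (40 * M + B + 40), Runs F.fold (.cons
    (encList l) (.cons env (acc 0)))
      (.cons .nil (.cons env (acc l.length))) c := by
  induction l generalizing acc with
  | nil =>
    have := hM 0 le_rfl
    exact ⟨_, by simp only [encList, Data.size, List.length_nil] at *; omega, .loop_false (.hd _)⟩
  | cons a l ih =>
    have h0 := hM 0 (Nat.zero_le _)
    obtain ⟨c, hc, hr⟩ := h 0 (by simp)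
    obtain ⟨c', hc', hr'⟩ := ih (fun k => acc (k + 1))
      (fun k hk => by
        have := hM (k + 1) (by simpa using hk)
        simp only [encList, Data.size] at this; omega)
      fun k hk => h (k + 1) (by simpa using hk)
    have ha := a.size_pos
    refine ⟨_, ?_, Runs.loop_true (.hd _) (.pair (.comp (.hd _) (.tl _)) (.pair (.comp (.tl _) (.hd _)) (.comp
      (.pair (.comp (.tl _) (.hd _)) (.pair (.comp (.hd _) (.hd _)) (.comp (.tl _) (.tl _)))) hr))) hr'⟩
    simp only [List.length_cons, Data.size, Data.hd, Data.tl, encList] at *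
    rw [Nat.succ_mul]
    omega

theorem encList_length_le (l : List Data) : l.length + 1 ≤ (encList l).size := by
  induction l with
  | nil => simp [encList, Data.size]
  | cons a l ih => have := a.size_pos; simp only [encList, Data.size, List.length_cons]; omega

theorem size_le_encList {l : List Data} {a : Data} (h : a ∈ l) : a.size ≤ (encList l).size := by
  induction l with
  | nil => simp at h
  | cons b l ih =>
    simp only [encList, Data.size]
    rcases List.mem_cons.1 h with rfl | h
    · omega
    · have := ih h; omega

section
variable {ι : Type*} {α β γ δ : Type} [Encode α] [Encode β] [Encode γ] [Encode δ] {s : ι → ℕ}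

theorem length_lt_sz (l : List α) : l.length < sz l := by
  have := encList_length_le (l.map Encode.enc)
  rw [List.length_map] at this
  exact this

theorem sz_le_of_mem {l : List α} {a : α} (h : a ∈ l) : sz a ≤ sz l :=
  size_le_encList (List.mem_map_of_mem (f := Encode.enc) h)

theorem sz_pair (a : α) (b : β) : sz (a, b) = sz a + sz b + 1 := rfl

theorem sz_nil : sz ([] : List α) = 1 := rfl

theorem sz_cons (a : α) (l : List α) : sz (a :: l) = sz a + sz l + 1 := rfl

theorem sz_pos (a : α) : 0 < sz a := Data.size_pos _

theorem sz_bool (b : Bool) : sz b ≤ 3 := by cases b <;> simp [sz, Encode.enc, Data.size]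

theorem sz_le_of_all {l : List α} {c : ℕ} (h : ∀ a ∈ l, sz a ≤ c) :
    sz l ≤ l.length * (c + 1) + 1 := by
  induction l with
  | nil => simp [sz_nil]
  | cons a l ih =>
    have h1 := ih fun b hb => h b (List.mem_cons_of_mem _ hb)
    have h2 := h a (by simp)
    rw [sz_cons, List.length_cons, Nat.succ_mul]; omega

/-- `acc i k` is the accumulator after `k` passes. The bound on all of them is a separate
hypothesis: a body that doubles its data runs in polynomial time, but its iterates do not. -/
theorem PT.loop {env : ι → γ} {l : ι → List δ} {acc : ι → ℕ → β} (hl : PolyBdd s fun i => sz (l i)) (henv :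
    PolyBdd s fun i => sz (env i)) (hacc : PolyBdd (ι := Σ i, Fin ((l i).length + 1)) (fun x => s x.1) fun x
    => sz (acc x.1 x.2)) (h : PT (ι := Σ i, Fin (l i).length) (fun x => s x.1) (fun x => (env x.1, (l
    x.1)[x.2], acc x.1 x.2)) fun x => acc x.1 (x.2 + 1)) :
    PT s (fun i => (l i, env i, acc i 0)) fun i => acc i (l i).length := by
  obtain ⟨F, q, h⟩ := h
  obtain ⟨r, hr⟩ := hacc
  refine PT.of_bdd (.comp .tl (.comp .tl F.fold)) ⟨fun i =>
    (sz (l i) + 1) * (40 * (sz (l i) + sz (env i) + r.eval (s i) + 3) + q.eval (s i) + 40) +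
    (2 * (sz (env i) + r.eval (s i)) + 10),
    .add (.mul (hl.add (.const _)) (.add (.add (.mul (.const _) (.add (.add (hl.add henv)
      ⟨r, fun _ => le_rfl⟩) (.const _))) ⟨q, fun _ => le_rfl⟩) (.const _)))
      (.add (.mul (.const _) (henv.add ⟨r, fun _ => le_rfl⟩)) (.const _)), fun i => ?_⟩
  obtain ⟨c, hc, hrun⟩ := Runs.fold (F := F) (env := Encode.enc (env i)) (B := q.eval (s i)) (M := sz (l i) +
    sz (env i) + r.eval (s i) + 3) ((l i).map Encode.enc) (fun k => Encode.enc (acc i k))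
    (fun k hk => by
      have := hr ⟨i, k, by simpa [Nat.lt_succ_iff] using hk⟩
      have e : sz (l i) = (encList ((l i).map Encode.enc)).size := rfl
      simp only [sz] at *; omega)
    (fun k hk => by
      have hk' : k < (l i).length := by simpa using hk
      obtain ⟨c, hc, hr⟩ := h ⟨i, k, hk'⟩
      exact ⟨c, hc, by rw [List.getElem_map]; exact hr⟩)
  rw [List.length_map] at hrun hc
  refine ⟨_, ?_, .comp (.comp hrun (.tl _)) (.tl _)⟩
  have h1 := hr ⟨i, (l i).length, by simp⟩
  have h2 := length_lt_sz (l i)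
  have h3 : ((l i).length + 1) * (40 * (sz (l i) + sz (env i) + r.eval (s i) + 3) + q.eval (s i) + 40)
    ≤ (sz (l i) + 1) * (40 * (sz (l i) + sz (env i) + r.eval (s i) + 3) + q.eval (s i) + 40) := by
    gcongr
  simp only [Data.size, Data.tl] at *
  simp only [sz] at h1 h2 h3 hc ⊢
  omega

theorem FP.foldl_of_bdd {l : α → List δ} {b : α → β} {f : α → β → δ → β} (hl : FP l) (hb : FP b) (hf : FP fun
    p : α × δ × β => f p.1 p.2.2 p.2.1) (hs : ∃ q : Polynomial ℕ, ∀ a, ∀ k ≤ (l a).length, sz (((l a).take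
    k).foldl (f a) (b a)) ≤ q.eval (sz a)) :
    FP fun a => (l a).foldl (f a) (b a) := by
  obtain ⟨q, hq⟩ := hs
  have h0 : PT sz (id : α → α) fun a => (l a, a, b a) := hl.prodMk (FP.self.prodMk hb)
  refine h0.comp ?_
  have hacc : PolyBdd (ι := Σ a, Fin ((l a).length + 1)) (fun x => sz x.1) (fun x => sz (((l x.1).take
      x.2).foldl (f x.1) (b x.1))) := ⟨q, fun x => hq x.1 x.2 (Nat.lt_succ_iff.1 x.2.2)⟩
  have := PT.loop (s := sz) (env := fun a => a) (l := l)
    (acc := fun a k => ((l a).take k).foldl (f a) (b a)) hl.bdd .self hacc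
    (by
      have h1 : PolyBdd (ι := Σ a, Fin (l a).length) (fun x => sz x.1) fun x =>
          sz (x.1, (l x.1)[x.2], ((l x.1).take x.2).foldl (f x.1) (b x.1)) := by
        refine PolyBdd.mono (.add (.add .self (.add (hl.bdd.comap Sigma.fst)
          ⟨q, fun x => hq x.1 x.2 x.2.2.le⟩)) (.const 2)) fun x => ?_
        have := sz_le_of_mem (List.getElem_mem (l := (l x.1)) x.2.2)
        simp only [sz_pair, Fin.getElem_fin]
        omega
      refine ((PT.refl h1).fp hf).congr (fun _ => rfl) fun x => ?_
      congr 1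
      dsimp only
      rw [List.take_add_one, List.getElem?_eq_getElem x.2.2, List.foldl_append]
      rfl)
  simpa using this

/-- The increase in size per pass is bounded independently of the accumulator, so sizes grow only
linearly with the number of passes. -/
theorem FP.foldl {l : α → List δ} {b : α → β} {f : α → β → δ → β} (hl : FP l) (hb : FP b)
    (hf : FP fun p : α × δ × β => f p.1 p.2.2 p.2.1)
    (hs : ∃ q : Polynomial ℕ, ∀ a b d, sz (f a b d) ≤ sz b + q.eval (sz a + sz d)) :
    FP fun a => (l a).foldl (f a) (b a) := by
  refine .foldl_of_bdd hl hb hf ?_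
  obtain ⟨q, hq⟩ := hs
  have : PolyBdd (ι := α) sz fun a => sz (b a) + sz (l a) * q.eval (sz a + sz (l a)) :=
    hb.bdd.add (hl.bdd.mul (PolyBdd.eval (.add .self hl.bdd) q))
  refine this.imp fun r hr a k hk => le_trans ?_ (hr a)
  have key : ∀ (l' : List δ) (b' : β), (∀ d ∈ l', sz d ≤ sz (l a)) →
      sz (l'.foldl (f a) b') ≤ sz b' + l'.length * q.eval (sz a + sz (l a)) := by
    intro l'
    induction l' with
    | nil => intro b' _; simp
    | cons d l' ih =>
      intro b' hd
      have h1 := ih (f a b' d) fun x hx => hd x (by simp [hx])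
      have h2 := hq a b' d
      have h3 := eval_mono q (show sz a + sz d ≤ sz a + sz (l a) by
        have := hd d (by simp); omega)
      rw [List.foldl_cons, List.length_cons, Nat.succ_mul]
      omega
  refine (key _ _ fun d hd => sz_le_of_mem (List.mem_of_mem_take hd)).trans ?_
  have := length_lt_sz (l a)
  exact Nat.add_le_add_left (Nat.mul_le_mul_right _ (by simp; omega)) _

end

/-! ### Polynomial-time functions on Booleans, numbers and lists -/

section
variable {α β γ δ : Type} [Encode α] [Encode β] [Encode γ] [Encode δ]

theorem FP.of_data {f : α → β} (h : FP fun a => Encode.enc (f a)) : FP f :=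
  PT.congr h (fun _ => rfl) fun _ => rfl

theorem FP.enc : FP (Encode.enc : α → Data) := .of_enc fun _ => rfl

@[fun_prop] theorem FP.enc_comp {f : α → β} (h : FP f) : FP fun a => Encode.enc (f a) := h.comp' .enc

@[fun_prop] theorem FP.not {f : α → Bool} (hf : FP f) : FP fun a => !f a := hf.comp' .finite_bool

@[fun_prop] theorem FP.and {f g : α → Bool} (hf : FP f) (hg : FP g) : FP fun a => f a && g a :=
  (hf.cond hg (.const false)).congr fun a => by cases f a <;> rfl

@[fun_prop] theorem FP.or {f g : α → Bool} (hf : FP f) (hg : FP g) : FP fun a => f a || g a :=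
  (hf.cond (.const true) hg).congr fun a => by cases f a <;> rfl

@[fun_prop] theorem FP.xor {f g : α → Bool} (hf : FP f) (hg : FP g) : FP fun a => (f a ^^ g a) :=
  (hf.cond hg.not hg).congr fun a => by cases f a <;> cases g a <;> rfl

@[fun_prop] theorem FP.cons {f : α → β} {l : α → List β} (hf : FP f) (hl : FP l) : FP fun a => f a :: l a :=
    PT.congr (hf.prodMk hl) (fun _ => rfl) fun _ => rfl

theorem FP.tail' : FP (List.tail : List α → List α) :=
  PT.congr (FP.enc (α := List α)).tl (fun _ => rfl) fun l => by cases l <;> rfl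

@[fun_prop] theorem FP.tail {l : α → List β} (hl : FP l) : FP fun a => (l a).tail := hl.comp' .tail'

theorem FP.isEmpty' : FP (List.isEmpty : List α → Bool) := by
  refine PT.of_bdd (.cond .skip .nil (.const (.cons .nil .nil))) ⟨fun l => 10 * (sz l + 1),
    .mul (.const _) (.add .self (.const _)), fun l => ?_⟩
  cases l with
  | nil => exact ⟨_, by simp [sz, Encode.enc, encList, Data.size],
      .cond_false (.skip _) (.pair (.nil _) (.nil _))⟩
  | cons a l =>
    exact ⟨_, by simp only [sz, id]; omega, .cond_true (.skip _) (.nil _)⟩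

@[fun_prop] theorem FP.isEmpty {l : α → List β} (hl : FP l) : FP fun a => (l a).isEmpty := hl.comp' .isEmpty'

@[fun_prop] theorem FP.headD {l : α → List β} {d : α → β} (hl : FP l) (hd : FP d) :
    FP fun a => (l a).headD (d a) :=
  .of_data <| (hl.isEmpty.cond hd.enc_comp hl.enc_comp.hd).congr fun a => by
    cases l a <;> rfl

@[fun_prop] theorem FP.map {l : α → List δ} {f : α → δ → β} (hl : FP l)
    (hf : FP fun p : α × δ => f p.1 p.2) : FP fun a => (l a).map (f a) := by
  have h1 : FP fun p : α × δ × List β => f p.1 p.2.1 := hf.comp (.prodMk (by fun_prop) (by fun_prop))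
  have hrev : FP (List.reverse : List β → List β) := by
    refine (FP.foldl (l := fun l : List β => l) (b := fun _ => []) (f := fun _ b d => d :: b)
      .self (.const _) (by fun_prop) ⟨.X + 1, fun a b d => ?_⟩).congr fun l => ?_
    · simp [sz_cons]; omega
    · simp
  refine ((FP.foldl (b := fun _ => []) (f := fun a b d => f a d :: b) hl (.const _)
    (by fun_prop) ?_).comp' hrev).congr fun a => by simp
  obtain ⟨q, hq⟩ := hf.bdd
  refine ⟨q.comp (.X + 1) + 1, fun a b d => ?_⟩
  have := hq (a, d)
  simp only [sz_pair] at this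
  simp [sz_cons]; omega

theorem FP.reverse' : FP (List.reverse : List α → List α) := by
  refine (FP.foldl (l := fun l : List α => l) (b := fun _ => []) (f := fun _ b d => d :: b)
      .self (.const _) (by fun_prop) ⟨.X + 1, fun a b d => ?_⟩).congr fun l => ?_
  · simp [sz_cons]; omega
  · simp

@[fun_prop] theorem FP.reverse {l : α → List β} (hl : FP l) : FP fun a => (l a).reverse := hl.comp' .reverse'

@[fun_prop] theorem FP.append {l m : α → List β} (hl : FP l) (hm : FP m) :
    FP fun a => l a ++ m a := by
  refine (FP.foldl (l := fun a => (l a).reverse) (f := fun _ b d => d :: b) hl.reverse hm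
    (by fun_prop) ⟨.X + 1, fun a b d => ?_⟩).congr fun a => by simp
  simp [sz_cons]; omega

theorem sz_append (l m : List α) : sz (l ++ m) + 1 = sz l + sz m := by
  induction l with
  | nil => simp [sz_nil]; omega
  | cons a l ih => simp only [List.cons_append, sz_cons]; omega

@[fun_prop] theorem FP.filter {l : α → List δ} {f : α → δ → Bool} (hl : FP l)
    (hf : FP fun p : α × δ => f p.1 p.2) : FP fun a => (l a).filter (f a) := by
  have h1 : FP fun p : α × δ × List δ => f p.1 p.2.1 := hf.comp (.prodMk (by fun_prop) (by fun_prop))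
  refine (FP.foldl (l := fun a => (l a).reverse) (b := fun _ => [])
    (f := fun a b d => _root_.cond (f a d) (d :: b) b) hl.reverse (.const _) (by fun_prop)
    ⟨.X + 1, fun a b d => ?_⟩).congr fun a => ?_
  · cases f a d <;> simp [sz_cons]; omega
  · rw [List.foldl_reverse]
    induction l a with
    | nil => rfl
    | cons x l ih => cases h : f a x <;> simp [h, ih]

@[fun_prop] theorem FP.flatMap {l : α → List δ} {f : α → δ → List β} (hl : FP l)
    (hf : FP fun p : α × δ => f p.1 p.2) : FP fun a => (l a).flatMap (f a) := by
  have h1 : FP fun p : α × δ × List β => f p.1 p.2.1 := hf.comp (.prodMk (by fun_prop) (by fun_prop))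
  obtain ⟨q, hq⟩ := hf.bdd
  refine (FP.foldl (l := fun a => (l a).reverse) (b := fun _ => [])
    (f := fun a b d => f a d ++ b) hl.reverse (.const _) (by fun_prop)
    ⟨q.comp (.X + 1), fun a b d => ?_⟩).congr fun a => ?_
  · have h1 := hq (a, d)
    have h2 := sz_append (f a d) b
    simp only [sz_pair] at h1
    simp; omega
  · rw [List.foldl_reverse]
    induction l a with
    | nil => rfl
    | cons x l ih => simp [ih]

/-! Numbers are unary, that is, lists. -/

def unary (n : ℕ) : List Data := List.replicate n .nil

@[simp] theorem length_unary (n : ℕ) : (unary n).length = n := by simp [unary]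

@[fun_prop] theorem FP.toUnary {f : α → ℕ} (hf : FP f) : FP fun a => unary (f a) :=
  hf.comp' (.of_enc fun n => by simp [unary, Encode.enc, encNat])

theorem sz_nat (n : ℕ) : sz n = 2 * n + 1 := by
  induction n with
  | zero => rfl
  | succ n ih =>
    have : sz (n + 1) = 1 + sz n + 1 := rfl
    omega

@[fun_prop] theorem FP.succ {f : α → ℕ} (hf : FP f) : FP fun a => f a + 1 :=
  PT.congr (FP.prodMk (.const Data.nil) hf) (fun _ => rfl) fun _ => rfl

theorem FP.length' : FP (List.length : List α → ℕ) := by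
  refine (FP.foldl (l := fun l : List α => l) (b := fun _ => 0) (f := fun _ b _ => b + 1)
      .self (.const _) (by fun_prop) ⟨2, fun a b d => ?_⟩).congr fun l => ?_
  · simp [sz_nat]; omega
  · generalize h : 0 = k
    rw [show l.length = l.length + k by omega]
    clear h
    induction l generalizing k with
    | nil => simp
    | cons a l ih => rw [List.foldl_cons, ← ih, List.length_cons]; omega

@[fun_prop] theorem FP.length {l : α → List β} (hl : FP l) : FP fun a => (l a).length := hl.comp' .length'

@[fun_prop] theorem FP.add {f g : α → ℕ} (hf : FP f) (hg : FP g) : FP fun a => f a + g a :=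
  (hf.toUnary.append hg.toUnary).length.congr fun a => by simp

@[fun_prop] theorem FP.drop {f : α → ℕ} {l : α → List β} (hf : FP f) (hl : FP l) :
    FP fun a => (l a).drop (f a) := by
  refine (FP.foldl (l := fun a => unary (f a)) (f := fun _ b _ => b.tail) hf.toUnary hl
    (by fun_prop) ⟨0, fun a b d => ?_⟩).congr fun a => ?_
  · cases b <;> simp [sz_cons, sz_nil]; omega
  · generalize l a = l
    unfold unary
    induction f a generalizing l with
    | zero => rfl
    | succ n ih => rw [List.replicate_succ, List.foldl_cons, ← ih]; simp

@[fun_prop] theorem FP.getD {f : α → ℕ} {l : α → List β} {d : α → β} (hl : FP l) (hf : FP f)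
    (hd : FP d) : FP fun a => (l a).getD (f a) (d a) :=
  ((FP.drop hf hl).headD hd).congr fun a => by
    rw [List.getD_eq_getElem?_getD, List.headD_eq_head?_getD, List.head?_drop]

@[fun_prop] theorem FP.sub {f g : α → ℕ} (hf : FP f) (hg : FP g) : FP fun a => f a - g a :=
  (FP.drop hg hf.toUnary).length.congr fun a => by simp

@[fun_prop] theorem FP.mul {f g : α → ℕ} (hf : FP f) (hg : FP g) : FP fun a => f a * g a := by
  have : FP fun p : α × Data => unary (g p.1) := (hg.comp .fst').toUnary
  refine ((FP.flatMap (f := fun a _ => unary (g a)) hf.toUnary this).length).congr fun a => ?_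
  simp [unary]

@[fun_prop] theorem FP.decide_le {f g : α → ℕ} (hf : FP f) (hg : FP g) : FP fun a => decide (f a ≤ g a) :=
  (hf.sub hg).toUnary.isEmpty.congr fun a => by
    rw [Bool.eq_iff_iff, List.isEmpty_iff_length_eq_zero]; simp; omega

@[fun_prop] theorem FP.decide_lt {f g : α → ℕ} (hf : FP f) (hg : FP g) : FP fun a => decide (f a < g a) :=
    hf.succ.decide_le hg

@[fun_prop] theorem FP.decide_eq {f g : α → ℕ} (hf : FP f) (hg : FP g) : FP fun a => decide (f a = g a) :=
  ((hf.decide_le hg).and (hg.decide_le hf)).congr fun a => by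
    rw [Bool.eq_iff_iff]; simp [le_antisymm_iff]

-- The length of the list built so far serves as the counter. The increment depends on the
-- accumulator here, so the intermediate sizes are bounded directly.
@[fun_prop] theorem FP.range {f : α → ℕ} (hf : FP f) : FP fun a => List.range (f a) := by
  refine ((FP.foldl_of_bdd (l := fun a => unary (f a)) (b := fun _ => ([] : List ℕ))
    (f := fun _ b _ => b.length :: b) hf.toUnary (.const _) (by fun_prop) ?_).reverse).congr
    fun a => ?_
  · obtain ⟨q, hq⟩ := hf.bdd
    have : PolyBdd (ι := α) sz fun a => sz (f a) * (2 * sz (f a) + 2) + 1 :=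
      .add (.mul hf.bdd (.add (.mul (.const _) hf.bdd) (.const _))) (.const _)
    refine this.imp fun r hr a k hk => le_trans ?_ (hr a)
    have key : ∀ l : List Data, (∀ x ∈ (l.foldl (fun b _ => b.length :: b) ([] : List ℕ)),
        x < l.length) ∧ (l.foldl (fun b _ => b.length :: b) ([] : List ℕ)).length = l.length := by
      intro l
      induction l using List.reverseRecOn with
      | nil => simp
      | append_singleton l a ih =>
        rw [List.foldl_append]
        refine ⟨fun x hx => ?_, by simp [ih.2]⟩
        rw [List.foldl_cons, List.foldl_nil, List.mem_cons] at hx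
        rw [List.length_append, List.length_singleton]
        rcases hx with rfl | hx
        · rw [ih.2]; omega
        · have := ih.1 x hx; omega
    obtain ⟨k1, k2⟩ := key ((unary (f a)).take k)
    refine (sz_le_of_all (c := 2 * sz (f a) + 1) fun x hx => ?_).trans ?_
    · have h1 := k1 x hx
      rw [length_unary] at hk
      rw [List.length_take, length_unary] at h1
      simp only [sz_nat]; omega
    · rw [k2, List.length_take, length_unary]
      have : min k (f a) ≤ sz (f a) := by rw [sz_nat]; omega
      exact Nat.add_le_add_right (Nat.mul_le_mul_right _ this) _
  · have key : ∀ n, (unary n).foldl (fun b _ => b.length :: b) ([] : List ℕ)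
        = (List.range n).reverse := by
      intro n
      induction n with
      | zero => rfl
      | succ n ih =>
        rw [unary, List.replicate_succ', List.foldl_append]
        unfold unary at ih
        rw [ih]; simp [List.range_succ]
    rw [key, List.reverse_reverse]

@[fun_prop] theorem FP.replicate {f : α → ℕ} {d : α → β} (hf : FP f) (hd : FP d) :
    FP fun a => List.replicate (f a) (d a) := by
  have : FP fun p : α × Data => d p.1 := hd.comp .fst'
  exact (FP.map (f := fun a _ => d a) hf.toUnary this).congr fun a => by simp [unary]

@[fun_prop] theorem FP.take {f : α → ℕ} {l : α → List β} (hf : FP f) (hl : FP l) :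
    FP fun a => (l a).take (f a) :=
  (FP.reverse (FP.drop (hl.length.sub hf) hl.reverse)).congr fun a => by
    rw [List.drop_reverse, List.reverse_reverse]
    rcases le_total (f a) (l a).length with h | h
    · rw [Nat.sub_sub_self h]
    · rw [Nat.sub_eq_zero_of_le h, Nat.sub_zero, List.take_length, List.take_of_length_le h]

theorem FP.foldl_bool {l : α → List δ} {b : α → Bool} {f : α → Bool → δ → Bool} (hl : FP l) (hb : FP b) (hf :
    FP fun p : α × δ × Bool => f p.1 p.2.2 p.2.1) : FP fun a => (l a).foldl (f a) (b a) :=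
  .foldl hl hb hf ⟨3, fun a b d => by have := sz_bool (f a b d); simp; omega⟩

/-- Families over the lines are lists indexed by natural numbers, with a default value, and not
functions on `Fin N`: lists are data, and one program has to serve all numbers of lines. -/
def tab {α : Type} (N : ℕ) (f : ℕ → α) : List α := (List.range N).map f

def par (N : ℕ) (f : ℕ → Bool) : Bool := (List.range N).foldl (fun b i => b ^^ f i) false

@[fun_prop] theorem FP.tab {N : α → ℕ} {f : α → ℕ → β} (hN : FP N) (hf : FP fun p : α × ℕ => f p.1 p.2) : FP
    fun a => tab (N a) (f a) := FP.map hN.range hf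

@[fun_prop] theorem FP.par {N : α → ℕ} {f : α → ℕ → Bool} (hN : FP N)
    (hf : FP fun p : α × ℕ => f p.1 p.2) : FP fun a => par (N a) (f a) := by
  have h1 : FP fun p : α × ℕ × Bool => f p.1 p.2.1 := hf.comp (.prodMk (by fun_prop) (by fun_prop))
  exact .foldl_bool hN.range (.const _) (by fun_prop)

theorem getD_tab {α : Type} {N i : ℕ} (hi : i < N) (f : ℕ → α) (d : α) :
    (tab N f).getD i d = f i := by
  simp [tab, hi]

theorem par_succ (N : ℕ) (f : ℕ → Bool) : par (N + 1) f = (par N f ^^ f N) := by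
  simp [par, List.range_succ]

theorem par_congr {N : ℕ} {f g : ℕ → Bool} (h : ∀ i < N, f i = g i) : par N f = par N g := by
  induction N with
  | zero => rfl
  | succ N ih => rw [par_succ, par_succ, ih fun i hi => h i (by omega), h N (by omega)]

theorem par_xor (N : ℕ) (f g : ℕ → Bool) :
    par N (fun i => f i ^^ g i) = (par N f ^^ par N g) := by
  induction N with
  | zero => rfl
  | succ N ih =>
    rw [par_succ, par_succ, par_succ, ih]
    cases par N f <;> cases par N g <;> cases f N <;> cases g N <;> rfl

theorem par_false (N : ℕ) : par N (fun _ => false) = false := by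
  induction N with
  | zero => rfl
  | succ N ih => rw [par_succ, ih]; rfl

theorem par_single {N q : ℕ} (hq : q < N) (f : ℕ → Bool) :
    par N (fun i => decide (i = q) && f i) = f q := by
  induction N with
  | zero => omega
  | succ N ih =>
    rw [par_succ]
    rcases Nat.lt_succ_iff_lt_or_eq.1 hq with h | rfl
    · rw [ih h]; simp [show N ≠ q by omega]
    · rw [par_congr (g := fun _ => false) fun i hi => by simp [show i ≠ q by omega], par_false]
      simp

end

/-! ### Pauli strings with a phase -/

def sgn (b : Bool) : ℂ := if b then -1 else 1

@[simp] theorem sgn_true : sgn true = -1 := rfl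
@[simp] theorem sgn_false : sgn false = 1 := rfl
theorem sgn_xor (a b : Bool) : sgn (a ^^ b) = sgn a * sgn b := by cases a <;> cases b <;> simp
@[simp] theorem sgn_mul_self (a : Bool) : sgn a * sgn a = 1 := by cases a <;> simp
@[simp] theorem star_sgn (a : Bool) : star (sgn a) = sgn a := by cases a <;> simp
theorem sgn_ne_zero (a : Bool) : sgn a ≠ 0 := by cases a <;> simp
theorem sgn_inj {a b : Bool} (h : sgn a = sgn b) : a = b := by
  cases a <;> cases b <;> simp_all <;> norm_num at h

def iph (b : Bool) : ℂ := cond b Complex.I 1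

@[simp] theorem iph_true : iph true = Complex.I := rfl
@[simp] theorem iph_false : iph false = 1 := rfl

/-- The sign is the carry in the addition of two exponents of `i`. -/
theorem iph_xor (a b : Bool) : iph (a ^^ b) * sgn (a && b) = iph a * iph b := by
  cases a <;> cases b <;> simp

theorem prod_sgn (N : ℕ) (f : ℕ → Bool) : ∏ i : Fin N, sgn (f i) = sgn (par N f) := by
  induction N with
  | zero => simp [par]
  | succ N ih => rw [Fin.prod_univ_castSucc, par_succ, sgn_xor, ← ih]; simp

/-- The operator `i ^ (2 hi + lo) * X ^ x * Z ^ z`, with the bits `x i`, `z i` for line `i`. -/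
structure PStr where
  hi : Bool
  lo : Bool
  bits : List (Bool × Bool)

namespace PStr

def x (P : PStr) (i : ℕ) : Bool := (P.bits.getD i (false, false)).1

def z (P : PStr) (i : ℕ) : Bool := (P.bits.getD i (false, false)).2

def ph (P : PStr) : ℂ := sgn P.hi * iph P.lo

/-- `Z ^ z` acts first, so its sign is read off the column index `b`, which `X ^ x` then shifts. -/
def op (N : ℕ) (P : PStr) : Op N := fun a b =>
  if ∀ i : Fin N, a i = (b i ^^ P.x i) then P.ph * ∏ i : Fin N, sgn (P.z i && b i) else 0

def mk' (N : ℕ) (hi lo : Bool) (x z : ℕ → Bool) : PStr := ⟨hi, lo, tab N fun i => (x i, z i)⟩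

@[simp] theorem mk'_hi (N : ℕ) (hi lo : Bool) (x z : ℕ → Bool) : (mk' N hi lo x z).hi = hi := rfl

@[simp] theorem mk'_lo (N : ℕ) (hi lo : Bool) (x z : ℕ → Bool) : (mk' N hi lo x z).lo = lo := rfl

theorem mk'_x {N i : ℕ} (h : i < N) (hi lo : Bool) (x z : ℕ → Bool) :
    (mk' N hi lo x z).x i = x i := by
  unfold PStr.x mk'; rw [getD_tab h]

theorem mk'_z {N i : ℕ} (h : i < N) (hi lo : Bool) (x z : ℕ → Bool) :
    (mk' N hi lo x z).z i = z i := by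
  unfold PStr.z mk'; rw [getD_tab h]

@[simp] theorem mk'_xF {N : ℕ} (i : Fin N) (hi lo : Bool) (x z : ℕ → Bool) :
    (mk' N hi lo x z).x i = x i := mk'_x i.2 ..

@[simp] theorem mk'_zF {N : ℕ} (i : Fin N) (hi lo : Bool) (x z : ℕ → Bool) :
    (mk' N hi lo x z).z i = z i := mk'_z i.2 ..

/-- The parity is the sign from moving `Z ^ z` of the first factor past `X ^ x` of the second; `P.lo
&& Q.lo` is the carry of the exponents of `i`. -/
def mul (N : ℕ) (P Q : PStr) : PStr :=
  mk' N (P.hi ^^ Q.hi ^^ (P.lo && Q.lo) ^^ par N fun i => P.z i && Q.x i) (P.lo ^^ Q.lo)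
    (fun i => P.x i ^^ Q.x i) fun i => P.z i ^^ Q.z i

/-- Whether the two operators anticommute. -/
def anti (N : ℕ) (P Q : PStr) : Bool := par N fun i => (P.x i && Q.z i) ^^ (P.z i && Q.x i)

def timesI (P : PStr) : PStr := ⟨P.hi ^^ P.lo, !P.lo, P.bits⟩

def neg (P : PStr) : PStr := ⟨!P.hi, P.lo, P.bits⟩

theorem ph_mul (N : ℕ) (P Q : PStr) :
    (P.mul N Q).ph = P.ph * Q.ph * sgn (par N fun i => P.z i && Q.x i) := by
  simp only [ph, mul, mk'_hi, mk'_lo, sgn_xor]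
  linear_combination (sgn P.hi * sgn Q.hi * sgn (par N fun i => P.z i && Q.x i)) * iph_xor P.lo Q.lo

theorem ph_timesI (P : PStr) : P.timesI.ph = Complex.I * P.ph := by
  simp only [ph, timesI, sgn_xor]
  cases P.lo <;> simp [mul_comm]
  linear_combination (- sgn P.hi) * Complex.I_mul_I

theorem ph_neg (P : PStr) : P.neg.ph = - P.ph := by
  simp only [ph, neg]
  cases P.hi <;> simp

@[simp] theorem timesI_x (P : PStr) : P.timesI.x = P.x := rfl
@[simp] theorem timesI_z (P : PStr) : P.timesI.z = P.z := rfl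
@[simp] theorem neg_x (P : PStr) : P.neg.x = P.x := rfl
@[simp] theorem neg_z (P : PStr) : P.neg.z = P.z := rfl

def Z (N q : ℕ) : PStr := mk' N false false (fun _ => false) fun i => decide (i = q)

def X (N q : ℕ) : PStr := mk' N false false (fun i => decide (i = q)) fun _ => false

/-- `Z` on line `c` and `X` on line `q`. -/
def ZX (N c q : ℕ) : PStr := mk' N false false (fun i => decide (i = q)) fun i => decide (i = c)

theorem op_mul (N : ℕ) (P Q : PStr) : P.op N * Q.op N = (P.mul N Q).op N := by
  ext a b
  rw [Matrix.mul_apply, Finset.sum_eq_single fun i : Fin N => (b i ^^ Q.x i)]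
  · simp only [op, mul, mk'_xF, mk'_zF, implies_true, if_true]
    have hc : (∀ i : Fin N, a i = ((b i ^^ Q.x i) ^^ P.x i)) ↔ ∀ i : Fin N, a i = (b i ^^ (P.x i ^^ Q.x i)) :=
      forall_congr' fun i => by rw [Bool.xor_assoc, Bool.xor_comm (Q.x i)]
    simp only [hc]
    split_ifs
    · have h : (∏ i : Fin N, sgn (P.z i && (b i ^^ Q.x i))) * ∏ i : Fin N, sgn (Q.z i && b i)
          = sgn (par N fun i => P.z i && Q.x i) * ∏ i : Fin N, sgn ((P.z i ^^ Q.z i) && b i) := by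
        rw [← prod_sgn, ← Finset.prod_mul_distrib, ← Finset.prod_mul_distrib]
        refine Finset.prod_congr rfl fun i _ => ?_
        cases P.z i <;> cases Q.z i <;> cases b i <;> cases Q.x i <;> simp
      have h2 := ph_mul N P Q
      rw [mul] at h2
      rw [h2]
      linear_combination P.ph * Q.ph * h
    · simp
  · intro c _ hc
    have : ¬ ∀ i : Fin N, c i = (b i ^^ Q.x i) := fun h => hc (funext h)
    simp [op, this]
  · simp

theorem op_congr {N : ℕ} {P Q : PStr} (hhi : P.hi = Q.hi) (hlo : P.lo = Q.lo)
    (hx : ∀ i < N, P.x i = Q.x i) (hz : ∀ i < N, P.z i = Q.z i) : P.op N = Q.op N := by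
  ext a b
  simp only [op, ph, hhi, hlo, fun i : Fin N => hx i i.2, fun i : Fin N => hz i i.2]

theorem op_timesI (N : ℕ) (P : PStr) : P.timesI.op N = Complex.I • P.op N := by
  ext a b
  simp only [op, ph_timesI, timesI_x, timesI_z, Matrix.smul_apply, smul_eq_mul]
  split_ifs <;> ring

theorem op_neg (N : ℕ) (P : PStr) : P.neg.op N = - P.op N := by
  ext a b
  simp only [op, ph_neg, neg_x, neg_z, Matrix.neg_apply]
  split_ifs <;> ring

theorem op_eq_ph {N : ℕ} {P : PStr} (hx : ∀ i < N, P.x i = false) (hz : ∀ i < N, P.z i = false) :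
    P.op N = P.ph • 1 := by
  ext a b
  simp [op, fun i : Fin N => hx i i.2, fun i : Fin N => hz i i.2, Matrix.one_apply, funext_iff]

theorem op_comm (N : ℕ) (P Q : PStr) :
    P.op N * Q.op N = sgn (anti N P Q) • (Q.op N * P.op N) := by
  have : sgn (anti N P Q) = sgn (par N fun i => P.z i && Q.x i) *
      sgn (par N fun i => Q.z i && P.x i) := by
    rw [← sgn_xor, ← par_xor, anti]
    congr 2; ext i
    cases P.x i <;> cases P.z i <;> cases Q.x i <;> cases Q.z i <;> rfl
  rw [op_mul, op_mul, this]
  set p := par N fun i => P.z i && Q.x i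
  set p' := par N fun i => Q.z i && P.x i
  ext a b
  have h2 : (Q.mul N P).ph = P.ph * Q.ph * sgn p' := by rw [ph_mul, mul_comm Q.ph]
  simp only [op, ph_mul, h2, Matrix.smul_apply, smul_eq_mul]
  simp only [mul, mk'_xF, mk'_zF, Bool.xor_comm (Q.x _), Bool.xor_comm (Q.z _)]
  split_ifs
  · linear_combination (-P.ph * Q.ph * sgn p * ∏ i : Fin N, sgn ((P.z i ^^ Q.z i) && b i)) * sgn_mul_self p'
  · simp

/-- The operator is Hermitian, equivalently an involution. -/
def Herm (N : ℕ) (P : PStr) : Prop := P.lo = par N fun i => P.z i && P.x i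

theorem op_sq (N : ℕ) (P : PStr) :
    P.op N * P.op N = sgn (P.lo ^^ par N fun i => P.z i && P.x i) • 1 := by
  rw [op_mul, op_eq_ph (fun i hi => by simp [mul, mk'_x hi]) fun i hi => by simp [mul, mk'_z hi]]
  congr 1
  rw [ph_mul, sgn_xor, ph]
  cases P.lo <;> cases P.hi <;> simp

theorem herm_iff {N : ℕ} {P : PStr} : P.Herm N ↔ P.op N * P.op N = 1 := by
  rw [op_sq, Herm]
  cases P.lo <;> cases (par N fun i => P.z i && P.x i) <;> simp
  all_goals
    intro h
    have := congrFun (congrFun h fun _ => false) fun _ => false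
    simp at this
    norm_num [Complex.ext_iff] at this

theorem op_conjTranspose (N : ℕ) (P : PStr) :
    (P.op N)ᴴ = sgn (P.lo ^^ par N fun i => P.z i && P.x i) • P.op N := by
  ext a b
  simp only [Matrix.conjTranspose_apply, op, Matrix.smul_apply, smul_eq_mul]
  have hc : (∀ i : Fin N, b i = (a i ^^ P.x i)) ↔ ∀ i : Fin N, a i = (b i ^^ P.x i) :=
    forall_congr' fun i => by cases a i <;> cases b i <;> cases P.x i <;> simp
  simp only [hc]
  split_ifs with h
  · have h1 : star P.ph = sgn P.lo * P.ph := by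
      cases h : P.lo <;> simp [ph, h]
    have h2 : ∏ i : Fin N, sgn (P.z i && a i) =
        sgn (par N fun i => P.z i && P.x i) * ∏ i : Fin N, sgn (P.z i && b i) := by
      rw [← prod_sgn, ← Finset.prod_mul_distrib]
      refine Finset.prod_congr rfl fun i _ => ?_
      rw [h i]
      cases P.z i <;> cases P.x i <;> cases b i <;> simp
    rw [h2, star_mul', star_mul', h1, star_sgn, star_prod]
    simp only [star_sgn, sgn_xor]
    ring
  · simp

theorem Herm.conjTranspose {N : ℕ} {P : PStr} (h : P.Herm N) : (P.op N)ᴴ = P.op N := by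
  rw [op_conjTranspose, ← h.symm]; simp

theorem Herm.sq {N : ℕ} {P : PStr} (h : P.Herm N) : P.op N * P.op N = 1 := herm_iff.1 h

theorem herm_Z (N q : ℕ) : (Z N q).Herm N := by
  have : par N (fun i => (Z N q).z i && (Z N q).x i) = par N fun _ => false :=
    par_congr fun i hi => by simp [Z, mk'_x hi]
  rw [Herm, this, par_false]; rfl

theorem herm_X (N q : ℕ) : (X N q).Herm N := by
  have : par N (fun i => (X N q).z i && (X N q).x i) = par N fun _ => false :=
    par_congr fun i hi => by simp [X, mk'_z hi]
  rw [Herm, this, par_false]; rfl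

theorem herm_ZX {N c q : ℕ} (h : c ≠ q) : (ZX N c q).Herm N := by
  have : par N (fun i => (ZX N c q).z i && (ZX N c q).x i) = par N fun _ => false :=
    par_congr fun i hi => by
      simp only [ZX, mk'_x hi, mk'_z hi, Bool.and_eq_false_iff, decide_eq_false_iff_not]; omega
  rw [Herm, this, par_false]; rfl

theorem Herm.neg {N : ℕ} {P : PStr} (h : P.Herm N) : P.neg.Herm N := h

theorem mul_Z_X {N : ℕ} (c q : ℕ) (h : c ≠ q) :
    (Z N c).op N * (X N q).op N = (ZX N c q).op N := by
  rw [op_mul]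
  have : par N (fun i => (Z N c).z i && (X N q).x i) = par N fun _ => false :=
    par_congr fun i hi => by
      simp only [Z, X, mk'_x hi, mk'_z hi, Bool.and_eq_false_iff, decide_eq_false_iff_not]; omega
  refine op_congr ?_ rfl (fun i hi => ?_) fun i hi => ?_
  · simp only [mul, mk'_hi, this, par_false]; rfl
  · simp [mul, mk'_x hi, Z, X, ZX]
  · simp [mul, mk'_z hi, Z, X, ZX]

theorem anti_comm (N : ℕ) (P Q : PStr) : anti N P Q = anti N Q P :=
  par_congr fun i _ => by cases P.x i <;> cases P.z i <;> cases Q.x i <;> cases Q.z i <;> rfl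

theorem anti_Z {N q : ℕ} (hq : q < N) (P : PStr) : anti N P (Z N q) = P.x q := by
  rw [← par_single hq P.x]
  exact par_congr fun i hi => by simp [Z, mk'_x hi, mk'_z hi, Bool.and_comm]

theorem anti_X {N q : ℕ} (hq : q < N) (P : PStr) : anti N P (X N q) = P.z q := by
  rw [← par_single hq P.z]
  exact par_congr fun i hi => by simp [X, mk'_x hi, mk'_z hi, Bool.and_comm]

theorem anti_ZX {N c q : ℕ} (hc : c < N) (hq : q < N) (P : PStr) :
    anti N P (ZX N c q) = (P.x c ^^ P.z q) := by
  rw [← par_single hq P.z, ← par_single hc P.x, ← par_xor]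
  exact par_congr fun i hi => by simp [ZX, mk'_x hi, mk'_z hi, Bool.and_comm]

theorem op_Z_apply (N : ℕ) (q : Fin N) (a b : Fin N → Bool) :
    (Z N q).op N a b = if a = b then sgn (b q) else 0 := by
  have h : ∏ i : Fin N, sgn (decide ((i : ℕ) = q) && b i) = sgn (b q) := by
    rw [Finset.prod_eq_single q (fun i _ hi => by simp [Fin.val_ne_of_ne hi]) (by simp)]; simp
  have h2 : (Z N q).ph = 1 := by simp [ph, Z]
  rw [op, h2]
  simp only [Z, mk'_xF, mk'_zF, h, funext_iff, Bool.xor_false, one_mul]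

theorem op_X_apply (N : ℕ) (q : Fin N) (a b : Fin N → Bool) :
    (X N q).op N a b = if a = Function.update b q (!b q) then 1 else 0 := by
  have h : (∀ i : Fin N, a i = (b i ^^ decide ((i : ℕ) = q))) ↔
      a = Function.update b q (!b q) := by
    rw [funext_iff]
    refine forall_congr' fun i => ?_
    by_cases hi : i = q
    · subst hi; simp
    · simp [hi, Fin.val_ne_of_ne hi]
  have h2 : (X N q).ph = 1 := by simp [ph, X]
  rw [op, h2]
  simp only [X, mk'_xF, mk'_zF, h]
  simp

end PStr

/-! ### Pauli rotations, and Clifford gates as products of them -/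

open PStr

/-- `exp (i π/4 T)` for an involution `T`. -/
def rotOp (N : ℕ) (T : PStr) : Op N := ((Real.sqrt 2 : ℝ) : ℂ)⁻¹ • (1 + Complex.I • T.op N)

theorem sqrt2_inv_mul_self : ((Real.sqrt 2 : ℝ) : ℂ)⁻¹ * ((Real.sqrt 2 : ℝ) : ℂ)⁻¹ = 2⁻¹ := by
  rw [← mul_inv, ← Complex.ofReal_mul, Real.mul_self_sqrt (by norm_num)]; simp

/-- Conjugation of `R` by the inverse of the rotation. -/
def rotConj (N : ℕ) (T R : PStr) : PStr := cond (anti N T R) (R.mul N T).timesI R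

theorem rotOp_conjTranspose {N : ℕ} {T : PStr} (h : T.Herm N) :
    (rotOp N T)ᴴ = ((Real.sqrt 2 : ℝ) : ℂ)⁻¹ • (1 - Complex.I • T.op N) := by
  simp [rotOp, Matrix.conjTranspose_smul, h.conjTranspose, sub_eq_add_neg]

theorem rotOp_neg {N : ℕ} {T : PStr} (h : T.Herm N) : rotOp N T.neg = (rotOp N T)ᴴ := by
  rw [rotOp_conjTranspose h, rotOp, op_neg]; simp [sub_eq_add_neg]

theorem rotOp_mul_star {N : ℕ} {T : PStr} (h : T.Herm N) : rotOp N T * (rotOp N T)ᴴ = 1 := by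
  rw [rotOp_conjTranspose h, rotOp]
  simp only [smul_mul_smul_comm, sqrt2_inv_mul_self, add_mul, mul_sub, one_mul, mul_one,
    smul_mul_smul_comm, Complex.I_mul_I, h.sq]
  module

theorem rotOp_star_mul {N : ℕ} {T : PStr} (h : T.Herm N) : (rotOp N T)ᴴ * rotOp N T = 1 :=
  mul_eq_one_comm.1 (rotOp_mul_star h)

theorem rotOp_sq {N : ℕ} {T : PStr} (h : T.Herm N) :
    rotOp N T * rotOp N T = Complex.I • T.op N := by
  simp only [rotOp, smul_mul_smul_comm, sqrt2_inv_mul_self, add_mul, mul_add, one_mul, mul_one,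
    smul_mul_smul_comm, Complex.I_mul_I, h.sq]
  module

/-- If `T` and `R` anticommute, then `exp (-i π/4 T) R = R exp (i π/4 T)`, so the conjugate is `R`
times the square of the rotation, which is `i T`. -/
theorem rotOp_conj {N : ℕ} {T : PStr} (h : T.Herm N) (R : PStr) :
    (rotOp N T)ᴴ * R.op N * rotOp N T = (rotConj N T R).op N := by
  have hc := op_comm N T R
  cases ha : anti N T R
  · have : R.op N * rotOp N T = rotOp N T * R.op N := by
      rw [ha, sgn_false, one_smul] at hc
      simp only [rotOp, mul_smul_comm, smul_mul_assoc, mul_add, add_mul, hc, mul_one, one_mul]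
    rw [mul_assoc, this, ← mul_assoc, rotOp_star_mul h, one_mul, rotConj, ha]; rfl
  · have : (rotOp N T)ᴴ * R.op N = R.op N * rotOp N T := by
      rw [ha, sgn_true] at hc
      rw [rotOp_conjTranspose h]
      simp only [rotOp, mul_smul_comm, smul_mul_assoc, mul_add, sub_mul, hc, mul_one, one_mul]
      module
    rw [this, mul_assoc, rotOp_sq h, rotConj, ha, cond_true, op_timesI, ← op_mul, mul_smul_comm]

theorem rotConj_herm {N : ℕ} {T R : PStr} (h : T.Herm N) (hR : R.Herm N) :
    (rotConj N T R).Herm N := by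
  have h1 := rotOp_mul_star h
  rw [herm_iff, ← rotOp_conj h]
  calc _ = (rotOp N T)ᴴ * R.op N * (rotOp N T * (rotOp N T)ᴴ) * R.op N * rotOp N T := by
        simp only [mul_assoc]
    _ = (rotOp N T)ᴴ * (R.op N * R.op N) * rotOp N T := by rw [h1]; simp only [mul_assoc, one_mul]
    _ = 1 := by rw [hR.sq, mul_one, rotOp_star_mul h]

/-- A Clifford unitary is stored as the list of axes of its quarter turns. Multiplication by a
Clifford unitary extends the list, and a Pauli string is carried through it by a fold, signs
included. -/
def frame (N : ℕ) (ops : List PStr) : Op N := (ops.map (rotOp N)).prod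

/-- Conjugation by the inverse of the frame. -/
def pull (N : ℕ) (ops : List PStr) (R : PStr) : PStr := ops.foldl (fun R T => rotConj N T R) R

def AllHerm (N : ℕ) (ops : List PStr) : Prop := ∀ T ∈ ops, T.Herm N

def invRots (ops : List PStr) : List PStr := ops.reverse.map PStr.neg

section frame
variable {N : ℕ} {ops ops' : List PStr}

@[simp] theorem frame_nil : frame N [] = 1 := rfl

theorem frame_cons (T : PStr) : frame N (T :: ops) = rotOp N T * frame N ops := by simp [frame]

theorem frame_append : frame N (ops ++ ops') = frame N ops * frame N ops' := by simp [frame]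

theorem AllHerm.append (h : AllHerm N ops) (h' : AllHerm N ops') : AllHerm N (ops ++ ops') :=
  fun T hT => (List.mem_append.1 hT).elim (h T) (h' T)

theorem AllHerm.tail {T : PStr} (h : AllHerm N (T :: ops)) : AllHerm N ops :=
  fun T hT => h T (List.mem_cons_of_mem _ hT)

theorem AllHerm.inv (h : AllHerm N ops) : AllHerm N (invRots ops) := by
  intro T hT
  obtain ⟨S, hS, rfl⟩ := List.mem_map.1 hT
  exact (h S (List.mem_reverse.1 hS)).neg

theorem frame_mul_star (h : AllHerm N ops) : frame N ops * (frame N ops)ᴴ = 1 := by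
  induction ops with
  | nil => simp
  | cons T ops ih =>
    rw [frame_cons, Matrix.conjTranspose_mul, mul_assoc, ← mul_assoc (frame N ops), ih h.tail,
      one_mul, rotOp_mul_star (h T (by simp))]

theorem frame_star_mul (h : AllHerm N ops) : (frame N ops)ᴴ * frame N ops = 1 :=
  mul_eq_one_comm.1 (frame_mul_star h)

theorem frame_inv (h : AllHerm N ops) : frame N (invRots ops) = (frame N ops)ᴴ := by
  induction ops with
  | nil => simp [invRots]
  | cons T ops ih =>
    have : invRots (T :: ops) = invRots ops ++ [T.neg] := by simp [invRots]
    rw [this, frame_append, ih h.tail, frame_cons, frame_cons, Matrix.conjTranspose_mul, frame_nil,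
      mul_one, rotOp_neg (h T (by simp))]

theorem frame_conj (h : AllHerm N ops) (R : PStr) :
    (frame N ops)ᴴ * R.op N * frame N ops = (pull N ops R).op N := by
  induction ops generalizing R with
  | nil => simp [pull]
  | cons T ops ih =>
    have := ih h.tail (rotConj N T R)
    rw [← rotOp_conj (h T (by simp))] at this
    rw [pull, List.foldl_cons]
    rw [pull] at this
    rw [← this, frame_cons, Matrix.conjTranspose_mul]
    simp only [mul_assoc]

theorem pull_herm (h : AllHerm N ops) {R : PStr} (hR : R.Herm N) : (pull N ops R).Herm N := by
  induction ops generalizing R with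
  | nil => exact hR
  | cons T ops ih => exact ih h.tail (rotConj_herm (h T (by simp)) hR)

theorem pull_append (R : PStr) : pull N (ops ++ ops') R = pull N ops' (pull N ops R) := by
  simp [pull]

theorem op_mul_frame (h : AllHerm N ops) (R : PStr) :
    R.op N * frame N ops = frame N ops * (pull N ops R).op N := by
  rw [← frame_conj h, ← mul_assoc, ← mul_assoc, frame_mul_star h, one_mul]

theorem star_frame_mul_op (h : AllHerm N ops) (R : PStr) :
    (frame N ops)ᴴ * R.op N = (pull N ops R).op N * (frame N ops)ᴴ := by
  rw [← frame_conj h, mul_assoc _ (frame N ops), frame_mul_star h, mul_one]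

theorem trace_frame (h : AllHerm N ops) (B : Op N) :
    (frame N ops * B * (frame N ops)ᴴ).trace = B.trace := by
  rw [Matrix.trace_mul_comm, ← mul_assoc, frame_star_mul h, one_mul]

end frame

/-! Gates are coded as `(0, q, q)` for `H`, `(1, q, q)` for `S` and `(2, c, q)` for `CX`. -/

abbrev GCode : Type := ℕ × ℕ × ℕ

def Gate.code {N : ℕ} : Gate N → GCode
  | .H q => (0, q, q)
  | .S q => (1, q, q)
  | .CX c q _ => (2, c, q)

def GCode.Valid (N : ℕ) (g : GCode) : Prop := g.2.1 < N ∧ g.2.2 < N ∧ (g.1 = 0 ∨ g.1 = 1 ∨ g.2.1 ≠ g.2.2)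

/-- The rotations whose product is the gate, up to a phase. -/
def gateRots (N : ℕ) (g : GCode) : List PStr :=
  cond (decide (g.1 = 0)) [(Z N g.2.1).neg, (X N g.2.1).neg, (Z N g.2.1).neg]
    (cond (decide (g.1 = 1)) [(Z N g.2.1).neg]
      [(Z N g.2.1).neg, (X N g.2.2).neg, ZX N g.2.1 g.2.2])

theorem Gate.code_valid {N : ℕ} (u : Gate N) : u.code.Valid N := by
  cases u with
  | H q => simp [Gate.code, GCode.Valid]
  | S q => simp [Gate.code, GCode.Valid]
  | CX c q h => simpa [Gate.code, GCode.Valid] using Fin.val_ne_of_ne h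

theorem gateRots_herm {N : ℕ} {g : GCode} (hg : g.1 = 0 ∨ g.1 = 1 ∨ g.2.1 ≠ g.2.2) :
    AllHerm N (gateRots N g) := by
  intro T hT
  revert T
  by_cases h0 : g.1 = 0
  · simp [gateRots, h0, (herm_Z N _).neg, (herm_X N _).neg]
  by_cases h1 : g.1 = 1
  · simp [gateRots, h1, (herm_Z N _).neg]
  · simp [gateRots, h0, h1, (herm_Z N _).neg, (herm_X N _).neg, herm_ZX (show g.2.1 ≠ g.2.2 by tauto)]

theorem eq_update_of_agree {N : ℕ} {q : Fin N} {x y : Fin N → Bool}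
    (h : ∀ j, j ≠ q → x j = y j) : x = Function.update y q (x q) := by
  ext j
  by_cases hj : j = q
  · subst hj; simp
  · simp [hj, h j hj]

theorem op_X_mul_op_Z_apply {N : ℕ} (q c : Fin N) (x y : Fin N → Bool) :
    ((X N q).op N * (Z N c).op N) x y = if x = Function.update y q (!y q) then sgn (y c) else 0 := by
  rw [Matrix.mul_apply, Finset.sum_eq_single y]
  · rw [op_Z_apply, op_X_apply]; simp
  · intro z _ hz
    rw [op_Z_apply, if_neg hz, mul_zero]
  · simp

theorem onLine_eq {N : ℕ} (q : Fin N) (u : Matrix Bool Bool ℂ) (a b c d : ℂ) (h00 : u false false = a + b)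
    (h11 : u true true = a - b) (h01 : u false true = c - d) (h10 : u true false = c + d) : onLine q u = a • 1
    + b • (Z N q).op N + c • (X N q).op N +
      d • ((X N q).op N * (Z N q).op N) := by
  ext x y
  simp only [Matrix.add_apply, Matrix.smul_apply, op_Z_apply, op_X_apply, op_X_mul_op_Z_apply,
    smul_eq_mul, onLine, Matrix.one_apply]
  by_cases h : ∀ j, j ≠ q → x j = y j
  · rw [if_pos h]
    have e1 : x = y ↔ x q = y q :=
      ⟨fun h => h ▸ rfl, fun hq => by rw [eq_update_of_agree h, hq, Function.update_eq_self]⟩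
    have e2 : x = Function.update y q (!y q) ↔ x q = !y q :=
      ⟨fun h => by rw [h]; simp, fun hq => by rw [eq_update_of_agree h, hq]⟩
    simp only [e1, e2]
    cases x q <;> cases y q <;> simp [*] <;> ring
  · rw [if_neg h]
    have e1 : x ≠ y := fun e => h fun j _ => by rw [e]
    have e2 : x ≠ Function.update y q (!y q) := fun e => h fun j hj => by rw [e]; simp [hj]
    simp [e1, e2]

theorem projZ_eq {N : ℕ} (q : Fin N) (b : Bool) :
    projZ q b = (2 : ℂ)⁻¹ • (1 + sgn b • (Z N q).op N) := by
  refine (onLine_eq q _ 2⁻¹ (2⁻¹ * sgn b) 0 0 ?_ ?_ ?_ ?_).trans ?_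
  all_goals cases b <;> norm_num

/-- `H` is a product of quarter turns about `Z`, `X`, `Z`, as for Euler angles, and `S` is one about
`Z`. For `CX` the reason is `CX = exp (i π/4 (1 - Z_c) (1 - X_q))`, whose exponent expands into
commuting terms. -/
theorem Gate.op_eq {N : ℕ} (u : Gate N) :
    ∃ c : ℂ, c * star c = 1 ∧ u.op = c • frame N (gateRots N u.code) := by
  have hI := Complex.I_mul_I
  have h2 := sqrt2_inv_mul_self
  have hX : ∀ q, (X N q).op N * (X N q).op N = 1 := fun q => (herm_X N q).sq
  have hZ : ∀ q, (Z N q).op N * (Z N q).op N = 1 := fun q => (herm_Z N q).sq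
  set w : ℂ := ((Real.sqrt 2 : ℝ) : ℂ)⁻¹ with hw
  have hws : star w = w := by
    rw [hw, star_inv₀]
    congr 1
    exact Complex.conj_ofReal _
  -- `w * (1 + i)` is `exp (i π/4)`, the global phase of `S` and of `CX`.
  have hw1 : w * (1 + Complex.I) * star (w * (1 + Complex.I)) = 1 := by
    have : star (w * (1 + Complex.I)) = w * (1 - Complex.I) := by
      rw [star_mul', hws]
      congr 1
      simp [sub_eq_add_neg]
    rw [this]
    linear_combination (1 - Complex.I * Complex.I) * h2 - 2⁻¹ * hI
  cases u with
  | H q =>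
    have hXZ : (X N q).op N * (Z N q).op N = - ((Z N q).op N * (X N q).op N) := by
      rw [op_comm, anti_Z q.2, X, mk'_xF]; simp
    refine ⟨Complex.I, by simp, ?_⟩
    have e1 : (Gate.H q : Gate N).op = w • (Z N q).op N + w • (X N q).op N := by
      rw [Gate.op]
      refine (onLine_eq q _ 0 w w 0 ?_ ?_ ?_ ?_).trans ?_ <;> simp [hw]
    rw [e1]
    simp only [Gate.code, gateRots, frame_cons, frame_nil, rotOp, op_neg, decide_true, cond_true, ← hw]
    have hX := hX q
    have hZ := hZ q
    generalize (Z N q).op N = z at *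
    generalize (X N q).op N = x at *
    have e2 : (1 + Complex.I • -z) * ((1 + Complex.I • -x) * (1 + Complex.I • -z)) =
        (-2 * Complex.I) • (z + x) := by
      have t1 : z * (z * x) = x := by rw [← mul_assoc, hZ, one_mul]
      simp only [smul_neg, add_mul, mul_add, mul_neg, neg_mul, smul_mul_assoc, mul_smul_comm,
        one_mul, mul_one, smul_add, smul_smul, hI, hZ, hXZ, t1]
      module
    simp only [mul_one, smul_mul_assoc, mul_smul_comm, e2, smul_smul]
    rw [← smul_add]
    congr 1
    linear_combination (2 * w * w * w) * hI - 2 * w * h2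
  | S q =>
    refine ⟨w * (1 + Complex.I), hw1, ?_⟩
    · have e1 : (Gate.S q : Gate N).op = ((1 + Complex.I) / 2) • 1 +
          ((1 - Complex.I) / 2) • (Z N q).op N := by
        rw [Gate.op]
        refine (onLine_eq q _ ((1 + Complex.I) / 2) ((1 - Complex.I) / 2) 0 0 ?_ ?_ ?_ ?_).trans ?_
        any_goals simp
        all_goals ring
      rw [e1]
      simp only [Gate.code, gateRots, frame_cons, frame_nil, rotOp, op_neg, ← hw, one_ne_zero,
        decide_false, decide_true, cond_false, cond_true, mul_one, smul_smul, smul_add, smul_neg]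
      have e2 : w * (1 + Complex.I) * w = (1 + Complex.I) / 2 := by
        linear_combination (1 + Complex.I) * h2
      have e3 : w * (1 + Complex.I) * (w * Complex.I) = - ((1 - Complex.I) / 2) := by
        linear_combination (1 + Complex.I) * Complex.I * h2 + 2⁻¹ * hI
      rw [e2, e3, neg_smul, neg_neg]
  | CX c q hcq =>
    have hcq' : (c : ℕ) ≠ q := Fin.val_ne_of_ne hcq
    have hXZ : (X N q).op N * (Z N c).op N = (Z N c).op N * (X N q).op N := by
      rw [op_comm, anti_Z c.2, X, mk'_xF]; simp [hcq']
    refine ⟨w * (1 + Complex.I), hw1, ?_⟩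
    · have e1 : (Gate.CX c q hcq : Gate N).op = (2 : ℂ)⁻¹ • (1 + (Z N c).op N + (X N q).op N -
          (Z N c).op N * (X N q).op N) := by
        rw [← hXZ]
        ext x y
        simp only [Gate.op, Matrix.smul_apply, Matrix.sub_apply, Matrix.add_apply, op_Z_apply,
          op_X_apply, op_X_mul_op_Z_apply, smul_eq_mul, Matrix.one_apply]
        have hne : y ≠ Function.update y q (!y q) := fun h => by
          have := congrFun h q
          simp at this
        cases hc : y c
        · simp only [Bool.xor_false, Function.update_eq_self, sgn_false]
          by_cases h1 : x = y
          · subst h1; simp [hne]; norm_num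
          · simp [h1]
        · simp only [Bool.xor_true, sgn_true]
          by_cases h1 : x = y
          · subst h1; simp [hne]
          · simp only [h1, if_false]
            split_ifs <;> norm_num
      rw [e1]
      simp only [Gate.code, gateRots, frame_cons, frame_nil, rotOp, op_neg, ← hw, OfNat.ofNat_ne_zero,
        OfNat.ofNat_ne_one, decide_false, cond_false, mul_one, ← mul_Z_X _ _ hcq']
      have hX := hX q
      have hZ := hZ c
      generalize (Z N c).op N = z at *
      generalize (X N q).op N = x at *
      have e2 : (1 + Complex.I • -z) * ((1 + Complex.I • -x) * (1 + Complex.I • (z * x))) =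
          (1 - Complex.I) • (1 + z + x - z * x) := by
        have t1 : x * (z * x) = z := by rw [← mul_assoc, hXZ, mul_assoc, hX, mul_one]
        have t2 : z * (z * x) = x := by rw [← mul_assoc, hZ, one_mul]
        simp only [smul_neg, add_mul, mul_add, mul_neg, neg_mul, smul_mul_assoc, mul_smul_comm,
          one_mul, mul_one, smul_add, smul_smul, hI, t1, t2, hZ]
        module
      simp only [smul_mul_assoc, mul_smul_comm, e2, smul_smul]
      congr 1
      linear_combination (-(1 - Complex.I * Complex.I) * (w * w + 2⁻¹)) * h2 + (1 / 4) * hI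

theorem Gate.conj_eq {N : ℕ} (u : Gate N) (α : Op N) : u.op * α * (u.op)ᴴ =
    frame N (gateRots N u.code) * α * (frame N (gateRots N u.code))ᴴ := by
  obtain ⟨c, hc, h⟩ := u.op_eq
  rw [h, Matrix.conjTranspose_smul, smul_mul_assoc, smul_mul_assoc, mul_smul_comm, smul_smul, hc, one_smul]

/-! ### The classical engine

The state of the simulated circuit is `U B Uᴴ`, where `U` is the frame of `ops`, and `B` is
supported on the basis states which have on every known line the recorded value. -/

/-- Gates, the line which is measured next, and the role of its measurement. -/
abbrev Plan : Type := List GCode × ℕ × Role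

structure ES where
  ops : List PStr
  /-- for each line, whether it is known, and its value -/
  ln : List (Bool × Bool)
  log : Record
  /-- the gates made so far on the real device -/
  gts : List GCode
  /-- the lines measured so far on the real device -/
  piv : List (ℕ × Role)
  /-- the gates and the line of the next real measurement, if its outcome is still missing -/
  wait : List Plan

def Role.isPost : Role → Bool
  | .postselected => true
  | _ => false

/-- `0` for idle, `1` for a gate, `2` for a measurement, `3` for the measurement of any line
which is not known. -/
abbrev ICode : Type := ℕ × GCode × Role

def Instr.code {N : ℕ} : Instr N → ICode
  | .idle => (0, (0, 0, 0), .output)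
  | .gate u => (1, u.code, .output)
  | .meas q role => (2, (0, q, q), role)

def padCode : ICode := (3, (0, 0, 0), .output)

/-- When gates `G` act on the real lines, `B` becomes `G B Gᴴ`, and the frame has to absorb `Gᴴ` on
its right for the represented state to stay the same. Hence the gates appear inverted. -/
def innerRots (N : ℕ) (G : List GCode) : List PStr := G.flatMap fun g => invRots (gateRots N g)

def setLn (N : ℕ) (ln : List (Bool × Bool)) (j : ℕ) (m : Bool) : List (Bool × Bool) :=
  tab N fun i => cond (decide (i = j)) (true, m) (ln.getD i (false, false))

/-- Gates on the lines which are not known that turn `Q` into a `Z` on line `j` there. -/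
def reduceGates (N : ℕ) (ln : List (Bool × Bool)) (Q : PStr) (j : ℕ) : List GCode :=
  ((List.range N).flatMap fun i => cond (!(ln.getD i (false, false)).1 && Q.x i)
    (cond (Q.z i) [(1, i, i), (0, i, i)] [(0, i, i)]) []) ++
  (List.range N).flatMap fun i =>
    cond (!(ln.getD i (false, false)).1 && (Q.x i || Q.z i) && !decide (i = j)) [(2, i, j)] []

/-- `H S S H = X`; the gate set has no `X` of its own. -/
def flipGates (j : ℕ) : List GCode := [(0, j, j), (1, j, j), (1, j, j), (0, j, j)]

/-- The `Z` of line `q`, as the engine sees it. -/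
notation "Ẑ[" N ", " S ", " q "]" => EGK.pull N (ES.ops S) (PStr.Z N q)

namespace ES

def kn (S : ES) (i : ℕ) : Bool := (S.ln.getD i (false, false)).1

def vl (S : ES) (i : ℕ) : Bool := (S.ln.getD i (false, false)).2

/-- The value of a Pauli operator which is a product of `Z` on known lines. -/
def outc (N : ℕ) (S : ES) (Q : PStr) : Bool := Q.hi ^^ par N fun i => Q.z i && S.vl i

def gate (N : ℕ) (S : ES) (g : GCode) : ES := { S with ops := gateRots N g ++ S.ops }

/-- The known lines whose `Z` anticommutes with `Q`. A single one makes the outcome of `Q` uniformly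
random. -/
def antiL (N : ℕ) (S : ES) (Q : PStr) : List ℕ :=
  (List.range N).filter fun i => S.kn i && Q.x i

def realL (N : ℕ) (S : ES) (Q : PStr) : List ℕ :=
  (List.range N).filter fun i => !S.kn i && (Q.x i || Q.z i)

def unkL (N : ℕ) (S : ES) : List ℕ := (List.range N).filter fun i => !S.kn i

/-- The axis `T` is chosen with `i T = (-1) ^ (b + v) Q Z_j`, where `v` is the value of line `j`. On
states with `Z_j = (-1) ^ v` this agrees with `(-1) ^ b Q`, so `√2` times the projector onto the
outcome `b` acts as the rotation about `T`. -/
def coinRot (N : ℕ) (S : ES) (Q : PStr) (j : ℕ) (b : Bool) : PStr :=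
  cond (b ^^ S.vl j) (Q.mul N (Z N j)).timesI (Q.mul N (Z N j)).timesI.neg

def coin (N : ℕ) (S : ES) (Q : PStr) (j : ℕ) (b : Bool) (role : Role) : ES :=
  { S with ops := S.ops ++ [S.coinRot N Q j b], log := S.log ++ [(role, b)] }

def det (N : ℕ) (S : ES) (q : ℕ) (role : Role) : ES :=
  { S with log := S.log ++ [(role, S.outc N Ẑ[N, S, q])] }

def real (N : ℕ) (S : ES) (G : List GCode) (j : ℕ) (m : Bool) (role : Role) : ES :=
  ⟨S.ops ++ innerRots N G, setLn N S.ln j m, S.log, S.gts ++ G, S.piv ++ [(j, role)], []⟩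

/-- Gates before the real measurement of `Q` on line `j`; if it is postselected, then the outcome
`+1` has to mean `+1`. -/
def realGates (N : ℕ) (S : ES) (q : ℕ) (role : Role) (j : ℕ) : List GCode :=
  reduceGates N S.ln Ẑ[N, S, q] j ++
    cond (role.isPost && (S.real N (reduceGates N S.ln Ẑ[N, S, q] j) j false role).outc N
      (pull N (S.ops ++ innerRots N (reduceGates N S.ln Ẑ[N, S, q] j)) (Z N q)))
      (flipGates j) []

/-- The real measurement which is needed for a step, if any. -/
def plan (N : ℕ) (S : ES) (u : ICode) : List Plan :=
  cond (decide (u.1 = 2))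
    (cond ((S.antiL N Ẑ[N, S, u.2.1.2.1]).isEmpty &&
        !(S.realL N Ẑ[N, S, u.2.1.2.1]).isEmpty)
      [(S.realGates N u.2.1.2.1 u.2.2 ((S.realL N Ẑ[N, S, u.2.1.2.1]).headD 0),
        (S.realL N Ẑ[N, S, u.2.1.2.1]).headD 0, u.2.2)] [])
    (cond (decide (u.1 = 3) && !(S.unkL N).isEmpty) [([], (S.unkL N).headD 0, .output)] [])

/-- The bit `b` is read only if the measured operator anticommutes with the `Z` of a known line. -/
def pass (N : ℕ) (S : ES) (u : ICode) (b : Bool) : ES := cond (decide (u.1 = 1)) (S.gate N u.2.1) (cond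
  (decide (u.1 = 2)) (cond (S.antiL N Ẑ[N, S, u.2.1.2.1]).isEmpty (S.det N u.2.1.2.1 u.2.2) (S.coin N Ẑ[N, S,
  u.2.1.2.1] ((S.antiL N Ẑ[N, S, u.2.1.2.1]).headD 0) b u.2.2)) S)

/-- A step with a real measurement, with outcome `m`. -/
def take (N : ℕ) (S : ES) (u : ICode) (p : Plan) (m : Bool) : ES :=
  cond (decide (u.1 = 2)) ((S.real N p.1 p.2.1 m p.2.2).det N u.2.1.2.1 u.2.2)
    (S.real N p.1 p.2.1 m p.2.2)

/-- A step, with the list `h` of all real outcomes which are available. -/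
def step (N : ℕ) (S : ES) (u : ICode) (b : Bool) (h : List Bool) : ES :=
  cond S.wait.isEmpty
    (cond (S.plan N u).isEmpty (S.pass N u b)
      (cond (decide (S.piv.length < h.length))
        (S.take N u ((S.plan N u).headD ([], 0, .output)) (h.getD S.piv.length false))
        { S with wait := S.plan N u })) S

end ES

/-! ### The action of gates on the bits of Pauli strings -/

section bits
variable {N : ℕ}

theorem rotConj_x {T R : PStr} {i : ℕ} (hi : i < N) :
    (rotConj N T R).x i = (R.x i ^^ (anti N T R && T.x i)) := by
  unfold rotConj
  cases anti N T R <;> simp [PStr.mul, mk'_x hi]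

theorem rotConj_z {T R : PStr} {i : ℕ} (hi : i < N) :
    (rotConj N T R).z i = (R.z i ^^ (anti N T R && T.z i)) := by
  unfold rotConj
  cases anti N T R <;> simp [PStr.mul, mk'_z hi]

theorem pull_one_Z {q : ℕ} (hq : q < N) (R : PStr) {i : ℕ} (hi : i < N) : (rotConj N (Z N q) R).x i = R.x i ∧
      (rotConj N (Z N q) R).z i = (R.z i ^^ (R.x q && decide (i = q))) := by
  rw [rotConj_x hi, rotConj_z hi, anti_comm, anti_Z hq, Z, mk'_x hi, mk'_z hi]; simp

theorem pull_one_X {q : ℕ} (hq : q < N) (R : PStr) {i : ℕ} (hi : i < N) :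
    (rotConj N (X N q) R).x i = (R.x i ^^ (R.z q && decide (i = q))) ∧
      (rotConj N (X N q) R).z i = R.z i := by
  rw [rotConj_x hi, rotConj_z hi, anti_comm, anti_X hq, X, mk'_x hi, mk'_z hi]; simp

theorem pull_one_ZX {c q : ℕ} (hc : c < N) (hq : q < N) (R : PStr) {i : ℕ} (hi : i < N) :
    (rotConj N (ZX N c q) R).x i = (R.x i ^^ ((R.x c ^^ R.z q) && decide (i = q))) ∧
      (rotConj N (ZX N c q) R).z i = (R.z i ^^ ((R.x c ^^ R.z q) && decide (i = c))) := by
  rw [rotConj_x hi, rotConj_z hi, anti_comm, anti_ZX hc hq, ZX, mk'_x hi, mk'_z hi]; simp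

theorem rotConj_bits_congr {T T' R R' : PStr} (hT : ∀ i < N, T.x i = T'.x i ∧ T.z i = T'.z i) (hR : ∀ i < N,
    R.x i = R'.x i ∧ R.z i = R'.z i) : anti N T R = anti N T' R' ∧ ∀ i < N, (rotConj N T R).x i = (rotConj N
    T' R').x i ∧
        (rotConj N T R).z i = (rotConj N T' R').z i := by
  have ha : anti N T R = anti N T' R' := par_congr fun i hi => by
    rw [(hT i hi).1, (hT i hi).2, (hR i hi).1, (hR i hi).2]
  refine ⟨ha, fun i hi => ?_⟩
  rw [rotConj_x hi, rotConj_x hi, rotConj_z hi, rotConj_z hi, ha,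
    (hT i hi).1, (hT i hi).2, (hR i hi).1, (hR i hi).2]
  exact ⟨rfl, rfl⟩

/-- This is the action `R ↦ g R gᴴ` on bits: `H` exchanges `x` and `z`, `S` adds `x` to `z`, and
`CX` adds `x` of the control to the target and `z` of the target to the control. Signs play no role
in the choice of the reducing gates, so negated axes may be replaced by the axes themselves. -/
theorem gate_bits {g : GCode} (hg : g.Valid N) (R : PStr) {i : ℕ} (hi : i < N) :
    ((pull N (invRots (gateRots N g)) R).x i, (pull N (invRots (gateRots N g)) R).z i) =
      cond (decide (g.1 = 0)) (cond (decide (i = g.2.1)) (R.z i, R.x i) (R.x i, R.z i))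
        (cond (decide (g.1 = 1)) (R.x i, R.z i ^^ (R.x g.2.1 && decide (i = g.2.1)))
          (R.x i ^^ (R.x g.2.1 && decide (i = g.2.2)),
            R.z i ^^ (R.z g.2.2 && decide (i = g.2.1)))) := by
  obtain ⟨k, c, q⟩ := g
  obtain ⟨hc, hq, hne⟩ := hg
  dsimp only at *
  have hn' : ∀ T : PStr, ∀ R : PStr, ∀ i < N, (rotConj N T.neg R).x i = (rotConj N T R).x i ∧
      (rotConj N T.neg R).z i = (rotConj N T R).z i := fun T R =>
    (rotConj_bits_congr (N := N) (T := T.neg) (T' := T) (fun _ _ => ⟨rfl, rfl⟩) fun _ _ => ⟨rfl, rfl⟩).2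
  have hn : ∀ T : PStr, ∀ R : PStr, ∀ i < N, (rotConj N T.neg.neg R).x i = (rotConj N T R).x i ∧
      (rotConj N T.neg.neg R).z i = (rotConj N T R).z i := fun T R i hi =>
    ⟨(hn' _ R i hi).1.trans (hn' T R i hi).1, (hn' _ R i hi).2.trans (hn' T R i hi).2⟩
  by_cases h0 : k = 0
  · subst h0
    simp only [gateRots, invRots, pull, decide_true, cond_true, List.reverse_cons, List.reverse_nil,
      List.nil_append, List.cons_append, List.map_cons, List.map_nil, List.foldl_cons, List.foldl_nil, (hn _ _
      _ hi).1, (hn _ _ _ hi).2, (hn _ _ _ hc).1, (hn _ _ _ hc).2, (pull_one_Z hc _ hi).1, (pull_one_Z hc _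
      hi).2, (pull_one_X hc _ hi).1, (pull_one_X hc _ hi).2, (pull_one_Z hc _ hc).1, (pull_one_Z hc _ hc).2,
      (pull_one_X hc _ hc).1, (pull_one_X hc _ hc).2]
    by_cases h : i = c
    · subst h
      cases R.x i <;> cases R.z i <;> simp
    · simp [h]
  by_cases h1 : k = 1
  · subst h1
    simp only [gateRots, invRots, pull, decide_true, cond_true, List.reverse_cons, List.reverse_nil,
      List.nil_append, List.map_cons, List.map_nil, List.foldl_cons, one_ne_zero, decide_false, cond_false,
      List.foldl_nil, (hn _ _ _ hi).1, (hn _ _ _ hi).2, (pull_one_Z hc _ hi).1, (pull_one_Z hc _ hi).2]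
  · simp only [gateRots, invRots, pull, h0, h1, List.reverse_cons, List.reverse_nil, List.nil_append,
      List.cons_append, List.map_cons, List.map_nil, List.foldl_cons, decide_false, cond_false,
      List.foldl_nil, (hn _ _ _ hi).1, (hn _ _ _ hi).2, (pull_one_Z hc _ hi).1, (pull_one_Z hc _ hi).2,
      (pull_one_X hq _ hi).1, (pull_one_X hq _ hi).2, (hn' _ _ _ hi).1, (hn' _ _ _ hi).2, (pull_one_ZX hc hq _
      hi).1, (pull_one_ZX hc hq _ hi).2, (hn _ _ _ hc).1, (hn _ _ _ hc).2, (pull_one_X hq _ hc).1, (pull_one_X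
      hq _ hc).2, (hn' _ _ _ hc).1, (hn' _ _ _ hc).2, (hn' _ _ _ hq).1, (hn' _ _ _ hq).2, (pull_one_ZX hc hq _
      hc).1, (pull_one_ZX hc hq _ hc).2, (pull_one_ZX hc hq _ hq).1, (pull_one_ZX hc hq _ hq).2]
    have hcq : c ≠ q := by tauto
    by_cases h : i = c
    · subst h
      cases R.x i <;> cases R.z i <;> cases R.z q <;> simp [hcq]
    · by_cases h' : i = q
      · subst h'
        cases R.x i <;> cases R.z i <;> cases R.x c <;> simp [h, Ne.symm h]
      · simp [h, h']

end bits

/-! ### Reduction of a Pauli string to a single `Z` by gates on the unknown lines -/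

section reduce
variable {N : ℕ}

theorem pull_innerRots_append (G G' : List GCode) (R : PStr) :
    pull N (innerRots N (G ++ G')) R = pull N (innerRots N G') (pull N (innerRots N G) R) := by
  rw [innerRots, List.flatMap_append, pull_append]; rfl

@[simp] theorem innerRots_cons (g : GCode) (G : List GCode) :
    innerRots N (g :: G) = invRots (gateRots N g) ++ innerRots N G := rfl

@[simp] theorem innerRots_nil : innerRots N [] = [] := rfl
@[simp] theorem pull_nil (R : PStr) : pull N [] R = R := rfl

/-- On an unknown line `H` turns `X` into `Z`, and `Y` is first turned into `X` by `S`. The lines do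
not interact, so the induction treats them one by one. -/
theorem reduce_stage1 (kn x z : ℕ → Bool) (Q : PStr) (hx : ∀ i < N, Q.x i = x i)
    (hz : ∀ i < N, Q.z i = z i) (k : ℕ) (hk : k ≤ N) : ∀ i < N,
    let R := pull N (innerRots N ((List.range k).flatMap fun i => cond (!kn i && x i)
      (cond (z i) [(1, i, i), (0, i, i)] [(0, i, i)]) [])) Q
    (R.x i, R.z i) = cond (decide (i < k) && !kn i) (false, x i || z i) (x i, z i) := by
  induction k with
  | zero => intro i hi; simp [hx i hi, hz i hi]
  | succ k ih =>
    have hk' : k < N := hk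
    have h0 : GCode.Valid N (0, k, k) := ⟨hk', hk', by simp⟩
    have h1 : GCode.Valid N (1, k, k) := ⟨hk', hk', by simp⟩
    intro i hi
    have e := ih hk'.le i hi
    have ek := ih hk'.le k hk'
    dsimp only at e ek ⊢
    rw [List.range_succ, List.flatMap_append, pull_innerRots_append]
    set R := pull N (innerRots N ((List.range k).flatMap fun i => cond (!kn i && x i)
      (cond (z i) [(1, i, i), (0, i, i)] [(0, i, i)]) [])) Q
    simp only [lt_self_iff_false, decide_false, Bool.false_and, cond_false, Prod.mk.injEq] at ek
    rw [Prod.mk.injEq, ← Prod.mk.injEq] at e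
    simp only [List.flatMap_cons, List.flatMap_nil, List.append_nil]
    have b0 : ∀ R : PStr, _ := fun R => gate_bits h0 R hi
    have b1 : ∀ R : PStr, _ := fun R => gate_bits h1 R hi
    simp only [decide_true, cond_true, one_ne_zero, decide_false, cond_false, Prod.mk.injEq] at b0 b1
    rcases lt_trichotomy i k with h | h | h
    · have hne : i ≠ k := by omega
      cases kn k <;> cases x k <;> cases z k <;>
        simp [pull_append, b0, b1, hne, h, e, Nat.lt_succ_of_lt h]
    · subst h
      simp only [lt_self_iff_false, decide_false, Bool.false_and, cond_false, Prod.mk.injEq] at e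
      cases hkn : kn i <;> cases hxi : x i <;> cases hzi : z i <;>
        simp [pull_append, b0, b1, e, hxi, hzi]
    · have hne : i ≠ k := by omega
      cases kn k <;> cases x k <;> cases z k <;>
        simp [pull_append, b0, b1, hne, e, show ¬ i < k by omega, show ¬ i < k + 1 by omega]

/-- With no `X` left on unknown lines, the `CX` from line `i` to line `j` adds `z_j = 1` to `z_i`
and changes nothing else. It cancels the `Z` on line `i` and keeps the one on line `j`. -/
theorem reduce_stage2 (kn w : ℕ → Bool) (j : ℕ) (hj : j < N) (R : PStr) (hxj : ∀ i < N, !kn i → R.x i = false)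
    (hw : ∀ i < N, !kn i → R.z i = w i) (hwj : w j = true) (hkj : kn j = false) (k : ℕ) (hk : k ≤ N) :
    ∀ i < N,
    let R' := pull N (innerRots N ((List.range k).flatMap fun i => cond (!kn i && w i && !decide (i = j))
      [(2, i, j)] [])) R
    (R'.x i, R'.z i) = (R.x i, cond (decide (i < k) && !kn i && !decide (i = j)) false (R.z i)) := by
  induction k with
  | zero => intro i hi; simp
  | succ k ih =>
    have hk' : k < N := hk
    intro i hi
    have e := ih hk'.le i hi
    have ek := ih hk'.le k hk'
    have ej := ih hk'.le j hj
    dsimp only at e ek ej ⊢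
    rw [List.range_succ, List.flatMap_append, pull_innerRots_append]
    set R' := pull N (innerRots N ((List.range k).flatMap fun i => cond (!kn i && w i && !decide (i = j))
      [(2, i, j)] [])) R
    simp only [lt_self_iff_false, decide_false, Bool.false_and, cond_false, Prod.mk.injEq,
      decide_true, Bool.not_true, Bool.and_false] at ek ej
    rw [Prod.mk.injEq, ← Prod.mk.injEq] at e
    simp only [List.flatMap_cons, List.flatMap_nil, List.append_nil]
    cases hc : !kn k && w k && !decide (k = j)
    · simp only [cond_false, innerRots_nil, pull_nil]
      rcases eq_or_ne i k with h | h
      · subst h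
        rw [Prod.mk.injEq, ek.1, ek.2]
        refine ⟨rfl, ?_⟩
        cases h1 : kn i
        · cases h2 : w i
          · rw [hw i hi (by simp [h1]), h2]; simp
          · have : decide (i = j) = true := by simpa [h1, h2] using hc
            simp [this]
        · simp
      · have : (i < k + 1) ↔ i < k := by omega
        simp only [e, this]
    · simp only [Bool.and_eq_true, Bool.not_eq_true', decide_eq_false_iff_not] at hc
      obtain ⟨⟨h1, h2⟩, h3⟩ := hc
      have b2 := gate_bits (N := N) (g := (2, k, j)) ⟨hk', hj, Or.inr (Or.inr h3)⟩ R' hi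
      simp only [OfNat.ofNat_ne_zero, OfNat.ofNat_ne_one, decide_false, cond_false] at b2
      simp only [cond_true, innerRots_cons, innerRots_nil, List.append_nil]
      rw [b2, ek.1, ej.2, hxj k hk' (by simp [h1]), hw j hj (by simp [hkj]), hwj]
      rcases eq_or_ne i k with h | h
      · subst h
        rw [ek.1, ek.2, hw i hi (by simp [h1]), h2]
        simp [h1, h3]
      · have : (i < k + 1) ↔ i < k := by omega
        rw [Prod.mk.injEq] at e
        simp [e, this, h]

theorem reduceGates_bits (ln : List (Bool × Bool)) (Q : PStr) {j : ℕ} (hj : j < N)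
    (hkj : (ln.getD j (false, false)).1 = false) (hQj : (Q.x j || Q.z j) = true) : ∀ i < N,
    let R := pull N (innerRots N (reduceGates N ln Q j)) Q
    (R.x i, R.z i) = cond (ln.getD i (false, false)).1 (Q.x i, Q.z i) (false, decide (i = j)) := by
  intro i hi
  have s1 := reduce_stage1 (N := N) (fun i => (ln.getD i (false, false)).1) Q.x Q.z Q
    (fun _ _ => rfl) (fun _ _ => rfl) N le_rfl
  dsimp only at s1 ⊢
  rw [reduceGates, pull_innerRots_append]
  set R := pull N (innerRots N ((List.range N).flatMap fun i => cond (!(ln.getD i (false, false)).1 && Q.x i)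
    (cond (Q.z i) [(1, i, i), (0, i, i)] [(0, i, i)]) [])) Q
  have s1' : ∀ i < N, !(ln.getD i (false, false)).1 → R.x i = false ∧ R.z i = (Q.x i || Q.z i) := by
    intro i hi hk
    have := s1 i hi
    simp only [hi, decide_true, Bool.true_and, hk, cond_true, Prod.mk.injEq] at this
    exact this
  have s2 := reduce_stage2 (N := N) (fun i => (ln.getD i (false, false)).1) (fun i => Q.x i || Q.z i)
    j hj R (fun i hi h => (s1' i hi h).1) (fun i hi h => (s1' i hi h).2) hQj hkj N le_rfl i hi
  dsimp only at s2
  rw [s2]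
  have s3 := s1 i hi
  rw [Prod.mk.injEq, ← Prod.mk.injEq] at s3
  cases hk : (ln.getD i (false, false)).1
  · have := s1' i hi (by rw [hk]; rfl)
    by_cases hij : i = j
    · subst hij; simp [this, hQj]
    · rw [List.getD_eq_getElem?_getD] at hk
      simp [this, hi, hij, hk]
  · simp only [hk, Bool.not_true, Bool.and_false, cond_false, Bool.false_and, cond_true] at s3 ⊢
    exact s3

theorem flipGates_bits {j : ℕ} (hj : j < N) (Q : PStr) : ∀ i < N,
    (pull N (innerRots N (flipGates j)) Q).x i = Q.x i ∧
      (pull N (innerRots N (flipGates j)) Q).z i = Q.z i := by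
  intro i hi
  have h0 : GCode.Valid N (0, j, j) := ⟨hj, hj, by simp⟩
  have h1 : GCode.Valid N (1, j, j) := ⟨hj, hj, by simp⟩
  have b0 : ∀ R : PStr, _ := fun R => gate_bits h0 R hi
  have b1 : ∀ R : PStr, _ := fun R => gate_bits h1 R hi
  have c0 : ∀ R : PStr, _ := fun R => gate_bits h0 R hj
  have c1 : ∀ R : PStr, _ := fun R => gate_bits h1 R hj
  simp only [decide_true, cond_true, one_ne_zero, decide_false, cond_false, Prod.mk.injEq,
    Bool.and_true, eq_self] at b0 b1 c0 c1
  simp only [flipGates, innerRots_cons, innerRots_nil, List.append_nil, pull_append]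
  by_cases h : i = j
  · subst h
    rw [(c0 _).1, (c0 _).2, (c1 _).1, (c1 _).2, (c1 _).1, (c1 _).2, (c0 _).1, (c0 _).2]
    exact ⟨by cases Q.x i <;> cases Q.z i <;> rfl, rfl⟩
  · simp only [h, decide_false, cond_false, Bool.and_false, Bool.xor_false, Prod.mk.injEq] at b0 b1
    simp [b0, b1]

/-- All gates are on lines which are not known. -/
def GatesOff (N : ℕ) (kn : ℕ → Bool) (G : List GCode) : Prop :=
  ∀ g ∈ G, GCode.Valid N g ∧ kn g.2.1 = false ∧ kn g.2.2 = false

theorem GatesOff.append {kn : ℕ → Bool} {G G' : List GCode} (h : GatesOff N kn G) (h' : GatesOff N kn G') :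
    GatesOff N kn (G ++ G') := fun g hg => (List.mem_append.1 hg).elim (h g) (h' g)

theorem flipGates_off {kn : ℕ → Bool} {j : ℕ} (hj : j < N) (hk : kn j = false) :
    GatesOff N kn (flipGates j) := by
  intro g hg
  simp only [flipGates, List.mem_cons, List.not_mem_nil, or_false] at hg
  rcases hg with rfl | rfl | rfl | rfl <;> exact ⟨⟨hj, hj, by simp⟩, hk, hk⟩

theorem reduceGates_off (ln : List (Bool × Bool)) (Q : PStr) {j : ℕ} (hj : j < N)
    (hkj : (ln.getD j (false, false)).1 = false) :
    GatesOff N (fun i => (ln.getD i (false, false)).1) (reduceGates N ln Q j) := by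
  intro g hg
  rcases List.mem_append.1 hg with hg | hg
  · obtain ⟨i, hi, hg⟩ := List.mem_flatMap.1 hg
    rw [List.mem_range] at hi
    have hk : (ln.getD i (false, false)).1 = false := by
      cases h : (ln.getD i (false, false)).1
      · rfl
      · rw [h] at hg; simp at hg
    have : g = (1, i, i) ∨ g = (0, i, i) := by
      revert hg
      cases (!(ln.getD i (false, false)).1 && Q.x i) <;> cases Q.z i <;> simp +contextual
    rcases this with rfl | rfl <;> exact ⟨⟨hi, hi, by simp⟩, hk, hk⟩
  · obtain ⟨i, hi, hg⟩ := List.mem_flatMap.1 hg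
    rw [List.mem_range] at hi
    cases h : !(ln.getD i (false, false)).1 && (Q.x i || Q.z i) && !decide (i = j)
    · rw [h] at hg; simp at hg
    · rw [h] at hg
      simp only [cond_true, List.mem_singleton] at hg
      simp only [Bool.and_eq_true, Bool.not_eq_true', decide_eq_false_iff_not] at h
      rw [hg]
      exact ⟨⟨hi, hj, Or.inr (Or.inr h.2)⟩, h.1.1, hkj⟩

theorem innerRots_herm {kn : ℕ → Bool} {G : List GCode} (h : GatesOff N kn G) :
    AllHerm N (innerRots N G) := by
  intro T hT
  obtain ⟨g, hg, hT⟩ := List.mem_flatMap.1 hT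
  exact (gateRots_herm (h g hg).1.2.2).inv T hT

theorem gateRots_x {g : GCode} {k : ℕ} (hk : k < N) (h2 : g.2.1 ≠ k) (h3 : g.2.2 ≠ k) {T : PStr}
    (hT : T ∈ gateRots N g) : T.x k = false ∧ T.z k = false := by
  have hZ : (Z N g.2.1).x k = false ∧ (Z N g.2.1).z k = false := by
    rw [Z, mk'_x hk, mk'_z hk]; simp [h2.symm]
  have hX : ∀ q, q ≠ k → (X N q).x k = false ∧ (X N q).z k = false := by
    intro q hq
    rw [X, mk'_x hk, mk'_z hk]; simp [hq.symm]
  have hZX : (ZX N g.2.1 g.2.2).x k = false ∧ (ZX N g.2.1 g.2.2).z k = false := by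
    rw [ZX, mk'_x hk, mk'_z hk]; simp [h2.symm, h3.symm]
  by_cases h0 : g.1 = 0
  · simp only [gateRots, h0, decide_true, cond_true, List.mem_cons, List.not_mem_nil, or_false] at hT
    rcases hT with rfl | rfl | rfl
    exacts [hZ, hX _ h2, hZ]
  by_cases h1 : g.1 = 1
  · simp only [gateRots, h1, decide_true, cond_true, one_ne_zero, decide_false, cond_false,
      List.mem_cons, List.not_mem_nil, or_false] at hT
    rw [hT]
    exact hZ
  · simp only [gateRots, h0, h1, decide_false, cond_false, List.mem_cons, List.not_mem_nil, or_false] at hT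
    rcases hT with rfl | rfl | rfl
    exacts [hZ, hX _ h3, hZX]

theorem pull_eq_self {ops : List PStr} {R : PStr} (h : ∀ T ∈ ops, anti N T R = false) :
    pull N ops R = R := by
  induction ops with
  | nil => rfl
  | cons T ops ih =>
    rw [pull, List.foldl_cons, rotConj, h T (by simp)]
    exact ih fun T hT => h T (List.mem_cons_of_mem _ hT)

/-- All axes of the gates act trivially on the known line, hence commute with its `Z`. -/
theorem pull_innerRots_Z {kn : ℕ → Bool} {G : List GCode} (h : GatesOff N kn G) {k : ℕ} (hk : k < N)
    (hkn : kn k = true) : pull N (innerRots N G) (Z N k) = Z N k := by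
  refine pull_eq_self fun T hT => ?_
  obtain ⟨g, hg, hT⟩ := List.mem_flatMap.1 hT
  obtain ⟨S, hS, rfl⟩ := List.mem_map.1 hT
  have := (gateRots_x (N := N) (g := g) hk (fun e => by have := (h g hg).2.1; simp_all)
    (fun e => by have := (h g hg).2.2; simp_all) (List.mem_reverse.1 hS)).1
  rw [anti_Z hk]; exact this

end reduce

/-! ### Soundness of the engine -/

/-- The projector onto the value `b` of a Pauli operator. -/
def pproj (N : ℕ) (Q : PStr) (b : Bool) : Op N := (2 : ℂ)⁻¹ • (1 + sgn b • Q.op N)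

section diag
variable {N : ℕ}

theorem projZ_eq_pproj (q : Fin N) (b : Bool) : projZ q b = pproj N (Z N q) b := projZ_eq q b

/-- The value of a product of `Z` on a basis state. -/
def zval (N : ℕ) (Q : PStr) (a : Fin N → Bool) : ℂ := sgn Q.hi * ∏ i : Fin N, sgn (Q.z i && a i)

theorem pproj_diag {Q : PStr} (hx : ∀ i < N, Q.x i = false) (hlo : Q.lo = false) (b : Bool) :
    pproj N Q b = Matrix.diagonal fun a => 2⁻¹ * (1 + sgn b * zval N Q a) := by
  ext a a'
  simp only [pproj, op, fun i : Fin N => hx i i.2, ph, hlo, iph_false, mul_one, Bool.xor_false, ← funext_iff,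
    Matrix.smul_apply, Matrix.add_apply, Matrix.one_apply, Matrix.diagonal_apply, zval, smul_eq_mul]
  split_ifs with h
  · rw [h]
  · simp

theorem diag_sandwich_apply (e : (Fin N → Bool) → ℂ) (B : Op N) (a a' : Fin N → Bool) :
    (Matrix.diagonal e * B * Matrix.diagonal e) a a' = e a * B a a' * e a' := by
  rw [Matrix.mul_diagonal, Matrix.diagonal_mul]

theorem zval_eq {Q : PStr} {a : Fin N → Bool} {v : ℕ → Bool} (h : ∀ i : Fin N, Q.z i = true → a i = v i) :
    zval N Q a = sgn (Q.hi ^^ par N fun i => Q.z i && v i) := by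
  rw [zval, sgn_xor, ← prod_sgn]
  congr 1
  refine Finset.prod_congr rfl fun i _ => ?_
  cases hz : Q.z i
  · rfl
  · rw [h i hz]

theorem half_sgn (b c : Bool) : (2 : ℂ)⁻¹ * (1 + sgn b * sgn c) = if b = c then 1 else 0 := by
  cases b <;> cases c <;> norm_num

theorem zval_Z (j : Fin N) (a : Fin N → Bool) : zval N (Z N j) a = sgn (a j) := by
  rw [zval, Finset.prod_eq_single j]
  · simp [Z]
  · intro i _ hi
    simp [Z, Fin.val_ne_of_ne hi]
  · simp

theorem pproj_Z_diag (j : Fin N) (m : Bool) :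
    pproj N (Z N j) m = Matrix.diagonal fun a => if a j = m then 1 else 0 := by
  rw [pproj_diag (fun i hi => by rw [Z, mk'_x hi]) rfl]
  congr 1
  ext a
  rw [zval_Z, half_sgn]
  simp only [eq_comm]

theorem pproj_frame {ops : List PStr} (h : AllHerm N ops) (R : PStr) (b : Bool) (B : Op N) :
    pproj N R b * (frame N ops * B * (frame N ops)ᴴ) * pproj N R b =
      frame N ops * (pproj N (pull N ops R) b * B * pproj N (pull N ops R) b) * (frame N ops)ᴴ := by
  have h1 : pproj N R b * frame N ops = frame N ops * pproj N (pull N ops R) b := by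
    simp only [pproj, smul_mul_assoc, mul_smul_comm, add_mul, mul_add, one_mul, mul_one, op_mul_frame h]
  have h2 : (frame N ops)ᴴ * pproj N R b = pproj N (pull N ops R) b * (frame N ops)ᴴ := by
    simp only [pproj, smul_mul_assoc, mul_smul_comm, add_mul, mul_add, one_mul, mul_one, star_frame_mul_op h]
  calc _ = (pproj N R b * frame N ops) * B * ((frame N ops)ᴴ * pproj N R b) := by
        simp only [mul_assoc]
    _ = _ := by rw [h1, h2]; simp only [mul_assoc]

end diag

namespace ES
variable {N : ℕ} {S : ES} {B : Op N}

/-- The state which is represented. -/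
def den (N : ℕ) (S : ES) (B : Op N) : Op N := frame N S.ops * B * (frame N S.ops)ᴴ

/-- The support condition concerns rows and columns, so that `Z` of a known line acts on `B` as a
sign from either side. Positivity and normalisation of `B` are not needed: a run is linear in the
state. -/
structure Inv (N : ℕ) (S : ES) (B : Op N) : Prop where
  herm : AllHerm N S.ops
  sup : ∀ a b, B a b ≠ 0 → ∀ i : Fin N, S.kn i = true → a i = S.vl i ∧ b i = S.vl i

theorem Inv.trace (h : S.Inv N B) : (S.den N B).trace = B.trace := trace_frame h.herm B

theorem Inv.Z_mul (h : S.Inv N B) (i : Fin N) (hi : S.kn i = true) :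
    (Z N i).op N * B = sgn (S.vl i) • B := by
  ext a b
  rw [Matrix.mul_apply, Finset.sum_eq_single a, op_Z_apply, if_pos rfl, Matrix.smul_apply, smul_eq_mul]
  · by_cases hB : B a b = 0
    · simp [hB]
    · rw [(h.sup a b hB i hi).1]
  · intro c _ hc
    rw [op_Z_apply, if_neg (Ne.symm hc), zero_mul]
  · simp

theorem Inv.mul_Z (h : S.Inv N B) (i : Fin N) (hi : S.kn i = true) :
    B * (Z N i).op N = sgn (S.vl i) • B := by
  ext a b
  rw [Matrix.mul_apply, Finset.sum_eq_single b, op_Z_apply, if_pos rfl, Matrix.smul_apply, smul_eq_mul]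
  · by_cases hB : B a b = 0
    · simp [hB]
    · rw [(h.sup a b hB i hi).2, mul_comm]
  · intro c _ hc
    rw [op_Z_apply, if_neg hc, mul_zero]
  · simp

/-! Gates -/

theorem Inv.gate (h : S.Inv N B) {g : GCode} (hg : GCode.Valid N g) : (S.gate N g).Inv N B :=
  ⟨(gateRots_herm hg.2.2).append h.herm, h.sup⟩

theorem den_gate (g : GCode) : (S.gate N g).den N B =
    frame N (gateRots N g) * S.den N B * (frame N (gateRots N g))ᴴ := by
  simp only [den, ES.gate, frame_append, Matrix.conjTranspose_mul, mul_assoc]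

/-! Measurements with a random outcome -/

theorem coinRot_op {Q : PStr} {j : ℕ} {b : Bool} : Complex.I • (S.coinRot N Q j b).op N =
    (sgn b * sgn (S.vl j)) • (Q.op N * (Z N j).op N) := by
  rw [op_mul, ← sgn_xor, coinRot]
  cases b ^^ S.vl j
  · rw [cond_false, op_neg, op_timesI, smul_neg, smul_smul, Complex.I_mul_I]; simp
  · rw [cond_true, op_timesI, smul_smul, Complex.I_mul_I]; simp

theorem anti_op {Q : PStr} {j : Fin N} (hQ : Q.x j = true) :
    (Z N j).op N * Q.op N = - (Q.op N * (Z N j).op N) := by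
  rw [op_comm, anti_comm, anti_Z j.2, hQ]; simp

theorem coinRot_herm {Q : PStr} {j : Fin N} {b : Bool} (hQh : Q.Herm N) (hQ : Q.x j = true) :
    (S.coinRot N Q j b).Herm N := by
  have h2 := anti_op hQ
  have h3 := coinRot_op (N := N) (S := S) (Q := Q) (j := j) (b := b)
  have h4 : (S.coinRot N Q j b).op N =
      (-Complex.I * (sgn b * sgn (S.vl j))) • (Q.op N * (Z N j).op N) := by
    rw [← smul_smul, ← h3, smul_smul]; simp
  have h5 : Q.op N * (Z N j).op N * (Q.op N * (Z N j).op N) = -1 := by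
    rw [mul_assoc, ← mul_assoc ((Z N j).op N), h2, neg_mul, mul_neg, mul_assoc, ← mul_assoc (Q.op N),
      hQh.sq, one_mul, (herm_Z N j).sq]
  rw [herm_iff, h4, smul_mul_smul_comm, h5, smul_neg, ← neg_smul]
  have : -(-Complex.I * (sgn b * sgn (S.vl j)) * (-Complex.I * (sgn b * sgn (S.vl j)))) = 1 := by
    linear_combination (-(sgn b * sgn b) * (sgn (S.vl j) * sgn (S.vl j))) * Complex.I_mul_I +
      (sgn b * sgn b) * sgn_mul_self (S.vl j) + sgn_mul_self b
  rw [this, one_smul]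

/-- Each projected branch is a unitary image of `B` with weight 1/2. Thus a fair coin replaces the
measurement, and the real state is not touched. -/
theorem coin_sound (h : S.Inv N B) {q : ℕ} {j : Fin N} (b : Bool) (role : Role) (hj : S.kn j = true) (hQ :
    Ẑ[N, S, q].x j = true) : (S.coin N Ẑ[N, S, q] j b role).Inv N B ∧ pproj N (Z N q) b * S.den N B * pproj N
    (Z N q) b =
      (2 : ℂ)⁻¹ • (S.coin N Ẑ[N, S, q] j b role).den N B := by
  have hQh := pull_herm h.herm (herm_Z N q)
  set Q := Ẑ[N, S, q] with hQdef
  have hT : (S.coinRot N Q j b).Herm N := coinRot_herm hQh hQ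
  refine ⟨⟨h.herm.append fun T hT' => by rwa [List.mem_singleton.1 hT'], h.sup⟩, ?_⟩
  have hv := sgn_mul_self (S.vl j)
  have e1 : pproj N Q b * B = ((Real.sqrt 2 : ℝ) : ℂ)⁻¹ • (rotOp N (S.coinRot N Q j b) * B) := by
    rw [rotOp, coinRot_op, smul_mul_assoc, smul_smul, sqrt2_inv_mul_self, pproj, smul_mul_assoc,
      add_mul, add_mul, smul_mul_assoc, smul_mul_assoc, mul_assoc (Q.op N), h.Z_mul j hj,
      mul_smul_comm, smul_smul, mul_assoc, hv, mul_one]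
  -- From the right, `Z` has to stand before `Q` to act on `B`. Exchanging the two produces the sign
  -- by which the adjoint of the rotation differs from the rotation.
  have e2 : B * pproj N Q b = ((Real.sqrt 2 : ℝ) : ℂ)⁻¹ • (B * (rotOp N (S.coinRot N Q j b))ᴴ) := by
    have h1 := anti_op hQ
    have h2 : Q.op N * (Z N j).op N = - ((Z N j).op N * Q.op N) := by rw [h1, neg_neg]
    rw [rotOp_conjTranspose hT, coinRot_op, mul_smul_comm, smul_smul, sqrt2_inv_mul_self, pproj,
      mul_smul_comm, mul_add, mul_sub, mul_smul_comm, mul_smul_comm, h2, mul_neg, smul_neg, sub_neg_eq_add, ←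
      mul_assoc, h.mul_Z j hj, smul_mul_assoc, smul_smul, mul_assoc, hv, mul_one, mul_one]
  rw [den, pproj_frame h.herm, den, ES.coin, frame_append, frame_cons, frame_nil, mul_one,
    Matrix.conjTranspose_mul, ← hQdef, e1, smul_mul_assoc, mul_assoc (rotOp _ _), e2]
  simp only [mul_smul_comm, smul_mul_assoc, smul_smul, sqrt2_inv_mul_self, mul_assoc]

/-! Measurements with a determined outcome -/

theorem lo_eq_false {Q : PStr} (hQ : Q.Herm N) (hx : ∀ i < N, Q.x i = false) : Q.lo = false := by
  rw [hQ, par_congr (g := fun _ => false) fun i hi => by rw [hx i hi, Bool.and_false], par_false]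

/-- The pulled-back operator is diagonal and involves known lines only, so it is a constant sign on
the support of `B`. -/
theorem det_sound (h : S.Inv N B) {R : PStr} (hR : R.Herm N) (hx : ∀ i < N, (pull N S.ops R).x i = false) (hz
    : ∀ i < N, S.kn i = false → (pull N S.ops R).z i = false) (b : Bool) : pproj N R b * S.den N B * pproj N R
    b =
      if b = S.outc N (pull N S.ops R) then S.den N B else 0 := by
  have hQh := pull_herm h.herm hR
  rw [den, pproj_frame h.herm]
  set Q := pull N S.ops R
  have key : pproj N Q b * B * pproj N Q b = if b = S.outc N Q then B else 0 := by
    rw [pproj_diag hx (lo_eq_false hQh hx)]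
    ext a a'
    rw [diag_sandwich_apply]
    by_cases hB : B a a' = 0
    · split_ifs <;> simp [hB]
    · have hk : ∀ i : Fin N, Q.z i = true → S.kn i = true := fun i hi => by
        by_contra hk
        rw [hz i i.2 (by simpa using hk)] at hi
        simp at hi
      rw [zval_eq (v := S.vl) fun i hi => (h.sup a a' hB i (hk i hi)).1,
        zval_eq (v := S.vl) fun i hi => (h.sup a a' hB i (hk i hi)).2, half_sgn]
      unfold outc
      split_ifs <;> simp
  rw [key]
  split_ifs <;> simp

/-! Real measurements -/

theorem setLn_getD {ln : List (Bool × Bool)} {i j : ℕ} {m : Bool} (hi : i < N) :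
    (setLn N ln j m).getD i (false, false) = if i = j then (true, m) else ln.getD i (false, false) := by
  rw [setLn, getD_tab hi]
  by_cases h : i = j <;> simp [h]

theorem real_kn {G : List GCode} {i j : ℕ} {m : Bool} {role : Role} (hi : i < N) :
    (S.real N G j m role).kn i = (decide (i = j) || S.kn i) := by
  unfold kn ES.real
  rw [setLn_getD hi]
  by_cases h : i = j <;> simp [h]

theorem real_vl {G : List GCode} {i j : ℕ} {m : Bool} {role : Role} (hi : i < N) :
    (S.real N G j m role).vl i = if i = j then m else S.vl i := by
  unfold vl ES.real
  rw [setLn_getD hi]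
  by_cases h : i = j <;> simp [h]

/-- The state after the gates. -/
def gatesOn (N : ℕ) (G : List GCode) (B : Op N) : Op N :=
  (frame N (innerRots N G))ᴴ * B * frame N (innerRots N G)

/-- The state after the gates and the measurement. -/
def realOn (N : ℕ) (G : List GCode) (j : ℕ) (m : Bool) (B : Op N) : Op N :=
  pproj N (Z N j) m * gatesOn N G B * pproj N (Z N j) m

/-- The gates commute with the `Z` of a known line, so this `Z` still acts on both sides as the
recorded sign; comparison of entries gives the support. -/
theorem gatesOn_sup (h : S.Inv N B) {G : List GCode} (hG : GatesOff N S.kn G) :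
    ∀ a b, gatesOn N G B a b ≠ 0 → ∀ i : Fin N, S.kn i = true → a i = S.vl i ∧ b i = S.vl i := by
  have hH := innerRots_herm hG
  intro a b hab i hi
  have hp := pull_innerRots_Z hG i.2 hi
  have h1 : (Z N i).op N * gatesOn N G B = sgn (S.vl i) • gatesOn N G B := by
    have := star_frame_mul_op hH (Z N i)
    rw [hp] at this
    rw [gatesOn, ← mul_assoc, ← mul_assoc, ← this, mul_assoc _ _ B, h.Z_mul i hi, mul_smul_comm,
      smul_mul_assoc]
  have h2 : gatesOn N G B * (Z N i).op N = sgn (S.vl i) • gatesOn N G B := by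
    have := op_mul_frame hH (Z N i)
    rw [hp] at this
    rw [gatesOn, mul_assoc, ← this, ← mul_assoc, mul_assoc _ B, h.mul_Z i hi, mul_smul_comm, smul_mul_assoc]
  have h1' := congrFun (congrFun h1 a) b
  have h2' := congrFun (congrFun h2 a) b
  rw [Matrix.mul_apply, Finset.sum_eq_single a (fun c _ hc => by
    rw [op_Z_apply, if_neg (Ne.symm hc), zero_mul]) (by simp), op_Z_apply, if_pos rfl,
    Matrix.smul_apply, smul_eq_mul] at h1'
  rw [Matrix.mul_apply, Finset.sum_eq_single b (fun c _ hc => by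
    rw [op_Z_apply, if_neg hc, mul_zero]) (by simp), op_Z_apply, if_pos rfl,
    Matrix.smul_apply, smul_eq_mul, mul_comm] at h2'
  exact ⟨sgn_inj (mul_right_cancel₀ hab h1'), sgn_inj (mul_right_cancel₀ hab h2')⟩

theorem Inv.real (h : S.Inv N B) {G : List GCode} (hG : GatesOff N S.kn G) (j : Fin N) (m : Bool)
    (role : Role) : (S.real N G j m role).Inv N (realOn N G j m B) := by
  refine ⟨h.herm.append (innerRots_herm hG), fun a b hab i hi => ?_⟩
  rw [realOn, pproj_Z_diag, diag_sandwich_apply] at hab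
  rw [real_kn i.2] at hi
  rw [real_vl i.2]
  split_ifs with hij
  · have hij' : i = j := Fin.ext hij
    subst hij'
    constructor <;> by_contra hne <;> simp [hne] at hab
  · simp only [hij, decide_false, Bool.false_or] at hi
    refine gatesOn_sup h hG a b (fun h0 => ?_) i hi
    rw [h0] at hab; simp at hab

/-- The value of line `j` enters the parity because `Q` has a `Z` there. So simulated and real
outcome differ by a bit that does not depend on `m`. -/
theorem outc_real {G : List GCode} {j : ℕ} (hj : j < N) {role : Role} {Q : PStr}
    (hQ : Q.z j = true) (m : Bool) : (S.real N G j m role).outc N Q =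
      ((S.real N G j false role).outc N Q ^^ m) := by
  simp only [outc]
  have : par N (fun i => Q.z i && (S.real N G j m role).vl i) =
      (par N (fun i => Q.z i && (S.real N G j false role).vl i) ^^ m) := by
    have e : m = par N (fun i => decide (i = j) && m) := (par_single hj fun _ => m).symm
    conv_rhs => rw [e]
    rw [← par_xor]
    refine par_congr fun i hi => ?_
    rw [real_vl hi, real_vl hi]
    by_cases hij : i = j
    · subst hij; simp [hQ]
    · simp [hij]
  rw [this]; simp

/-- In the new frame the measured operator is `Z` on line `j` times `Z` on known lines. On the
support of the state the latter are signs, so the projectors of the simulated and of the real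
measurement coincide. -/
theorem real_sound (h : S.Inv N B) {G : List GCode} (hG : GatesOff N S.kn G) {R : PStr} (hR : R.Herm N) {j :
    Fin N} (role : Role) (hx : ∀ i < N, (pull N (S.ops ++ innerRots N G) R).x i = false) (hz : ∀ i < N, S.kn i
    = false → (pull N (S.ops ++ innerRots N G) R).z i = decide (i = (j : ℕ))) (hj : S.kn j = false) (m : Bool)
    : pproj N R ((S.real N G j m role).outc N (pull N (S.ops ++ innerRots N G) R)) * S.den N B * pproj N R
    ((S.real N G j m role).outc N (pull N (S.ops ++ innerRots N G) R)) =
      (S.real N G j m role).den N (realOn N G j m B) := by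
  have hall := h.herm.append (innerRots_herm hG)
  have hQh := pull_herm hall hR
  have e : S.den N B = frame N (S.ops ++ innerRots N G) * gatesOn N G B *
      (frame N (S.ops ++ innerRots N G))ᴴ := by
    have hF := frame_mul_star (innerRots_herm hG)
    rw [den, gatesOn, frame_append, Matrix.conjTranspose_mul]
    calc _ = frame N S.ops * (frame N (innerRots N G) * (frame N (innerRots N G))ᴴ) * B *
          (frame N (innerRots N G) * (frame N (innerRots N G))ᴴ) * (frame N S.ops)ᴴ := by
          rw [hF, mul_one, mul_one]
      _ = _ := by simp only [mul_assoc]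
  rw [e, pproj_frame hall, den]
  set Q := pull N (S.ops ++ innerRots N G) R
  have hzj : Q.z j = true := by rw [hz j j.2 hj]; simp
  congr 2
  rw [pproj_diag hx (lo_eq_false hQh hx), realOn, pproj_Z_diag]
  ext a a'
  rw [diag_sandwich_apply, diag_sandwich_apply]
  by_cases hB : gatesOn N G B a a' = 0
  · simp [hB]
  have hs := gatesOn_sup h hG a a' hB
  have hv : ∀ a : Fin N → Bool, (∀ i : Fin N, S.kn i = true → a i = S.vl i) →
      (2 : ℂ)⁻¹ * (1 + sgn ((S.real N G j m role).outc N Q) * zval N Q a) =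
        if a j = m then 1 else 0 := by
    intro a ha
    -- On the basis state `a` the values on known lines are the recorded ones, and `a j` takes the
    -- place of the real outcome.
    rw [zval_eq (v := (S.real N G j (a j) role).vl) fun i hi => ?_, half_sgn]
    · change (if _ = (S.real N G j (a j) role).outc N Q then (1 : ℂ) else 0) = _
      rw [outc_real j.2 hzj m, outc_real j.2 hzj (a j)]
      congr 1
      cases (S.real N G j false role).outc N Q <;> cases m <;> cases a j <;> simp
    · rw [real_vl i.2]
      split_ifs with hij
      · rw [Fin.ext hij]
      · refine ha i ?_
        by_contra hk
        rw [hz i i.2 (by simpa using hk)] at hi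
        simp [hij] at hi
  rw [hv a fun i hi => (hs i hi).1, hv a' fun i hi => (hs i hi).2]

end ES

/-! ### Runs of a circuit from the middle -/

/-- The mean of a function of a string of `l` bits. -/
def avgL : ℕ → (List Bool → ℝ) → ℝ
  | 0, F => F []
  | l + 1, F => 2⁻¹ * avgL l (fun w => F (false :: w)) + 2⁻¹ * avgL l (fun w => F (true :: w))

theorem avgL_eq (l : ℕ) (F : List Bool → ℝ) :
    avgL l F = (2 ^ l : ℝ)⁻¹ * ∑ r : Fin l → Bool, F (List.ofFn r) := by
  induction l generalizing F with
  | zero => simp [avgL]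
  | succ l ih =>
    rw [avgL, ih, ih, ← (Fin.consEquiv fun _ => Bool).sum_comp, Fintype.sum_prod_type]
    simp [Fin.consEquiv, List.ofFn_succ, pow_succ]
    ring

theorem avgL_congr {l : ℕ} {F G : List Bool → ℝ} (h : ∀ w, w.length = l → F w = G w) :
    avgL l F = avgL l G := by
  induction l generalizing F G with
  | zero => exact h _ rfl
  | succ l ih =>
    rw [avgL, avgL, ih fun w hw => h _ (by simp [hw]), ih fun w hw => h _ (by simp [hw])]

theorem avgL_add (l : ℕ) (F G : List Bool → ℝ) :
    avgL l (fun w => F w + G w) = avgL l F + avgL l G := by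
  induction l generalizing F G with
  | zero => rfl
  | succ l ih => rw [avgL, ih, ih, avgL, avgL]; ring

theorem avgL_mul (l : ℕ) (c : ℝ) (F : List Bool → ℝ) :
    avgL l (fun w => c * F w) = c * avgL l F := by
  induction l generalizing F with
  | zero => rfl
  | succ l ih => rw [avgL, ih, ih, avgL]; ring

theorem avgL_const (l : ℕ) (c : ℝ) : avgL l (fun _ => c) = c := by
  induction l with
  | zero => rfl
  | succ l ih => rw [avgL, ih]; ring

theorem avgL_append (l l' : ℕ) (F : List Bool → ℝ) :
    avgL (l + l') F = avgL l fun w => avgL l' fun w' => F (w ++ w') := by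
  induction l generalizing F with
  | zero => simp [avgL]
  | succ l ih => rw [Nat.succ_add, avgL, ih, ih, avgL]; rfl

theorem sum_pair (x y : ℝ) : [x, y].sum = x + y := by simp

namespace Circuit
variable {N : ℕ} {C : Circuit N} {rd : List Bool}

/-- The value of `f` at the end of the run, with `k` steps to go after step `i`. -/
def run (C : Circuit N) (rd : List Bool) (f : Record → ℝ) : (k i : ℕ) → Record → Op N → ℝ
  | 0, _, m, α => f m * α.trace.re
  | k + 1, i, m, α =>
    (((C.step i m.history rd).apply m α).map fun b => C.run rd f k (i + 1) b.1 b.2).sum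

theorem sum_branches (f : Record → ℝ) (α : Op N) (k i : ℕ) :
    ((C.branches rd α (i + k)).map fun b => f b.1 * b.2.trace.re).sum =
      ((C.branches rd α i).map fun b => C.run rd f k i b.1 b.2).sum := by
  induction k generalizing i with
  | zero => rfl
  | succ k ih =>
    rw [← Nat.succ_add_eq_add_succ, ih, branches, List.flatMap_def, List.map_flatten,
      List.sum_flatten, List.map_map, List.map_map]
    congr 1

/-- The indicator of the runs which are accepted with output in `E`. -/
def ind (E : Set (List Bool)) (m : Record) : ℝ :=
  open Classical in if m.Accepted ∧ m.output ∈ E then 1 else 0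

theorem weight_eq (α : Op N) (E : Set (List Bool)) :
    C.weight α E = avgL C.coins fun rd => C.run rd (ind E) C.length 0 [] α := by
  classical
  rw [weight, avgL_eq]
  congr 1
  refine Finset.sum_congr rfl fun r _ => ?_
  have := sum_branches (C := C) (rd := List.ofFn r) (ind E) α C.length 0
  rw [zero_add] at this
  rw [show C.run (List.ofFn r) (ind E) C.length 0 [] α = _ from (by simp [branches] : _ =
    ((C.branches (List.ofFn r) α 0).map fun b =>
      C.run (List.ofFn r) (ind E) C.length 0 b.1 b.2).sum), ← this]
  congr 2
  ext b
  simp only [ind]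
  split_ifs <;> simp

/-- For a given record the rest of the run is linear in the state. This permits unnormalised
branches, the halves produced by coins, and mixtures. -/
theorem run_smul (f : Record → ℝ) (c : ℝ) (k i : ℕ) (m : Record) (α : Op N) :
    C.run rd f k i m ((c : ℂ) • α) = c * C.run rd f k i m α := by
  induction k generalizing i m α with
  | zero => simp [run, Matrix.trace_smul]; ring
  | succ k ih =>
    rw [run, run]
    cases C.step i m.history rd with
    | idle => simp [Instr.apply, ih, -Complex.coe_smul]
    | gate u => simp [Instr.apply, ih, mul_smul_comm, smul_mul_assoc, -Complex.coe_smul]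
    | meas q role => simp [Instr.apply, ih, mul_smul_comm, smul_mul_assoc, mul_add, -Complex.coe_smul]

theorem run_zero (f : Record → ℝ) (k i : ℕ) (m : Record) : C.run rd f k i m (0 : Op N) = 0 := by
  have := run_smul (C := C) (rd := rd) f 0 k i m 0
  simpa using this

theorem run_half (f : Record → ℝ) (k i : ℕ) (m : Record) (α : Op N) :
    C.run rd f k i m ((2 : ℂ)⁻¹ • α) = 2⁻¹ * C.run rd f k i m α := by
  have := run_smul (C := C) (rd := rd) f 2⁻¹ k i m α
  rw [← this]; norm_num

theorem run_add (f : Record → ℝ) (k i : ℕ) (m : Record) (α β : Op N) :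
    C.run rd f k i m (α + β) = C.run rd f k i m α + C.run rd f k i m β := by
  induction k generalizing i m α β with
  | zero => simp [run, Matrix.trace_add]; ring
  | succ k ih =>
    rw [run, run, run]
    cases C.step i m.history rd with
    | idle => simp [Instr.apply, ih]
    | gate u => simp [Instr.apply, ih, mul_add, add_mul]
    | meas q role => simp [Instr.apply, ih, mul_add, add_mul]; ring

end Circuit

/-! ### The simulation -/

namespace ES
variable {N : ℕ}

/-- The value of `f` at the end of a run of the engine on `B`, with `k` steps to go. -/
def sim (N : ℕ) (us : ℕ → Record → ICode) (f : Record → ℝ) : (k i : ℕ) → ES → Op N → List Bool → ℝ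
  | 0, _, S, B, _ => f S.log * B.trace.re
  | k + 1, i, S, B, r =>
    match S.plan N (us i S.log) with
    | [] => sim N us f k (i + 1) (S.pass N (us i S.log) (r.headD false)) B r.tail
    | p :: _ =>
      sim N us f k (i + 1) (S.take N (us i S.log) p false) (realOn N p.1 p.2.1 false B) r.tail +
      sim N us f k (i + 1) (S.take N (us i S.log) p true) (realOn N p.1 p.2.1 true B) r.tail

section
variable {S : ES} {B : Op N}

theorem isEmpty_filter {p : ℕ → Bool} (h : ((List.range N).filter p).isEmpty = true) :
    ∀ i < N, p i = false := by
  intro i hi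
  have := List.filter_eq_nil_iff.1 (List.isEmpty_iff.1 h) i (List.mem_range.2 hi)
  simpa using this

theorem head_filter {p : ℕ → Bool} (h : ((List.range N).filter p).isEmpty = false) :
    ((List.range N).filter p).headD 0 < N ∧ p (((List.range N).filter p).headD 0) = true := by
  cases hl : (List.range N).filter p with
  | nil => rw [hl] at h; simp at h
  | cons j l =>
    have : j ∈ (List.range N).filter p := by rw [hl]; simp
    simpa using this

theorem realGates_spec {q j : ℕ} {role : Role} (hj : j < N) (ha : (S.antiL N Ẑ[N, S, q]).isEmpty = true)
    (hr : (!S.kn j && (Ẑ[N, S, q].x j || Ẑ[N, S, q].z j)) = true) :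
    GatesOff N S.kn (S.realGates N q role j) ∧
      ∀ R, R = pull N (S.ops ++ innerRots N (S.realGates N q role j)) (Z N q) → ∀ i < N, R.x i = false ∧
        (S.kn i = false → R.z i = decide (i = j)) ∧ (S.kn i = true → R.z i = Ẑ[N, S, q].z i) := by
  rw [Bool.and_eq_true, Bool.not_eq_true'] at hr
  unfold realGates
  set Q := Ẑ[N, S, q]
  have hoff := reduceGates_off (N := N) S.ln Q hj hr.1
  have hbits := reduceGates_bits (N := N) S.ln Q hj hr.1 hr.2
  set G := reduceGates N S.ln Q j
  have base : ∀ i < N, (pull N (innerRots N G) Q).x i = false ∧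
      (S.kn i = false → (pull N (innerRots N G) Q).z i = decide (i = j)) ∧
      (S.kn i = true → (pull N (innerRots N G) Q).z i = Q.z i) := by
    intro i hi
    have hb := hbits i hi
    dsimp only at hb
    have hkn : (S.ln.getD i (false, false)).1 = S.kn i := rfl
    rw [hkn] at hb
    cases hk : S.kn i
    · rw [hk, cond_false, Prod.mk.injEq] at hb
      exact ⟨hb.1, fun _ => hb.2, fun h => by simp at h⟩
    · rw [hk, cond_true, Prod.mk.injEq] at hb
      have := isEmpty_filter ha i hi
      rw [hk, Bool.true_and] at this
      exact ⟨hb.1.trans this, fun h => by simp at h, fun _ => hb.2⟩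
  -- The flip changes signs only, so the bits are the same with and without it.
  generalize (role.isPost && _) = fl
  cases fl
  · simp only [cond_false, List.append_nil, pull_append]
    exact ⟨hoff, fun _ e => by rw [e]; exact base⟩
  · simp only [cond_true, pull_append, pull_innerRots_append]
    refine ⟨GatesOff.append hoff (flipGates_off hj hr.1), ?_⟩
    rintro _ rfl i hi
    obtain ⟨h1, h2⟩ := flipGates_bits hj (pull N (innerRots N G) Q) i hi
    have := base i hi
    rw [← h1, ← h2] at this
    exact this

theorem plan_meas_eq {q : ℕ} {role : Role} : S.plan N (2, (0, q, q), role) = cond ((S.antiL N Ẑ[N, S,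
    q]).isEmpty && !(S.realL N Ẑ[N, S, q]).isEmpty) [(S.realGates N q role ((S.realL N Ẑ[N, S, q]).headD 0),
    (S.realL N Ẑ[N, S, q]).headD 0, role)] [] := rfl

theorem pass_meas_eq {q : ℕ} {role : Role} {b : Bool} : S.pass N (2, (0, q, q), role) b = cond (S.antiL N Ẑ[N,
    S, q]).isEmpty (S.det N q role) (S.coin N Ẑ[N, S, q] ((S.antiL N Ẑ[N, S, q]).headD 0) b role) := rfl

theorem trace_realOn {G : List GCode} (hG : AllHerm N (innerRots N G)) (j : Fin N) (B : Op N) :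
    (realOn N G j false B).trace + (realOn N G j true B).trace = B.trace := by
  have hp : ∀ m, pproj N (Z N j) m * pproj N (Z N j) m = pproj N (Z N j) m := fun m => by
    rw [pproj_Z_diag, Matrix.diagonal_mul_diagonal]
    congr 1; ext a; split_ifs <;> simp
  have hs : pproj N (Z N j) false + pproj N (Z N j) true = 1 := by
    rw [pproj, pproj, ← smul_add]
    simp only [sgn_false, sgn_true, one_smul, neg_smul]
    rw [show (1 + (Z N j).op N + (1 + -(Z N j).op N)) = (2 : ℂ) • (1 : Op N) by
      rw [two_smul]; abel, smul_smul]
    norm_num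
  rw [realOn, realOn, Matrix.trace_mul_comm, ← mul_assoc, hp, Matrix.trace_mul_comm _ (pproj N _ true),
    ← mul_assoc, hp, ← Matrix.trace_add, ← add_mul, hs, one_mul, gatesOn, Matrix.trace_mul_comm,
    ← mul_assoc, frame_mul_star hG, one_mul]

theorem Inv.det_log (h : S.Inv N B) (l : Record) : ({ S with log := l } : ES).Inv N B := ⟨h.herm, h.sup⟩

theorem plan_code_ne {u : Instr N} (h : ∀ q role, u ≠ .meas q role) : S.plan N u.code = [] := by
  cases u with
  | idle => rfl
  | gate u => rfl
  | meas q role => exact absurd rfl (h q role)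

theorem Inv.pass (h : S.Inv N B) (u : Instr N) (hp : S.plan N u.code = []) (b : Bool) :
    (S.pass N u.code b).Inv N B := by
  cases u with
  | idle => exact h
  | gate u => exact h.gate (Gate.code_valid u)
  | meas q role =>
    rw [Instr.code, pass_meas_eq]
    cases ha : (S.antiL N Ẑ[N, S, q]).isEmpty
    · obtain ⟨hj, hx⟩ := head_filter ha
      rw [Bool.and_eq_true] at hx
      exact (coin_sound h (j := ⟨_, hj⟩) b role hx.1 hx.2).1
    · exact h.det_log _

theorem plan_meas {q : Fin N} {role : Role} {p : Plan} {l : List Plan} (hp : S.plan N (Instr.meas q role).code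
    = p :: l) : ∃ j : Fin N, (S.antiL N Ẑ[N, S, q]).isEmpty = true ∧
      (!S.kn j && (Ẑ[N, S, q].x j || Ẑ[N, S, q].z j)) = true ∧
      p = (S.realGates N q role j, (j : ℕ), role) ∧ l = [] := by
  rw [Instr.code, plan_meas_eq] at hp
  cases ha : (S.antiL N Ẑ[N, S, q]).isEmpty
  · rw [ha] at hp; simp at hp
  cases hr : (S.realL N Ẑ[N, S, q]).isEmpty
  swap
  · rw [ha, hr] at hp; simp at hp
  rw [ha, hr] at hp
  obtain ⟨hj, hx⟩ := head_filter hr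
  refine ⟨⟨_, hj⟩, rfl, hx, ?_⟩
  rw [Bool.not_false, Bool.and_true, cond_true, List.cons.injEq] at hp
  exact ⟨hp.1.symm, hp.2.symm⟩

theorem plan_pad {p : Plan} {l : List Plan}
    (hp : S.plan N padCode = p :: l) : ∃ j : Fin N, S.kn j = false ∧ p = ([], (j : ℕ), .output) ∧
      l = [] := by
  have e : S.plan N padCode = cond (!(S.unkL N).isEmpty) [([], (S.unkL N).headD 0, .output)] [] := rfl
  rw [e] at hp
  cases hr : (S.unkL N).isEmpty
  · obtain ⟨hj, hx⟩ := head_filter hr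
    rw [hr] at hp
    rw [Bool.not_false, cond_true, List.cons.injEq] at hp
    exact ⟨⟨_, hj⟩, by simpa using hx, hp.1.symm, hp.2.symm⟩
  · rw [hr] at hp; simp at hp

theorem Inv.take (h : S.Inv N B) {u : Instr N} {p : Plan} {l : List Plan} (hp : S.plan N u.code = p :: l) (m : Bool) :
    (S.take N u.code p m).Inv N (realOn N p.1 p.2.1 m B) := by
  cases u with
  | idle | gate => rw [plan_code_ne (by simp)] at hp; simp at hp
  | meas q role =>
    obtain ⟨j, ha, hr, rfl, -⟩ := plan_meas hp
    exact (h.real (realGates_spec j.2 ha hr).1 j m role).det_log _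

theorem Inv.take_pad (h : S.Inv N B) {p : Plan} {l : List Plan} (hp : S.plan N padCode = p :: l) (m : Bool) :
    (S.take N padCode p m).Inv N (realOn N p.1 p.2.1 m B) := by
  obtain ⟨j, -, rfl, -⟩ := plan_pad hp
  exact h.real (by intro g hg; simp at hg) j m .output

/-- `φ` stands for the rest of the run; only its homogeneity is used. If the coin is not read, both
halves on the right are equal. -/
theorem pass_sound (h : S.Inv N B) {u : Instr N} (hp : S.plan N u.code = []) (φ : Record → Op N → ℝ) (hφ0 : ∀
    m, φ m 0 = 0) (hφ : ∀ m α, φ m ((2 : ℂ)⁻¹ • α) = 2⁻¹ * φ m α) : ((u.apply S.log (S.den N B)).map fun b =>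
    φ b.1 b.2).sum = 2⁻¹ * φ (S.pass N u.code false).log ((S.pass N u.code false).den N B) +
      2⁻¹ * φ (S.pass N u.code true).log ((S.pass N u.code true).den N B) := by
  have two : ∀ x : ℝ, x = 2⁻¹ * x + 2⁻¹ * x := fun x => by ring
  cases u with
  | idle =>
    simp only [Instr.apply, List.map, sum_pair, List.sum_singleton]
    exact two _
  | gate u =>
    simp only [Instr.apply, List.map, sum_pair, List.sum_singleton, Gate.conj_eq, ← den_gate]
    exact two _
  | meas q role =>
    simp only [Instr.code, pass_meas_eq, Instr.apply, List.map_cons, List.map_nil, List.sum_cons,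
      List.sum_nil, add_zero, projZ_eq_pproj]
    cases ha : (S.antiL N Ẑ[N, S, q]).isEmpty
    · obtain ⟨hj, hx⟩ := head_filter ha
      rw [Bool.and_eq_true] at hx
      simp only [cond_false]
      rw [(coin_sound h (j := ⟨_, hj⟩) false role hx.1 hx.2).2,
        (coin_sound h (j := ⟨_, hj⟩) true role hx.1 hx.2).2, hφ, hφ]
      rfl
    · have hr : (S.realL N Ẑ[N, S, q]).isEmpty = true := by
        rw [Instr.code, plan_meas_eq, ha] at hp
        by_contra hr
        rw [Bool.not_eq_true] at hr
        rw [hr] at hp; simp at hp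
      have hx := isEmpty_filter ha
      have hx' := isEmpty_filter hr
      have h1 : ∀ i < N, Ẑ[N, S, q].x i = false := fun i hi => by
        have a := hx i hi
        have b := hx' i hi
        revert a b
        cases S.kn i <;> cases Ẑ[N, S, q].x i <;> simp
      have h2 : ∀ i < N, S.kn i = false → Ẑ[N, S, q].z i = false := fun i hi hk => by
        have b := hx' i hi
        rw [hk] at b
        revert b
        cases Ẑ[N, S, q].z i <;> simp
      simp only [cond_true]
      rw [det_sound h (herm_Z N q) h1 h2, det_sound h (herm_Z N q) h1 h2, ← two]
      change _ = φ (S.log ++ [(role, S.outc N Ẑ[N, S, q])]) (S.den N B)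
      cases S.outc N Ẑ[N, S, q] <;> simp [hφ0]

theorem take_sound (h : S.Inv N B) {u : Instr N} {p : Plan} {l : List Plan} (hp : S.plan N u.code = p :: l) (φ : Record → Op N → ℝ) :
    ((u.apply S.log (S.den N B)).map fun b => φ b.1 b.2).sum = φ (S.take N u.code p false).log ((S.take N
    u.code p false).den N (realOn N p.1 p.2.1 false B)) + φ (S.take N u.code p true).log
        ((S.take N u.code p true).den N (realOn N p.1 p.2.1 true B)) := by
  cases u with
  | idle | gate => rw [plan_code_ne (by simp)] at hp; simp at hp
  | meas q role =>
    obtain ⟨j, ha, hr, rfl, -⟩ := plan_meas hp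
    obtain ⟨hG, hb⟩ := realGates_spec (role := role) j.2 ha hr
    replace hb := hb _ rfl
    have hk : S.kn j = false := by
      rw [Bool.and_eq_true, Bool.not_eq_true'] at hr; exact hr.1
    have hu : ∀ m, S.take N (Instr.meas q role).code (S.realGates N q role j, (j : ℕ), role) m =
      (S.real N (S.realGates N q role j) j m role).det N q role := fun _ => rfl
    simp only [hu]
    set G := S.realGates N q role j
    have key := fun m => real_sound h hG (herm_Z N q) (j := j) role (fun i hi => (hb i hi).1)
      (fun i hi => (hb i hi).2.1) hk m
    have ho := fun m => outc_real (N := N) (S := S) (G := G) j.2 (role := role)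
      (((hb j j.2).2.1 hk).trans (by simp)) m
    simp only [Instr.apply, List.map, sum_pair, projZ_eq_pproj]
    set R := pull N (S.ops ++ innerRots N G) (Z N q)
    change _ = φ (S.log ++ [(role, (S.real N G j false role).outc N R)]) ((S.real N G j false role).den N
        (realOn N G j false B)) + φ (S.log ++ [(role, (S.real N G j true role).outc N R)]) ((S.real N G j true
        role).den N (realOn N G j true B))
    rw [← key, ← key, ho true]
    -- Simulated and real outcome differ by a fixed bit. If it is set, the two summands are merely
    -- exchanged.
    cases (S.real N G j false role).outc N R
    · simp
    · simp [add_comm]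

end

/-- One random bit is drawn for every step, whether it is read or not, so that the length of the
random string is fixed. Steps beyond the end of the circuit measure lines that are still unknown;
they do not enter the log. -/
theorem run_eq_avgL_sim (C : Circuit N) (rd : List Bool) (f : Record → ℝ) (us : ℕ → Record → ICode) (hus : ∀ i
    < C.length, ∀ m : Record, us i m = (C.step i m.history rd).code) (hpad : ∀ i ≥ C.length, ∀ m, us i m =
    padCode) (k i : ℕ) (hk : C.length ≤ i + k) (S : ES) (B : Op N) (h : S.Inv N B) :
    C.run rd f (C.length - i) i S.log (S.den N B) = avgL k fun w => sim N us f k i S B w := by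
  induction k generalizing i S B with
  | zero =>
    rw [Nat.sub_eq_zero_of_le (by simpa using hk), Circuit.run, h.trace]
    rfl
  | succ k ih =>
    have ih' := fun S B h => ih (i + 1) (by omega) S B h
    rw [avgL]
    simp only [sim, List.headD_cons, List.tail_cons]
    by_cases hi : i < C.length
    · rw [show C.length - i = (C.length - (i + 1)) + 1 by omega, Circuit.run, hus i hi]
      cases hp : S.plan N (C.step i S.log.history rd).code with
      | nil =>
        dsimp only
        rw [pass_sound h hp (fun m α => C.run rd f (C.length - (i + 1)) (i + 1) m α) (Circuit.run_zero f _ _)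
          (Circuit.run_half f _ _), ih' _ _ (h.pass _ hp false), ih' _ _ (h.pass _ hp true)]
      | cons p l =>
        dsimp only
        rw [take_sound h hp (fun m α => C.run rd f (C.length - (i + 1)) (i + 1) m α),
          ih' _ _ (h.take hp false), ih' _ _ (h.take hp true), avgL_add]
        ring
    · have e : C.length - i = C.length - (i + 1) := by omega
      rw [hpad i (by omega)]
      cases hp : S.plan N padCode with
      | nil =>
        dsimp only
        have e' : ∀ b, S.pass N padCode b = S := fun b => rfl
        have e0 : C.length - (i + 1) = 0 := by omega
        rw [e, e', e', ← ih' _ _ h, e0]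
        simp only [Circuit.run]; ring
      | cons p l =>
        dsimp only
        obtain ⟨j, hj, rfl, -⟩ := plan_pad hp
        have e0 : C.length - (i + 1) = 0 := by omega
        rw [avgL_add, ← ih' _ _ (h.take_pad hp false), ← ih' _ _ (h.take_pad hp true), e, e0, Circuit.run,
          Circuit.run, Circuit.run, h.trace, (h.take_pad hp false).trace, (h.take_pad hp true).trace]
        have ht := trace_realOn (N := N) (G := []) (by intro T hT; simp at hT) j B
        -- A padding measurement does not change the value because the traces of its two branches
        -- add up to that of the state.
        rw [← ht, Complex.add_re]
        change f S.log * _ = 2⁻¹ * (f S.log * _ + f S.log * _) + 2⁻¹ * (f S.log * _ + f S.log * _)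
        ring

end ES

/-! ### Stabiliser states -/

def Pauli.num : Pauli → ℕ
  | .I => 0
  | .X => 1
  | .Y => 2
  | .Z => 3

def SPauli.code {n : ℕ} (S : SPauli n) : Bool × List ℕ := (S.neg, List.ofFn fun i => (S.letter i).num)

def letterX (k : ℕ) : Bool := decide (k = 1) || decide (k = 2)

def letterZ (k : ℕ) : Bool := decide (k = 2) || decide (k = 3)

/-- Since `Y = i X Z`, the phase is `i` to the number of letters `Y`. The second parity counts the
pairs of such letters and gives the high bit of this number, see `prod_iph`. -/
def PStr.ofCode (n : ℕ) (c : Bool × List ℕ) : PStr := mk' n (c.1 ^^ par n fun i => decide (c.2.getD i 0 = 2)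
  && par i fun j => decide (c.2.getD j 0 = 2)) (par n fun i => decide (c.2.getD i 0 = 2)) (fun i => letterX
  (c.2.getD i 0)) fun i => letterZ (c.2.getD i 0)

theorem prod_iph (n : ℕ) (y : ℕ → Bool) :
    ∏ i : Fin n, iph (y i) = sgn (par n fun i => y i && par i y) * iph (par n y) := by
  induction n with
  | zero => simp [par]
  | succ n ih =>
    rw [Fin.prod_univ_castSucc, par_succ, par_succ, sgn_xor]
    simp only [Fin.val_castSucc, Fin.val_last]
    rw [ih, mul_assoc, ← iph_xor, Bool.and_comm (y n)]
    ring

theorem Pauli.mat_apply (p : Pauli) (a b : Bool) : p.mat a b =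
    if a = (b ^^ letterX p.num) then iph (decide (p.num = 2)) * sgn (letterZ p.num && b) else 0 := by
  cases p <;> cases a <;> cases b <;> simp [Pauli.mat, Pauli.num, letterX, letterZ]

theorem PStr.op_ofCode {n : ℕ} (S : SPauli n) : (ofCode n S.code).op n = S.op := by
  have hg : ∀ i : Fin n, S.code.2.getD i 0 = (S.letter i).num := fun i => by
    simp [SPauli.code, List.getD_eq_getElem?_getD]
  ext a b
  simp only [op, ofCode, mk'_xF, mk'_zF, ph, mk'_hi, mk'_lo, SPauli.op, Pauli.mat_apply, hg]
  have hs : sgn S.code.1 = if S.neg = true then -1 else 1 := by cases h : S.neg <;> simp [SPauli.code, h]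
  rw [← hs]
  split_ifs with h
  · rw [sgn_xor, mul_assoc (sgn _), ← prod_iph n fun i => decide (S.code.2.getD i 0 = 2), mul_assoc,
      ← Finset.prod_mul_distrib]
    congr 1
    refine Finset.prod_congr rfl fun i _ => ?_
    rw [if_pos (h i), hg]
  · rw [not_forall] at h
    obtain ⟨i, hi⟩ := h
    rw [Finset.prod_eq_zero (Finset.mem_univ i) (by rw [if_neg hi]), mul_zero]

theorem herm_ofCode {n : ℕ} (S : SPauli n) : (ofCode n S.code).Herm n := by
  have hg : ∀ i < n, (ofCode n S.code).z i = letterZ (S.code.2.getD i 0) ∧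
      (ofCode n S.code).x i = letterX (S.code.2.getD i 0) := fun i hi => by
    rw [ofCode, mk'_x hi, mk'_z hi]; exact ⟨rfl, rfl⟩
  refine par_congr fun i hi => ?_
  rw [(hg i hi).1, (hg i hi).2]
  have : ∀ k : ℕ, decide (k = 2) = (letterZ k && letterX k) := by
    intro k
    by_cases h2 : k = 2
    · simp [h2, letterX, letterZ]
    · by_cases h1 : k = 1 <;> simp [h1, h2, letterX, letterZ]
  exact this _

/-- A Pauli operator other than `±1` anticommutes with some `X` or `Z`, and conjugation by the
latter shows that its trace equals its own negative. -/
theorem trace_eq_zero {N : ℕ} {R : PStr} (hR : R.Herm N) (h1 : R.op N ≠ 1) (h2 : R.op N ≠ -1) :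
    (R.op N).trace = 0 := by
  have key : ∀ T : PStr, T.Herm N → anti N R T = true → (R.op N).trace = 0 := fun T hT ha => by
    have h : R.op N * T.op N = - (T.op N * R.op N) := by rw [op_comm, ha]; simp
    have e : (R.op N).trace = -(R.op N).trace := by
      conv_lhs => rw [← mul_one (R.op N), ← hT.sq, ← mul_assoc, h, neg_mul, Matrix.trace_neg,
        Matrix.trace_mul_comm, ← mul_assoc, hT.sq, one_mul]
    exact self_eq_neg.1 e
  by_cases hx : ∀ i < N, R.x i = false
  · by_cases hz : ∀ i < N, R.z i = false
    · exfalso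
      have hlo := ES.lo_eq_false hR hx
      have := op_eq_ph hx hz
      rw [ph, hlo, iph_false, mul_one] at this
      cases hh : R.hi <;> simp_all
    · push Not at hz
      obtain ⟨i, hi, hz⟩ := hz
      exact key (X N i) (herm_X N i) (by rw [anti_X hi]; simpa using hz)
  · push Not at hx
    obtain ⟨i, hi, hx⟩ := hx
    exact key (Z N i) (herm_Z N i) (by rw [anti_Z hi]; simpa using hx)

def halfSum {n : ℕ} (S : SPauli n) : Op n := (2 : ℂ)⁻¹ • (1 + S.op)

/-- The product of the `(1 + S) / 2` expands into a combination of the products over sublists. -/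
theorem trace_mul_prod_eq_zero {n : ℕ} (L : List (SPauli n)) (A : Op n)
    (h : ∀ l : List (SPauli n), l.Sublist L → ((l.map SPauli.op).prod * A).trace = 0) :
    ((L.map halfSum).prod * A).trace = 0 := by
  induction L generalizing A with
  | nil => simpa using h [] (List.Sublist.refl _)
  | cons x L ih =>
    have h1 := ih A fun l hl => h l (hl.cons x)
    have h2 := ih (A * x.op) fun l hl => by
      have := h (x :: l) (hl.cons_cons x)
      rw [← mul_assoc, Matrix.trace_mul_comm]
      rwa [List.map_cons, List.prod_cons, mul_assoc] at this
    rw [← mul_assoc, Matrix.trace_mul_comm] at h2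
    rw [List.map_cons, List.prod_cons, halfSum, smul_mul_assoc, smul_mul_assoc, add_mul, add_mul,
      one_mul, Matrix.trace_smul, Matrix.trace_add, h1, mul_assoc, h2]
    simp

theorem prod_sq {n : ℕ} {l : List (SPauli n)} (h : ∀ S ∈ l, ∀ S' ∈ l, S.op * S'.op = S'.op * S.op) :
    (l.map SPauli.op).prod * (l.map SPauli.op).prod = 1 := by
  induction l with
  | nil => simp
  | cons x l ih =>
    have hc : Commute x.op (l.map SPauli.op).prod := Commute.list_prod_right _ _ fun a ha => by
      obtain ⟨S, hS, rfl⟩ := List.mem_map.1 ha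
      exact h x (by simp) S (by simp [hS])
    have hx : x.op * x.op = 1 := by rw [← op_ofCode]; exact (herm_ofCode x).sq
    rw [List.map_cons, List.prod_cons, mul_assoc, ← mul_assoc _ x.op, ← hc.eq, mul_assoc x.op,
      ← mul_assoc x.op, hx, one_mul]
    exact ih fun S hS S' hS' => h S (by simp [hS]) S' (by simp [hS'])

theorem prod_isPauli {n : ℕ} (l : List (SPauli n)) : ∃ R : PStr, R.op n = (l.map SPauli.op).prod := by
  induction l with
  | nil => exact ⟨mk' n false false (fun _ => false) fun _ => false, by
      rw [op_eq_ph (fun i hi => mk'_x hi ..) fun i hi => mk'_z hi ..]; simp [ph]⟩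
  | cons x l ih =>
    obtain ⟨R, hR⟩ := ih
    exact ⟨(ofCode n x.code).mul n R, by
      rw [← op_mul, op_ofCode, hR, List.map_cons, List.prod_cons]⟩

theorem IsStabGens.trace {n : ℕ} {L : List (SPauli n)} (h : IsStabGens L) (hL : L ≠ []) :
    ((L.map SPauli.op).prod).trace = 0 := by
  obtain ⟨R, hR⟩ := prod_isPauli L
  have := h.2 L (List.Sublist.refl _) hL
  rw [← hR] at this ⊢
  exact trace_eq_zero (herm_iff.2 (by rw [hR]; exact prod_sq h.1)) this.1 this.2

theorem IsStabGens.sublist {n : ℕ} {L l : List (SPauli n)} (h : IsStabGens L) (hl : l.Sublist L) : IsStabGens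
    l := ⟨fun S hS S' hS' => h.1 S (hl.subset hS) S' (hl.subset hS'), fun l' hl' => h.2 l' (hl'.trans hl)⟩

namespace ES

def init : ES := ⟨[], [], [], [], [], []⟩

/-- One more generator: a line is chosen, whose `Z` becomes the generator. -/
def absorb (n : ℕ) (S : ES) (c : Bool × List ℕ) : ES :=
  let Q := pull n S.ops (ofCode n c)
  let j := (S.realL n Q).headD 0
  let G := reduceGates n S.ln Q j
  S.real n G j ((S.real n G j false .output).outc n (pull n (S.ops ++ innerRots n G) (ofCode n c))) .output

def absorbAll (n : ℕ) (g : List (Bool × List ℕ)) : ES := g.foldl (absorb n) init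

abbrev engineOf {n : ℕ} (L : List (SPauli n)) : ES := absorbAll n (L.map SPauli.code)

/-- The projector onto the known values. -/
def knProj (n : ℕ) (S : ES) : Op n :=
  open Classical in
  Matrix.diagonal fun a => if ∀ i : Fin n, S.kn i = true → a i = S.vl i then 1 else 0

/-- `short` allows the frame for `n` lines to be used unchanged on `n + t` lines, and `card`
provides the normalisation of the stabiliser state. -/
structure Repr {n : ℕ} (L : List (SPauli n)) (S : ES) : Prop where
  herm : AllHerm n S.ops
  short : ∀ T ∈ S.ops, T.bits.length = n
  prod : (L.map halfSum).prod = S.den n (knProj n S)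
  card : (Finset.univ.filter fun i : Fin n => S.kn i = true).card = L.length

theorem inv_knProj {n : ℕ} {S : ES} (h : AllHerm n S.ops) : S.Inv n (knProj n S) :=
  ⟨h, fun a b hab i hi => by
    classical
    rw [knProj, Matrix.diagonal_apply] at hab
    by_cases e : a = b
    · subst e
      rw [if_pos rfl] at hab
      split_ifs at hab with h'
      · exact ⟨h' i hi, h' i hi⟩
      · exact absurd rfl hab
    · rw [if_neg e] at hab; exact absurd rfl hab⟩

theorem trace_knProj (n : ℕ) (S : ES) : (knProj n S).trace ≠ 0 := by
  classical
  rw [knProj, Matrix.trace_diagonal, Finset.sum_boole, Nat.cast_ne_zero, Finset.card_ne_zero]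
  exact ⟨fun i => S.vl i, by simp⟩

theorem gateRots_bits {n : ℕ} {g : GCode} : ∀ T ∈ gateRots n g, T.bits.length = n := by
  unfold gateRots
  cases decide (g.1 = 0) <;> cases decide (g.1 = 1) <;> simp [PStr.neg, Z, X, ZX, mk', tab]

theorem innerRots_bits {n : ℕ} {G : List GCode} : ∀ T ∈ innerRots n G, T.bits.length = n := by
  intro T hT
  obtain ⟨g, -, hT⟩ := List.mem_flatMap.1 hT
  obtain ⟨T', hT', rfl⟩ := List.mem_map.1 hT
  exact gateRots_bits T' (List.mem_reverse.1 hT')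

/-- The unitary of the gates commutes with the `Z` of the known lines, so it has no entries between
basis states that differ on a known line, and hence commutes with the projector. -/
theorem gatesOn_knProj {n : ℕ} {S : ES} {G : List GCode} (hG : GatesOff n S.kn G) :
    gatesOn n G (knProj n S) = knProj n S := by
  classical
  have hH := innerRots_herm hG
  have hF : ∀ a b, frame n (innerRots n G) a b ≠ 0 → ∀ i : Fin n, S.kn i = true → a i = b i := by
    intro a b hab i hi
    have h1 := op_mul_frame hH (Z n i)
    rw [pull_innerRots_Z hG i.2 hi] at h1
    have h2 := congrFun (congrFun h1 a) b
    rw [Matrix.mul_apply, Finset.sum_eq_single a (fun c _ hc => by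
      rw [op_Z_apply, if_neg (Ne.symm hc), zero_mul]) (by simp), op_Z_apply, if_pos rfl,
      Matrix.mul_apply, Finset.sum_eq_single b (fun c _ hc => by
      rw [op_Z_apply, if_neg hc, mul_zero]) (by simp), op_Z_apply, if_pos rfl,
      mul_comm (frame n (innerRots n G) a b)] at h2
    exact sgn_inj (mul_right_cancel₀ hab h2)
  have hK : frame n (innerRots n G) * knProj n S = knProj n S * frame n (innerRots n G) := by
    ext a b
    rw [knProj, Matrix.mul_diagonal, Matrix.diagonal_mul, mul_comm]
    by_cases hab : frame n (innerRots n G) a b = 0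
    · simp [hab]
    · congr 2
      refine propext (forall_congr' fun i => forall_congr' fun hi => ?_)
      rw [hF a b hab i hi]
  rw [gatesOn, mul_assoc, ← hK, ← mul_assoc, frame_star_mul hH, one_mul]

theorem realOn_knProj {n : ℕ} {S : ES} {G : List GCode} (hG : GatesOff n S.kn G) (j : Fin n)
    (hj : S.kn j = false) (m : Bool) (role : Role) :
    realOn n G j m (knProj n S) = knProj n (S.real n G j m role) := by
  classical
  rw [realOn, gatesOn_knProj hG, pproj_Z_diag, knProj, knProj, Matrix.diagonal_mul_diagonal,
    Matrix.diagonal_mul_diagonal]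
  congr 1
  ext a
  have : (∀ i : Fin n, (S.real n G j m role).kn i = true → a i = (S.real n G j m role).vl i) ↔
      (a j = m ∧ ∀ i : Fin n, S.kn i = true → a i = S.vl i) := by
    simp only [fun i : Fin n => real_kn (S := S) (G := G) (j := j) (m := m) (role := role) i.2, fun i : Fin n
      => real_vl (S := S) (G := G) (j := j) (m := m) (role := role) i.2, Bool.or_eq_true, decide_eq_true_eq]
    constructor
    · intro h
      refine ⟨by simpa using h j (Or.inl rfl), fun i hi => ?_⟩
      have hij : (i : ℕ) ≠ j := fun e => by
        rw [e, hj] at hi; simp at hi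
      simpa [hij] using h i (Or.inr hi)
    · rintro ⟨h1, h2⟩ i hi
      split_ifs with hij
      · rw [Fin.ext hij, h1]
      · exact h2 i (hi.resolve_left hij)
  simp only [this]
  by_cases h1 : a j = m <;> by_cases h2 : ∀ i : Fin n, S.kn i = true → a i = S.vl i <;> simp [h1, h2]

/-- The new generator is treated like a real measurement whose outcome is set to `+1`. It commutes
with the old generators, so its pull-back `Q` has no `X` on known lines; it is independent of them,
so `Q` must act on some unknown line, which then becomes known. -/
theorem absorb_repr {n : ℕ} {L : List (SPauli n)} {x : SPauli n} {S : ES} (h : Repr L S)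
    (hg : IsStabGens (L ++ [x])) : Repr (L ++ [x]) (S.absorb n x.code) := by
  classical
  have hR := herm_ofCode x
  have hop := op_ofCode x
  have hInv := inv_knProj h.herm
  set R := ofCode n x.code with hRdef
  have hxx : x.op * x.op = 1 := by rw [← hop]; exact hR.sq
  have hcomm : Commute x.op (L.map halfSum).prod := Commute.list_prod_right _ _ fun a ha => by
    obtain ⟨T, hT, rfl⟩ := List.mem_map.1 ha
    have := hg.1 x (by simp) T (by simp [hT])
    show x.op * halfSum T = halfSum T * x.op
    rw [halfSum, mul_smul_comm, smul_mul_assoc, mul_add, add_mul, this, mul_one, one_mul]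
  have htr : ((L.map halfSum).prod * x.op).trace = 0 := trace_mul_prod_eq_zero L x.op fun l hl => by
    have := (hg.sublist (hl.append (List.Sublist.refl [x]))).trace (by simp)
    simpa using this
  have htr' : ((L.map halfSum).prod).trace ≠ 0 := by
    rw [h.prod, hInv.trace]; exact trace_knProj n S
  have hpp : pproj n R false * (L.map halfSum).prod * pproj n R false =
      ((L ++ [x]).map halfSum).prod := by
    have e : pproj n R false = halfSum x := by rw [pproj, halfSum, hop, sgn_false, one_smul]
    have hc : halfSum x * (L.map halfSum).prod = (L.map halfSum).prod * halfSum x := by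
      rw [halfSum, mul_smul_comm, smul_mul_assoc, mul_add, add_mul, hcomm.eq, mul_one, one_mul]
    have hi : halfSum x * halfSum x = halfSum x := by
      rw [halfSum, smul_mul_smul_comm, mul_add, add_mul, add_mul, hxx, one_mul, mul_one, one_mul,
        add_comm x.op 1, ← two_smul ℂ, smul_smul]
      norm_num
    rw [e, hc, mul_assoc, hi, List.map_append, List.prod_append]; simp
  have hprod : ((L ++ [x]).map halfSum).prod = (2 : ℂ)⁻¹ • ((L.map halfSum).prod +
      (L.map halfSum).prod * x.op) := by
    rw [List.map_append, List.prod_append]; simp [halfSum, mul_add]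
  have hpt : (((L ++ [x]).map halfSum).prod).trace = 2⁻¹ * ((L.map halfSum).prod).trace := by
    rw [hprod, Matrix.trace_smul, Matrix.trace_add, htr, add_zero, smul_eq_mul]
  set Q := pull n S.ops R with hQ
  have hQh : Q.Herm n := pull_herm h.herm hR
  -- `Q` commutes with the projector onto the known values, whereas an `X` on a known line would
  -- move a basis state out of its range.
  have hQx : ∀ i < n, S.kn i = true → Q.x i = false := by
    have hF := frame_mul_star h.herm
    have hF' := frame_star_mul h.herm
    have e0 : x.op * frame n S.ops = frame n S.ops * Q.op n := by
      rw [← hop]; exact op_mul_frame h.herm R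
    have e1 : (frame n S.ops)ᴴ * x.op = Q.op n * (frame n S.ops)ᴴ := by
      rw [← hop]; exact star_frame_mul_op h.herm R
    have hK : knProj n S = (frame n S.ops)ᴴ * (L.map halfSum).prod * frame n S.ops := by
      rw [h.prod, den]
      calc _ = ((frame n S.ops)ᴴ * frame n S.ops) * knProj n S *
          ((frame n S.ops)ᴴ * frame n S.ops) := by rw [hF', one_mul, mul_one]
        _ = _ := by simp only [mul_assoc]
    have hQK : Q.op n * knProj n S = knProj n S * Q.op n := by
      rw [hK, ← mul_assoc, ← mul_assoc, ← e1, mul_assoc _ x.op, hcomm.eq, mul_assoc _ _ (Q.op n), ← e0]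
      simp only [mul_assoc]
    intro i hi hk
    have e2 := congrFun (congrFun hQK fun i => (S.vl i ^^ Q.x i)) fun i => S.vl i
    rw [knProj, Matrix.mul_diagonal, Matrix.diagonal_mul, mul_comm] at e2
    have hne : Q.op n (fun i => (S.vl i ^^ Q.x i)) (fun i => S.vl i) ≠ 0 := by
      rw [op, if_pos fun _ => rfl]
      refine mul_ne_zero (mul_ne_zero (sgn_ne_zero _) ?_) (Finset.prod_ne_zero_iff.2 fun i _ => sgn_ne_zero _)
      cases Q.lo <;> simp
    have e3 := mul_right_cancel₀ hne e2
    rw [if_pos fun _ _ => rfl] at e3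
    split_ifs at e3 with h'
    · have : (S.vl i ^^ Q.x i) = S.vl i := h' ⟨i, hi⟩ hk
      revert this
      cases S.vl i <;> cases Q.x i <;> simp
    · simp at e3
  -- Otherwise the outcome would be determined, and the projector of the generator would keep the
  -- old product or annihilate it. By independence it halves the trace instead, and this trace is
  -- not zero.
  have hreal : (S.realL n Q).isEmpty = false := by
    by_contra hne
    have hr := isEmpty_filter (Bool.eq_true_of_not_eq_false hne)
    have h1 : ∀ i < n, S.kn i = false → Q.x i = false ∧ Q.z i = false := fun i hi hk => by
      have b := hr i hi
      rw [hk] at b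
      revert b
      cases Q.x i <;> cases Q.z i <;> simp
    have hd := det_sound hInv hR (fun i hi => by
      cases hk : S.kn i
      · exact (h1 i hi hk).1
      · exact hQx i hi hk) (fun i hi hk => (h1 i hi hk).2) false
    rw [← h.prod, hpp] at hd
    rw [hd] at hpt
    split_ifs at hpt
    · apply htr'
      linear_combination 2 * hpt
    · rw [Matrix.trace_zero] at hpt
      exact htr' (by linear_combination -2 * hpt)
  obtain ⟨hj, hjr⟩ := head_filter hreal
  obtain ⟨j, hjdef⟩ : ∃ j : Fin n, (j : ℕ) = (S.realL n Q).headD 0 := ⟨⟨_, hj⟩, rfl⟩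
  have hfold : (List.filter (fun i => !S.kn i && (Q.x i || Q.z i)) (List.range n)).headD 0 =
    (j : ℕ) := hjdef.symm
  rw [hfold, Bool.and_eq_true, Bool.not_eq_true'] at hjr
  set G := reduceGates n S.ln Q j with hGdef
  have hG : GatesOff n S.kn G := reduceGates_off S.ln Q j.2 hjr.1
  have hbits := reduceGates_bits (N := n) S.ln Q j.2 hjr.1 hjr.2
  have hkn : ∀ i, (S.ln.getD i (false, false)).1 = S.kn i := fun _ => rfl
  simp only [hkn, ← hGdef] at hbits
  have hGx : ∀ i < n, (pull n (S.ops ++ innerRots n G) R).x i = false := fun i hi => by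
    have := hbits i hi
    rw [pull_append, ← hQ]
    cases hk : S.kn i
    · rw [hk, cond_false, Prod.mk.injEq] at this
      exact this.1
    · rw [hk, cond_true, Prod.mk.injEq, hQx i hi hk] at this
      exact this.1
  have hGz : ∀ i < n, S.kn i = false →
      (pull n (S.ops ++ innerRots n G) R).z i = decide (i = (j : ℕ)) := fun i hi hk => by
    have := hbits i hi
    rw [pull_append, ← hQ]
    rw [hk, cond_false, Prod.mk.injEq] at this
    exact this.2
  -- The outcome for the value `false` of line `j`, taken as the value of line `j` itself: the two
  -- bits cancel, and the generator has the value `+1`.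
  set v := (S.real n G j false .output).outc n (pull n (S.ops ++ innerRots n G) R) with hv
  have hout : (S.real n G j v .output).outc n (pull n (S.ops ++ innerRots n G) R) = false := by
    rw [outc_real j.2 (by rw [hGz j j.2 hjr.1]; simp), ← hv]; simp
  have habs : S.absorb n x.code = S.real n G j v .output := by
    simp only [absorb, ← hRdef, ← hQ, ← hjdef, ← hGdef, ← hv]
  rw [habs]
  refine ⟨h.herm.append (innerRots_herm hG), fun T hT => ?_, ?_, ?_⟩
  · exact (List.mem_append.1 hT).elim (h.short T) (innerRots_bits T)
  · have := real_sound hInv hG hR .output hGx hGz hjr.1 v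
    rw [hout, ← h.prod, hpp, realOn_knProj hG j hjr.1 v .output] at this
    exact this
  · have e : (Finset.univ.filter fun i : Fin n => (S.real n G j v .output).kn i = true) =
        insert j (Finset.univ.filter fun i : Fin n => S.kn i = true) := by
      ext i
      simp only [Finset.mem_filter, Finset.mem_univ, true_and, Finset.mem_insert, real_kn i.2,
        Bool.or_eq_true, decide_eq_true_eq, Fin.ext_iff]
    rw [e, Finset.card_insert_of_notMem (by simp [hjr.1]), h.card, List.length_append]
    rfl

theorem absorbAll_repr {n : ℕ} (L : List (SPauli n)) (hL : IsStabGens L) :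
    Repr L (engineOf L) := by
  classical
  induction L using List.reverseRecOn with
  | nil =>
    refine ⟨by intro T hT; simp [absorbAll, init] at hT, by intro T hT; simp [absorbAll, init] at hT,
      ?_, ?_⟩
    · simp [absorbAll, init, den, knProj, kn]
    · simp [absorbAll, init, kn]
  | append_singleton L x ih =>
    have := absorb_repr (ih (hL.sublist (List.sublist_append_left _ _))) hL
    rwa [engineOf, absorbAll, List.map_append, List.foldl_append]

end ES

/-! ### Tensor products -/

section tensor
variable {n t : ℕ}

theorem tensor_append (A : Op n) (B : Op t) (a a' : Fin n → Bool) (b b' : Fin t → Bool) :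
    tensor A B (Fin.append a b) (Fin.append a' b') = A a a' * B b b' := by
  simp [tensor]

theorem exists_append (x : Fin (n + t) → Bool) : ∃ a b, x = Fin.append a b :=
  ⟨fun i => x (Fin.castAdd t i), fun i => x (Fin.natAdd n i), (Fin.append_castAdd_natAdd).symm⟩

theorem op_ext {A B : Op (n + t)} (h : ∀ a b a' b',
    A (Fin.append a b) (Fin.append a' b') = B (Fin.append a b) (Fin.append a' b')) : A = B := by
  ext x y
  obtain ⟨a, b, rfl⟩ := exists_append x
  obtain ⟨a', b', rfl⟩ := exists_append y
  exact h a b a' b'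

theorem sum_append (f : (Fin (n + t) → Bool) → ℂ) :
    ∑ x, f x = ∑ a : Fin n → Bool, ∑ b : Fin t → Bool, f (Fin.append a b) := by
  rw [← (Fin.appendEquiv n t).sum_comp, Fintype.sum_prod_type]
  rfl

theorem tensor_mul (A A' : Op n) (B B' : Op t) :
    tensor A B * tensor A' B' = tensor (A * A') (B * B') := by
  refine op_ext fun a b a' b' => ?_
  rw [Matrix.mul_apply, sum_append, tensor_append, Matrix.mul_apply, Matrix.mul_apply, Finset.sum_mul_sum]
  refine Finset.sum_congr rfl fun c _ => Finset.sum_congr rfl fun d _ => ?_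
  rw [tensor_append, tensor_append]
  ring

theorem append_inj {a a' : Fin n → Bool} {b b' : Fin t → Bool} :
    Fin.append a b = Fin.append a' b' ↔ a = a' ∧ b = b' := by
  constructor
  · intro h
    have := (Fin.appendEquiv (α := Bool) n t).injective (a₁ := (a, b)) (a₂ := (a', b')) h
    simpa using this
  · rintro ⟨rfl, rfl⟩; rfl

theorem tensor_one : tensor (1 : Op n) (1 : Op t) = 1 := by
  refine op_ext fun a b a' b' => ?_
  rw [tensor_append]
  simp only [Matrix.one_apply, append_inj]
  by_cases h : a = a' <;> by_cases h' : b = b' <;> simp [h, h']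

theorem tensor_conjTranspose (A : Op n) (B : Op t) : (tensor A B)ᴴ = tensor Aᴴ Bᴴ := by
  ext x y
  simp [tensor, Matrix.conjTranspose_apply]

theorem tensor_trace (A : Op n) (B : Op t) : (tensor A B).trace = A.trace * B.trace := by
  simp only [Matrix.trace, Matrix.diag_apply]
  rw [sum_append, Finset.sum_mul_sum]
  simp only [tensor_append]

theorem tensor_smul_left (c : ℂ) (A : Op n) (B : Op t) : tensor (c • A) B = c • tensor A B := by
  ext x y; simp [tensor, mul_assoc]

theorem tensor_smul_right (c : ℂ) (A : Op n) (B : Op t) : tensor A (c • B) = c • tensor A B := by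
  ext x y; simp [tensor, mul_left_comm]

theorem tensor_sum_left {ι : Type*} (s : Finset ι) (A : ι → Op n) (B : Op t) :
    tensor (∑ i ∈ s, A i) B = ∑ i ∈ s, tensor (A i) B := by
  ext x y; simp [tensor, Matrix.sum_apply, Finset.sum_mul]

theorem tensor_add_right (A : Op n) (B B' : Op t) : tensor A (B + B') = tensor A B + tensor A B' := by
  ext x y; simp [tensor, mul_add]

theorem tensor_add_left (A A' : Op n) (B : Op t) : tensor (A + A') B = tensor A B + tensor A' B := by
  ext x y; simp [tensor, add_mul]

theorem PStr.op_tensor {R R₁ R₂ : PStr} (hp : R.ph = R₁.ph * R₂.ph) (h₁ : ∀ i < n, R.x i = R₁.x i ∧ R.z i =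
    R₁.z i) (h₂ : ∀ i < t, R.x (n + i) = R₂.x i ∧ R.z (n + i) = R₂.z i) :
    R.op (n + t) = tensor (R₁.op n) (R₂.op t) := by
  refine op_ext fun a b a' b' => ?_
  rw [tensor_append]
  simp only [op, Fin.forall_fin_add, Fin.append_left, Fin.append_right, Fin.prod_univ_add,
    Fin.val_castAdd, Fin.val_natAdd, fun i : Fin n => (h₁ i i.2).1, fun i : Fin n => (h₁ i i.2).2,
    fun i : Fin t => (h₂ i i.2).1, fun i : Fin t => (h₂ i i.2).2, hp]
  by_cases ha : ∀ i : Fin n, a i = (a' i ^^ R₁.x i) <;>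
    by_cases hb : ∀ i : Fin t, b i = (b' i ^^ R₂.x i) <;> simp only [ha, hb, and_true, and_false,
      if_true, if_false, mul_zero, zero_mul, implies_true, true_and, false_and]
  ring

def PStr.one (N : ℕ) : PStr := mk' N false false (fun _ => false) fun _ => false

theorem PStr.op_one (N : ℕ) : (PStr.one N).op N = 1 := by
  rw [PStr.one, op_eq_ph (fun i hi => mk'_x hi ..) fun i hi => mk'_z hi ..]; simp [ph]

theorem PStr.one_ph (N : ℕ) : (PStr.one N).ph = 1 := by simp [PStr.one, ph]

/-- Lines beyond the end of the list of bits get the default value, which is the identity. -/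
theorem PStr.op_short {R : PStr} (h : R.bits.length = n) : R.op (n + t) = tensor (R.op n) 1 := by
  rw [← PStr.op_one t]
  refine PStr.op_tensor (by rw [PStr.one_ph, mul_one]) (fun _ _ => ⟨rfl, rfl⟩) fun i hi => ?_
  rw [PStr.one, mk'_x hi, mk'_z hi, PStr.x, PStr.z, List.getD_eq_default _ _ (by omega)]
  exact ⟨rfl, rfl⟩

theorem herm_short {R : PStr} (h : R.bits.length = n) (hR : R.Herm n) : R.Herm (n + t) := by
  rw [herm_iff, PStr.op_short h, tensor_mul, hR.sq, one_mul, tensor_one]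

theorem frame_tensor_left {ops : List PStr} (h : ∀ T ∈ ops, T.bits.length = n) :
    frame (n + t) ops = tensor (frame n ops) 1 := by
  induction ops with
  | nil => simp [tensor_one]
  | cons T ops ih =>
    rw [frame_cons, frame_cons, ih fun T hT => h T (List.mem_cons_of_mem _ hT),
      show rotOp (n + t) T = tensor (rotOp n T) 1 by
        rw [rotOp, rotOp, PStr.op_short (h T (by simp)), tensor_smul_left, tensor_add_left,
          tensor_one, tensor_smul_left], tensor_mul, one_mul]

def GCode.down (n : ℕ) (g : GCode) : GCode := (g.1, g.2.1 - n, g.2.2 - n)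

theorem op_Z_add (q : ℕ) : (Z (n + t) (n + q)).op (n + t) = tensor 1 ((Z t q).op t) := by
  rw [← PStr.op_one n]
  refine PStr.op_tensor (by simp [Z, PStr.one, ph]) (fun i hi => ?_) fun i hi => ?_
  · rw [Z, mk'_x (by omega), mk'_z (by omega), PStr.one, mk'_x hi, mk'_z hi]
    exact ⟨rfl, by simp; omega⟩
  · rw [Z, mk'_x (by omega), mk'_z (by omega), Z, mk'_x hi, mk'_z hi]
    exact ⟨rfl, by simp⟩

theorem op_X_add (q : ℕ) : (X (n + t) (n + q)).op (n + t) = tensor 1 ((X t q).op t) := by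
  rw [← PStr.op_one n]
  refine PStr.op_tensor (by simp [X, PStr.one, ph]) (fun i hi => ?_) fun i hi => ?_
  · rw [X, mk'_x (by omega), mk'_z (by omega), PStr.one, mk'_x hi, mk'_z hi]
    exact ⟨by simp; omega, rfl⟩
  · rw [X, mk'_x (by omega), mk'_z (by omega), X, mk'_x hi, mk'_z hi]
    exact ⟨by simp, rfl⟩

theorem op_ZX_add (c q : ℕ) :
    (ZX (n + t) (n + c) (n + q)).op (n + t) = tensor 1 ((ZX t c q).op t) := by
  rw [← PStr.op_one n]
  refine PStr.op_tensor (by simp [ZX, PStr.one, ph]) (fun i hi => ?_) fun i hi => ?_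
  · rw [ZX, mk'_x (by omega), mk'_z (by omega), PStr.one, mk'_x hi, mk'_z hi]
    exact ⟨by simp; omega, by simp; omega⟩
  · rw [ZX, mk'_x (by omega), mk'_z (by omega), ZX, mk'_x hi, mk'_z hi]
    exact ⟨by simp, by simp⟩

theorem rotOp_right {T T' : PStr} (h : T.op (n + t) = tensor 1 (T'.op t)) :
    rotOp (n + t) T = tensor 1 (rotOp t T') ∧ rotOp (n + t) T.neg = tensor 1 (rotOp t T'.neg) := by
  have e : T.neg.op (n + t) = tensor 1 (T'.neg.op t) := by
    rw [op_neg, op_neg, h]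
    ext x y; simp [tensor]
  constructor
  · rw [rotOp, rotOp, h, tensor_smul_right, tensor_add_right, tensor_one, tensor_smul_right]
  · rw [rotOp, rotOp, e, tensor_smul_right, tensor_add_right, tensor_one, tensor_smul_right]

theorem frame_gateRots_down {g : GCode} (h1 : n ≤ g.2.1) (h2 : n ≤ g.2.2) :
    frame (n + t) (gateRots (n + t) g) = tensor 1 (frame t (gateRots t (g.down n))) := by
  obtain ⟨k, c, q⟩ := g
  dsimp only at h1 h2
  obtain ⟨c, rfl⟩ := Nat.exists_eq_add_of_le h1
  obtain ⟨q, rfl⟩ := Nat.exists_eq_add_of_le h2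
  have hZ := rotOp_right (op_Z_add (n := n) (t := t) c)
  have hX := rotOp_right (op_X_add (n := n) (t := t) c)
  have hX' := rotOp_right (op_X_add (n := n) (t := t) q)
  have hZX := rotOp_right (op_ZX_add (n := n) (t := t) c q)
  simp only [gateRots, GCode.down, Nat.add_sub_cancel_left]
  by_cases h0 : k = 0
  · simp only [h0, decide_true, cond_true, frame_cons, frame_nil, mul_one, hZ.2, hX.2, tensor_mul]
  · by_cases h1 : k = 1
    · simp only [h1, one_ne_zero, decide_false, cond_false, decide_true, cond_true, frame_cons,
        frame_nil, mul_one, hZ.2]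
    · simp only [h0, h1, decide_false, cond_false, frame_cons, frame_nil, mul_one, hZ.2, hX'.2,
        hZX.1, tensor_mul]

namespace ES

theorem gatesOn_cons {N : ℕ} {g : GCode} (hg : g.1 = 0 ∨ g.1 = 1 ∨ g.2.1 ≠ g.2.2)
    (G : List GCode) (B : Op N) : gatesOn N (g :: G) B = gatesOn N G
      (frame N (gateRots N g) * B * (frame N (gateRots N g))ᴴ) := by
  rw [gatesOn, gatesOn, innerRots_cons, frame_append, frame_inv (gateRots_herm hg),
    Matrix.conjTranspose_mul, Matrix.conjTranspose_conjTranspose]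
  simp only [mul_assoc]

theorem gatesOn_tensor {G : List GCode} (hG : ∀ g ∈ G, (g.1 = 0 ∨ g.1 = 1 ∨ g.2.1 ≠ g.2.2) ∧
    n ≤ g.2.1 ∧ n ≤ g.2.2) (A : Op n) (B : Op t) :
    gatesOn (n + t) G (tensor A B) = tensor A (gatesOn t (G.map (GCode.down n)) B) := by
  induction G generalizing B with
  | nil => simp [gatesOn]
  | cons g G ih =>
    obtain ⟨h1, h2, h3⟩ := hG g (by simp)
    have h1' : (g.down n).1 = 0 ∨ (g.down n).1 = 1 ∨ (g.down n).2.1 ≠ (g.down n).2.2 := by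
      refine h1.imp_right (Or.imp_right fun h => ?_)
      simp only [GCode.down]; omega
    rw [List.map_cons, gatesOn_cons h1, gatesOn_cons h1', frame_gateRots_down h2 h3,
      tensor_conjTranspose, tensor_mul, tensor_mul, Matrix.conjTranspose_one, one_mul, mul_one]
    exact ih (fun g hg => hG g (by simp [hg])) _

theorem realOn_tensor {G : List GCode} (hG : ∀ g ∈ G, (g.1 = 0 ∨ g.1 = 1 ∨ g.2.1 ≠ g.2.2) ∧
    n ≤ g.2.1 ∧ n ≤ g.2.2) (A : Op n) (B : Op t) {j : ℕ} (hj : n ≤ j) (m : Bool) :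
    realOn (n + t) G j m (tensor A B) = tensor A (realOn t (G.map (GCode.down n)) (j - n) m B) := by
  obtain ⟨j, rfl⟩ := Nat.exists_eq_add_of_le hj
  have hp : pproj (n + t) (Z (n + t) (n + j)) m = tensor 1 (pproj t (Z t j) m) := by
    rw [pproj, pproj, op_Z_add, tensor_smul_right, tensor_add_right, tensor_one, tensor_smul_right]
  rw [realOn, realOn, gatesOn_tensor hG, hp, tensor_mul, tensor_mul, one_mul, mul_one,
    Nat.add_sub_cancel_left]

end ES

/-! ### A stabiliser state as a mixture -/

def ket (n : ℕ) (v : ℕ → Bool) : Op n :=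
  open Classical in Matrix.diagonal fun a => if ∀ i : Fin n, a i = v i then 1 else 0

theorem trace_ket (n : ℕ) (v : ℕ → Bool) : (ket n v).trace = 1 := by
  classical
  rw [ket, Matrix.trace_diagonal, Finset.sum_eq_single fun i : Fin n => v i]
  · simp
  · intro a _ ha
    rw [if_neg]
    exact fun h => ha (funext h)
  · simp

theorem ket_ne_zero {v : ℕ → Bool} {a b : Fin n → Bool} (h : ket n v a b ≠ 0) (i : Fin n) :
    a i = v i ∧ b i = v i := by
  classical
  rw [ket, Matrix.diagonal_apply] at h
  split_ifs at h with h1 h2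
  · subst h1; exact ⟨h2 i, h2 i⟩
  · exact absurd rfl h
  · exact absurd rfl h

/-- The values of the first lines, with random bits for the unknown ones. -/
def ES.fill (S : ES) (r : List Bool) (i : ℕ) : Bool := cond (S.kn i) (S.vl i) (r.getD i false)

/-- The bits of `r` at known lines are ignored, so every basis state in the range of the projector
is counted once for each choice of these bits. -/
theorem knProj_eq_sum (S : ES) :
    ((2 : ℂ) ^ (Finset.univ.filter fun i : Fin n => S.kn i = true).card) • S.knProj n =
      ∑ r : Fin n → Bool, ket n (S.fill (List.ofFn r)) := by
  classical
  have hf : ∀ (r : Fin n → Bool) (i : Fin n),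
      S.fill (List.ofFn r) i = cond (S.kn i) (S.vl i) (r i) := fun r i => by
    simp [ES.fill, List.getD_eq_getElem?_getD]
  ext a b
  simp only [ES.knProj, ket, Matrix.smul_apply, Matrix.sum_apply, Matrix.diagonal_apply, hf]
  by_cases hab : a = b
  swap
  · simp [hab]
  simp only [hab, if_true, smul_eq_mul]
  have e : ∀ r : Fin n → Bool, (if ∀ i : Fin n, b i = cond (S.kn i) (S.vl i) (r i) then (1 : ℂ) else 0) =
      ∏ i : Fin n, if b i = cond (S.kn i) (S.vl i) (r i) then 1 else 0 := fun r => by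
    rw [Finset.prod_boole]; simp
  have e' := Finset.prod_univ_sum (fun _ : Fin n => (Finset.univ : Finset Bool))
    fun i r => if b i = cond (S.kn i) (S.vl i) r then (1 : ℂ) else 0
  rw [Fintype.piFinset_univ] at e'
  simp only [e]
  rw [← e']
  have e2 : ∀ i : Fin n, (∑ r : Bool, if b i = cond (S.kn i) (S.vl i) r then (1 : ℂ) else 0) =
      (if S.kn i = true then 2 else 1) * if S.kn i = true → b i = S.vl i then 1 else 0 := fun i => by
    rw [Fintype.sum_bool]
    cases S.kn i <;> cases b i <;> cases S.vl i <;> norm_num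
  simp only [e2]
  rw [Finset.prod_mul_distrib, Finset.prod_boole, Finset.prod_ite, Finset.prod_const,
    Finset.prod_const_one, mul_one]
  simp

/-- The unknown lines of the stabiliser state are maximally mixed, that is, they carry uniformly
random bits. The frame acts on the first `n` lines only. -/
theorem tensor_stabState {L : List (SPauli n)} (hL : IsStabGens L) (ρ : Op t) : tensor (stabState L) ρ = ((2 :
    ℂ) ^ n)⁻¹ • ∑ r : Fin n → Bool, frame (n + t) (ES.engineOf L).ops * tensor (ket n ((ES.engineOf L).fill
    (List.ofFn r))) ρ *
        (frame (n + t) (ES.engineOf L).ops)ᴴ := by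
  have h := ES.absorbAll_repr L hL
  set S := ES.engineOf L
  have hle : L.length ≤ n := by
    rw [← h.card]
    exact (Finset.card_le_univ _).trans (by simp)
  have h1 : stabState L = ((2 : ℂ) ^ n)⁻¹ • ∑ r : Fin n → Bool,
      frame n S.ops * ket n (S.fill (List.ofFn r)) * (frame n S.ops)ᴴ := by
    have e : (L.map fun S : SPauli n => (2 : ℂ)⁻¹ • (1 + S.op)).prod = (L.map halfSum).prod := rfl
    rw [stabState, e, h.prod, ES.den, ← Finset.sum_mul, ← Finset.mul_sum, ← knProj_eq_sum, h.card,
      mul_smul_comm, smul_mul_assoc, smul_smul]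
    congr 1
    have h2 : (2 : ℂ) ^ n = 2 ^ L.length * 2 ^ (n - L.length) := by
      rw [← pow_add]; congr 1; omega
    have : (2 : ℂ) ^ L.length ≠ 0 := by positivity
    rw [h2]
    field_simp
  rw [h1, tensor_smul_left, tensor_sum_left]
  congr 1
  refine Finset.sum_congr rfl fun r _ => ?_
  rw [frame_tensor_left h.short, tensor_conjTranspose, tensor_mul, tensor_mul,
    Matrix.conjTranspose_one, one_mul, mul_one]

end tensor

/-! ### Devices given by codes of instructions -/

def ICode.toInstr (t : ℕ) (u : ICode) : Instr t :=
  if u.1 = 1 then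
    if h : u.2.1.2.1 < t then
      if u.2.1.1 = 0 then .gate (.H ⟨_, h⟩)
      else if u.2.1.1 = 1 then .gate (.S ⟨_, h⟩)
      else if h' : u.2.1.2.2 < t ∧ u.2.1.2.1 ≠ u.2.1.2.2 then
        .gate (.CX ⟨_, h⟩ ⟨_, h'.1⟩ fun e => h'.2 (congrArg Fin.val e))
      else .idle
    else .idle
  else if u.1 = 2 then
    if h : u.2.1.2.1 < t then .meas ⟨_, h⟩ u.2.2 else .idle
  else .idle

/-- The encoding of the decoded instruction, written without the type `Instr t`, which depends on
`t`; in this form it is visibly computable in polynomial time. -/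
def ICode.data (t : ℕ) (u : ICode) : Data := cond (decide (u.1 = 1)) (cond (decide (u.2.1.2.1 < t)) (cond
  (decide (u.2.1.1 = 0)) (Encode.enc (0, 0, u.2.1.2.1)) (cond (decide (u.2.1.1 = 1)) (Encode.enc (0, 1,
  u.2.1.2.1)) (cond (decide (u.2.1.2.2 < t) && !decide (u.2.1.2.1 = u.2.1.2.2)) (Encode.enc (0, 2, u.2.1.2))
  .nil))) .nil) (cond (decide (u.1 = 2) && decide (u.2.1.2.1 < t)) (Encode.enc (1, u.2.1.2.1, u.2.2)) .nil)

theorem ICode.enc_toInstr (t : ℕ) (u : ICode) : Encode.enc (u.toInstr t) = u.data t := by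
  unfold ICode.toInstr ICode.data
  split_ifs with h1 h2 h3 h4 h5 h6 h7 <;> simp_all [Encode.enc]
  · by_cases h : u.2.1.2.2 < t <;> simp [h, h5]
  · simp [Nat.not_lt.2 h2]
  · simp [Nat.not_lt.2 h7]

def gateI (g : GCode) : ICode := (1, g, .output)

def measI (e : ℕ × Role) : ICode := (2, (0, e.1, e.1), e.2)

def idleI : ICode := (0, (0, 0, 0), .output)

theorem toInstr_idle (t : ℕ) : idleI.toInstr t = .idle := rfl

theorem toInstr_meas {t : ℕ} (q : Fin t) (role : Role) : (measI (q, role)).toInstr t = .meas q role := by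
  simp [measI, ICode.toInstr]

theorem toInstr_gate {t : ℕ} {g : GCode} (hg : g.Valid t) :
    ∃ u : Gate t, (gateI g).toInstr t = .gate u ∧ gateRots t u.code = gateRots t g := by
  obtain ⟨k, c, q⟩ := g
  obtain ⟨h1, h2, h3⟩ := hg
  dsimp only at *
  by_cases h0 : k = 0
  · exact ⟨.H ⟨c, h1⟩, by simp [gateI, ICode.toInstr, h0, h1], by simp [Gate.code, gateRots, h0]⟩
  by_cases h1' : k = 1
  · exact ⟨.S ⟨c, h1⟩, by simp [gateI, ICode.toInstr, h0, h1, h1'],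
      by simp [Gate.code, gateRots, h0, h1']⟩
  have hne : c ≠ q := by tauto
  exact ⟨.CX ⟨c, h1⟩ ⟨q, h2⟩ (by simpa using hne),
    by simp [gateI, ICode.toInstr, h0, h1, h1', h2, hne],
    by simp [Gate.code, gateRots, h0, h1']⟩

namespace Circuit
variable {t : ℕ} {D : Circuit t} {rd : List Bool} {f : Record → ℝ}
open ES

theorem run_gates {gs : List GCode} (hv : ∀ g ∈ gs, g.Valid t) (k idx : ℕ) (m : Record) (β : Op t)
    (h : ∀ s < gs.length, D.step (idx + s) m.history rd = (gateI (gs.getD s (0, 0, 0))).toInstr t) :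
    D.run rd f (gs.length + k) idx m β = D.run rd f k (idx + gs.length) m (gatesOn t gs β) := by
  induction gs generalizing idx β with
  | nil => simp [gatesOn]
  | cons g gs ih =>
    have h0 := h 0 (by simp)
    obtain ⟨u, hu, hu'⟩ := toInstr_gate (hv g (by simp))
    rw [List.getD_cons_zero, hu, Nat.add_zero] at h0
    rw [List.length_cons, show gs.length + 1 + k = gs.length + k + 1 by omega, run, h0,
      gatesOn_cons (hv g (by simp)).2.2]
    simp only [Instr.apply, List.map, sum_pair, List.sum_singleton]
    rw [Gate.conj_eq, hu', ih (fun g hg => hv g (by simp [hg])), show idx + 1 + gs.length =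
      idx + (gs.length + 1) by omega]
    intro s hs
    have := h (s + 1) (by simpa using hs)
    rw [List.getD_cons_succ] at this
    rw [← this]; congr 1; omega

theorem run_idle (c k idx : ℕ) (m : Record) (β : Op t) (h : ∀ s < c, D.step (idx + s) m.history rd = .idle) :
    D.run rd f (c + k) idx m β = D.run rd f k (idx + c) m β := by
  induction c generalizing idx with
  | zero => simp
  | succ c ih =>
    have h0 := h 0 (by simp)
    rw [Nat.add_zero] at h0
    rw [show c + 1 + k = c + k + 1 by omega, run, h0]
    simp only [Instr.apply, List.map, sum_pair, List.sum_singleton]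
    rw [ih, show idx + 1 + c = idx + (c + 1) by omega]
    intro s hs
    rw [← h (s + 1) (by omega)]; congr 1; omega

theorem run_meas (k idx : ℕ) (m : Record) (β : Op t) (q : Fin t) (role : Role) (h : D.step idx m.history rd =
    .meas q role) : D.run rd f (k + 1) idx m β = D.run rd f k (idx + 1) (m ++ [(role, false)]) (pproj t (Z t
    q) false * β * pproj t (Z t q) false) +
      D.run rd f k (idx + 1) (m ++ [(role, true)]) (pproj t (Z t q) true * β * pproj t (Z t q) true) := by
  rw [run, h]
  simp [Instr.apply, projZ_eq_pproj]

/-- As soon as the block has made its measurement the history is longer, and the remaining steps of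
the block are idle. This makes all blocks equally long. -/
theorem run_block {gs : List GCode} (hv : ∀ g ∈ gs, g.Valid t) (q : Fin t) (role : Role) {Lb : ℕ} (hL :
    gs.length + 1 ≤ Lb) (k idx : ℕ) (m : Record) (β : Op t) (h : ∀ s < Lb, D.step (idx + s) m.history rd =
    ((gs.map gateI ++ [measI (q, role)]).getD s idleI).toInstr t) (h' : ∀ b, ∀ s < Lb, D.step (idx + s)
    (m.history ++ [b]) rd = .idle) : D.run rd f (Lb + k) idx m β = D.run rd f k (idx + Lb) (m ++ [(role,
    false)]) (realOn t gs q false β) +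
      D.run rd f k (idx + Lb) (m ++ [(role, true)]) (realOn t gs q true β) := by
  obtain ⟨c, rfl⟩ := Nat.exists_eq_add_of_le hL
  rw [show gs.length + 1 + c + k = gs.length + (c + k + 1) by omega, run_gates hv]
  · rw [run_meas _ _ _ _ q role, run_idle, run_idle]
    · rw [show idx + gs.length + 1 + c = idx + (gs.length + 1 + c) by omega]; rfl
    · intro s hs
      rw [Record.history, List.map_append]
      have := h' true (gs.length + 1 + s) (by omega)
      rw [← this]; congr 1; omega
    · intro s hs
      rw [Record.history, List.map_append]
      have := h' false (gs.length + 1 + s) (by omega)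
      rw [← this]; congr 1; omega
    · rw [h _ (by omega), List.getD_append_right _ _ _ _ (by simp), List.length_map, Nat.sub_self,
        List.getD_cons_zero, toInstr_meas]
  · intro s hs
    rw [h s (by omega), List.getD_append _ _ _ _ (by simpa using hs)]
    simp [List.getD_eq_getElem?_getD, hs]

end Circuit

/-! ### The bit flip -/

section flip
variable {N : ℕ}

theorem onLine_mul (q : Fin N) (u w : Matrix Bool Bool ℂ) :
    onLine q u * onLine q w = onLine q (u * w) := by
  ext a b
  rw [Matrix.mul_apply]
  have key : ∀ c : Fin N → Bool, onLine q u a c * onLine q w c b =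
      if ∀ j, j ≠ q → a j = b j then
        (if c = Function.update b q (c q) then u (a q) (c q) * w (c q) (b q) else 0) else 0 := by
    intro c
    simp only [onLine]
    by_cases h1 : ∀ j, j ≠ q → a j = c j
    · rw [if_pos h1]
      by_cases h2 : ∀ j, j ≠ q → c j = b j
      · rw [if_pos h2, if_pos fun j hj => (h1 j hj).trans (h2 j hj), if_pos]
        exact (Function.eq_update_iff.2 ⟨rfl, h2⟩)
      · rw [if_neg h2, mul_zero]
        split_ifs with h3 h4
        · exact absurd (Function.eq_update_iff.1 h4).2 h2
        · rfl
        · rfl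
    · rw [if_neg h1, zero_mul]
      split_ifs with h3 h4
      · exfalso
        exact h1 fun j hj => (h3 j hj).trans ((Function.eq_update_iff.1 h4).2 j hj).symm
      · rfl
      · rfl
  simp only [key]
  rw [onLine]
  split_ifs with h
  · rw [Matrix.mul_apply, ← Finset.sum_filter]
    have : (Finset.univ.filter fun c : Fin N → Bool => c = Function.update b q (c q)) =
        Finset.univ.image fun v : Bool => Function.update b q v := by
      ext c
      simp only [Finset.mem_filter, Finset.mem_univ, true_and, Finset.mem_image]
      constructor
      · intro h; exact ⟨c q, h.symm⟩
      · rintro ⟨v, rfl⟩; simp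
    rw [this, Finset.sum_image]
    · simp
    · intro v _ v' _ hvv
      simpa using congrFun hvv q
  · simp

theorem HSSH_op (q : Fin N) :
    (Gate.H q).op * (Gate.S q).op * (Gate.S q).op * (Gate.H q).op = (X N q).op N := by
  have key : ∀ (u s : Matrix Bool Bool ℂ) (w : ℂ), w * w = 2⁻¹ → u false false = w →
      u false true = w → u true false = w → u true true = -w → s false false = 1 →
      s false true = 0 → s true false = 0 → s true true = Complex.I →
      onLine q u * onLine q s * onLine q s * onLine q u = (X N q).op N := by
    intro u s w hw h1 h2 h3 h4 h5 h6 h7 h8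
    have hI := Complex.I_mul_I
    rw [onLine_mul, onLine_mul, onLine_mul, onLine_eq q _ 0 0 1 0]
    · simp
    all_goals simp only [Matrix.mul_apply, Fintype.sum_bool, h1, h2, h3, h4, h5, h6, h7, h8]
    · linear_combination w * w * hI
    · linear_combination w * w * hI
    · linear_combination 2 * hw - w * w * hI
    · linear_combination 2 * hw - w * w * hI
  exact key _ _ _ sqrt2_inv_mul_self (by simp) (by simp) (by simp) (by simp) (by simp) (by simp)
    (by simp) (by simp)

theorem gatesOn_flip (q : Fin N) (B : Op N) :
    ES.gatesOn N (flipGates q) B = (X N q).op N * B * (X N q).op N := by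
  have hX : ((X N q).op N)ᴴ = (X N q).op N := (herm_X N q).conjTranspose
  rw [flipGates, ES.gatesOn_cons (by simp), ES.gatesOn_cons (by simp), ES.gatesOn_cons (by simp),
    ES.gatesOn_cons (by simp)]
  have eH : ((0, (q : ℕ), (q : ℕ)) : GCode) = (Gate.H q).code := rfl
  have eS : ((1, (q : ℕ), (q : ℕ)) : GCode) = (Gate.S q).code := rfl
  rw [eH, eS, ← Gate.conj_eq, ← Gate.conj_eq, ← Gate.conj_eq, ← Gate.conj_eq]
  conv_rhs => rw [← hX]
  rw [hX]
  conv_rhs => enter [2]; rw [← hX]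
  rw [← HSSH_op]
  simp only [ES.gatesOn, innerRots_nil, frame_nil, Matrix.conjTranspose_one, one_mul, mul_one,
    Matrix.conjTranspose_mul, mul_assoc]

theorem flip_op (q : Fin N) (Q : PStr) :
    (pull N (innerRots N (flipGates q)) Q).op N = sgn (Q.z q) • Q.op N := by
  have hG : GatesOff N (fun _ => false) (flipGates q) := flipGates_off q.2 rfl
  rw [← frame_conj (innerRots_herm hG)]
  change ES.gatesOn N (flipGates q) (Q.op N) = _
  rw [gatesOn_flip, op_comm N (X N q), anti_comm, anti_X q.2, smul_mul_assoc, mul_assoc,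
    (herm_X N q).sq, mul_one]

/-- `Q` anticommutes with `X` on line `q`, so conjugation by the flip negates it; the bits and the
low bit of the phase stay the same, so the sign must be in the high bit. -/
theorem flip_hi {q : Fin N} {Q : PStr} (hQ : Q.Herm N) (hz : Q.z q = true) :
    (pull N (innerRots N (flipGates q)) Q).hi = !Q.hi := by
  have hG : GatesOff N (fun _ => false) (flipGates q) := flipGates_off q.2 rfl
  set R := pull N (innerRots N (flipGates q)) Q with hR
  have hb := flipGates_bits q.2 Q
  have hRh : R.Herm N := pull_herm (innerRots_herm hG) hQ
  have hlo : R.lo = Q.lo := by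
    rw [hRh, hQ]
    exact par_congr fun i hi => by rw [(hb i hi).1, (hb i hi).2]
  have h := flip_op q Q
  rw [← hR, hz] at h
  by_contra hne
  have hhi : R.hi = Q.hi := by revert hne; cases R.hi <;> cases Q.hi <;> simp
  rw [op_congr hhi hlo (fun i hi => (hb i hi).1) fun i hi => (hb i hi).2] at h
  have h2 : (2 : ℂ) • Q.op N = 0 := by
    rw [two_smul]; nth_rewrite 1 [h]; simp
  have h3 : Q.op N = 0 := (smul_eq_zero.1 h2).resolve_left two_ne_zero
  have h4 := hQ.sq
  rw [h3, mul_zero] at h4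
  exact zero_ne_one h4

/-- The `X` moves through the projector and exchanges the outcomes; the trace does not see the `X`
that remains outside. -/
theorem trace_realOn_flip {G : List GCode} {q : Fin N} (m : Bool) (B : Op N) :
    (ES.realOn N (G ++ flipGates q) q m B).trace = (ES.realOn N G q (!m) B).trace := by
  have hap : ES.gatesOn N (G ++ flipGates q) B = (X N q).op N * ES.gatesOn N G B * (X N q).op N := by
    rw [← gatesOn_flip, ES.gatesOn, ES.gatesOn, ES.gatesOn, innerRots, innerRots, innerRots,
      List.flatMap_append, frame_append, Matrix.conjTranspose_mul]
    simp only [mul_assoc]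
  have hc : pproj N (Z N q) m * (X N q).op N = (X N q).op N * pproj N (Z N q) (!m) := by
    have : (Z N q).op N * (X N q).op N = -((X N q).op N * (Z N q).op N) := by
      rw [op_comm, anti_X q.2]; simp [Z]
    simp only [pproj, smul_mul_assoc, mul_smul_comm, add_mul, mul_add, one_mul, mul_one, this]
    cases m <;> simp
  have hc' : (X N q).op N * pproj N (Z N q) m = pproj N (Z N q) (!m) * (X N q).op N := by
    have : (X N q).op N * (Z N q).op N = -((Z N q).op N * (X N q).op N) := by
      rw [op_comm, anti_comm, anti_X q.2]; simp [Z]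
    simp only [pproj, smul_mul_assoc, mul_smul_comm, add_mul, mul_add, one_mul, mul_one, this]
    cases m <;> simp
  rw [ES.realOn, hap, ES.realOn]
  calc _ = ((pproj N (Z N q) m * (X N q).op N) * ES.gatesOn N G B *
        ((X N q).op N * pproj N (Z N q) m)).trace := by simp only [mul_assoc]
    _ = _ := by
      rw [hc, hc', mul_assoc, mul_assoc, Matrix.trace_mul_comm]
      simp only [mul_assoc, (herm_X N q).sq, mul_one]

end flip

/-! ### The adaptive device -/

def Role.isOut : Role → Bool
  | .output => true
  | _ => false

/-- All postselected measurements have given `+1`. -/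
def Record.ok (m : Record) : Bool := (m.filter fun e => e.1.isPost && e.2).isEmpty

theorem Record.ok_iff (m : Record) : m.ok = true ↔ m.Accepted := by
  rw [ok, List.isEmpty_iff, List.filter_eq_nil_iff]
  refine forall_congr' fun e => forall_congr' fun _ => ?_
  obtain ⟨role, b⟩ := e
  cases role <;> cases b <;> simp [Role.isPost]

theorem Record.output_eq (m : Record) : m.output = (m.filter fun e => e.1.isOut).map Prod.snd := by
  rw [output]
  congr 1
  refine List.filter_congr fun e _ => ?_
  obtain ⟨role, b⟩ := e
  cases role <;> simp [Role.isOut]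

theorem Record.output_append (m m' : Record) : Record.output (m ++ m') = m.output ++ Record.output m' := by
  simp [Record.output_eq]

theorem Record.accepted_append (m m' : Record) :
    Record.Accepted (m ++ m') ↔ m.Accepted ∧ Record.Accepted m' := by
  simp only [Accepted, List.mem_append, or_imp, forall_and]

theorem Record.output_of_all {m : Record} (h : ∀ e ∈ m, e.1 = Role.output) :
    m.output = m.history ∧ m.Accepted := by
  refine ⟨?_, fun e he h' => by rw [h e he] at h'; cases h'⟩
  rw [output_eq, history, List.filter_eq_self.2]
  intro e he
  rw [h e he]; rfl

namespace ES

/-- The engine after `i` steps, with the real outcomes `h`. -/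
def traj (N : ℕ) (us : ℕ → Record → ICode) (rd h : List Bool) (S₀ : ES) : ℕ → ES
  | 0 => S₀
  | i + 1 => (traj N us rd h S₀ i).step N (us i (traj N us rd h S₀ i).log) (rd.getD i false) h

section fields
variable {N : ℕ} {S : ES} {u : ICode}

theorem pass_fields (b : Bool) : (S.pass N u b).ln = S.ln ∧ (S.pass N u b).piv = S.piv ∧
    (S.pass N u b).wait = S.wait ∧ (S.pass N u b).gts = S.gts := by
  unfold pass
  cases decide (u.1 = 1) <;> cases decide (u.1 = 2) <;> cases (S.antiL N Ẑ[N, S, u.2.1.2.1]).isEmpty <;>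
    exact ⟨rfl, rfl, rfl, rfl⟩

theorem take_fields (p : Plan) (m : Bool) :
    (S.take N u p m).ln = setLn N S.ln p.2.1 m ∧ (S.take N u p m).piv = S.piv ++ [p.2] ∧
    (S.take N u p m).wait = [] ∧ (S.take N u p m).gts = S.gts ++ p.1 := by
  unfold take
  cases decide (u.1 = 2) <;> exact ⟨rfl, rfl, rfl, rfl⟩

theorem pass_kn (b : Bool) (i : ℕ) : (S.pass N u b).kn i = S.kn i := by
  unfold kn; rw [(pass_fields b).1]

theorem pass_vl (b : Bool) (i : ℕ) : (S.pass N u b).vl i = S.vl i := by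
  unfold vl; rw [(pass_fields b).1]

theorem take_kn (p : Plan) (m : Bool) {i : ℕ} (hi : i < N) :
    (S.take N u p m).kn i = (decide (i = p.2.1) || S.kn i) := by
  rw [← real_kn (S := S) (G := p.1) (m := m) (role := p.2.2) hi]
  unfold kn; rw [(take_fields p m).1]; rfl

theorem take_vl (p : Plan) (m : Bool) {i : ℕ} (hi : i < N) :
    (S.take N u p m).vl i = if i = p.2.1 then m else S.vl i := by
  rw [← real_vl (S := S) (G := p.1) (m := m) (role := p.2.2) hi]
  unfold vl; rw [(take_fields p m).1]; rfl

theorem step_wait {b : Bool} {h : List Bool} (hw : S.wait ≠ []) : S.step N u b h = S := by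
  unfold step
  rw [show S.wait.isEmpty = false by simpa using hw]
  rfl

theorem step_pass {b : Bool} {h : List Bool} (hw : S.wait = []) (hp : S.plan N u = []) :
    S.step N u b h = S.pass N u b := by
  simp [step, hw, hp]

theorem step_take {b : Bool} {h : List Bool} {p : Plan} {l : List Plan} (hw : S.wait = []) (hp : S.plan N u = p :: l)
    (hh : S.piv.length < h.length) :
    S.step N u b h = S.take N u p (h.getD S.piv.length false) := by
  simp [step, hw, hp, hh]

theorem step_freeze {b : Bool} {h : List Bool} {p : Plan} {l : List Plan} (hw : S.wait = []) (hp : S.plan N u = p :: l)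
    (hh : ¬ S.piv.length < h.length) :
    S.step N u b h = { S with wait := p :: l } := by
  simp [step, hw, hp, hh]

end fields

section traj
variable {N : ℕ} {us : ℕ → Record → ICode} {rd h : List Bool} {S₀ : ES}

theorem traj_wait {i : ℕ} (hw : (traj N us rd h S₀ i).wait ≠ []) (k : ℕ) :
    traj N us rd h S₀ (i + k) = traj N us rd h S₀ i := by
  induction k with
  | zero => rfl
  | succ k ih => rw [← Nat.add_assoc, traj, ih, step_wait hw]

/-- An engine that is not waiting has found all the outcomes it asked for among `h`, and reads no
further ones. -/
theorem traj_append (h0 : S₀.piv = []) {i : ℕ} (hw : (traj N us rd h S₀ i).wait = []) (l : List Bool) :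
    traj N us rd (h ++ l) S₀ i = traj N us rd h S₀ i ∧ (traj N us rd h S₀ i).piv.length ≤ h.length := by
  induction i with
  | zero => exact ⟨rfl, by simp [traj, h0]⟩
  | succ i ih =>
    have hw' : (traj N us rd h S₀ i).wait = [] := by
      by_contra hne
      exact hne ((traj_wait hne 1).symm ▸ hw)
    obtain ⟨ih1, ih2⟩ := ih hw'
    rw [traj, traj, ih1]
    rw [traj] at hw
    set S := traj N us rd h S₀ i
    cases hp : S.plan N (us i S.log) with
    | nil =>
      rw [step_pass hw' hp, step_pass hw' hp, (pass_fields _).2.1]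
      exact ⟨rfl, ih2⟩
    | cons p q =>
      by_cases hh : S.piv.length < h.length
      · rw [step_take hw' hp hh, step_take hw' hp (by simp; omega), (take_fields _ _).2.1,
          List.getD_append _ _ _ _ hh]
        exact ⟨rfl, by simpa using hh⟩
      · rw [step_freeze hw' hp hh] at hw
        simp at hw

end traj

theorem length_flatMap_le {α β : Type} (l : List α) (f : α → List β) (c : ℕ)
    (h : ∀ a ∈ l, (f a).length ≤ c) : (l.flatMap f).length ≤ l.length * c := by
  induction l with
  | nil => simp
  | cons a l ih =>
    have := h a (by simp)
    have := ih fun a ha => h a (by simp [ha])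
    simp only [List.flatMap_cons, List.length_append, List.length_cons]
    nlinarith

theorem reduceGates_length (N : ℕ) (ln : List (Bool × Bool)) (Q : PStr) (j : ℕ) :
    (reduceGates N ln Q j).length ≤ 3 * N := by
  rw [reduceGates, List.length_append]
  have a := length_flatMap_le (List.range N) (fun i => cond (!(ln.getD i (false, false)).1 && Q.x i)
    (cond (Q.z i) [((1, i, i) : GCode), (0, i, i)] [(0, i, i)]) []) 2 fun i _ => by
      cases (!(ln.getD i (false, false)).1 && Q.x i) <;> cases Q.z i <;> simp
  have b := length_flatMap_le (List.range N) (fun i => cond (!(ln.getD i (false, false)).1 &&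
    (Q.x i || Q.z i) && !decide (i = j)) [((2, i, j) : GCode)] []) 1 fun i _ => by
      cases (!(ln.getD i (false, false)).1 && (Q.x i || Q.z i) && !decide (i = j)) <;> simp
  rw [List.length_range] at a b
  omega

theorem realGates_length {N : ℕ} {S : ES} {q j : ℕ} {role : Role} :
    (S.realGates N q role j).length ≤ 3 * N + 4 := by
  rw [realGates, List.length_append]
  have := reduceGates_length N S.ln Ẑ[N, S, q] j
  generalize (role.isPost && _) = c
  cases c
  · simp only [cond_false, List.length_nil]; omega
  · simp only [cond_true, flipGates, List.length_cons, List.length_nil]; omega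

/-- A known line cannot give the other value. This supplies the event of probability zero by which a
run is rejected inside the device. -/
theorem realOn_eq_zero {N : ℕ} {S : ES} {B : Op N} (h : S.Inv N B) {j : Fin N} (hj : S.kn j = true)
    {m : Bool} (hm : S.vl j ≠ m) : realOn N [] j m B = 0 := by
  rw [realOn, pproj_Z_diag, gatesOn]
  ext a b
  rw [diag_sandwich_apply]
  by_cases hB : B a b = 0
  · simp [hB]
  · have := (h.sup a b hB j hj).1
    rw [if_neg (by rw [this]; exact hm)]; simp

end ES

section device
variable (n t : ℕ) (ps : Bool) (fin : List Bool → ES)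

/-- The outcome which is not measured, because the run is accepted only for one value of it. -/
def completion (y : List Bool) : List Bool :=
  cond (fin (y ++ [false])).log.ok (y ++ [false]) (y ++ [true])

/-- Whether the run will be accepted is known for both values of the last outcome. If for both, the
measurement is an output; if for one, that outcome is postselected, after a flip if it is `-1`. If
for none, line `j₀`, whose value is still its recorded outcome `h.headD`, is brought to the value
`-1` and postselected to `+1`, which never happens. -/
def lastBlock (h : List Bool) (G : List GCode) (j j₀ : ℕ) : List ICode := cond (fin (h ++ [false])).log.ok
  (cond (fin (h ++ [true])).log.ok (G.map gateI ++ [measI (j, .output)]) (G.map gateI ++ [measI (j,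
  .postselected)])) (cond (fin (h ++ [true])).log.ok ((G ++ flipGates j).map gateI ++ [measI (j,
  .postselected)]) ((cond (h.headD false) [] (flipGates j₀)).map gateI ++ [measI (j₀, .postselected)]))

def block (h : List Bool) : List ICode := cond (fin h).wait.isEmpty [] (cond (ps && decide (h.length + 1 = t)
  && decide (2 ≤ t)) (lastBlock fin h ((((fin h).wait.headD ([], 0, .output)).1).map (GCode.down n)) (((fin
  h).wait.headD ([], 0, .output)).2.1 - n) (((fin h).piv.headD (0, .output)).1 - n)) (((((fin h).wait.headD
  ([], 0, .output)).1).map (GCode.down n)).map gateI ++ [measI (((fin h).wait.headD ([], 0, .output)).2.1 - n,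
  .output)]))

/-- At most `3 N + 4` gates before a real measurement, with `N = n + t`, four more for a flip in the
last block, and the measurement. -/
def blockLen : ℕ := 3 * (n + t) + 9

/-- The number of outcomes is the number of blocks that have made their measurement. An index
smaller than that many full blocks thus belongs to the idle rest of a block. -/
def device : Circuit t where
  length := t * blockLen n t
  coins := 0
  step idx h _ := ICode.toInstr t (cond (decide (idx < h.length * blockLen n t)) idleI
    ((block n t ps fin h).getD (idx - h.length * blockLen n t) idleI))

theorem device_atMostMeas : (device n t ps fin).AtMostMeas t := by
  intro r α b hb
  have key : ∀ i ≤ t * blockLen n t, ∀ b ∈ (device n t ps fin).branches (List.ofFn r) α i,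
      b.1.length ≤ t := by
    intro i
    induction i with
    | zero => intro _ b hb; simp [Circuit.branches] at hb; simp [hb]
    | succ i ih =>
      intro hi b hb
      rw [Circuit.branches, List.mem_flatMap] at hb
      obtain ⟨c, hc, hb⟩ := hb
      have hlen := ih (by omega) c hc
      cases hs : (device n t ps fin).step i c.1.history (List.ofFn r) with
      | idle | gate =>
        rw [hs] at hb
        simp only [Instr.apply, List.mem_singleton] at hb
        rw [hb]; exact hlen
      | meas q role =>
        rw [hs] at hb
        have hlt : c.1.length < t := by
          by_contra hge
          have hct : t = c.1.length := by omega
          -- After `t` outcomes all indices lie in finished blocks, so no measurement can follow.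
          have : i < c.1.history.length * blockLen n t := by
            rw [Record.history, List.length_map, ← hct]; omega
          simp only [device, this, decide_true, cond_true, toInstr_idle] at hs
          cases hs
        simp only [Instr.apply, List.mem_map] at hb
        obtain ⟨_, _, rfl⟩ := hb
        simpa using hlt
  exact key _ le_rfl b hb

end device

/-! ### Correctness of the adaptive device -/

open Circuit (ind)

/-- The outputs of the device after which the simulated circuit accepts with an output in `E`, and,
if `b` holds, also those after which it does not accept. -/
def goodSet (fin : List Bool → ES) (E : Set (List Bool)) (b : Prop) : Set (List Bool) :=
  {y | ((fin (completion fin y)).log.ok = true ∧ (fin (completion fin y)).log.output ∈ E) ∨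
    (b ∧ (fin (completion fin y)).log.ok = false)}

theorem ind_of_ok {fin : List Bool → ES} {E : Set (List Bool)} {b : Prop} {m : Record}
    (hm : m.Accepted) (h : (fin (completion fin m.output)).log.ok = true) :
    ind (goodSet fin E b) m = ind E (fin (completion fin m.output)).log := by
  have := (Record.ok_iff _).1 h
  have e : (m.Accepted ∧ m.output ∈ goodSet fin E b) ↔ (fin (completion fin m.output)).log.Accepted ∧
      (fin (completion fin m.output)).log.output ∈ E := by simp [goodSet, hm, h, this]
  unfold ind
  by_cases h' : m.Accepted ∧ m.output ∈ goodSet fin E b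
  · rw [if_pos h', if_pos (e.1 h')]
  · rw [if_neg h', if_neg (mt e.2 h')]

theorem ind_of_not_ok {E : Set (List Bool)} {m : Record} (h : m.ok = false) : ind E m = 0 := by
  have : ¬ m.Accepted := fun h' => by rw [← Record.ok_iff, h] at h'; simp at h'
  simp [ind, this]

theorem ind_false {fin : List Bool → ES} {E : Set (List Bool)} {m : Record} (hm : m.Accepted) :
    ind (goodSet fin E False) m = ind E (fin (completion fin m.output)).log := by
  cases h : (fin (completion fin m.output)).log.ok
  · rw [ind_of_not_ok h]
    simp [ind, goodSet, h]
  · exact ind_of_ok hm h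

theorem ind_not_accepted {E : Set (List Bool)} {m : Record} (hm : ¬ m.Accepted) : ind E m = 0 := by
  simp [ind, hm]

section claim
variable {n t : ℕ} {us : ℕ → Record → ICode} {rd : List Bool} {S₀ : ES} {K M : ℕ}

/-- The situation before step `i` when all requested outcomes were available. Every outcome has made
one more line known (`unk`). From step `K` on there is only padding, and `rest` says that enough
steps remain to make all lines known. `head` keeps the first measured line with its value for the
impossible postselection. -/
structure Stage (n t K M : ℕ) (h : List Bool) (i : ℕ) (S : ES) : Prop where
  wait : S.wait = []
  piv : S.piv.length = h.length
  fst : ∀ k < n, S.kn k = true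
  unk : ((Finset.range (n + t)).filter fun k => S.kn k = false).card + h.length = t
  rest : ((Finset.range (n + t)).filter fun k => S.kn k = false).card + max i K ≤ M
  head : h ≠ [] → ∃ j < t, (S.piv.headD (0, .output)).1 = n + j ∧ S.kn (n + j) = true ∧
    S.vl (n + j) = h.headD false

open ES

theorem unk_take {N : ℕ} {S : ES} {u : ICode} {p : Plan} {m : Bool} (hj : p.2.1 < N) (hk : S.kn p.2.1 = false)
    : ((Finset.range N).filter fun k => (S.take N u p m).kn k = false).card + 1 =
      ((Finset.range N).filter fun k => S.kn k = false).card := by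
  have : (Finset.range N).filter (fun k => (S.take N u p m).kn k = false) =
      ((Finset.range N).filter fun k => S.kn k = false).erase p.2.1 := by
    ext k
    simp only [Finset.mem_filter, Finset.mem_range, Finset.mem_erase]
    rw [and_left_comm]
    exact and_congr_right fun h => by rw [take_kn p m h]; simp
  rw [this, Finset.card_erase_add_one]
  simp [hj, hk]

theorem plan_spec {N : ℕ} {S : ES} {B : Op N} {u : ICode} (hu : u = padCode ∨ ∃ v : Instr N, u = v.code)
    {p : Plan} {l : List Plan} (hp : S.plan N u = p :: l)
    (hI : S.Inv N B) : p.2.1 < N ∧ S.kn p.2.1 = false ∧ GatesOff N S.kn p.1 ∧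
      p.1.length ≤ 3 * N + 4 ∧ ∀ m, (S.take N u p m).Inv N (realOn N p.1 p.2.1 m B) := by
  rcases hu with rfl | ⟨v, rfl⟩
  · have hT := fun m => hI.take_pad hp m
    obtain ⟨j, hj, rfl, -⟩ := plan_pad hp
    exact ⟨j.2, hj, by intro g hg; simp at hg, by simp, hT⟩
  · have hT := fun m => hI.take hp m
    cases v with
    | idle | gate => rw [plan_code_ne (by simp)] at hp; simp at hp
    | meas q role =>
      obtain ⟨j, ha, hr, rfl, -⟩ := plan_meas hp
      have hk : S.kn j = false := by
        rw [Bool.and_eq_true, Bool.not_eq_true'] at hr; exact hr.1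
      exact ⟨j.2, hk, (realGates_spec j.2 ha hr).1, realGates_length, hT⟩

theorem off_down {S : ES} {G : List GCode} (hG : GatesOff (n + t) S.kn G)
    (hf : ∀ k < n, S.kn k = true) : ∀ g ∈ G,
      ((g.1 = 0 ∨ g.1 = 1 ∨ g.2.1 ≠ g.2.2) ∧ n ≤ g.2.1 ∧ n ≤ g.2.2) ∧ (g.down n).Valid t := by
  intro g hg
  obtain ⟨⟨h1, h2, h3⟩, h4, h5⟩ := hG g hg
  have e1 : n ≤ g.2.1 := by
    by_contra hlt
    rw [hf _ (by omega)] at h4; simp at h4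
  have e2 : n ≤ g.2.2 := by
    by_contra hlt
    rw [hf _ (by omega)] at h5; simp at h5
  refine ⟨⟨h3, e1, e2⟩, ?_, ?_, h3.imp_right (Or.imp_right fun h => ?_)⟩ <;> simp only [GCode.down] <;> omega

theorem Stage.pass {h : List Bool} {i : ℕ} {S : ES} {u : ICode} {b : Bool}
    (hS : Stage n t K M h i S) (hi : i < M) (hp : S.plan (n + t) u = [])
    (hu : K ≤ i → u = padCode) : Stage n t K M h (i + 1) (S.pass (n + t) u b) := by
  have hk : ∀ k, (S.pass (n + t) u b).kn k = S.kn k := fun k => pass_kn b k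
  refine ⟨(pass_fields b).2.2.1.trans hS.wait, by rw [(pass_fields b).2.1, hS.piv],
    fun k hk' => by rw [hk, hS.fst k hk'], by simp only [hk, hS.unk], ?_, ?_⟩
  · simp only [hk]
    have := hS.rest
    -- A padding step that needs no real measurement means that no line is unknown. Before step `K`,
    -- `max i K` does not change.
    by_cases hKi : K ≤ i
    · have e : S.plan (n + t) padCode =
        cond (!(S.unkL (n + t)).isEmpty) [([], (S.unkL (n + t)).headD 0, .output)] [] := rfl
      rw [hu hKi, e] at hp
      have h0 : (S.unkL (n + t)).isEmpty = true := by
        by_contra hne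
        rw [Bool.not_eq_true] at hne
        rw [hne] at hp; simp at hp
      have : ((Finset.range (n + t)).filter fun k => S.kn k = false) = ∅ := by
        rw [Finset.filter_eq_empty_iff]
        intro k hk
        simpa using isEmpty_filter h0 k (Finset.mem_range.1 hk)
      rw [this, Finset.card_empty]
      omega
    · omega
  · intro hne
    obtain ⟨j, h1, h2, h3, h4⟩ := hS.head hne
    exact ⟨j, h1, by rw [(pass_fields b).2.1, h2], by rw [hk, h3], by rw [pass_vl b, h4]⟩

theorem Stage.take {h : List Bool} {i : ℕ} {S : ES} {u : ICode} {m : Bool} {p : Plan} (hS : Stage n t K M h i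
    S) (hj : p.2.1 < n + t) (hk : S.kn p.2.1 = false) :
    Stage n t K M (h ++ [m]) (i + 1) (S.take (n + t) u p m) := by
  have hc := unk_take (u := u) (m := m) hj hk
  have hu := hS.unk
  have hr := hS.rest
  refine ⟨(take_fields p m).2.2.1, by rw [(take_fields p m).2.1]; simp [hS.piv],
    fun k hk' => by rw [take_kn p m (by omega), hS.fst k hk', Bool.or_true], ?_, ?_, ?_⟩
  · simp only [List.length_append, List.length_cons, List.length_nil]; omega
  · omega
  · intro _
    by_cases hne : h = []
    · have hpiv : S.piv = [] := List.length_eq_zero_iff.1 (by rw [hS.piv, hne]; rfl)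
      have hn : n ≤ p.2.1 := by
        by_contra hlt
        rw [hS.fst _ (by omega)] at hk; simp at hk
      refine ⟨p.2.1 - n, by omega, ?_, ?_, ?_⟩
      · rw [(take_fields p m).2.1, hpiv]; simp; omega
      · rw [Nat.add_sub_cancel' hn, take_kn p m hj]; simp
      · rw [Nat.add_sub_cancel' hn, take_vl p m hj, hne]; simp
    · obtain ⟨j, h1, h2, h3, h4⟩ := hS.head hne
      have hjp : n + j ≠ p.2.1 := fun e => by
        rw [e, hk] at h3; simp at h3
      refine ⟨j, h1, ?_, ?_, ?_⟩
      · rw [(take_fields p m).2.1, ← h2]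
        cases hpv : S.piv with
        | nil => exact absurd (List.length_eq_zero_iff.1 (by rw [← hS.piv, hpv]; rfl)) hne
        | cons x l => rfl
      · rw [take_kn p m (by omega), h3, Bool.or_true]
      · rw [take_vl p m (by omega), if_neg hjp, h4]
        cases h with
        | nil => exact absurd rfl hne
        | cons x l => rfl

theorem device_step {ps : Bool} {fin : List Bool → ES} {h : List Bool} {s : ℕ} (rd' : List Bool) :
    (device n t ps fin).step (h.length * blockLen n t + s) h rd' =
      ((block n t ps fin h).getD s idleI).toInstr t := by
  simp [device]

theorem device_idle {ps : Bool} {fin : List Bool → ES} {h : List Bool} {s : ℕ} (hs : s < blockLen n t)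
    (b : Bool) (rd' : List Bool) :
    (device n t ps fin).step (h.length * blockLen n t + s) (h ++ [b]) rd' = .idle := by
  have : h.length * blockLen n t + s < (h.length + 1) * blockLen n t := by
    rw [Nat.add_mul]; omega
  simp [device, this, toInstr_idle]

theorem run_device_block {ps : Bool} {fin : List Bool → ES} {rd' : List Bool} {f : Record → ℝ} {m : Record} {h
    : List Bool} (hm : m.history = h) {gs : List GCode} (hv : ∀ g ∈ gs, g.Valid t) {j : ℕ} (hj : j < t) {role
    : Role} (hL : gs.length + 1 ≤ blockLen n t) (hb : block n t ps fin h = gs.map gateI ++ [measI (j, role)])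
    (β : Op t) (k : ℕ) : (device n t ps fin).run rd' f (blockLen n t + k) (h.length * blockLen n t) m β =
    (device n t ps fin).run rd' f k ((h.length + 1) * blockLen n t) (m ++ [(role, false)]) (realOn t gs j
    false β) + (device n t ps fin).run rd' f k ((h.length + 1) * blockLen n t) (m ++ [(role, true)])
        (realOn t gs j true β) := by
  rw [Circuit.run_block hv ⟨j, hj⟩ role hL, Nat.add_mul, Nat.one_mul]
  · intro s _
    rw [hm, device_step, hb]
  · intro b s hs
    rw [hm, device_idle hs]

theorem run_device_last {ps : Bool} {fin : List Bool → ES} {rd' : List Bool} {f : Record → ℝ} {m : Record} {h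
    : List Bool} (hm : m.history = h) {gs : List GCode} (hv : ∀ g ∈ gs, g.Valid t) {j : ℕ} (hj : j < t) {role
    : Role} (hL : gs.length + 1 ≤ blockLen n t) (hb : block n t ps fin h = gs.map gateI ++ [measI (j, role)])
    (β : Op t) : (device n t ps fin).run rd' f (blockLen n t) (h.length * blockLen n t) m β = f (m ++ [(role,
    false)]) * (realOn t gs j false β).trace.re + f (m ++ [(role, true)]) * (realOn t gs j true β).trace.re :=
    run_device_block hm hv hj hL hb β 0

theorem trace_tensor_ket (v : ℕ → Bool) (β : Op t) : (tensor (ket n v) β).trace = β.trace := by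
  rw [tensor_trace, trace_ket, one_mul]

/-- Induction on the remaining steps of the engine: a step without a real measurement leaves the
device where it is, and one with a real measurement consumes a block. `b` says whether rejected runs
are counted too; it makes no difference as long as the last block is still to come and has been
arranged to give such runs the weight zero. -/
theorem run_device (hus : ∀ i m, us i m = padCode ∨ ∃ u : Instr (n + t), us i m = u.code) (hpad : ∀ i ≥ K, ∀
    m, us i m = padCode) (h0 : S₀.piv = []) (ps : Bool) (v : ℕ → Bool) (E : Set (List Bool)) (rd' : List Bool)
    (k i : ℕ) (hki : i + k = M) (h : List Bool) (hS : Stage n t K M h i (traj (n + t) us rd h S₀ i)) (β : Op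
    t) (hI : (traj (n + t) us rd h S₀ i).Inv (n + t) (tensor (ket n v) β)) (m : Record) (hm : m.history = h)
    (hm' : ∀ e ∈ m, e.1 = Role.output) : (h.length = t → (traj (n + t) us rd h S₀ M).wait = []) ∧ ∀ b : Prop,
    (b → ps = true ∧ 2 ≤ t ∧ h.length < t) → (device n t ps fun h => traj (n + t) us rd h S₀ M).run rd' (ind
    (goodSet (fun h => traj (n + t) us rd h S₀ M) E b)) ((t - h.length) * blockLen n t) (h.length * blockLen n
    t) m β =
      sim (n + t) us (ind E) k i (traj (n + t) us rd h S₀ i) (tensor (ket n v) β) (rd.drop i) := by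
  set fin := fun h => traj (n + t) us rd h S₀ M with hfin
  induction k generalizing i h β m with
  | zero =>
    rw [Nat.add_zero] at hki
    subst hki
    have hl : h.length = t := by
      have := hS.rest; have := hS.unk; omega
    refine ⟨fun _ => hS.wait, fun b hb => ?_⟩
    have hb' : b = False := eq_false fun hb' => absurd (hb hb').2.2 (by omega)
    obtain ⟨ho, hacc⟩ := Record.output_of_all hm'
    rw [hl, Nat.sub_self, Nat.zero_mul, Circuit.run, sim, hb', ind_false hacc, trace_tensor_ket, ho, hm]
    -- All `t` outcomes are present, so the bit that `completion` appends is not read.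
    have : ∀ c, fin (h ++ [c]) = fin h := fun c => (traj_append h0 hS.wait [c]).1
    have : fin (completion fin h) = fin h := by
      rw [completion]
      cases (fin (h ++ [false])).log.ok <;> exact this _
    rw [this]
  | succ k ih =>
    have hiM : i < M := by omega
    have happ := fun l => traj_append h0 hS.wait l
    set S := traj (n + t) us rd h S₀ i
    have hfst : ∀ h', traj (n + t) us rd h' S₀ i = S → traj (n + t) us rd h' S₀ (i + 1) =
        S.step (n + t) (us i S.log) (rd.getD i false) h' := fun h' e => by rw [traj, e]
    have hhd : (rd.drop i).headD false = rd.getD i false := by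
      rw [List.headD_eq_head?_getD, List.head?_drop, List.getD_eq_getElem?_getD]
    have htl : (rd.drop i).tail = rd.drop (i + 1) := by simp
    cases hp : S.plan (n + t) (us i S.log) with
    | nil =>
      have e := (hfst h rfl).trans (step_pass hS.wait hp)
      rw [sim, hp]
      dsimp only
      have hS' := hS.pass (b := rd.getD i false) hiM hp fun hK => hpad i hK _
      rw [← e] at hS'
      have hI' : (traj (n + t) us rd h S₀ (i + 1)).Inv (n + t) (tensor (ket n v) β) := by
        rw [e]
        rcases hus i S.log with hu | ⟨u, hu⟩
        · rw [hu]; exact hI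
        · rw [hu] at hp ⊢; exact hI.pass u hp _
      rw [hhd, htl, ← e]
      exact ih (i + 1) (by omega) h hS' β hI' m hm hm'
    | cons p l =>
      obtain ⟨hj, hk, hG, hGl, hT⟩ := plan_spec (hus i S.log) hp hI
      have hdown := off_down hG hS.fst
      have hn : n ≤ p.2.1 := by
        by_contra hlt
        rw [hS.fst _ (by omega)] at hk; simp at hk
      have hlt : h.length < t := by
        have h1 := hS.unk
        have : 0 < ((Finset.range (n + t)).filter fun k => S.kn k = false).card :=
          Finset.card_pos.2 ⟨p.2.1, by simp [hj, hk]⟩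
        omega
      have hreal : ∀ c, realOn (n + t) p.1 p.2.1 c (tensor (ket n v) β) =
          tensor (ket n v) (realOn t (p.1.map (GCode.down n)) (p.2.1 - n) c β) := fun c =>
        realOn_tensor (fun g hg => (hdown g hg).1) _ _ hn c
      -- With the outcomes `h` alone the engine stops at this step and keeps the request `p`, which
      -- is what the next block of the device reads.
      have hwait : fin h = { S with wait := p :: l } := by
        have e := (hfst h rfl).trans (step_freeze hS.wait hp (by rw [hS.piv]; omega))
        have := traj_wait (N := n + t) (us := us) (rd := rd) (h := h) (S₀ := S₀) (i := i + 1)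
          (by rw [e]; simp) k
        rw [hfin]
        dsimp only
        rw [← hki, show i + (k + 1) = i + 1 + k by omega, this, e]
      have e : ∀ c, traj (n + t) us rd (h ++ [c]) S₀ (i + 1) = S.take (n + t) (us i S.log) p c :=
        fun c => by
          rw [hfst (h ++ [c]) (happ [c]).1, step_take hS.wait hp (by rw [hS.piv]; simp)]
          congr 1
          rw [hS.piv, List.getD_append_right _ _ _ _ le_rfl]; simp
      have hmc : ∀ c : Bool, Record.history (m ++ [(Role.output, c)]) = h ++ [c] := fun c => by
        rw [Record.history, List.map_append, ← hm]; rfl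
      have hmc' : ∀ c : Bool, ∀ e ∈ m ++ [(Role.output, c)], e.1 = Role.output := fun c e he => by
        rcases List.mem_append.1 he with he | he
        · exact hm' e he
        · rw [List.mem_singleton.1 he]
      have ih' := fun c => ih (i + 1) (by omega) (h ++ [c])
        (by rw [e]; exact hS.take hj hk) (realOn t (p.1.map (GCode.down n)) (p.2.1 - n) c β)
        (by rw [e, ← hreal]; exact hT c) (m ++ [(Role.output, c)]) (hmc c) (hmc' c)
      simp only [List.length_append, List.length_cons, List.length_nil, zero_add, e, ← hreal] at ih'
      refine ⟨fun hl => absurd hl (by omega), fun b hb => ?_⟩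
      rw [sim, hp]
      dsimp only
      rw [htl]
      rw [show t - h.length = 1 + (t - (h.length + 1)) by omega, Nat.add_mul, Nat.one_mul]
      have hblk : block n t ps fin h = cond (ps && decide (h.length + 1 = t) && decide (2 ≤ t)) (lastBlock fin
          h (p.1.map (GCode.down n)) (p.2.1 - n) ((S.piv.headD (0, .output)).1 - n))
            ((p.1.map (GCode.down n)).map gateI ++ [measI (p.2.1 - n, .output)]) := by
        rw [block, hwait]; rfl
      have hvalid : ∀ g ∈ p.1.map (GCode.down n), g.Valid t := fun g hg => by
        obtain ⟨g', hg', rfl⟩ := List.mem_map.1 hg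
        exact (hdown g' hg').2
      have hjt : p.2.1 - n < t := by omega
      have hlenG : (p.1.map (GCode.down n)).length + 1 ≤ blockLen n t := by
        rw [List.length_map, blockLen]; omega
      by_cases hlast : (ps && decide (h.length + 1 = t) && decide (2 ≤ t)) = true
      swap
      · rw [Bool.not_eq_true] at hlast
        rw [hlast, cond_false] at hblk
        rw [run_device_block hm hvalid hjt hlenG hblk]
        have hb' : b → ps = true ∧ 2 ≤ t ∧ h.length + 1 < t := fun hb' => by
          obtain ⟨h1, h2, h3⟩ := hb hb'
          refine ⟨h1, h2, lt_of_le_of_ne h3 fun h4 => ?_⟩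
          rw [h1, decide_eq_true h4, decide_eq_true h2] at hlast
          simp at hlast
        rw [(ih' false).2 b hb', (ih' true).2 b hb']
      · rw [hlast, cond_true] at hblk
        simp only [Bool.and_eq_true, decide_eq_true_eq] at hlast
        obtain ⟨⟨hps, ht⟩, h2t⟩ := hlast
        rw [ht, Nat.sub_self, Nat.zero_mul] at ih' ⊢
        have hfull : ∀ c, ∀ d, fin (h ++ [c] ++ [d]) = fin (h ++ [c]) := fun c d =>
          (traj_append h0 ((ih' c).1 rfl) [d]).1
        have hcomp : ∀ c, fin (completion fin (h ++ [c])) = fin (h ++ [c]) := fun c => by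
          rw [completion]
          cases (fin (h ++ [c] ++ [false])).log.ok <;> exact hfull c _
        have hout : ∀ c, Record.output (m ++ [(Role.output, c)]) = h ++ [c] ∧
            Record.Accepted (m ++ [(Role.output, c)]) := fun c => by
          have := Record.output_of_all (hmc' c)
          rwa [hmc c] at this
        have hval : ∀ c, sim (n + t) us (ind E) k (i + 1) (S.take (n + t) (us i S.log) p c) (realOn (n + t)
            p.1 p.2.1 c (tensor (ket n v) β)) (rd.drop (i + 1)) = ind E (fin (h ++ [c])).log *
              (realOn t (p.1.map (GCode.down n)) (p.2.1 - n) c β).trace.re := fun c => by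
          rw [← (ih' c).2 False (fun hf => hf.elim), Circuit.run, ind_false (hout c).2, (hout c).1, hcomp]
        rw [hval, hval]
        have hm0 := Record.output_of_all hm'
        have hpost : ∀ c, Record.output (m ++ [(Role.postselected, c)]) = h := fun c => by
          rw [Record.output_append, hm0.1, hm]; simp [Record.output_eq, Role.isOut]
        have hpf : Record.Accepted (m ++ [(Role.postselected, false)]) := by
          rw [Record.accepted_append]
          exact ⟨hm0.2, by simp [Record.Accepted]⟩
        have hpt : ∀ E', ind E' (m ++ [(Role.postselected, true)]) = 0 := fun E' => by
          refine ind_not_accepted ?_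
          rw [Record.accepted_append]
          simp [Record.Accepted]
        have hflip : ∀ {j : ℕ}, j < t → ∀ g ∈ flipGates j, g.Valid t := fun hj g hg =>
          (flipGates_off (kn := fun _ => false) hj rfl g hg).1
        rw [Nat.add_zero]
        cases ha0 : (fin (h ++ [false])).log.ok <;> cases ha1 : (fin (h ++ [true])).log.ok <;>
          rw [lastBlock, ha0, ha1] at hblk <;> simp only [cond_true, cond_false] at hblk
        -- Neither outcome leads to acceptance. Since `2 ≤ t`, the history is not empty, and the
        -- first measured line is used to give the run the weight zero.
        · rw [ind_of_not_ok ha0, ind_of_not_ok ha1, zero_mul, zero_mul, add_zero]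
          have hne : h ≠ [] := fun e => by
            rw [e] at ht; simp at ht; omega
          obtain ⟨j, hjt, hpj, hkj, hvj⟩ := hS.head hne
          rw [hpj, Nat.add_sub_cancel_left] at hblk
          have hz : (realOn t [] j (!h.headD false) β).trace = 0 := by
            have h1 := realOn_eq_zero hI (j := ⟨n + j, by omega⟩) hkj (m := !h.headD false)
              (by simp [hvj])
            have h2 := realOn_tensor (n := n) (t := t) (G := []) (by simp) (ket n v) β
              (j := n + j) (by omega) (!h.headD false)
            rw [Nat.add_sub_cancel_left] at h2
            have h3 := congrArg Matrix.trace (h2.symm.trans h1)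
            rwa [trace_tensor_ket, Matrix.trace_zero] at h3
          rw [run_device_last hm (gs := cond (h.headD false) [] (flipGates j)) (fun g hg => by
            cases hh : h.headD false
            · rw [hh] at hg; exact hflip hjt g hg
            · rw [hh] at hg; simp at hg) hjt (by
              cases h.headD false <;> simp [flipGates, blockLen]) hblk, hpt, zero_mul, add_zero]
          have hz' : (realOn t (cond (h.headD false) [] (flipGates j)) j false β).trace = 0 := by
            cases hh : h.headD false
            · rw [hh] at hz
              have := trace_realOn_flip (N := t) (G := []) (q := ⟨j, hjt⟩) false β
              rw [List.nil_append] at this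
              exact this.trans hz
            · rw [hh] at hz; exact hz
          rw [hz']; simp
        -- Only `-1` leads to acceptance. After the flip it appears as `+1` and is postselected; it
        -- is not part of the output, and `completion` restores it.
        · rw [ind_of_not_ok ha0, zero_mul, zero_add, run_device_last hm (fun g hg => by
            rcases List.mem_append.1 hg with hg | hg
            · exact hvalid g hg
            · exact hflip hjt g hg) hjt (by
            rw [List.length_append, List.length_map, blockLen]; simp [flipGates]; omega) hblk,
            hpt, zero_mul, add_zero]
          have := trace_realOn_flip (N := t) (G := p.1.map (GCode.down n)) (q := ⟨p.2.1 - n, hjt⟩) false β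
          dsimp only at this
          have hc : completion fin h = h ++ [true] := by rw [completion, ha0]; rfl
          rw [this, ind_of_ok hpf (by rw [hpost, hc, ha1]), hpost, hc]; rfl
        · have hc : completion fin h = h ++ [false] := by rw [completion, ha0]; rfl
          rw [ind_of_not_ok ha1, zero_mul, add_zero, run_device_last hm hvalid hjt hlenG hblk,
            hpt, zero_mul, add_zero,
            ind_of_ok hpf (by rw [hpost, hc, ha0]), hpost, hc]
        · rw [run_device_last hm hvalid hjt hlenG hblk, 
            ind_of_ok (hout false).2 (by rw [(hout false).1, hcomp, ha0]),
            ind_of_ok (hout true).2 (by rw [(hout true).1, hcomp, ha1]), (hout false).1, (hout true).1,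
            hcomp, hcomp]

end claim

/-! ### Simulation of adaptive circuits -/


theorem avgL_take {k l : ℕ} (h : k ≤ l) (F : List Bool → ℝ) :
    avgL l (fun w => F (w.take k)) = avgL k F := by
  obtain ⟨c, rfl⟩ := Nat.exists_eq_add_of_le h
  rw [avgL_append]
  refine avgL_congr fun w hw => ?_
  rw [← avgL_const c (F w)]
  refine avgL_congr fun w' _ => ?_
  rw [← hw, List.take_left]

namespace Circuit
variable {N : ℕ} {C : Circuit N} {rd : List Bool}

theorem run_sum {ι : Type*} (f : Record → ℝ) (k i : ℕ) (m : Record) (s : Finset ι) (α : ι → Op N) :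
    C.run rd f k i m (∑ x ∈ s, α x) = ∑ x ∈ s, C.run rd f k i m (α x) := by
  classical
  induction s using Finset.induction_on with
  | empty => simp [run_zero]
  | insert a s ha ih => rw [Finset.sum_insert ha, Finset.sum_insert ha, run_add, ih]

theorem projZ_trace (q : Fin N) (α : Op N) :
    (projZ q false * α * projZ q false).trace + (projZ q true * α * projZ q true).trace = α.trace := by
  rw [projZ_eq_pproj, projZ_eq_pproj]
  have := ES.trace_realOn (N := N) (G := []) (by intro T hT; simp at hT) q α
  simpa [ES.realOn, ES.gatesOn] using this

theorem run_noPost (hC : C.NoPost) (hr : rd.length = C.coins) (k i : ℕ) (hk : i + k ≤ C.length)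
    (m : Record) (hm : m.length ≤ i) (hm' : m.Accepted) (hm'' : ∀ e ∈ m, e.1 ≠ .postselected)
    (α : Op N) : C.run rd (ind Set.univ) k i m α = α.trace.re := by
  induction k generalizing i m α with
  | zero => simp [run, ind, hm']
  | succ k ih =>
    rw [run]
    cases hs : C.step i m.history rd with
    | idle =>
      simp only [Instr.apply, List.map, sum_pair, List.sum_singleton]
      exact ih (i + 1) (by omega) m (by omega) hm' hm'' α
    | gate u =>
      simp only [Instr.apply, List.map, sum_pair, List.sum_singleton]
      rw [ih (i + 1) (by omega) m (by omega) hm' hm'' _, Gate.conj_eq,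
        trace_frame (gateRots_herm (Gate.code_valid u).2.2)]
    | meas q role =>
      have hrole : role ≠ .postselected := fun e => by
        rw [e] at hs
        exact hC i (by omega) m.history rd ((List.length_map _).trans_le hm) hr q hs
      have hall : ∀ b, ∀ e ∈ m ++ [(role, b)], e.1 ≠ .postselected := fun b e he => by
        rcases List.mem_append.1 he with he | he
        · exact hm'' e he
        · rw [List.mem_singleton.1 he]; exact hrole
      have hacc : ∀ b, Record.Accepted (m ++ [(role, b)]) := fun b e he h => absurd h (hall b e he)
      simp only [Instr.apply, List.map, sum_pair, List.sum_singleton]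
      rw [ih (i + 1) (by omega) _ (by simpa using hm) (hacc _) (hall _),
        ih (i + 1) (by omega) _ (by simpa using hm) (hacc _) (hall _), ← Complex.add_re, projZ_trace]

theorem weight_univ (hC : C.NoPost) (α : Op N) : C.weight α Set.univ = α.trace.re := by
  rw [weight_eq, ← avgL_const C.coins α.trace.re]
  exact avgL_congr fun rd hr => run_noPost hC hr _ _ (by simp) _ (by simp)
    (by intro e he; simp at he) (by simp) _

/-- The codes of the steps, which go on forever. -/
def icode (C : Circuit N) (rd : List Bool) (i : ℕ) (m : Record) : ICode :=
  cond (decide (i < C.length)) (C.step i m.history rd).code padCode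

end Circuit

section adaptive
variable {n t : ℕ}

namespace ES

/-- The engine at the start, when the frame `A` comes from the stabiliser generators. -/
def start (n N : ℕ) (A : ES) (r : List Bool) : ES :=
  ⟨A.ops, tab N fun i => (decide (i < n), decide (i < n) && A.fill r i), [], [], [], []⟩

theorem start_kn {N : ℕ} {A : ES} {r : List Bool} {i : ℕ} (hi : i < N) :
    (start n N A r).kn i = decide (i < n) := by
  rw [kn, start, getD_tab hi]

theorem start_vl {N : ℕ} {A : ES} {r : List Bool} {i : ℕ} (hi : i < n) (hN : i < N) :
    (start n N A r).vl i = A.fill r i := by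
  rw [vl, start, getD_tab hN]
  simp [hi]

theorem start_inv {L : List (SPauli n)} {A : ES} (hA : Repr L A) (r : List Bool) (ρ : Op t) :
    (start n (n + t) A r).Inv (n + t) (tensor (ket n (A.fill r)) ρ) := by
  refine ⟨fun T hT => herm_short (hA.short T hT) (hA.herm T hT), fun a b hab i hi => ?_⟩
  rw [start_kn i.2, decide_eq_true_eq] at hi
  rw [start_vl hi i.2]
  exact ket_ne_zero (left_ne_zero_of_mul hab) ⟨i, hi⟩

theorem start_stage {K M : ℕ} (A : ES) (r : List Bool) (hM : K + t ≤ M) :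
    Stage n t K M [] 0 (start n (n + t) A r) := by
  have hc : ((Finset.range (n + t)).filter fun k => (start n (n + t) A r).kn k = false).card = t := by
    have : (Finset.range (n + t)).filter (fun k => (start n (n + t) A r).kn k = false) =
        Finset.Ico n (n + t) := by
      ext k
      simp only [Finset.mem_filter, Finset.mem_range, Finset.mem_Ico]
      rw [and_comm]
      exact and_congr_left fun hk => by rw [start_kn hk]; simp
    rw [this]; simp
  refine ⟨rfl, rfl, fun k hk => ?_, ?_, ?_, fun h => absurd rfl h⟩
  · rw [start_kn (by omega)]; simp [hk]
  · rw [hc]; simp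
  · rw [hc]; simp; omega

end ES

open ES

def finState (C : Circuit (n + t)) (A : ES) (M : ℕ) (rd r₀ r₁ h : List Bool) : ES :=
  traj (n + t) (C.icode rd) r₁ h (start n (n + t) A r₀) M

theorem run_tensor_stabState {L : List (SPauli n)} (hL : IsStabGens L) (C : Circuit (n + t))
    (rd : List Bool) (f : Record → ℝ) (ρ : Op t) :
    C.run rd f C.length 0 [] (tensor (stabState L) ρ) = avgL n fun r₀ =>
      C.run rd f C.length 0 [] ((start n (n + t) (engineOf L) r₀).den (n + t)
        (tensor (ket n ((engineOf L).fill r₀)) ρ)) := by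
  rw [tensor_stabState hL, avgL_eq]
  have : ((2 : ℂ) ^ n)⁻¹ = (((2 : ℝ) ^ n)⁻¹ : ℝ) := by push_cast; rfl
  rw [this, Circuit.run_smul, Circuit.run_sum]
  rfl

theorem trace_tensor_stabState {L : List (SPauli n)} (hL : IsStabGens L) (ρ : Op t) :
    (tensor (stabState L) ρ).trace = ρ.trace := by
  have hA := absorbAll_repr L hL
  rw [tensor_stabState hL, Matrix.trace_smul, Matrix.trace_sum]
  have : ∀ r : Fin n → Bool, (frame (n + t) (engineOf L).ops *
        tensor (ket n ((engineOf L).fill (List.ofFn r))) ρ *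
        (frame (n + t) (engineOf L).ops)ᴴ).trace = ρ.trace := fun r => by
    rw [trace_frame fun T hT => herm_short (hA.short T hT) (hA.herm T hT), trace_tensor_ket]
  simp only [this]
  simp

theorem icode_spec (C : Circuit (n + t)) (rd : List Bool) (i : ℕ) (m : Record) :
    C.icode rd i m = padCode ∨ ∃ u : Instr (n + t), C.icode rd i m = u.code := by
  unfold Circuit.icode
  cases decide (i < C.length)
  · exact Or.inl rfl
  · exact Or.inr ⟨_, rfl⟩

/-- There are three independent sources of randomness: the random bits of the circuit, the values of
the mixed lines of the stabiliser state, and the simulated outcomes. -/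
theorem weight_eq_device {L : List (SPauli n)} (hL : IsStabGens L) (C : Circuit (n + t)) {M : ℕ}
    (hM : C.length + t ≤ M) (ρ : Op t) (ps : Bool) (E : Set (List Bool)) (b : Prop)
    (hb : b → ps = true ∧ 2 ≤ t) :
    C.weight (tensor (stabState L) ρ) E = avgL C.coins fun rd => avgL n fun r₀ => avgL M fun r₁ =>
      (device n t ps (finState C (engineOf L) M rd r₀ r₁)).weight ρ
        (goodSet (finState C (engineOf L) M rd r₀ r₁) E b) := by
  have hA := absorbAll_repr L hL
  rw [Circuit.weight_eq]
  refine avgL_congr fun rd _ => ?_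
  rw [run_tensor_stabState hL]
  refine avgL_congr fun r₀ _ => ?_
  have h1 := run_eq_avgL_sim C rd (ind E) (C.icode rd) (fun i hi m => by simp [Circuit.icode, hi])
    (fun i hi m => by simp [Circuit.icode, Nat.not_lt.2 hi]) M 0 (by omega)
    (start n (n + t) (engineOf L) r₀) _ (start_inv hA r₀ ρ)
  rw [Nat.sub_zero] at h1
  refine h1.trans (avgL_congr fun r₁ _ => ?_)
  have h2 := (run_device (n := n) (t := t) (us := C.icode rd) (rd := r₁)
    (S₀ := start n (n + t) (engineOf L) r₀) (K := C.length) (M := M)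
    (icode_spec C rd) (fun i hi m => by simp [Circuit.icode, Nat.not_lt.2 hi]) rfl ps
    _ E [] M 0 (zero_add M) [] (start_stage _ _ hM) ρ (start_inv hA r₀ ρ) [] rfl (by simp)).2 b
    fun h => ⟨(hb h).1, (hb h).2, lt_of_lt_of_le (by simp) (hb h).2⟩
  rw [Circuit.weight_eq]
  change _ = (device n t ps _).run [] _ (t * blockLen n t) 0 [] ρ
  simp only [List.length_nil, Nat.sub_zero, Nat.zero_mul, List.drop_zero] at h2
  exact h2.symm

/-- The random string is the concatenation of the random bits of the circuit, the random
values of the lines of the stabiliser state, and the random outcomes. -/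
def finOf (C : Circuit (n + t)) (A : ES) (P Q : ℕ) (w : List Bool) : List Bool → ES :=
  finState C A (P + Q) (w.take C.coins) ((w.drop P).take n) (w.drop (P + Q))

section
variable {L : List (SPauli n)} {C : Circuit (n + t)} {P Q l : ℕ} {fin : List Bool → List Bool → ES}

/-- The random string has a length that does not depend on the details of the circuit; superfluous
bits are averaged away. -/
theorem weight_eq_avgL_device (hL : IsStabGens L) (hP : C.length ≤ P) (hP' : C.coins ≤ P) (hn : n ≤ Q)
    (ht : t ≤ Q) (hl : l = P + Q + (P + Q)) (hfin : fin = finOf C (engineOf L) P Q) (ρ : Op t) (ps : Bool)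
    (E : Set (List Bool)) (b : Prop) (hb : b → ps = true ∧ 2 ≤ t) :
    C.weight (tensor (stabState L) ρ) E = avgL l fun w =>
      (device n t ps (fin w)).weight ρ (goodSet (fin w) E b) := by
  subst hl hfin
  rw [weight_eq_device hL C (M := P + Q) (by omega) ρ ps E b hb, avgL_append, avgL_append, ← avgL_take hP']
  refine avgL_congr fun w₁ h₁ => ?_
  rw [← avgL_take hn]
  refine avgL_congr fun w₂ h₂ => avgL_congr fun w₃ _ => ?_
  have e : finOf C (engineOf L) P Q (w₁ ++ w₂ ++ w₃) =
      finState C (engineOf L) (P + Q) (w₁.take C.coins) (w₂.take n) w₃ := by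
    unfold finOf
    congr 1
    · rw [List.append_assoc, List.take_append_of_le_length (by omega)]
    · rw [List.append_assoc, ← h₁, List.drop_left, List.take_append_of_le_length (by omega)]
    · rw [List.drop_left' (by simp [h₁, h₂])]
  rw [e]

end

theorem pass_log {N : ℕ} {S : ES} {u : ICode} {b : Bool} : ∃ l : Record,
    (S.pass N u b).log = S.log ++ l ∧ l.length ≤ 1 ∧ ∀ e ∈ l, e.1 = u.2.2 := by
  unfold ES.pass
  cases decide (u.1 = 1) <;> cases decide (u.1 = 2) <;> cases (S.antiL N Ẑ[N, S, u.2.1.2.1]).isEmpty <;>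
    first | exact ⟨[], (List.append_nil _).symm, by simp⟩ | exact ⟨_, rfl, by simp⟩

theorem take_log {N : ℕ} {S : ES} {u : ICode} {p : Plan} {m : Bool} : ∃ l : Record,
    (S.take N u p m).log = S.log ++ l ∧ l.length ≤ 1 ∧ ∀ e ∈ l, e.1 = u.2.2 := by
  unfold take
  cases decide (u.1 = 2)
  · exact ⟨[], (List.append_nil _).symm, by simp⟩
  · exact ⟨_, rfl, by simp⟩

theorem step_log {N : ℕ} {S : ES} {u : ICode} {b : Bool} {h : List Bool} : ∃ l : Record,
    (S.step N u b h).log = S.log ++ l ∧ l.length ≤ 1 ∧ ∀ e ∈ l, e.1 = u.2.2 := by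
  unfold step
  cases S.wait.isEmpty
  · exact ⟨[], by simp⟩
  · cases (S.plan N u).isEmpty
    · cases decide (S.piv.length < h.length)
      · exact ⟨[], by simp⟩
      · exact take_log
    · exact pass_log

/-- The bound on the log is needed because `NoPost` and `DescribedBy` speak of step `i` only for
histories of length at most `i`. -/
theorem traj_log {N : ℕ} {us : ℕ → Record → ICode} {rd h : List Bool} {S₀ : ES} (h0 : S₀.log = []) (i : ℕ) :
    (traj N us rd h S₀ i).log.length ≤ i ∧ ((∀ i, ∀ m : Record, List.length m ≤ i → (us i m).2.2.isPost =
    false) →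
        ∀ e ∈ (traj N us rd h S₀ i).log, e.1.isPost = false) := by
  induction i with
  | zero => simp [traj, h0]
  | succ i ih =>
    rw [traj]
    obtain ⟨l, h1, h2, h3⟩ := step_log (N := N) (S := traj N us rd h S₀ i)
      (u := us i (traj N us rd h S₀ i).log) (b := rd.getD i false) (h := h)
    rw [h1]
    refine ⟨by rw [List.length_append]; omega, fun hus e he => ?_⟩
    rcases List.mem_append.1 he with he | he
    · exact ih.2 hus e he
    · rw [h3 e he]; exact hus i _ ih.1

theorem finOf_ok {C : Circuit (n + t)} (hC : C.NoPost) (A : ES) {P Q : ℕ} (hP' : C.coins ≤ P)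
    {w : List Bool} (hw : w.length = P + Q + (P + Q)) (h : List Bool) :
    (finOf C A P Q w h).log.ok = true := by
  have := (traj_log (N := n + t) (us := C.icode (w.take C.coins)) (rd := w.drop (P + Q))
    (h := h) (S₀ := start n (n + t) A ((w.drop P).take n)) rfl (P + Q)).2 fun i m hm => by
      unfold Circuit.icode
      by_cases hi : i < C.length
      · rw [decide_eq_true hi, cond_true]
        cases hs : C.step i m.history (w.take C.coins) with
        | idle | gate => rfl
        | meas q role =>
          cases role
          case postselected => exact absurd hs (hC i hi _ _ ((List.length_map _).trans_le hm)
            (by rw [List.length_take]; omega) q)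
          all_goals rfl
      · rw [decide_eq_false hi]; rfl
  rw [Record.ok, List.isEmpty_iff, List.filter_eq_nil_iff]
  intro e he
  rw [this e he]; simp

theorem device_noPost (fin : List Bool → ES) : (device n t false fin).NoPost := by
  intro i _ h r _ _ q hq
  simp only [device] at hq
  have key : ∀ u : ICode, u.2.2.isPost = false → u.toInstr t ≠ .meas q .postselected := by
    intro u hu he
    unfold ICode.toInstr at he
    split_ifs at he
    injection he with h1 h2
    rw [h2] at hu
    cases hu
  refine key _ ?_ hq
  cases decide (i < h.length * blockLen n t)
  · rw [cond_false, block, Bool.false_and, Bool.false_and, cond_false]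
    have : ∀ l : List ICode, (∀ u ∈ l, u.2.2.isPost = false) → ∀ k,
        (l.getD k idleI).2.2.isPost = false := fun l hl k => by
      rw [List.getD_eq_getElem?_getD]
      cases hk : l[k]? with
      | none => rfl
      | some u => exact hl u (List.mem_of_getElem? hk)
    refine this _ (fun u hu => ?_) _
    cases hw : (fin h).wait.isEmpty
    · rw [hw, cond_false] at hu
      rcases List.mem_append.1 hu with hu | hu
      · obtain ⟨g, -, rfl⟩ := List.mem_map.1 hu
        rfl
      · rw [List.mem_singleton.1 hu]; rfl
    · rw [hw] at hu; simp at hu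
  · rfl

def postOf (fin : List Bool → ES) (m : List Bool) : List Bool := Record.output (fin (completion fin m)).log

/-- For `2 ≤ t` a run that is not accepted has probability zero, so any value will do in place of
`none`. -/
def postOptOf (t : ℕ) (fin : List Bool → ES) (m : List Bool) : Option (List Bool) :=
  cond (fin (completion fin m)).log.ok (some (postOf fin m)) (cond (decide (2 ≤ t)) (some []) none)

theorem postOptOf_ne_none (ht : 2 ≤ t) (fin : List Bool → ES) (m : List Bool) :
    postOptOf t fin m ≠ none := by
  unfold postOptOf
  cases (fin (completion fin m)).log.ok <;> simp [ht]

section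
variable {L : List (SPauli n)} {C : Circuit (n + t)} {P Q l : ℕ} {fin : List Bool → List Bool → ES} {ρ : Op t}

theorem sameOutput_device (hL : IsStabGens L) (hC : C.NoPost) (hP : C.length ≤ P) (hP' : C.coins ≤ P)
    (hn : n ≤ Q) (ht : t ≤ Q) (hl : l = P + Q + (P + Q)) (hfin : fin = finOf C (engineOf L) P Q)
    (hρ : IsState ρ) : SameOutput C (tensor (stabState L) ρ)
      (fun r : Fin l → Bool => device n t false (fin (List.ofFn r))) ρ fun r => postOf (fin (List.ofFn r)) := by
  intro y
  rw [Circuit.outProb, Circuit.weight_univ hC, trace_tensor_stabState hL, hρ.2, Complex.one_re, div_one,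
    weight_eq_avgL_device hL hP hP' hn ht hl hfin ρ false {y} False (fun h => h.elim), avgL_eq]
  congr 1
  refine Finset.sum_congr rfl fun r _ => ?_
  rw [Circuit.outProb, Circuit.weight_univ (device_noPost _), hρ.2, Complex.one_re, div_one]
  congr 1
  ext m
  have := finOf_ok hC (engineOf L) hP' (Q := Q) (w := List.ofFn r) (by simp [hl])
  simp [goodSet, postOf, this, hfin]

/-- For every event the summed weight of the hybrid process is `2 ^ l` times that of the circuit;
the factor cancels in the conditional probabilities, and no normalisation of the single devices is
needed. -/
theorem samePostselectedOutput_device (hL : IsStabGens L) (hP : C.length ≤ P) (hP' : C.coins ≤ P) (hn : n ≤ Q)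
    (ht : t ≤ Q) (hl : l = P + Q + (P + Q)) (hfin : fin = finOf C (engineOf L) P Q) (hpos : 0 < C.weight
    (tensor (stabState L) ρ) Set.univ) : SamePostselectedOutput C (tensor (stabState L) ρ) (fun r : Fin l →
    Bool => device n t true (fin (List.ofFn r))) ρ
      fun r => postOptOf t (fin (List.ofFn r)) := by
  have h2 : (0 : ℝ) < 2 ^ l := by positivity
  have hval : ∀ E b (F : (List Bool → ES) → Set (List Bool)), (b → 2 ≤ t) → (∀ fin m, m ∈ F fin ↔ m ∈ goodSet
      fin E b) → ∑ r : Fin l → Bool, (device n t true (fin (List.ofFn r))).weight ρ (F (fin (List.ofFn r))) =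
      2 ^ l * C.weight (tensor (stabState L) ρ) E := fun E b F hb hF => by
    obtain rfl : F = fun fin => goodSet fin E b := funext fun fin => Set.ext (hF fin)
    rw [weight_eq_avgL_device hL hP hP' hn ht hl hfin ρ true E b fun h => ⟨rfl, hb h⟩, avgL_eq, ← mul_assoc,
      mul_inv_cancel₀ h2.ne', one_mul]
  have hall := hval Set.univ (2 ≤ t) (fun fin => {m | postOptOf t fin m ≠ none}) id fun fin m => by
    simp only [goodSet, postOptOf, Set.mem_ofPred_eq, Set.mem_univ, and_true]
    cases (fin (completion fin m)).log.ok <;> by_cases h : 2 ≤ t <;> simp [h]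
  refine ⟨by rw [hall]; positivity, fun y => ?_⟩
  -- For `2 ≤ t` rejected runs yield the output `[]`, so they belong to the event of `y` exactly if
  -- `y = []`.
  rw [hall, Circuit.outProb, hval {y} (2 ≤ t ∧ [] = y) (fun fin => {m | postOptOf t fin m = some y}) And.left
    fun fin m => by
      simp only [goodSet, postOptOf, postOf, Set.mem_ofPred_eq, Set.mem_singleton_iff]
      cases (fin (completion fin m)).log.ok <;> by_cases h : 2 ≤ t <;> simp [h],
    mul_div_mul_left _ _ h2.ne']

end
end adaptive

/-! ### The engine runs in polynomial time -/

instance : Encode PStr := ⟨fun P => Encode.enc (P.hi, P.lo, P.bits)⟩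
instance : Encode ES := ⟨fun S => Encode.enc (S.ops, S.ln, S.log, S.gts, S.piv, S.wait)⟩

section
variable {α β δ : Type} [Encode α] [Encode β] [Encode δ]

@[fun_prop] theorem FP.PStr_mk {f g : α → Bool} {l : α → List (Bool × Bool)} (hf : FP f) (hg : FP g)
    (hl : FP l) : FP fun a => PStr.mk (f a) (g a) (l a) :=
  PT.congr (hf.prodMk (hg.prodMk hl)) (fun _ => rfl) fun _ => rfl

theorem FP.PStr_tuple : FP fun P : PStr => (P.hi, P.lo, P.bits) := .of_enc fun _ => rfl

@[fun_prop] theorem FP.PStr_hi {f : α → PStr} (hf : FP f) : FP fun a => (f a).hi := hf.comp' FP.PStr_tuple.fst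

@[fun_prop] theorem FP.PStr_lo {f : α → PStr} (hf : FP f) : FP fun a => (f a).lo :=
  hf.comp' FP.PStr_tuple.snd.fst

@[fun_prop] theorem FP.PStr_bits {f : α → PStr} (hf : FP f) : FP fun a => (f a).bits :=
  hf.comp' FP.PStr_tuple.snd.snd

@[fun_prop] theorem FP.ES_mk {f1 : α → List PStr} {f2 : α → List (Bool × Bool)} {f3 : α → Record} {f4 : α →
    List GCode} {f5 : α → List (ℕ × Role)} {f6 : α → List Plan} (h1 : FP f1) (h2 : FP f2) (h3 : FP f3) (h4 :
    FP f4) (h5 : FP f5) (h6 : FP f6) : FP fun a => ES.mk (f1 a) (f2 a) (f3 a) (f4 a) (f5 a) (f6 a) := PT.congr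
    (h1.prodMk (h2.prodMk (h3.prodMk (h4.prodMk (h5.prodMk h6))))) (fun _ => rfl) fun _ => rfl

theorem FP.ES_tuple : FP fun S : ES => (S.ops, S.ln, S.log, S.gts, S.piv, S.wait) := .of_enc fun _ => rfl

@[fun_prop] theorem FP.ES_ops {f : α → ES} (hf : FP f) : FP fun a => (f a).ops := hf.comp' FP.ES_tuple.fst

@[fun_prop] theorem FP.ES_ln {f : α → ES} (hf : FP f) : FP fun a => (f a).ln := hf.comp' FP.ES_tuple.snd.fst

@[fun_prop] theorem FP.ES_log {f : α → ES} (hf : FP f) : FP fun a => (f a).log :=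
  hf.comp' FP.ES_tuple.snd.snd.fst

@[fun_prop] theorem FP.ES_gts {f : α → ES} (hf : FP f) : FP fun a => (f a).gts :=
  hf.comp' FP.ES_tuple.snd.snd.snd.fst

@[fun_prop] theorem FP.ES_piv {f : α → ES} (hf : FP f) : FP fun a => (f a).piv :=
  hf.comp' FP.ES_tuple.snd.snd.snd.snd.fst

@[fun_prop] theorem FP.ES_wait {f : α → ES} (hf : FP f) : FP fun a => (f a).wait :=
  hf.comp' FP.ES_tuple.snd.snd.snd.snd.snd

def Role.num : Role → ℕ
  | .output => 0
  | .internal => 1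
  | .postselected => 2

@[fun_prop] theorem FP.roleNum {f : α → Role} (hf : FP f) : FP fun a => (f a).num :=
  hf.comp' (.of_enc fun r => by cases r <;> rfl)

@[fun_prop] theorem FP.isPost {f : α → Role} (hf : FP f) : FP fun a => (f a).isPost :=
  (hf.roleNum.decide_eq (.const 2)).congr fun a => by cases f a <;> rfl

@[fun_prop] theorem FP.isOut {f : α → Role} (hf : FP f) : FP fun a => (f a).isOut :=
  (hf.roleNum.decide_eq (.const 0)).congr fun a => by cases f a <;> rfl

variable {N c i j q : α → ℕ} {b : α → Bool} {l : α → List (Bool × Bool)} {P Q : α → PStr} {ops : α → List PStr}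
  {ro : α → Role} {g : α → GCode} {G : α → List GCode} {p : α → Plan} {S : α → ES} {u : α → ICode}

@[fun_prop] theorem FP.PStr_x (hP : FP P) (hi : FP i) : FP fun a => (P a).x (i a) := by
  unfold PStr.x; fun_prop

@[fun_prop] theorem FP.PStr_z (hP : FP P) (hi : FP i) : FP fun a => (P a).z (i a) := by
  unfold PStr.z; fun_prop

@[fun_prop] theorem FP.PStr_mk' {hi lo : α → Bool} {x z : α → ℕ → Bool} (hN : FP N) (h1 : FP hi)
    (h2 : FP lo) (hx : FP fun p : α × ℕ => x p.1 p.2) (hz : FP fun p : α × ℕ => z p.1 p.2) :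
    FP fun a => mk' (N a) (hi a) (lo a) (x a) (z a) := by
  unfold mk'
  fun_prop

@[fun_prop] theorem FP.PStr_mul (hN : FP N) (hP : FP P) (hQ : FP Q) :
    FP fun a => (P a).mul (N a) (Q a) := by
  unfold PStr.mul; fun_prop

@[fun_prop] theorem FP.PStr_anti (hN : FP N) (hP : FP P) (hQ : FP Q) :
    FP fun a => (P a).anti (N a) (Q a) := by
  unfold PStr.anti; fun_prop

@[fun_prop] theorem FP.PStr_timesI (hP : FP P) : FP fun a => (P a).timesI := by
  unfold PStr.timesI; fun_prop

@[fun_prop] theorem FP.PStr_neg (hP : FP P) : FP fun a => (P a).neg := by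
  unfold PStr.neg; fun_prop

@[fun_prop] theorem FP.PStr_Z (hN : FP N) (hq : FP q) : FP fun a => Z (N a) (q a) := by
  unfold PStr.Z; fun_prop

@[fun_prop] theorem FP.PStr_X (hN : FP N) (hq : FP q) : FP fun a => X (N a) (q a) := by
  unfold PStr.X; fun_prop

@[fun_prop] theorem FP.rotConj (hN : FP N) (hP : FP P) (hQ : FP Q) :
    FP fun a => rotConj (N a) (P a) (Q a) := by
  unfold EGK.rotConj; fun_prop

theorem sz_bits (l : List (Bool × Bool)) : sz l ≤ 8 * l.length + 1 := by
  refine (sz_le_of_all (c := 7) fun a _ => ?_).trans (by omega)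
  have h1 := sz_bool a.1
  have h2 := sz_bool a.2
  have : sz a = sz (a.1, a.2) := rfl
  rw [this, sz_pair]; omega

theorem sz_pstr_le (R : PStr) : sz R ≤ 9 + 8 * R.bits.length := by
  have h1 := sz_bool R.hi
  have h2 := sz_bool R.lo
  have h3 := sz_bits R.bits
  have : sz R = sz (R.hi, R.lo, R.bits) := rfl
  rw [this, sz_pair, sz_pair]; omega

theorem length_tab {α : Type} (N : ℕ) (f : ℕ → α) : (tab N f).length = N := by simp [tab]

theorem sz_rotConj (N : ℕ) (T R : PStr) : sz (rotConj N T R) ≤ max (sz R) (9 + 8 * N) := by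
  unfold EGK.rotConj
  cases anti N T R
  · exact le_max_left _ _
  · refine le_trans ((sz_pstr_le _).trans ?_) (le_max_right _ _)
    rw [cond_true, timesI, PStr.mul, mk', length_tab]

/-- A product of Pauli strings has `N` bits whatever its factors, so sizes do not accumulate along
the fold. -/
theorem sz_pull (N : ℕ) (ops : List PStr) (R : PStr) : sz (pull N ops R) ≤ max (sz R) (9 + 8 * N) := by
  induction ops generalizing R with
  | nil => exact le_max_left _ _
  | cons T ops ih =>
    refine (ih (EGK.rotConj N T R)).trans ?_
    have := sz_rotConj N T R
    simp only [max_le_iff] at *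
    omega

@[fun_prop] theorem FP.pull (hN : FP N) (ho : FP ops) (hP : FP P) :
    FP fun a => pull (N a) (ops a) (P a) := by
  unfold EGK.pull
  refine .foldl_of_bdd ho hP (by fun_prop) ?_
  obtain ⟨r, hr⟩ := (PolyBdd.add hP.bdd (.add (.const 9) (.mul (.const 8) hN.bdd)) : PolyBdd sz _)
  refine ⟨r, fun a k _ => (sz_pull (N a) _ _).trans (le_trans ?_ (hr a))⟩
  have := sz_nat (N a)
  dsimp only
  omega

@[fun_prop] theorem FP.gateRots (hN : FP N) (hg : FP g) :
    FP fun a => gateRots (N a) (g a) := by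
  unfold EGK.gateRots PStr.ZX; fun_prop

@[fun_prop] theorem FP.invRots (ho : FP ops) : FP fun a => invRots (ops a) := by
  unfold EGK.invRots; fun_prop

@[fun_prop] theorem FP.innerRots (hN : FP N) (hG : FP G) :
    FP fun a => innerRots (N a) (G a) := by
  unfold EGK.innerRots; fun_prop

@[fun_prop] theorem FP.reduceGates (hN : FP N)
    (hl : FP l) (hP : FP P) (hj : FP j) : FP fun a => reduceGates (N a) (l a) (P a) (j a) := by
  unfold EGK.reduceGates; fun_prop

@[fun_prop] theorem FP.flipGates (hj : FP j) : FP fun a => flipGates (j a) := by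
  unfold EGK.flipGates; fun_prop

@[fun_prop] theorem FP.ES_kn (hS : FP S) (hi : FP i) : FP fun a => (S a).kn (i a) := by
  unfold ES.kn; fun_prop

@[fun_prop] theorem FP.ES_vl (hS : FP S) (hi : FP i) : FP fun a => (S a).vl (i a) := by
  unfold ES.vl; fun_prop

@[fun_prop] theorem FP.outc (hN : FP N) (hS : FP S) (hP : FP P) :
    FP fun a => (S a).outc (N a) (P a) := by
  unfold ES.outc; fun_prop

@[fun_prop] theorem FP.antiL (hN : FP N) (hS : FP S) (hP : FP P) :
    FP fun a => (S a).antiL (N a) (P a) := by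
  unfold ES.antiL; fun_prop

@[fun_prop] theorem FP.ES_det (hN : FP N) (hS : FP S)
    (hj : FP j) (hr : FP ro) : FP fun a => (S a).det (N a) (j a) (ro a) := by
  unfold ES.det; fun_prop

@[fun_prop] theorem FP.ES_real (hN : FP N) (hS : FP S) (hG : FP G) (hj : FP j) (hb : FP b) (hr : FP ro) :
    FP fun a => (S a).real (N a) (G a) (j a) (b a) (ro a) := by
  unfold ES.real EGK.setLn; fun_prop

@[fun_prop] theorem FP.plan (hN : FP N) (hS : FP S) (hu : FP u) :
    FP fun a => (S a).plan (N a) (u a) := by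
  unfold ES.plan ES.realGates ES.realL ES.unkL; fun_prop

@[fun_prop] theorem FP.pass (hN : FP N) (hS : FP S) (hu : FP u) (hb : FP b) :
    FP fun a => (S a).pass (N a) (u a) (b a) := by
  unfold ES.pass ES.gate ES.coin ES.coinRot; fun_prop

@[fun_prop] theorem FP.ES_take (hN : FP N) (hS : FP S)
    (hu : FP u) (hp : FP p) (hb : FP b) : FP fun a => (S a).take (N a) (u a) (p a) (b a) := by
  unfold ES.take; fun_prop

@[fun_prop] theorem FP.step {h : α → List Bool} (hN : FP N) (hS : FP S)
    (hu : FP u) (hb : FP b) (hh : FP h) : FP fun a => (S a).step (N a) (u a) (b a) (h a) := by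
  unfold ES.step; fun_prop

end

/-! ### Sizes of the states of the engine -/

theorem sz_role (r : Role) : sz r ≤ 5 := by cases r <;> simp [sz, Encode.enc, encNat, encList, Data.size]

theorem sz_es (S : ES) : sz S = sz S.ops + sz S.ln + sz S.log + sz S.gts + sz S.piv + sz S.wait + 5 := by
  have : sz S = sz (S.ops, S.ln, S.log, S.gts, S.piv, S.wait) := rfl
  rw [this, sz_pair, sz_pair, sz_pair, sz_pair, sz_pair]; omega

theorem sz_rots {N : ℕ} {ops : List PStr} (h : ∀ T ∈ ops, T.bits.length = N) :
    sz ops ≤ ops.length * (10 + 8 * N) + 1 :=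
  (sz_le_of_all (c := 9 + 8 * N) fun T hT => by rw [← h T hT]; exact sz_pstr_le T).trans (by
    rw [show 9 + 8 * N + 1 = 10 + 8 * N by omega])

theorem sz_logEntry (r : Role) (b : Bool) : sz [(r, b)] ≤ 11 := by
  have h1 := sz_role r
  have h2 := sz_bool b
  rw [sz_cons, sz_pair, sz_nil]; omega

theorem sz_setLn (N : ℕ) (ln : List (Bool × Bool)) (j : ℕ) (m : Bool) :
    sz (setLn N ln j m) ≤ 8 * N + 1 := by
  have := sz_bits (setLn N ln j m)
  rwa [setLn, length_tab] at this

theorem gateRots_length_le (N : ℕ) (g : GCode) : (gateRots N g).length ≤ 3 := by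
  unfold gateRots
  cases decide (g.1 = 0) <;> cases decide (g.1 = 1) <;> simp

theorem innerRots_length_le (N : ℕ) (G : List GCode) : (innerRots N G).length ≤ 3 * G.length := by
  induction G with
  | nil => simp [innerRots]
  | cons g G ih =>
    have := gateRots_length_le N g
    simp only [innerRots, List.flatMap_cons, List.length_append, List.length_cons, invRots,
      List.length_map, List.length_reverse] at *
    omega

def GatesIn (N : ℕ) (G : List GCode) : Prop := ∀ g ∈ G, g.1 ≤ 2 ∧ g.2.1 ≤ N ∧ g.2.2 ≤ N

theorem GatesIn.append {N : ℕ} {G G' : List GCode} (h : GatesIn N G) (h' : GatesIn N G') :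
    GatesIn N (G ++ G') := fun g hg => (List.mem_append.1 hg).elim (h g) (h' g)

theorem GatesIn.sz {N : ℕ} {G : List GCode} (h : GatesIn N G) : sz G ≤ G.length * (10 + 4 * N) + 1 :=
  (sz_le_of_all (c := 9 + 4 * N) fun g hg => by
    obtain ⟨h1, h2, h3⟩ := h g hg
    have : EGK.sz g = EGK.sz (g.1, g.2.1, g.2.2) := rfl
    rw [this, sz_pair, sz_pair, sz_nat, sz_nat, sz_nat]; omega).trans (by
    rw [show 9 + 4 * N + 1 = 10 + 4 * N by omega])

theorem flipGates_in {N j : ℕ} (hj : j ≤ N) : GatesIn N (flipGates j) := by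
  intro g hg
  simp only [flipGates, List.mem_cons, List.not_mem_nil, or_false] at hg
  rcases hg with rfl | rfl | rfl | rfl <;> exact ⟨by norm_num, hj, hj⟩

theorem reduceGates_in {N j : ℕ} (ln : List (Bool × Bool)) (Q : PStr) (hj : j ≤ N) :
    GatesIn N (reduceGates N ln Q j) := by
  intro g hg
  rcases List.mem_append.1 hg with hg | hg
  · obtain ⟨i, hi, hg⟩ := List.mem_flatMap.1 hg
    have hi := (List.mem_range.1 hi).le
    cases hc : (!(ln.getD i (false, false)).1 && Q.x i) <;> rw [hc] at hg
    · simp at hg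
    · cases hz : Q.z i <;> rw [hz] at hg <;>
        simp only [cond_true, cond_false, List.mem_cons, List.not_mem_nil, or_false] at hg
      · subst hg; exact ⟨by norm_num, hi, hi⟩
      · rcases hg with rfl | rfl <;> exact ⟨by norm_num, hi, hi⟩
  · obtain ⟨i, hi, hg⟩ := List.mem_flatMap.1 hg
    have hi := (List.mem_range.1 hi).le
    cases hc : (!(ln.getD i (false, false)).1 && (Q.x i || Q.z i) && !decide (i = j)) <;> rw [hc] at hg
    · simp at hg
    · simp only [cond_true, List.mem_cons, List.not_mem_nil, or_false] at hg
      subst hg; exact ⟨by norm_num, hi, hj⟩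

theorem headD_filter_le (N : ℕ) (p : ℕ → Bool) : ((List.range N).filter p).headD 0 ≤ N := by
  cases h : (List.range N).filter p with
  | nil => exact Nat.zero_le _
  | cons a l =>
    have : a ∈ (List.range N).filter p := by rw [h]; simp
    exact (List.mem_range.1 (List.mem_filter.1 this).1).le

namespace ES

theorem realGates_in {N j : ℕ} (S : ES) (q : ℕ) (role : Role) (hj : j ≤ N) :
    GatesIn N (S.realGates N q role j) := by
  unfold realGates
  refine (reduceGates_in _ _ hj).append ?_
  cases (role.isPost && _)
  · intro g hg; simp at hg
  · exact flipGates_in hj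

theorem sz_gate (N : ℕ) (S : ES) (g : GCode) : sz (S.gate N g) ≤ sz S + (30 + 24 * N) := by
  have h1 := sz_rots (N := N) (ops := gateRots N g) gateRots_bits
  have h2 := Nat.mul_le_mul_right (10 + 8 * N) (gateRots_length_le N g)
  have h3 := sz_append (gateRots N g) S.ops
  rw [sz_es, sz_es, gate]; dsimp only; omega

theorem sz_coin (N : ℕ) (S : ES) (Q : PStr) (j : ℕ) (b : Bool) (role : Role) :
    sz (S.coin N Q j b role) ≤ sz S + (30 + 24 * N) := by
  have h1 := sz_rots (N := N) (ops := [S.coinRot N Q j b]) fun T hT => by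
    rw [List.mem_singleton.1 hT, coinRot]
    cases (b ^^ S.vl j) <;> exact length_tab _ _
  have h3 := sz_append S.ops [S.coinRot N Q j b]
  have h4 := sz_append S.log [(role, b)]
  have h5 := sz_logEntry role b
  rw [sz_es, sz_es, coin]; dsimp only
  rw [List.length_singleton] at h1
  omega

theorem sz_det (N : ℕ) (S : ES) (q : ℕ) (role : Role) : sz (S.det N q role) ≤ sz S + 10 := by
  have h4 := sz_append S.log [(role, S.outc N Ẑ[N, S, q])]
  have h5 := sz_logEntry role (S.outc N Ẑ[N, S, q])
  rw [sz_es, sz_es, det]; dsimp only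
  omega

theorem sz_real (N : ℕ) (S : ES) {G : List GCode} {j : ℕ} (m : Bool) (role : Role)
    (hG : GatesIn N G) (hl : G.length ≤ 3 * N + 4) (hj : j ≤ N) :
    sz (S.real N G j m role) ≤ sz S + ((9 * N + 12) * (10 + 8 * N) + (3 * N + 4) * (10 + 4 * N) +
      10 * N + 20) := by
  have h1 := sz_rots (N := N) (ops := innerRots N G) innerRots_bits
  have h2 := Nat.mul_le_mul_right (10 + 8 * N) (show (innerRots N G).length ≤ 9 * N + 12 by
    have := innerRots_length_le N G; omega)
  have h3 := sz_append S.ops (innerRots N G)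
  have h4 := sz_append S.gts G
  have h5 := hG.sz
  have h6 := Nat.mul_le_mul_right (10 + 4 * N) hl
  have h7 := sz_append S.piv [(j, role)]
  have h8 : sz [(j, role)] ≤ 2 * N + 9 := by
    have := sz_role role
    rw [sz_cons, sz_pair, sz_nil, sz_nat]; omega
  have h9 := sz_setLn N S.ln j m
  have h10 := sz_pos S.wait
  have h11 := sz_pos S.ln
  rw [sz_es, sz_es, real]; dsimp only
  rw [sz_nil]
  omega

theorem plan_mem {N : ℕ} {S : ES} {u : ICode} {p : Plan} (hp : p ∈ S.plan N u) :
    GatesIn N p.1 ∧ p.1.length ≤ 3 * N + 4 ∧ p.2.1 ≤ N := by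
  unfold plan at hp
  cases h2 : decide (u.1 = 2) <;> rw [h2] at hp
  · cases h3 : (decide (u.1 = 3) && !(S.unkL N).isEmpty) <;> rw [h3] at hp
    · simp at hp
    · rw [cond_false, cond_true, List.mem_singleton] at hp
      subst hp
      exact ⟨fun g hg => by simp at hg, by simp, headD_filter_le _ _⟩
  · cases h3 : ((S.antiL N Ẑ[N, S, u.2.1.2.1]).isEmpty &&
        !(S.realL N Ẑ[N, S, u.2.1.2.1]).isEmpty) <;> rw [h3] at hp
    · simp at hp
    · rw [cond_true, cond_true, List.mem_singleton] at hp
      subst hp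
      exact ⟨realGates_in _ _ _ (headD_filter_le _ _), realGates_length .., headD_filter_le _ _⟩

theorem plan_length (N : ℕ) (S : ES) (u : ICode) : (S.plan N u).length ≤ 1 := by
  unfold plan
  cases decide (u.1 = 2)
  · cases (decide (u.1 = 3) && !(S.unkL N).isEmpty) <;> simp
  · cases ((S.antiL N Ẑ[N, S, u.2.1.2.1]).isEmpty &&
        !(S.realL N Ẑ[N, S, u.2.1.2.1]).isEmpty) <;> simp

/-- The main part comes from a real measurement, with at most `3 N + 4` gates and three rotations
for each of them. -/
def growth (N : ℕ) : ℕ := (9 * N + 12) * (10 + 8 * N) + (3 * N + 4) * (10 + 4 * N) + 24 * N + 60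

theorem sz_pass (N : ℕ) (S : ES) (u : ICode) (b : Bool) : sz (S.pass N u b) ≤ sz S + growth N := by
  have h1 := sz_gate N S u.2.1
  have h2 := sz_det N S u.2.1.2.1 u.2.2
  have h3 := sz_coin N S Ẑ[N, S, u.2.1.2.1] ((S.antiL N Ẑ[N, S, u.2.1.2.1]).headD 0) b u.2.2
  rw [pass]
  unfold growth
  generalize (9 * N + 12) * (10 + 8 * N) = A
  generalize (3 * N + 4) * (10 + 4 * N) = B
  cases decide (u.1 = 1) <;> cases decide (u.1 = 2) <;>
    cases (S.antiL N Ẑ[N, S, u.2.1.2.1]).isEmpty <;>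
    simp only [cond_true, cond_false] <;> omega

theorem sz_take {N : ℕ} {S : ES} {u : ICode} {p : Plan} (hp : p ∈ S.plan N u) (m : Bool) :
    sz (S.take N u p m) ≤ sz S + growth N := by
  obtain ⟨h1, h2, h3⟩ := plan_mem hp
  rw [take]
  have h4 := sz_real N S m p.2.2 h1 h2 h3
  have h5 := sz_det N (S.real N p.1 p.2.1 m p.2.2) u.2.1.2.1 u.2.2
  unfold growth
  cases decide (u.1 = 2) <;> simp only [cond_true, cond_false] <;> omega

theorem sz_step (N : ℕ) (S : ES) (u : ICode) (b : Bool) (h : List Bool) :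
    sz (S.step N u b h) ≤ sz S + growth N := by
  unfold step
  cases hw : S.wait.isEmpty
  · exact Nat.le_add_right _ _
  rw [List.isEmpty_iff] at hw
  cases hp : S.plan N u with
  | nil => exact sz_pass N S u b
  | cons p l =>
    obtain ⟨h1, h2, h3⟩ := plan_mem (show p ∈ S.plan N u by rw [hp]; simp)
    have hl : l = [] := by
      have := plan_length N S u
      rw [hp, List.length_cons] at this
      exact List.length_eq_zero_iff.1 (by omega)
    subst hl
    rw [List.isEmpty_cons, cond_true, cond_false, List.headD_cons]
    cases decide (S.piv.length < h.length)
    · have h4 : sz [p] ≤ (3 * N + 4) * (10 + 4 * N) + 2 * N + 12 := by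
        have h5 := h1.sz
        have h6 := Nat.mul_le_mul_right (10 + 4 * N) h2
        have h7 := sz_role p.2.2
        have : sz p = sz (p.1, p.2.1, p.2.2) := rfl
        rw [sz_cons, sz_nil, this, sz_pair, sz_pair, sz_nat]; omega
      rw [cond_false, sz_es, sz_es, hw, sz_nil, growth]
      dsimp only
      omega
    · exact sz_take (by rw [hp]; simp) _

theorem sz_absorb (n : ℕ) (S : ES) (c : Bool × List ℕ) : sz (absorb n S c) ≤ sz S + growth n := by
  refine (sz_real n S _ .output (reduceGates_in _ _ (headD_filter_le _ _))
    ((ES.reduceGates_length ..).trans (by omega)) (headD_filter_le _ _)).trans ?_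
  unfold growth; omega

theorem polyBdd_growth {ι : Type*} {s N : ι → ℕ} (h : PolyBdd s N) :
    PolyBdd s fun i => growth (N i) := by
  unfold growth
  exact .add (.add (.add (.mul (.add (.mul (.const _) h) (.const _)) (.add (.const _) (.mul (.const _) h)))
    (.mul (.add (.mul (.const _) h) (.const _)) (.add (.const _) (.mul (.const _) h))))
    (.mul (.const _) h)) (.const _)

end ES

section
variable {α : Type} [Encode α] {N n : α → ℕ} {S : α → ES} {c : α → Bool × List ℕ} {m : α → Record}

@[fun_prop] theorem FP.ofCode (hn : FP n) (hc : FP c) :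
    FP fun a => ofCode (n a) (c a) := by
  unfold PStr.ofCode EGK.letterX EGK.letterZ; fun_prop

@[fun_prop] theorem FP.absorb (hn : FP n) (hS : FP S) (hc : FP c) :
    FP fun a => ES.absorb (n a) (S a) (c a) := by
  unfold ES.absorb ES.realL; fun_prop

theorem exists_bound_sz (hN : FP N) : ∃ q : Polynomial ℕ, ∀ a : α, ES.growth (N a) ≤ q.eval (sz a) :=
  ES.polyBdd_growth (hN.bdd.mono fun a => by rw [sz_nat]; omega)

@[fun_prop] theorem FP.absorbAll {g : α → List (Bool × List ℕ)} (hn : FP n) (hg : FP g) :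
    FP fun a => ES.absorbAll (n a) (g a) := by
  unfold ES.absorbAll
  obtain ⟨q, hq⟩ := exists_bound_sz hn
  refine .foldl hg (.const _) (by fun_prop) ⟨q, fun a b d => (ES.sz_absorb ..).trans ?_⟩
  have := eval_mono q (Nat.le_add_right (sz a) (sz d))
  have := hq a
  omega

@[fun_prop] theorem FP.start {r : α → List Bool} (hn : FP n) (hN : FP N) (hS : FP S)
    (hr : FP r) : FP fun a => ES.start (n a) (N a) (S a) (r a) := by
  unfold ES.start ES.fill; fun_prop

@[fun_prop] theorem FP.ok (hm : FP m) : FP fun a => (m a).ok := by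
  unfold Record.ok; fun_prop

@[fun_prop] theorem FP.output (hm : FP m) : FP fun a => (m a).output := by
  simp only [Record.output_eq]; fun_prop

theorem FP.polyEval {f : α → ℕ} (hf : FP f) (p : Polynomial ℕ) : FP fun a => p.eval (f a) := by
  induction p using Polynomial.induction_on' with
  | add p q hp hq => simpa only [Polynomial.eval_add] using hp.add hq
  | monomial k c =>
    simp only [Polynomial.eval_monomial]
    refine FP.mul (.const _) ?_
    induction k with
    | zero => simpa using FP.const 1
    | succ k ih => simpa only [pow_succ] using ih.mul hf

end

/-! ### Reading the steps of a circuit -/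

def Data.toList : Data → List Data
  | .nil => []
  | .cons a b => a :: b.toList

theorem Data.enc_toList (d : Data) : Encode.enc d.toList = d := by
  induction d with
  | nil => rfl
  | cons a b _ ih =>
    exact congrArg (Data.cons a) ih

theorem Data.toList_encNat (k : ℕ) : (encNat k).toList.length = k := by
  induction k with
  | zero => rfl
  | succ k ih => exact congrArg (· + 1) ih

def Role.ofNum (k : ℕ) : Role := cond (decide (k = 0)) .output (cond (decide (k = 1)) .internal .postselected)

def Instr.read (d : Data) : ICode := cond d.toList.isEmpty (0, (0, 0, 0), .output) (cond d.hd.toList.isEmpty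
  (1, (d.tl.hd.toList.length, cond (decide (d.tl.hd.toList.length = 2)) d.tl.tl.hd.toList.length
  d.tl.tl.toList.length, cond (decide (d.tl.hd.toList.length = 2)) d.tl.tl.tl.toList.length
  d.tl.tl.toList.length), .output) (2, (0, d.tl.hd.toList.length, d.tl.hd.toList.length), Role.ofNum
  d.tl.tl.toList.length))

/-- The program of the circuit answers with an encoded `Instr N`; the simulation goes on with an
untyped code, for which one program serves all `N`. -/
theorem Instr.read_enc {N : ℕ} (s : Instr N) : Instr.read (Encode.enc s) = s.code := by
  have h0 : Data.toList (encNat 0) = [] := rfl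
  have h1 : Data.toList (encNat 1) = [.nil] := rfl
  have h2 : Data.toList (encNat 2) = [.nil, .nil] := rfl
  cases s with
  | idle => rfl
  | gate u => cases u <;> simp [Instr.read, Encode.enc, Instr.code, Gate.code, Data.toList, Data.hd, Data.tl,
      Data.toList_encNat, h0, h1, h2]
  | meas q role =>
    cases role <;> simp [Instr.read, Encode.enc, Instr.code, Data.toList, Data.hd, Data.tl,
      Data.toList_encNat, h1, Role.ofNum]

section
variable {α : Type} [Encode α]

@[fun_prop] theorem FP.toList {f : α → Data} (hf : FP f) : FP fun a => (f a).toList :=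
  hf.comp' (.of_enc Data.enc_toList)

@[fun_prop] theorem FP.roleOfNum {f : α → ℕ} (hf : FP f) : FP fun a => Role.ofNum (f a) := by
  unfold Role.ofNum; fun_prop

@[fun_prop] theorem FP.read {f : α → Data} (hf : FP f) : FP fun a => Instr.read (f a) := by
  unfold Instr.read; fun_prop

end

open PStr ES

/-! ### The programs of the simulation -/

theorem Prog.Computes.congr {α β α' β' : Type} [Encode α] [Encode β] [Encode α'] [Encode β'] {P : Prog}
    {a : α} {b : β} {a' : α'} {b' : β'} {T T' : ℕ} (h : P.Computes a b T)
    (ha : Encode.enc a' = Encode.enc a) (hb : Encode.enc b' = Encode.enc b) (hT : T ≤ T') :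
    P.Computes a' b' T' := by
  obtain ⟨k, hk, hr⟩ := h
  exact ⟨k, hk.trans hT, by rw [ha, hb]; exact hr⟩

theorem enc_code {n : ℕ} (S : SPauli n) : Encode.enc S.code = Encode.enc S := by
  have : (List.ofFn fun i => (S.letter i).num).map Encode.enc = (List.ofFn S.letter).map Encode.enc := by
    rw [List.map_ofFn, List.map_ofFn]
    congr 1
    funext i
    simp only [Function.comp]
    cases S.letter i <;> rfl
  exact congrArg (fun l => Data.cons (Encode.enc S.neg) (encList l)) this

theorem enc_map_code {n : ℕ} (g : List (SPauli n)) :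
    Encode.enc (g.map SPauli.code) = Encode.enc g := by
  simp only [Encode.enc, List.map_map]
  congr 1
  exact List.map_congr_left fun S _ => enc_code S

/-- The description of a circuit with its stabiliser input. -/
abbrev Raw : Type := ℕ × List (Bool × List ℕ) × ℕ × ℕ × ℕ × Data

/-- A circuit which is described by the program `P`, with its stabiliser input. -/
structure Job (P : Prog) (p : Polynomial ℕ) where
  n : ℕ
  t : ℕ
  g : List (SPauli n)
  C : Circuit (n + t)
  d : Data
  gens : IsStabGens g
  desc : C.DescribedBy P d (p.eval (n + t))

section
variable {P : Prog} {p : Polynomial ℕ}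

namespace Job

def N (x : Job P p) : ℕ := x.n + x.t

/-- `f` is bounded by a polynomial in the number of lines. -/
abbrev Bdd {ι : Type*} (x : ι → Job P p) (f : ι → ℕ) : Prop := PolyBdd (fun i => (x i).N) f

def raw (x : Job P p) : Raw := (x.n, x.g.map SPauli.code, x.C.code x.d)

theorem enc_raw (x : Job P p) : Encode.enc x.raw = Encode.enc (x.n, x.g, x.C.code x.d) := by
  show Data.cons _ (.cons (Encode.enc (x.g.map SPauli.code)) _) = _
  rw [enc_map_code]; rfl

theorem length_le (x : Job P p) : x.g.length ≤ x.n := by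
  rw [← (absorbAll_repr x.g x.gens).card]
  exact (Finset.card_le_univ _).trans (by simp)

/-- Independent generators number at most `n`, and `DescribedBy` bounds the rest. Hence bounds may
be stated in terms of the number of lines alone. -/
theorem polyBdd_sz_raw : PolyBdd N fun x : Job P p => sz x.raw := by
  have hN : PolyBdd N fun x : Job P p => x.N := .self
  have h : PolyBdd N fun x : Job P p => (2 * x.N + 1) + (x.N * (8 * x.N + 6) + 1) + (2 * x.N + 1) +
      (2 * p.eval x.N + 1) + (2 * p.eval x.N + 1) + p.eval x.N + 5 := by
    refine .add (.add (.add (.add (.add (.add ?_ ?_) ?_) ?_) ?_) ?_) (.const _)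
    · exact .add (.mul (.const _) hN) (.const _)
    · exact .add (.mul hN (.add (.mul (.const _) hN) (.const _))) (.const _)
    · exact .add (.mul (.const _) hN) (.const _)
    · exact .add (.mul (.const _) (hN.eval p)) (.const _)
    · exact .add (.mul (.const _) (hN.eval p)) (.const _)
    · exact hN.eval p
  refine h.mono fun x => ?_
  have e : sz x.raw = sz (x.n, x.g.map SPauli.code, x.n + x.t, x.C.length, x.C.coins, x.d) := rfl
  obtain ⟨h1, h2, h3, -⟩ := x.desc
  have h4 : sz x.d = x.d.size := rfl
  have h5 : sz (x.g.map SPauli.code) ≤ x.N * (8 * x.N + 6) + 1 := by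
    refine (sz_le_of_all (c := 8 * x.N + 5) fun c hc => ?_).trans ?_
    · obtain ⟨S, -, rfl⟩ := List.mem_map.1 hc
      have h6 := sz_bool S.neg
      have h7 : sz (List.ofFn fun i => (S.letter i).num) ≤ x.n * 8 + 1 := by
        refine (sz_le_of_all (c := 7) fun k hk => ?_).trans (by rw [List.length_ofFn])
        obtain ⟨i, rfl⟩ := (List.mem_ofFn' _ _).1 hk
        rw [sz_nat]
        show 2 * (S.letter i).num + 1 ≤ 7
        cases S.letter i <;> simp [Pauli.num]
      rw [SPauli.code, sz_pair]
      have : x.n ≤ x.N := Nat.le_add_right _ _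
      omega
    · rw [List.length_map]
      exact Nat.add_le_add_right (Nat.mul_le_mul_right _ (x.length_le.trans (Nat.le_add_right _ _))) _
  rw [e]
  simp only [sz_pair, sz_nat, N] at *
  omega

end Job

theorem sz_boolList (l : List Bool) : sz l ≤ 4 * l.length + 1 :=
  (sz_le_of_all (c := 3) fun b _ => sz_bool b).trans (by omega)

theorem sz_traj (N : ℕ) (us : ℕ → Record → ICode) (rd h : List Bool) (S₀ : ES) (k : ℕ) :
    sz (traj N us rd h S₀ k) ≤ sz S₀ + k * growth N := by
  induction k with
  | zero => simp [traj]
  | succ k ih =>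
    rw [traj, Nat.succ_mul]
    exact (sz_step ..).trans (by omega)

theorem traj_add (N : ℕ) (us : ℕ → Record → ICode) (rd h : List Bool) (S₀ : ES) (i k : ℕ) (c : ICode) (hc : ∀
    j ≥ i, ∀ m, us j m = c) : traj N us rd h S₀ (i + k) = (List.range k).foldl
      (fun S j => S.step N c (rd.getD (i + j) false) h) (traj N us rd h S₀ i) := by
  induction k with
  | zero => rfl
  | succ k ih =>
    rw [List.range_succ, List.foldl_append, ← ih, ← Nat.add_assoc, traj, hc _ (Nat.le_add_right _ _)]
    rfl

/-- The padding steps form a loop of their own, since the program of the circuit promises nothing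
beyond the last step of the circuit. -/
def padFold (p : Polynomial ℕ) (x : (Raw × List Bool × List Bool) × ES) : ES := (List.range (p.eval
  x.1.1.2.2.1 + x.1.1.2.2.1 - x.1.1.2.2.2.1)).foldl (fun S j => S.step x.1.1.2.2.1 padCode ((x.1.2.1.drop
  (p.eval x.1.1.2.2.1 + x.1.1.2.2.1)).getD (x.1.1.2.2.2.1 + j) false) x.1.2.2) x.2

theorem FP.padFold : FP (padFold p) := by
  unfold EGK.padFold
  obtain ⟨q, hq⟩ := exists_bound_sz (α := (Raw × List Bool × List Bool) × ES)
    (N := fun x => x.1.1.2.2.1) (by fun_prop)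
  have hp : FP fun x : (Raw × List Bool × List Bool) × ES => p.eval x.1.1.2.2.1 :=
    .polyEval (by fun_prop) p
  have hp' : FP fun x : ((Raw × List Bool × List Bool) × ES) × ℕ × ES => p.eval x.1.1.1.2.2.1 :=
    .polyEval (by fun_prop) p
  refine .foldl (by fun_prop) (by fun_prop) (by fun_prop) ⟨q, fun a b d => (sz_step ..).trans ?_⟩
  have := eval_mono q (Nat.le_add_right (sz a) (sz d))
  have := hq a
  omega

def startOf (p : Polynomial ℕ) (x : Raw × List Bool × List Bool) : ES :=
  start x.1.1 x.1.2.2.1 (absorbAll x.1.1 x.1.2.1) ((x.2.1.drop (p.eval x.1.2.2.1)).take x.1.1)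

theorem FP.startOf : FP (startOf p) := by
  unfold EGK.startOf
  have hp : FP fun x : Raw × List Bool × List Bool => p.eval x.1.2.2.1 :=
    .polyEval (by fun_prop) p
  fun_prop

/-- The final state of the simulation of a job. -/
def Job.fin (x : Job P p) (w : List Bool) : List Bool → ES :=
  finOf x.C (engineOf x.g) (p.eval x.N) x.N w

section
variable {ι : Type*} {x : ι → Job P p} {w h : ι → List Bool}

theorem polyBdd_sz_input (hw : Job.Bdd x fun i => (w i).length) (hh : Job.Bdd x fun i => (h i).length) :
    Job.Bdd x fun i => sz ((x i).raw, w i, h i) := by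
  refine PolyBdd.mono (.add (.add (.add (Job.polyBdd_sz_raw.comap x) (.mul (.const 4) hw))
    (.mul (.const 4) hh)) (.const 4)) fun i => ?_
  have h1 := sz_boolList (w i)
  have h2 := sz_boolList (h i)
  rw [sz_pair (x i).raw, sz_pair (w i)]
  omega

abbrev Steps (x : ι → Job P p) : Type _ := Σ i, Fin (x i).C.length

/-- The body is required only at indices below the length of the circuit, where its program is known
to answer in time. `hstep` receives the identity on the loop data as a starting point for
composition. -/
theorem PT.iterate {β : Type} [Encode β] {T : ι → ℕ → β} {f : Raw × List Bool × List Bool → β} {B : ι → ℕ}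
    (hin : Job.Bdd x fun i => sz ((x i).raw, w i, h i)) (hf : FP f) (hT0 : ∀ i, T i 0 = f ((x i).raw, w i, h
    i)) (hB : Job.Bdd x B) (hT : ∀ i, ∀ k ≤ (x i).C.length, sz (T i k) ≤ B i) (hstep : PT (fun y : Steps x =>
    (x y.1).N) (fun y => (((x y.1).raw, w y.1, h y.1), (y.2 : ℕ), T y.1 y.2)) (fun y => (((x y.1).raw, w y.1,
    h y.1), (y.2 : ℕ), T y.1 y.2)) → PT (fun y : Steps x => (x y.1).N) (fun y => (((x y.1).raw, w y.1, h y.1),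
    (y.2 : ℕ), T y.1 y.2)) fun y => T y.1 (y.2 + 1)) :
    PT (fun i => (x i).N) (fun i => ((x i).raw, w i, h i)) fun i => T i (x i).C.length := by
  have hlen : Job.Bdd x fun i => (x i).C.length := (PolyBdd.self.eval p).mono fun i => (x i).desc.1
  have h1 := (hstep (.refl (((((hin.comap Sigma.fst).add ((PolyBdd.const 2).mul (hlen.comap Sigma.fst))).add
    (hB.comap Sigma.fst)).add (.const 3)).mono fun y => by
      have := hT y.1 y.2 y.2.2.le
      rw [sz_pair _ (_, T y.1 y.2), sz_pair (_ : ℕ), sz_nat]; omega))).comap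
    fun y : Σ i, Fin (List.range (x i).C.length).length =>
      (⟨y.1, y.2.1, y.2.2.trans_eq List.length_range⟩ : Steps x)
  have hr : FP fun z : Raw × List Bool × List Bool => List.range z.1.2.2.2.1 := by fun_prop
  have hrefl := PT.refl hin
  have h2 : FP fun z : Raw × List Bool × List Bool => (List.range z.1.2.2.2.1, z, f z) := by fun_prop
  refine (hrefl.fp h2).comp ((PT.loop (env := fun i => ((x i).raw, w i, h i)) (acc := T)
    (hrefl.fp hr).bdd_right hin ((hB.comap Sigma.fst).mono fun y => hT y.1 y.2 ?_)
    (h1.congr (fun y => by simp) fun _ => rfl)).congr (fun i => by rw [hT0]) fun i => by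
      rw [List.length_range]; rfl)
  exact (Nat.lt_succ_iff.1 y.2.2).trans_eq List.length_range

theorem PT.fin (hw : ∀ i, p.eval (x i).N ≤ (w i).length) (hw' : Job.Bdd x fun i => (w i).length) (hh : Job.Bdd
    x fun i => (h i).length) :
    PT (fun i => (x i).N) (fun i => ((x i).raw, w i, h i)) fun i => (x i).fin (w i) (h i) := by
  have hin := polyBdd_sz_input hw' hh
  have hrefl := PT.refl hin
  have hNb : Job.Bdd x fun i => (x i).N := .self
  let T (i : ι) (k : ℕ) : ES := traj (x i).N ((x i).C.icode ((w i).take (x i).C.coins))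
    ((w i).drop (p.eval (x i).N + (x i).N)) (h i) (startOf p ((x i).raw, w i, h i)) k
  have hloop := PT.iterate (T := T) hin (FP.startOf (p := p)) (fun _ => rfl) ((hrefl.fp (FP.startOf (p :=
    p))).bdd_right.add (((hNb.eval p).mono fun i => (x i).desc.1).mul (polyBdd_growth hNb)))
    (fun i k hk => (sz_traj ..).trans (Nat.add_le_add_left (Nat.mul_le_mul_right _ hk) _)) fun h1 => by
    have h2 : FP fun z : (Raw × List Bool × List Bool) × ℕ × ES =>
        (z.1.1.2.2, z.2.1, z.2.2.log.map Prod.snd, z.1.2.1.take z.1.1.2.2.2.2.1) := by fun_prop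
    -- Here the given program `P` is called; its promise applies because the log of the engine is no
    -- longer than the index and the random string has enough bits.
    have h3 : PT (fun y : Steps x => (x y.1).N) (fun y => ((x y.1).raw.2.2, (y.2 : ℕ), (T y.1 y.2).log.map
        Prod.snd, (w y.1).take (x y.1).C.coins)) fun y => Encode.enc ((x y.1).C.step y.2
          (Record.history (T y.1 y.2).log) ((w y.1).take (x y.1).C.coins)) := by
      refine ⟨P, p, fun y => (x y.1).desc.2.2.2 y.2 y.2.2 _ _ ?_ ?_⟩
      · exact (List.length_map _).trans_le (traj_log rfl _).1
      · rw [List.length_take]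
        have := hw y.1
        have := (x y.1).desc.2.1
        unfold Job.N at *
        omega
    have h5 : FP fun z : ((Raw × List Bool × List Bool) × ℕ × ES) × ICode =>
        z.1.2.2.step z.1.1.1.2.2.1 z.2 ((z.1.1.2.1.drop (p.eval z.1.1.1.2.2.1 + z.1.1.1.2.2.1)).getD
          z.1.2.1 false) z.1.1.2.2 := by
      have hp : FP fun z : ((Raw × List Bool × List Bool) × ℕ × ES) × ICode =>
        p.eval z.1.1.1.2.2.1 := .polyEval (by fun_prop) p
      fun_prop
    refine ((h1.pair (((h1.fp h2).comp h3).fp (f := Instr.read) (by fun_prop))).fp h5).congr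
      (fun _ => rfl) fun y => ?_
    dsimp only [T]
    rw [traj, Instr.read_enc]
    unfold Circuit.icode
    rw [decide_eq_true y.2.2]
    rfl
  refine ((hrefl.pair hloop).fp (FP.padFold (p := p))).congr (fun _ => rfl) fun i => congrArg _ ?_
  have h2 := (x i).desc.1
  have h3 : p.eval (x i).N + (x i).N = (x i).C.length + (p.eval (x i).N + (x i).N - (x i).C.length) := by
    unfold Job.N at *; omega
  have h4 := traj_add (x i).N ((x i).C.icode ((w i).take (x i).C.coins))
    ((w i).drop (p.eval (x i).N + (x i).N)) (h i) (startOf p ((x i).raw, w i, h i)) (x i).C.length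
    (p.eval (x i).N + (x i).N - (x i).C.length) padCode fun j hj m => by
      unfold Circuit.icode; rw [decide_eq_false (Nat.not_lt.2 hj)]; rfl
  rw [← h3] at h4
  exact h4

theorem PT.fin_append (hw : ∀ i, p.eval (x i).N ≤ (w i).length) (hw' : Job.Bdd x fun i => (w i).length) (hh :
    Job.Bdd x fun i => (h i).length) (b : Bool) :
    PT (fun i => (x i).N) (fun i => ((x i).raw, w i, h i)) fun i => (x i).fin (w i) (h i ++ [b]) := by
  have h1 := PT.fin (h := fun i => h i ++ [b]) hw hw' ((hh.add (.const 1)).mono fun i => by simp)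
  have h2 : FP fun z : Raw × List Bool × List Bool => (z.1, z.2.1, z.2.2 ++ [b]) := by fun_prop
  exact ((PT.refl (polyBdd_sz_input hw' hh)).fp h2).comp h1

end

end

theorem Prog.Computes.mono {α β : Type} [Encode α] [Encode β] {P : Prog} {a : α} {b : β} {T T' : ℕ}
    (h : P.Computes a b T) (hT : T ≤ T') : P.Computes a b T' := h.congr rfl rfl hT

section
variable {α : Type} [Encode α]

@[fun_prop] theorem FP.down {n : α → ℕ} {g : α → GCode} (hn : FP n) (hg : FP g) :
    FP fun a => GCode.down (n a) (g a) := by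
  unfold GCode.down; fun_prop

@[fun_prop] theorem FP.gateI {g : α → GCode} (hg : FP g) : FP fun a => gateI (g a) := by
  unfold EGK.gateI; fun_prop

@[fun_prop] theorem FP.measI {e : α → ℕ × Role} (he : FP e) : FP fun a => measI (e a) := by
  unfold EGK.measI; fun_prop

@[fun_prop] theorem FP.icodeData {t : α → ℕ} {u : α → ICode} (ht : FP t) (hu : FP u) :
    FP fun a => (u a).data (t a) := by
  unfold ICode.data; fun_prop

theorem FP.some' {β : Type} [Encode β] : FP (some : β → Option β) :=
  PT.congr (FP.prodMk (.const Data.nil) .self) (fun _ => rfl) fun _ => rfl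

@[fun_prop] theorem FP.some {β : Type} [Encode β] {f : α → β} (hf : FP f) : FP fun a => some (f a) :=
  hf.comp' .some'

end

/-- The simulation states that are needed for one block of the device, or for its output: with the
outcomes as they are, and with one more outcome. -/
abbrev Three : Type := ES × ES × ES

def three (fin : List Bool → ES) (h : List Bool) : Three := (fin h, fin (h ++ [false]), fin (h ++ [true]))

/-- `block` takes the final state as a function of all histories, which cannot be given to a
program. It evaluates this function only at `h` and its two extensions, so three states suffice. -/
def blockOf (ps : Bool) (n t : ℕ) (h : List Bool) (F : Three) : List ICode :=
  block n t ps (fun h' => cond (decide (h'.length = h.length)) F.1 (cond (h'.getD h.length false) F.2.2 F.2.1)) h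

theorem blockOf_three (ps : Bool) (n t : ℕ) (h : List Bool) (fin : List Bool → ES) :
    blockOf ps n t h (three fin h) = block n t ps fin h := by
  have h1 : ∀ b, decide ((h ++ [b]).length = h.length) = false := fun b => by simp
  have h2 : ∀ b, (h ++ [b]).getD h.length false = b := fun b => by
    rw [List.getD_append_right _ _ _ _ le_rfl, Nat.sub_self, List.getD_cons_zero]
  simp only [blockOf, block, lastBlock, three, h1, h2, cond_false, cond_true, decide_true]

theorem FP.blockOf {α : Type} [Encode α] {n t : α → ℕ} {h : α → List Bool} {F : α → Three} (ps : Bool)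
    (hn : FP n) (ht : FP t) (hh : FP h) (hF : FP F) :
    FP fun a => blockOf ps (n a) (t a) (h a) (F a) := by
  unfold EGK.blockOf block lastBlock
  fun_prop

def postThree (F : Three) : ES := cond F.2.1.log.ok F.2.1 F.2.2

theorem postThree_three (fin : List Bool → ES) (m : List Bool) :
    postThree (three fin m) = fin (completion fin m) := by
  unfold postThree three completion
  cases (fin (m ++ [false])).log.ok <;> rfl

section
variable {P : Prog} {p : Polynomial ℕ}

theorem PT.three {ι : Type*} {x : ι → Job P p} {w h : ι → List Bool} (hw : ∀ i, p.eval (x i).N ≤ (w i).length)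
    (hw' : Job.Bdd x fun i => (w i).length) (hh : Job.Bdd x fun i => (h i).length) : PT (fun i => (x i).N)
    (fun i => ((x i).raw, w i, h i)) fun i => three ((x i).fin (w i)) (h i) := (PT.fin hw hw' hh).pair
    ((PT.fin_append hw hw' hh false).pair (PT.fin_append hw hw' hh true))

def Job.device (x : Job P p) (ps : Bool) (w : List Bool) : Circuit x.t := EGK.device x.n x.t ps (x.fin w)

def Job.Seed (x : Job P p) : Type := {w : List Bool // w.length = p.eval x.N + x.N + (p.eval x.N + x.N)}

theorem polyBdd_seed {ι : Type*} {x : ι → Job P p} {w : ∀ i, (x i).Seed} :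
    Job.Bdd x fun i => (w i).1.length := by
  have hN : Job.Bdd x fun i => (x i).N := .self
  exact (((hN.eval p).add hN).add ((hN.eval p).add hN)).mono fun i => (w i).2.le

theorem seed_le {x : Job P p} (w : x.Seed) : p.eval x.N ≤ w.1.length := by
  have := w.2; omega

theorem polyBdd_deviceLength :
    PolyBdd (fun x : Job P p => x.N) fun x => x.t * blockLen x.n x.t := by
  have hN : PolyBdd (fun x : Job P p => x.N) fun x => x.N := .self
  have ht : PolyBdd (fun x : Job P p => x.N) fun x => x.t := hN.mono fun x => Nat.le_add_left _ _
  exact ht.mul (((PolyBdd.const 3).mul hN).add (.const 9))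

/-- The description of the device is the input itself, with the random string; the work is left to
the control program. -/
theorem exists_translate : ∃ (Tr : Prog) (q : Polynomial ℕ), ∀ (x : Job P p) (w : x.Seed) (ps : Bool),
    Tr.Computes (x.raw, w.1) ((x.device ps w.1).code (Encode.enc (x.raw, w.1))) (q.eval x.N) := by
  have hin := polyBdd_sz_input (x := fun i : Σ x : Job P p, x.Seed => i.1) (w := fun i => i.2.1)
    (h := fun _ => []) polyBdd_seed (.const 0)
  have hF : FP fun z : Raw × List Bool =>
      (z.1.2.2.1 - z.1.1, (z.1.2.2.1 - z.1.1) * (3 * z.1.2.2.1 + 9), 0, Encode.enc z) := by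
    fun_prop
  obtain ⟨Tr, q, h⟩ := (PT.refl (a := fun i : Σ x : Job P p, x.Seed => (i.1.raw, i.2.1))
    (hin.mono fun i => by rw [sz_pair i.1.raw, sz_pair i.1.raw, sz_pair i.2.1]; omega)).fp hF
  refine ⟨Tr, q, fun x w ps => (h ⟨x, w⟩).congr rfl ?_ le_rfl⟩
  show Encode.enc (x.t, x.t * blockLen x.n x.t, 0, _) = Encode.enc (x.n + x.t - x.n, (x.n + x.t - x.n) *
    (3 * (x.n + x.t) + 9), 0, _)
  rw [Nat.add_sub_cancel_left]
  rfl

/-- The control program repeats the whole simulation for every step of the device, with the outcomes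
that are present. -/
theorem exists_control (ps : Bool) : ∃ (Ctl : Prog) (q : Polynomial ℕ), ∀ (x : Job P p) (w : x.Seed),
    (x.device ps w.1).DescribedBy Ctl (Encode.enc (x.raw, w.1)) (q.eval x.N) := by
  let ι : Type := Σ x : Job P p, x.Seed × {y : ℕ × List Bool // y.2.length ≤ y.1 ∧
    y.1 < x.t * blockLen x.n x.t}
  have hlen : PolyBdd (fun i : ι => i.1.N) fun i => i.1.t * blockLen i.1.n i.1.t :=
    polyBdd_deviceLength.comap Sigma.fst
  have hw : PolyBdd (fun i : ι => i.1.N) fun i => i.2.1.1.length :=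
    polyBdd_seed (x := fun i : ι => i.1) (w := fun i => i.2.1)
  have hh : PolyBdd (fun i : ι => i.1.N) fun i => i.2.2.1.2.length :=
    hlen.mono fun i => i.2.2.2.1.trans i.2.2.2.2.le
  have hin := polyBdd_sz_input (x := fun i : ι => i.1) (w := fun i => i.2.1.1) (h := fun i => i.2.2.1.2) hw hh
  have h1 : PT (fun i : ι => i.1.N) (fun i => ((i.1.raw, i.2.1.1), i.2.2.1))
      fun i => ((i.1.raw, i.2.1.1), i.2.2.1) := by
    refine PT.refl ((hin.add ((PolyBdd.const 2).mul hlen)).add (.const 1) |>.mono fun i => ?_)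
    have := i.2.2.2.2
    have e : sz i.2.2.1 = sz (i.2.2.1.1, i.2.2.1.2) := rfl
    rw [sz_pair (i.1.raw, i.2.1.1), e, sz_pair i.2.2.1.1, sz_pair i.1.raw, sz_pair i.1.raw,
      sz_pair i.2.1.1, sz_nat]
    omega
  have h2 : FP fun z : (Raw × List Bool) × ℕ × List Bool => (z.1.1, z.1.2, z.2.2) := by fun_prop
  have h3 := h1.pair ((h1.fp h2).comp (PT.three (x := fun i : ι => i.1) (fun i => seed_le i.2.1) hw hh))
  have h4 : FP fun z : ((Raw × List Bool) × ℕ × List Bool) × Three =>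
      ICode.data (z.1.1.1.2.2.1 - z.1.1.1.1) (cond (decide (z.1.2.1 < z.1.2.2.length * (3 * z.1.1.1.2.2.1 +
        9))) idleI ((blockOf ps z.1.1.1.1 (z.1.1.1.2.2.1 - z.1.1.1.1) z.1.2.2 z.2).getD
          (z.1.2.1 - z.1.2.2.length * (3 * z.1.1.1.2.2.1 + 9)) idleI)) := by
    have := FP.blockOf (α := ((Raw × List Bool) × ℕ × List Bool) × Three)
      (n := fun z => z.1.1.1.1) (t := fun z => z.1.1.1.2.2.1 - z.1.1.1.1) (h := fun z => z.1.2.2)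
      (F := fun z => z.2) ps (by fun_prop) (by fun_prop) (by fun_prop) (by fun_prop)
    fun_prop
  have h5 : PT (fun i : ι => i.1.N) (fun i => ((i.1.device ps i.2.1.1).code (Encode.enc (i.1.raw, i.2.1.1)),
      i.2.2.1.1, i.2.2.1.2, ([] : List Bool))) fun i => ((i.1.raw, i.2.1.1), i.2.2.1) := by
    have h6 : FP fun z : (ℕ × ℕ × ℕ × Data) × ℕ × List Bool × List Bool =>
        (z.1.2.2.2, z.2.1, z.2.2.1) := by fun_prop
    refine PT.congr ((PT.refl (s := fun i : ι => i.1.N) (a := fun i : ι =>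
      ((i.1.device ps i.2.1.1).code (Encode.enc (i.1.raw, i.2.1.1)),
      i.2.2.1.1, i.2.2.1.2, ([] : List Bool))) ?_).fp h6) (fun _ => rfl) (fun _ => rfl)
    have hN : PolyBdd (fun i : ι => i.1.N) fun i => i.1.N := .self
    refine (((hin.add ((PolyBdd.const 2).mul hN)).add ((PolyBdd.const 4).mul hlen)).add
      (.const 20)).mono fun i => ?_
    have := i.2.2.2.2
    have e : sz ((i.1.device ps i.2.1.1).code (Encode.enc (i.1.raw, i.2.1.1))) =
      sz (i.1.t, i.1.t * blockLen i.1.n i.1.t, 0, (i.1.raw, i.2.1.1)) := rfl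
    have : i.1.t ≤ i.1.N := Nat.le_add_left _ _
    rw [sz_pair, e]
    simp only [sz_pair, sz_nat, sz_nil]
    omega
  obtain ⟨Ctl, q, hq⟩ := h5.comp (h3.fp h4)
  obtain ⟨q₁, hq₁⟩ := polyBdd_deviceLength (P := P) (p := p)
  obtain ⟨q₂, hq₂⟩ := (polyBdd_sz_input (x := fun i : Σ x : Job P p, x.Seed => i.1)
    (w := fun i => i.2.1) (h := fun _ => []) polyBdd_seed (.const 0))
  refine ⟨Ctl, q + q₁ + q₂, fun x w => ⟨?_, Nat.zero_le _, ?_, fun i hi h r hh hr => ?_⟩⟩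
  · simp only [Polynomial.eval_add]
    have := hq₁ x
    exact this.trans (by dsimp only; omega)
  · have := hq₂ ⟨x, w⟩
    dsimp only at this
    rw [sz_pair x.raw, sz_pair w.1] at this
    have e : (Encode.enc (x.raw, w.1)).size = sz x.raw + sz w.1 + 1 := rfl
    simp only [Polynomial.eval_add]
    omega
  · have hr' : r = [] := List.length_eq_zero_iff.1 hr
    subst hr'
    refine (hq ⟨x, w, (i, h), hh, hi⟩).congr rfl ?_ (by simp only [Polynomial.eval_add]; omega)
    show Encode.enc (ICode.toInstr x.t _) = ICode.data (x.n + x.t - x.n) (cond (decide (i < h.length * (3 *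
      (x.n + x.t) + 9))) idleI ((blockOf ps x.n (x.n + x.t - x.n) h (three (x.fin w.1) h)).getD (i - h.length
      * (3 * (x.n + x.t) + 9)) idleI))
    rw [ICode.enc_toInstr, Nat.add_sub_cancel_left, blockOf_three]
    rfl

theorem exists_post (β : Type) [Encode β] (f : ℕ × ES → β) (hf : FP f) :
    ∃ (Post : Prog) (q : Polynomial ℕ), ∀ (x : Job P p) (w : x.Seed) (m : List Bool), m.length ≤ x.t →
      Post.Computes (x.raw, w.1, m) (f (x.t, x.fin w.1 (completion (x.fin w.1) m))) (q.eval x.N) := by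
  let ι : Type := Σ x : Job P p, x.Seed × {m : List Bool // m.length ≤ x.t}
  have hN : PolyBdd (fun i : ι => i.1.N) fun i => i.1.N := .self
  have hw : PolyBdd (fun i : ι => i.1.N) fun i => i.2.1.1.length :=
    polyBdd_seed (x := fun i : ι => i.1) (w := fun i => i.2.1)
  have hh : PolyBdd (fun i : ι => i.1.N) fun i => i.2.2.1.length :=
    hN.mono fun i => i.2.2.2.trans (Nat.le_add_left _ _)
  have hin := polyBdd_sz_input (x := fun i : ι => i.1) (w := fun i => i.2.1.1) (h := fun i => i.2.2.1) hw hh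
  have h1 := (PT.refl hin).pair (PT.three (x := fun i : ι => i.1) (fun i => seed_le i.2.1) hw hh)
  have h2 : FP fun z : (Raw × List Bool × List Bool) × Three =>
      f (z.1.1.2.2.1 - z.1.1.1, postThree z.2) := by
    refine hf.comp ?_
    unfold postThree
    fun_prop
  obtain ⟨Post, q, h⟩ := h1.fp h2
  refine ⟨Post, q, fun x w m hm => (h ⟨x, w, m, hm⟩).congr rfl ?_ le_rfl⟩
  dsimp only
  rw [postThree_three]
  show Encode.enc (f (x.t, _)) = Encode.enc (f (x.n + x.t - x.n, _))
  rw [Nat.add_sub_cancel_left]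

theorem Circuit.DescribedBy.mono {N : ℕ} {C : Circuit N} {Q : Prog} {d : Data} {T T' : ℕ}
    (h : C.DescribedBy Q d T) (hT : T ≤ T') : C.DescribedBy Q d T' :=
  ⟨h.1.trans hT, h.2.1.trans hT, h.2.2.1.trans hT, fun i hi m r hm hr => (h.2.2.2 i hi m r hm hr).mono hT⟩

theorem Job.compiles (x : Job P p) {β : Type} [Encode β] {Tr Ctl Post : Prog} {q₁ q₂ q₃ : Polynomial ℕ} {D :
    List Bool → Circuit x.t} {d' : List Bool → Data} {post : List Bool → List Bool → β} (h₁ : ∀ w : x.Seed,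
    Tr.Computes (x.raw, w.1) ((D w.1).code (d' w.1)) (q₁.eval x.N)) (h₂ : ∀ w : x.Seed, (D w.1).DescribedBy
    Ctl (d' w.1) (q₂.eval x.N)) (h₃ : ∀ (w : x.Seed) (m : List Bool), m.length ≤ x.t → Post.Computes (x.raw,
    w.1, m) (post w.1 m) (q₃.eval x.N)) (h₄ : ∀ w, (D w).AtMostMeas x.t) {l : ℕ} (hl : l = p.eval x.N + x.N +
    (p.eval x.N + x.N)) : Compiles Tr Ctl Post ((q₁ + q₂ + q₃).eval x.N) l x.g x.C x.d (fun r => D (List.ofFn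
    r))
      fun r => post (List.ofFn r) := by
  intro r
  have hr : (List.ofFn r).length = p.eval x.N + x.N + (p.eval x.N + x.N) := by rw [List.length_ofFn, hl]
  have e : (q₁ + q₂ + q₃).eval x.N = q₁.eval x.N + q₂.eval x.N + q₃.eval x.N := by
    simp only [Polynomial.eval_add]
  refine ⟨⟨_, (h₁ ⟨_, hr⟩).congr ?_ rfl (by omega), (h₂ ⟨_, hr⟩).mono (by omega)⟩, h₄ _, fun m hm =>
    (h₃ ⟨_, hr⟩ m hm).congr ?_ rfl (by omega)⟩ <;>
  · show Data.cons (Encode.enc (x.n, x.g, x.C.code x.d)) _ = _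
    rw [← x.enc_raw]; rfl

theorem exists_compiles (β : Type) [Encode β] (f : ℕ × ES → β) (hf : FP f) (ps : Bool) (P : Prog) (p :
    Polynomial ℕ) : ∃ (Tr Ctl Post : Prog) (q : Polynomial ℕ), ∀ (x : Job P p) (l : ℕ), l = p.eval x.N + x.N +
    (p.eval x.N + x.N) → Compiles Tr Ctl Post (q.eval x.N) l x.g x.C x.d (fun r => x.device ps (List.ofFn r))
        fun r m => f (x.t, x.fin (List.ofFn r) (completion (x.fin (List.ofFn r)) m)) := by
  obtain ⟨Tr, q₁, h₁⟩ := exists_translate (P := P) (p := p)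
  obtain ⟨Ctl, q₂, h₂⟩ := exists_control (P := P) (p := p) ps
  obtain ⟨Post, q₃, h₃⟩ := exists_post (P := P) (p := p) β f hf
  exact ⟨Tr, Ctl, Post, q₁ + q₂ + q₃, fun x l hl => x.compiles (D := x.device ps) (d' := fun w => Encode.enc
    (x.raw, w)) (post := fun w m => f (x.t, x.fin w (completion (x.fin w) m))) (fun w => h₁ x w ps) (h₂ x) (h₃
    x) (fun w => device_atMostMeas _ _ _ _) hl⟩

end

/-! ### Deferred measurements

The first `A` of `K = A + N` lines are ancillas. -/

section blocks
variable {A N K : ℕ} (h : K = A + N)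

/-- The basis state with `v` on the ancillas and `x` on the other lines. -/
def jn (v : Fin A → Bool) (x : Fin N → Bool) : Fin K → Bool := fun i =>
  if hi : i.1 < A then v ⟨i, hi⟩ else x ⟨i - A, by omega⟩

theorem jn_append (v : Fin A → Bool) (x : Fin N → Bool) : jn rfl v x = Fin.append v x := by
  funext i
  refine Fin.addCases (fun i => ?_) (fun i => ?_) i
  · simp [jn]
  · simp [jn]

/-- A block of an operator, for given values of the ancillas. -/
def blk (v v' : Fin A → Bool) (B : Op K) : Op N := fun x y => B (jn h v x) (jn h v' y)

/-- Ancilla `a` is still in the state 0: all blocks vanish in which it has the value 1 on either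
side. -/
def ZeroAt (a : Fin A) (B : Op K) : Prop := ∀ v v', v a = true ∨ v' a = true → blk h v v' B = 0

/-- A Pauli operator on the lines which are not ancillas. -/
def up (A : ℕ) (T : PStr) : PStr := ⟨T.hi, T.lo, List.replicate A (false, false) ++ T.bits⟩

theorem up_bits_getD_lt (T : PStr) {i : ℕ} (hi : i < A) :
    (up A T).bits.getD i (false, false) = (false, false) := by
  rw [up, List.getD_append _ _ _ _ (by simpa using hi), List.getD_replicate _ hi]

theorem up_bits_getD_add (T : PStr) (i : ℕ) :
    (up A T).bits.getD (A + i) (false, false) = T.bits.getD i (false, false) := by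
  rw [up, List.getD_append_right _ _ _ _ (by simp)]; simp

theorem op_up (T : PStr) : (up A T).op (A + N) = tensor 1 (T.op N) := by
  rw [← PStr.op_one A]
  refine PStr.op_tensor (by rw [PStr.one_ph, one_mul]; rfl) (fun i hi => ?_) fun i _ => ?_
  · rw [PStr.one, mk'_x hi, mk'_z hi, PStr.x, PStr.z, up_bits_getD_lt T hi]
    exact ⟨rfl, rfl⟩
  · rw [PStr.x, PStr.z, up_bits_getD_add]
    exact ⟨rfl, rfl⟩

theorem herm_up (h : K = A + N) {T : PStr} (hT : T.Herm N) : (up A T).Herm K := by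
  subst h
  rw [herm_iff, op_up, tensor_mul, hT.sq, one_mul, tensor_one]

theorem frame_up (ops : List PStr) :
    frame (A + N) (ops.map (up A)) = tensor 1 (frame N ops) := by
  induction ops with
  | nil => simp [tensor_one]
  | cons T ops ih =>
    rw [List.map_cons, frame_cons, ih, (rotOp_right (op_up T)).1, tensor_mul, one_mul, ← frame_cons]

theorem blk_frame_up (ops : List PStr) (v v' : Fin A → Bool) (B : Op K) :
    blk h v v' (frame K (ops.map (up A)) * B * (frame K (ops.map (up A)))ᴴ) =
      frame N ops * blk h v v' B * (frame N ops)ᴴ := by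
  subst h
  rw [frame_up, tensor_conjTranspose, Matrix.conjTranspose_one]
  ext x y
  simp only [blk, jn_append]
  rw [Matrix.mul_apply, sum_append, Finset.sum_eq_single v', Matrix.mul_apply]
  · refine Finset.sum_congr rfl fun y' _ => ?_
    rw [tensor_append, Matrix.one_apply_eq, one_mul, Matrix.mul_apply, sum_append,
      Finset.sum_eq_single v, Matrix.mul_apply]
    · congr 1
      refine Finset.sum_congr rfl fun x' _ => ?_
      rw [tensor_append, Matrix.one_apply_eq, one_mul]
      simp only [blk, jn_append]
    · intro a _ ha
      refine Finset.sum_eq_zero fun b _ => ?_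
      rw [tensor_append, Matrix.one_apply_ne ha.symm, zero_mul, zero_mul]
    · simp
  · intro a _ ha
    refine Finset.sum_eq_zero fun b _ => ?_
    rw [tensor_append, Matrix.one_apply_ne ha, zero_mul, mul_zero]
  · simp

theorem ZeroAt.frame_up {a : Fin A} {B : Op K} (hB : ZeroAt h a B) (ops : List PStr) :
    ZeroAt h a (frame K (ops.map (up A)) * B * (frame K (ops.map (up A)))ᴴ) := fun v v' hv => by
  rw [blk_frame_up, hB v v' hv, mul_zero, zero_mul]

theorem CX_conj_apply {c q : Fin K} (hne : c ≠ q) (B : Op K) (X Y : Fin K → Bool) :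
    ((Gate.CX c q hne).op * B * ((Gate.CX c q hne).op)ᴴ) X Y =
      B (Function.update X q (X q ^^ X c)) (Function.update Y q (Y q ^^ Y c)) := by
  have inv : ∀ X Z : Fin K → Bool, X = Function.update Z q (Z q ^^ Z c) ↔
      Z = Function.update X q (X q ^^ X c) := by
    have : ∀ X Z : Fin K → Bool, X = Function.update Z q (Z q ^^ Z c) →
        Z = Function.update X q (X q ^^ X c) := by
      rintro _ Z rfl
      rw [Function.update_self, Function.update_of_ne hne, Function.update_idem]
      simp
    exact fun X Z => ⟨this X Z, this Z X⟩
  have e : ∀ X Z, (Gate.CX c q hne).op X Z = if Z = Function.update X q (X q ^^ X c) then 1 else 0 :=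
    fun X Z => by
      simp only [Gate.op]
      by_cases hX : X = Function.update Z q (Z q ^^ Z c)
      · rw [if_pos hX, if_pos ((inv _ _).1 hX)]
      · rw [if_neg hX, if_neg fun h' => hX ((inv _ _).2 h')]
  rw [Matrix.mul_apply, Finset.sum_eq_single (Function.update Y q (Y q ^^ Y c)), Matrix.mul_apply,
    Finset.sum_eq_single (Function.update X q (X q ^^ X c)), Matrix.conjTranspose_apply, e, e]
  · simp
  · intro Z _ hZ; rw [e, if_neg hZ, zero_mul]
  · simp
  · intro Z _ hZ; rw [Matrix.conjTranspose_apply, e, if_neg hZ]; simp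
  · simp

/-- The ancilla `a` gets a copy of line `q`. -/
def copyRots (K A q a : ℕ) : List PStr := gateRots K (2, A + q, a)

theorem blk_copy {a : Fin A} {q : Fin N} (v v' : Fin A → Bool) (B : Op K) (x y : Fin N → Bool) :
    blk h v v' (frame K (copyRots K A q a) * B * (frame K (copyRots K A q a))ᴴ) x y =
      blk h (Function.update v a (v a ^^ x q)) (Function.update v' a (v' a ^^ y q)) B x y := by
  have hq : A + q.1 < K := by omega
  have ha : a.1 < K := by omega
  have hne : (⟨A + q, hq⟩ : Fin K) ≠ ⟨a, ha⟩ := by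
    intro e; have := congrArg Fin.val e; simp at this; omega
  have key : ∀ (v : Fin A → Bool) (x : Fin N → Bool),
      Function.update (jn h v x) ⟨a, ha⟩ (jn h v x ⟨a, ha⟩ ^^ jn h v x ⟨A + q, hq⟩) =
        jn h (Function.update v a (v a ^^ x q)) x := by
    intro v x
    have h1 : jn h v x ⟨a, ha⟩ = v a := by simp [jn]
    have h2 : jn h v x ⟨A + q, hq⟩ = x q := by simp [jn]
    rw [h1, h2]
    funext i
    by_cases hi : i = ⟨a, ha⟩
    · subst hi; simp [jn]
    · rw [Function.update_of_ne hi]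
      simp only [jn]
      by_cases hi' : i.1 < A
      · rw [dif_pos hi', dif_pos hi', Function.update_of_ne]
        intro e; exact hi (Fin.ext (by simpa using congrArg Fin.val e))
      · rw [dif_neg hi', dif_neg hi']
  have := Gate.conj_eq (Gate.CX (⟨A + q, hq⟩ : Fin K) ⟨a, ha⟩ hne) B
  simp only [Gate.code] at this
  rw [copyRots, blk, ← this, CX_conj_apply, key, key]
  rfl

theorem ZeroAt.copy {a a' : Fin A} (hne : a' ≠ a) {q : Fin N} {B : Op K} (hB : ZeroAt h a' B) :
    ZeroAt h a' (frame K (copyRots K A q a) * B * (frame K (copyRots K A q a))ᴴ) := fun v v' hv => by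
  ext x y
  rw [blk_copy, hB _ _ (by rwa [Function.update_of_ne hne, Function.update_of_ne hne])]

theorem projZ_sandwich (q : Fin N) (b : Bool) (B : Op N) (x y : Fin N → Bool) :
    (projZ q b * B * projZ q b) x y = if x q = b ∧ y q = b then B x y else 0 := by
  rw [projZ_eq_pproj, pproj_Z_diag, diag_sandwich_apply]
  by_cases h1 : x q = b <;> by_cases h2 : y q = b <;> simp [h1, h2]

/-- A copy onto a fresh ancilla is a deferred measurement: the diagonal block with the ancilla value
`b` is the branch of the outcome `b`. Off-diagonal blocks do not enter traces. -/
theorem blk_copy_diag {a : Fin A} {q : Fin N} (v : Fin A → Bool) {B : Op K} (hB : ZeroAt h a B) :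
    blk h v v (frame K (copyRots K A q a) * B * (frame K (copyRots K A q a))ᴴ) =
      projZ q (v a) * blk h (Function.update v a false) (Function.update v a false) B * projZ q (v a) := by
  ext x y
  rw [blk_copy, projZ_sandwich]
  by_cases hx : x q = v a
  · by_cases hy : y q = v a
    · rw [if_pos ⟨hx, hy⟩, hx, hy, Bool.xor_self]
    · rw [if_neg fun h' => hy h'.2, hB _ _ (Or.inr _)]
      · rfl
      · rw [Function.update_self]; revert hy; cases y q <;> cases v a <;> simp
  · rw [if_neg fun h' => hx h'.1, hB _ _ (Or.inl _)]
    · rfl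
    · rw [Function.update_self]; revert hx; cases x q <;> cases v a <;> simp

/-- On the left the value of ancilla `a` plays the role of the outcome. On the right the outcome is
summed separately, and only the `v` with `v a = false` contribute. -/
theorem sum_update {M : Type*} [AddCommMonoid M] (a : Fin A) (F : Bool → (Fin A → Bool) → M) (hF : ∀ b v, v a
    = true → F b v = 0) : ∑ v : Fin A → Bool, F (v a) (Function.update v a false) =
      ∑ v : Fin A → Bool, (F false v + F true v) := by
  have hinv : Function.Involutive fun v : Fin A → Bool => Function.update v a (!v a) := fun v => by
    simp
  have h1 : ∀ G : (Fin A → Bool) → M, ∑ v, G v = ∑ v ∈ Finset.univ.filter fun v => v a = false,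
      (G v + G (Function.update v a true)) := by
    intro G
    rw [Finset.sum_add_distrib, ← Finset.sum_filter_add_sum_filter_not Finset.univ (fun v => v a = false)]
    congr 1
    refine Finset.sum_bij' (fun v _ => Function.update v a false) (fun v _ => Function.update v a true)
      ?_ ?_ ?_ ?_ ?_
    · simp
    · simp
    · intro v hv; simp at hv; simp [← hv]
    · intro v hv; simp at hv; simp [← hv]
    · intro v hv; simp at hv; simp [← hv]
  rw [h1, h1 fun v => F false v + F true v]
  refine Finset.sum_congr rfl fun v hv => ?_
  have hv : v a = false := by simpa using hv
  have h2 : Function.update v a false = v := by rw [← hv, Function.update_eq_self]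
  rw [hF _ (Function.update v a true) (by simp), hF _ (Function.update v a true) (by simp), hv,
    Function.update_self, Function.update_idem, h2, add_zero, add_zero]

theorem trace_eq_sum_blk (B : Op K) : B.trace = ∑ v, (blk h v v B).trace := by
  subst h
  simp only [Matrix.trace, Matrix.diag_apply, blk, jn_append]
  rw [sum_append]

end blocks

def conjOn (K : ℕ) (ops : List PStr) (B : Op K) : Op K := frame K ops * B * (frame K ops)ᴴ

theorem conjOn_append {K : ℕ} (ops ops' : List PStr) (B : Op K) :
    conjOn K (ops ++ ops') B = conjOn K ops (conjOn K ops' B) := by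
  simp only [conjOn, frame_append, Matrix.conjTranspose_mul, mul_assoc]

theorem conjOn_nil {K : ℕ} (B : Op K) : conjOn K [] B = B := by simp [conjOn]

section deferral
variable {A N K : ℕ} (h : K = A + N)

/-- The rotations for one step of a circuit whose measurement is deferred to ancilla `a`. -/
def stepRots (A N : ℕ) (u : ICode) (a : ℕ) : List PStr :=
  cond (decide (u.1 = 1)) ((gateRots N u.2.1).map (up A))
    (cond (decide (u.1 = 2)) (copyRots (A + N) A u.2.1.2.1 a) [])

/-- The rotations for the steps `0, …, i - 1`, when there are `n` ancillas for other purposes. -/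
def opsTo (A N n : ℕ) (us : ℕ → ICode) (base : List PStr) : ℕ → List PStr
  | 0 => base
  | i + 1 => stepRots A N (us i) (n + i) ++ opsTo A N n us base i

def bitOf (v : Fin A → Bool) (j : ℕ) : Bool := if hj : j < A then v ⟨j, hj⟩ else false

/-- The record of the first `i` steps, if the ancillas have the values `v`. -/
def recTo (n : ℕ) (us : ℕ → ICode) (v : ℕ → Bool) (i : ℕ) : Record :=
  (List.range i).flatMap fun j => cond (decide ((us j).1 = 2)) [((us j).2.2, v (n + j))] []

theorem recTo_succ (n : ℕ) (us : ℕ → ICode) (v : ℕ → Bool) (i : ℕ) : recTo n us v (i + 1) =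
    recTo n us v i ++ cond (decide ((us i).1 = 2)) [((us i).2.2, v (n + i))] [] := by
  rw [recTo, List.range_succ, List.flatMap_append, recTo]; simp

theorem recTo_congr {n : ℕ} {us : ℕ → ICode} {v v' : ℕ → Bool} {i : ℕ}
    (hv : ∀ j < i, v (n + j) = v' (n + j)) : recTo n us v i = recTo n us v' i := by
  induction i with
  | zero => rfl
  | succ i ih => rw [recTo_succ, recTo_succ, ih fun j hj => hv j (by omega), hv i (by omega)]

theorem length_recTo_le (n : ℕ) (us : ℕ → ICode) (v : ℕ → Bool) (i : ℕ) :
    (recTo n us v i).length ≤ i := by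
  induction i with
  | zero => simp [recTo]
  | succ i ih =>
    rw [recTo_succ, List.length_append]
    cases decide ((us i).1 = 2) <;> simp <;> omega

theorem ZeroAt.step {N : ℕ} {a a' : Fin A} (hne : a' ≠ a) {B : Op (A + N)} (hB : ZeroAt rfl a' B)
    (s : Instr N) : ZeroAt rfl a' (conjOn (A + N) (stepRots A N s.code a) B) := by
  cases s with
  | idle => simpa [stepRots, Instr.code, conjOn] using hB
  | gate u => exact hB.frame_up rfl (gateRots N u.code)
  | meas q role => exact hB.copy rfl hne

theorem sum_run_step {N : ℕ} {C : Circuit N} {rd : List Bool} (f : Record → ℝ) {n i k : ℕ} (us : ℕ → ICode) (s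
    : Instr N) (hs : us i = s.code) (hC : ∀ m : List Bool, m.length ≤ i → C.step i m rd = s) (ha : n + i < A)
    {B : Op (A + N)} (hB : ZeroAt rfl (⟨n + i, ha⟩ : Fin A) B) : ∑ v : Fin A → Bool, C.run rd f (k + 1) i
    (recTo n us (bitOf v) i) (blk rfl v v B) = ∑ v : Fin A → Bool, C.run rd f k (i + 1) (recTo n us (bitOf v)
    (i + 1))
        (blk rfl v v (conjOn (A + N) (stepRots A N (us i) (n + i)) B)) := by
  have hlen : ∀ v, C.step i (recTo n us v i).history rd = s := fun v => hC _ (by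
    rw [Record.history, List.length_map]; exact length_recTo_le ..)
  cases s with
  | idle =>
    refine Finset.sum_congr rfl fun v _ => ?_
    rw [Circuit.run, hlen, recTo_succ, hs]
    simp [Instr.apply, Instr.code, stepRots, conjOn_nil]
  | gate u =>
    refine Finset.sum_congr rfl fun v _ => ?_
    rw [Circuit.run, hlen, recTo_succ, hs]
    have : blk rfl v v (conjOn (A + N) (stepRots A N (Instr.gate u).code (n + i)) B) = frame N (gateRots N
      u.code) * blk rfl v v B * (frame N (gateRots N u.code))ᴴ := blk_frame_up rfl (gateRots N u.code) v v B
    rw [this]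
    simp [Instr.apply, Instr.code, Gate.conj_eq]
  | meas q role =>
    have e : stepRots A N (us i) (n + i) = copyRots (A + N) A q (⟨n + i, ha⟩ : Fin A) := by
      rw [hs]; rfl
    let F (b : Bool) (v : Fin A → Bool) : ℝ := C.run rd f k (i + 1)
      (recTo n us (bitOf v) i ++ [(role, b)]) (projZ q b * blk rfl v v B * projZ q b)
    have h1 := sum_update (⟨n + i, ha⟩ : Fin A) F fun b v hv => by
      simp only [F]
      rw [hB v v (Or.inl hv), mul_zero, zero_mul, Circuit.run_zero]
    have h2 : ∀ v, C.run rd f (k + 1) i (recTo n us (bitOf v) i) (blk rfl v v B) = F false v + F true v := by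
      intro v
      rw [Circuit.run, hlen]
      simp [Instr.apply, F]
    rw [Finset.sum_congr rfl fun v _ => h2 v, ← h1]
    refine Finset.sum_congr rfl fun v _ => ?_
    simp only [F]
    rw [e, conjOn, blk_copy_diag rfl v hB, recTo_succ, hs]
    have h3 : bitOf v (n + i) = v ⟨n + i, ha⟩ := by rw [bitOf, dif_pos ha]
    have h4 : recTo n us (bitOf (Function.update v ⟨n + i, ha⟩ false)) i = recTo n us (bitOf v) i :=
      recTo_congr fun j hj => by
        rw [bitOf, bitOf, dif_pos (by omega), dif_pos (by omega), Function.update_of_ne]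
        intro e; have := congrArg Fin.val e; simp at this; omega
    rw [h4]
    simp [Instr.code, h3]

/-- The state of the circuit is spread over the diagonal blocks, and the record of a block is read
off the values of its ancillas. Step `i` uses ancilla `n + i`, so the ancillas of later steps remain
in the state 0. -/
theorem sum_run_defer {N : ℕ} {C : Circuit N} {rd : List Bool} (f : Record → ℝ) {n : ℕ} (us : ℕ → ICode) (s :
    ℕ → Instr N) (hs : ∀ i < C.length, us i = (s i).code) (hC : ∀ i < C.length, ∀ m : List Bool, m.length ≤ i
    → C.step i m rd = s i) (hA : n + C.length ≤ A) {B₀ : Op (A + N)} {base : List PStr} (hB : ∀ j (hj : n + j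
    < A), ZeroAt rfl (⟨n + j, hj⟩ : Fin A) (conjOn (A + N) base B₀)) : ∑ v : Fin A → Bool, C.run rd f C.length
    0 [] (blk rfl v v (conjOn (A + N) base B₀)) = ∑ v : Fin A → Bool, f (recTo n us (bitOf v) C.length) *
        (blk rfl v v (conjOn (A + N) (opsTo A N n us base C.length) B₀)).trace.re := by
  have hz : ∀ i ≤ C.length, ∀ j ≥ i, ∀ hj : n + j < A,
      ZeroAt rfl (⟨n + j, hj⟩ : Fin A) (conjOn (A + N) (opsTo A N n us base i) B₀) := by
    intro i
    induction i with
    | zero => exact fun _ j _ hj => hB j hj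
    | succ i ih =>
      intro hi j hij hj
      rw [opsTo, conjOn_append, hs i hi]
      refine (ih (by omega) j (by omega) hj).step (a := ⟨n + i, by omega⟩) ?_ (s i)
      intro e; have := congrArg Fin.val e; simp at this; omega
  have key : ∀ k i, i + k = C.length → ∑ v : Fin A → Bool, C.run rd f k i (recTo n us (bitOf v) i) (blk rfl v
      v (conjOn (A + N) (opsTo A N n us base i) B₀)) = ∑ v : Fin A → Bool, f (recTo n us (bitOf v) C.length) *
        (blk rfl v v (conjOn (A + N) (opsTo A N n us base C.length) B₀)).trace.re := by
    intro k
    induction k with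
    | zero =>
      intro i hi
      rw [Nat.add_zero] at hi
      subst hi
      rfl
    | succ k ih =>
      intro i hi
      rw [sum_run_step f us (s i) (hs i (by omega)) (hC i (by omega)) (by omega)
        (hz i (by omega) i le_rfl (by omega)), ← ih (i + 1) (by omega)]
      refine Finset.sum_congr rfl fun v _ => ?_
      rw [opsTo, conjOn_append]
  exact key _ 0 (Nat.zero_add _)

end deferral

/-! ### The mixed lines -/

section base
variable {n t : ℕ}

def pdiag (n : ℕ) (w : ℕ → Bool → ℂ) : Op n := Matrix.diagonal fun a => ∏ i : Fin n, w i (a i)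

theorem ket_eq_pdiag (v : ℕ → Bool) : ket n v = pdiag n fun i b => if b = v i then 1 else 0 := by
  classical
  rw [ket, pdiag]
  congr 1
  funext a
  by_cases h : ∀ i : Fin n, a i = v i
  · rw [if_pos h, Finset.prod_eq_one fun i _ => if_pos (h i)]
  · rw [if_neg h]
    push Not at h
    obtain ⟨i, hi⟩ := h
    exact (Finset.prod_eq_zero (Finset.mem_univ i) (if_neg hi)).symm

theorem sum_ket (S : ES) : ((2 : ℂ) ^ n)⁻¹ • ∑ r : Fin n → Bool, ket n (S.fill (List.ofFn r)) =
    pdiag n fun i b => cond (S.kn i) (if b = S.vl i then 1 else 0) 2⁻¹ := by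
  classical
  have h1 : ∀ r : Fin n → Bool, ket n (S.fill (List.ofFn r)) = Matrix.diagonal fun a =>
      ∏ i : Fin n, if a i = cond (S.kn i) (S.vl i) (r i) then (1 : ℂ) else 0 := fun r => by
    rw [ket_eq_pdiag, pdiag]
    congr 1; funext a
    refine Finset.prod_congr rfl fun i _ => ?_
    rw [ES.fill]
    simp [List.getD_eq_getElem?_getD]
  ext a b
  rw [Matrix.smul_apply, Matrix.sum_apply, pdiag]
  simp only [h1, Matrix.diagonal_apply]
  by_cases hab : a = b
  swap
  · simp [hab]
  simp only [if_pos hab]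
  have h2 := Finset.prod_univ_sum (fun _ : Fin n => (Finset.univ : Finset Bool))
    fun i c => if a i = cond (S.kn i) (S.vl i) c then (1 : ℂ) else 0
  rw [Fintype.piFinset_univ] at h2
  rw [← h2, smul_eq_mul, ← inv_pow, ← Fin.prod_const, ← Finset.prod_mul_distrib]
  refine Finset.prod_congr rfl fun i _ => ?_
  rw [Fintype.sum_bool]
  cases S.kn i
  · cases a i <;> simp
  · simp only [cond_true]; split_ifs <;> norm_num

end base

section
variable {A n t N : ℕ}

def flipAt {N : ℕ} (q : Fin N) (x : Fin N → Bool) : Fin N → Bool := Function.update x q (!x q)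

theorem flipAt_flipAt {N : ℕ} (q : Fin N) (x : Fin N → Bool) : flipAt q (flipAt q x) = x := by
  simp [flipAt]

theorem op_X_mul (q : Fin N) (B : Op N) (x y : Fin N → Bool) :
    ((X N q).op N * B) x y = B (flipAt q x) y := by
  rw [Matrix.mul_apply, Finset.sum_eq_single (flipAt q x), op_X_apply, if_pos, one_mul]
  · exact (flipAt_flipAt q x).symm
  · intro z _ hz
    rw [op_X_apply, if_neg, zero_mul]
    rintro rfl
    exact hz (flipAt_flipAt q z).symm
  · simp

theorem mul_op_X (q : Fin N) (B : Op N) (x y : Fin N → Bool) :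
    (B * (X N q).op N) x y = B x (flipAt q y) := by
  rw [Matrix.mul_apply, Finset.sum_eq_single (flipAt q y), op_X_apply, if_pos (by rfl), mul_one]
  · intro z _ hz
    rw [op_X_apply, if_neg (by exact hz), mul_zero]
  · simp

/-- A quarter turn about `X` gives the mean of `B` and its flip, plus cross terms. The latter are
off-diagonal in line `q` because `B` is diagonal there, and the measurement removes them. -/
theorem dephase_apply (q : Fin N) (B : Op N) (hB : ∀ x y, x q ≠ y q → B x y = 0) (x y : Fin N → Bool) : (projZ
    q false * conjOn N [X N q] B * projZ q false + projZ q true * conjOn N [X N q] B * projZ q true) x y =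
      2⁻¹ * (B x y + B (flipAt q x) (flipAt q y)) := by
  have hR : frame N [X N q] = rotOp N (X N q) := by simp [frame]
  have hc : conjOn N [X N q] B = (2 : ℂ)⁻¹ • (B + (X N q).op N * B * (X N q).op N +
      Complex.I • ((X N q).op N * B) - Complex.I • (B * (X N q).op N)) := by
    rw [conjOn, hR, rotOp_conjTranspose (herm_X N q), rotOp]
    rw [smul_mul_assoc, smul_mul_assoc, mul_smul_comm, smul_smul, sqrt2_inv_mul_self]
    congr 1
    simp only [add_mul, mul_sub, mul_add, one_mul, mul_one, smul_mul_assoc, mul_smul_comm, smul_smul,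
      Complex.I_mul_I, smul_sub, smul_add, neg_smul, one_smul]
    abel
  rw [Matrix.add_apply, projZ_sandwich, projZ_sandwich]
  have hf : ∀ z : Fin N → Bool, flipAt q z q = !z q := fun z => by simp [flipAt]
  by_cases hxy : x q = y q
  · have h1 : conjOn N [X N q] B x y = 2⁻¹ * (B x y + B (flipAt q x) (flipAt q y)) := by
      rw [hc]
      simp only [Matrix.smul_apply, Matrix.add_apply, Matrix.sub_apply, mul_op_X, op_X_mul, smul_eq_mul]
      rw [hB (flipAt q x) y (by rw [hf, hxy]; cases y q <;> simp),
        hB x (flipAt q y) (by rw [hf, hxy]; cases y q <;> simp)]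
      ring
    rw [h1, hxy]
    cases y q <;> simp
  · rw [hB x y hxy, hB (flipAt q x) (flipAt q y) (by rw [hf, hf]; simpa using hxy)]
    revert hxy
    cases x q <;> cases y q <;> simp

theorem dephase_pdiag (w : ℕ → Bool → ℂ) (q : Fin n) (ρ : Op t) : projZ (Fin.castAdd t q) false * conjOn (n +
    t) [X (n + t) q] (tensor (pdiag n w) ρ) * projZ (Fin.castAdd t q) false + projZ (Fin.castAdd t q) true *
    conjOn (n + t) [X (n + t) q] (tensor (pdiag n w) ρ) * projZ (Fin.castAdd t q) true =
      tensor (pdiag n (Function.update w q fun b => 2⁻¹ * (w q b + w q !b))) ρ := by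
  ext x y
  have := dephase_apply (Fin.castAdd t q) (tensor (pdiag n w) ρ) (fun x y hxy => by
    rw [tensor, pdiag, Matrix.diagonal_apply_ne _ fun e => hxy (congrFun e q), zero_mul]) x y
  rw [Fin.val_castAdd] at this
  rw [this]
  have h1 : ∀ x : Fin (n + t) → Bool, (fun i => flipAt (Fin.castAdd t q) x (Fin.natAdd n i)) =
      fun i => x (Fin.natAdd n i) := fun x => by
    funext i
    rw [flipAt, Function.update_of_ne]
    intro e; have := congrArg Fin.val e; simp at this; omega
  have h2 : ∀ x : Fin (n + t) → Bool, (fun i => flipAt (Fin.castAdd t q) x (Fin.castAdd t i)) =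
      flipAt q fun i => x (Fin.castAdd t i) := fun x => by
    funext i
    by_cases hi : i = q
    · subst hi; simp [flipAt]
    · rw [flipAt, flipAt, Function.update_of_ne hi, Function.update_of_ne]
      intro e; exact hi (Fin.castAdd_injective n t e)
  simp only [tensor]
  rw [h1, h1, h2, h2, ← add_mul, ← mul_assoc]
  congr 1
  generalize (fun i => x (Fin.castAdd t i)) = a
  generalize (fun i => y (Fin.castAdd t i)) = b
  simp only [pdiag, Matrix.diagonal_apply]
  by_cases hab : a = b
  · subst hab
    rw [if_pos rfl, if_pos rfl, if_pos rfl]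
    rw [← Finset.mul_prod_erase Finset.univ (fun i : Fin n => w i (a i)) (Finset.mem_univ q), ←
      Finset.mul_prod_erase Finset.univ (fun i : Fin n => w i (flipAt q a i)) (Finset.mem_univ q), ←
      Finset.mul_prod_erase Finset.univ (fun i : Fin n => Function.update w (q : ℕ) (fun b => 2⁻¹ * (w q b + w
      q !b)) i (a i)) (Finset.mem_univ q)]
    have e1 : ∏ i ∈ Finset.univ.erase q, w i (flipAt q a i) = ∏ i ∈ Finset.univ.erase q, w i (a i) :=
      Finset.prod_congr rfl fun i hi => by
        rw [flipAt, Function.update_of_ne (Finset.ne_of_mem_erase hi)]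
    have e2 : ∏ i ∈ Finset.univ.erase q, Function.update w (q : ℕ)
        (fun b => 2⁻¹ * (w q b + w q !b)) i (a i) = ∏ i ∈ Finset.univ.erase q, w i (a i) :=
      Finset.prod_congr rfl fun i hi => by
        rw [Function.update_of_ne fun e => Finset.ne_of_mem_erase hi (Fin.ext e)]
    rw [e1, e2, Function.update_self, flipAt, Function.update_self]
    ring
  · rw [if_neg hab, if_neg hab, if_neg fun e => hab ?_]
    · simp
    · rw [← flipAt_flipAt q a, e, flipAt_flipAt]

/-- The rotations that put copies of random bits on the lines `0, …, k - 1` which are not known. -/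
def mixRots (A N : ℕ) (kn : ℕ → Bool) : ℕ → List PStr
  | 0 => []
  | i + 1 => cond (kn i) [] (copyRots (A + N) A i i ++ [X N i].map (up A)) ++ mixRots A N kn i

/-- The mixed lines of the stabiliser state are produced with ancillas and not with bits of the
random string. In this way the probability of the postselection does not depend on that string. -/
theorem sum_blk_mixRots (kn : ℕ → Bool) (v : ℕ → Bool) (ρ : Op t) (hn : n ≤ A) {B₀ : Op (A + (n + t))} (h0 : ∀
    a : Fin A, ZeroAt rfl a B₀) (hB : ∑ u, blk rfl u u B₀ = tensor (ket n v) ρ) (k : ℕ) (hk : k ≤ n) : (∀ j ≥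
    k, ∀ hj : j < A, ZeroAt rfl (⟨j, hj⟩ : Fin A) (conjOn (A + (n + t)) (mixRots A (n + t) kn k) B₀)) ∧ ∑ u :
    Fin A → Bool, blk rfl u u (conjOn (A + (n + t)) (mixRots A (n + t) kn k) B₀) =
      tensor (pdiag n fun i b => cond (kn i || decide (k ≤ i)) (if b = v i then 1 else 0) 2⁻¹) ρ := by
  induction k with
  | zero =>
    rw [mixRots]
    simp only [conjOn_nil]
    refine ⟨fun j _ hj => h0 _, hB.trans ?_⟩
    rw [ket_eq_pdiag]
    simp
  | succ k ih =>
    obtain ⟨ih1, ih2⟩ := ih (by omega)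
    rw [mixRots]
    cases hkn : kn k
    · rw [cond_false, conjOn_append, conjOn_append]
      have hz : ∀ j ≥ k, ∀ hj : j < A, ZeroAt rfl (⟨j, hj⟩ : Fin A) (conjOn (A + (n + t)) ([X (n + t) k].map
          (up A)) (conjOn (A + (n + t)) (mixRots A (n + t) kn k) B₀)) := fun j hj hj' => (ih1 j hj
          hj').frame_up rfl _
      refine ⟨fun j hj hj' => (hz j (by omega) hj').copy rfl (a := ⟨k, by omega⟩)
        (q := ⟨k, by omega⟩) fun e => ?_, ?_⟩
      · have := congrArg Fin.val e; simp at this; omega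
      have h1 : ∀ u : Fin A → Bool, blk rfl u u (conjOn (A + (n + t)) (copyRots (A + (n + t)) A k k)
          (conjOn (A + (n + t)) ([X (n + t) k].map (up A)) (conjOn (A + (n + t))
            (mixRots A (n + t) kn k) B₀))) = _ := fun u =>
        blk_copy_diag rfl (a := ⟨k, by omega⟩) (q := Fin.castAdd t (⟨k, by omega⟩ : Fin n)) u (hz k le_rfl _)
      rw [Finset.sum_congr rfl fun u _ => h1 u]
      have h2 := sum_update (⟨k, by omega⟩ : Fin A) (fun b u =>
        projZ (Fin.castAdd t (⟨k, by omega⟩ : Fin n)) b * blk rfl u u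
          (conjOn (A + (n + t)) ([X (n + t) k].map (up A)) (conjOn (A + (n + t))
            (mixRots A (n + t) kn k) B₀)) * projZ (Fin.castAdd t (⟨k, by omega⟩ : Fin n)) b)
        fun b u hu => by rw [hz k le_rfl _ u u (Or.inl hu), mul_zero, zero_mul]
      refine h2.trans ?_
      have h3 : ∀ u : Fin A → Bool, blk rfl u u (conjOn (A + (n + t)) ([X (n + t) k].map (up A))
          (conjOn (A + (n + t)) (mixRots A (n + t) kn k) B₀)) = _ := fun u => blk_frame_up rfl _ u u _
      simp only [h3]
      rw [Finset.sum_add_distrib]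
      simp only [← Finset.sum_mul, ← Finset.mul_sum]
      rw [ih2]
      refine (dephase_pdiag _ (⟨k, by omega⟩ : Fin n) ρ).trans ?_
      congr 2
      funext i b
      by_cases hi : i = k
      · subst hi
        simp only [Function.update_self, hkn]
        cases b <;> cases v i <;> simp
      · rw [Function.update_of_ne hi]
        have : decide (k + 1 ≤ i) = decide (k ≤ i) := by rw [decide_eq_decide]; omega
        rw [this]
    · rw [cond_true, List.nil_append]
      refine ⟨fun j hj => ih1 j (by omega), ih2.trans ?_⟩
      congr 2
      funext i b
      by_cases hi : i = k
      · subst hi; simp [hkn]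
      · have : decide (k + 1 ≤ i) = decide (k ≤ i) := by rw [decide_eq_decide]; omega
        rw [this]

/-- The rotations that produce the stabiliser state. -/
def baseRots (A n t : ℕ) (S : ES) : List PStr := S.ops.map (up A) ++ mixRots A (n + t) S.kn n

theorem sum_blk_baseRots {L : List (SPauli n)} (hL : IsStabGens L) (ρ : Op t) (hn : n ≤ A) {B₀ : Op (A + (n +
    t))} (h0 : ∀ a : Fin A, ZeroAt rfl a B₀) (hB : ∑ u, blk rfl u u B₀ = tensor (ket n (engineOf L).vl) ρ) :
    (∀ j ≥ n, ∀ hj : j < A, ZeroAt rfl (⟨j, hj⟩ : Fin A) (conjOn (A + (n + t)) (baseRots A n t (engineOf L))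
    B₀)) ∧ ∑ u : Fin A → Bool, blk rfl u u (conjOn (A + (n + t))
      (baseRots A n t (engineOf L)) B₀) = tensor (stabState L) ρ := by
  obtain ⟨h1, h2⟩ := sum_blk_mixRots (engineOf L).kn (engineOf L).vl ρ hn h0 hB n le_rfl
  rw [baseRots, conjOn_append]
  refine ⟨fun j hj hj' => (h1 j hj hj').frame_up rfl _, ?_⟩
  have h3 : ∀ (B : Op (A + (n + t))) (u : Fin A → Bool), blk rfl u u (conjOn (A + (n + t))
      ((engineOf L).ops.map (up A)) B) = _ := fun B u => blk_frame_up rfl _ u u B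
  simp only [h3, ← Finset.sum_mul, ← Finset.mul_sum]
  rw [h2, tensor_stabState hL]
  simp only [← Finset.sum_mul, ← Finset.mul_sum, ← tensor_sum_left, ← tensor_sum_left]
  rw [← smul_mul_assoc, ← mul_smul_comm, ← tensor_smul_left, sum_ket]
  congr 3
  rw [pdiag, pdiag]
  congr 1
  funext a
  refine Finset.prod_congr rfl fun i _ => ?_
  rw [decide_eq_false (Nat.not_le.2 i.2), Bool.or_false]

end

/-! ### The measurement of a fixed list of lines -/

/-- The value of `f` at the end of the measurements of the lines of a list. -/
def mrun (N : ℕ) : List (ℕ × Role) → (Record → ℝ) → Record → Op N → ℝ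
  | [], f, m, B => f m * B.trace.re
  | e :: L, f, m, B =>
    mrun N L f (m ++ [(e.2, false)]) (pproj N (Z N e.1) false * B * pproj N (Z N e.1) false) +
    mrun N L f (m ++ [(e.2, true)]) (pproj N (Z N e.1) true * B * pproj N (Z N e.1) true)

theorem mrun_congr {N : ℕ} (L : List (ℕ × Role)) {f g : Record → ℝ} {m : Record}
    (h : ∀ l : Record, l.map Prod.fst = L.map Prod.snd → f (m ++ l) = g (m ++ l)) (B : Op N) :
    mrun N L f m B = mrun N L g m B := by
  induction L generalizing m B with
  | nil => rw [mrun, mrun, ← List.append_nil m, h [] rfl]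
  | cons e L ih =>
    have h' : ∀ b (l : Record), l.map Prod.fst = L.map Prod.snd →
        f (m ++ [(e.2, b)] ++ l) = g (m ++ [(e.2, b)] ++ l) := fun b l hl => by
      rw [List.append_assoc, h _ (by simp [hl])]
    rw [mrun, mrun, ih (h' _), ih (h' _)]

theorem mrun_eq_zero {N : ℕ} (L : List (ℕ × Role)) {f : Record → ℝ} {m : Record}
    (h : ∀ l, f (m ++ l) = 0) (B : Op N) : mrun N L f m B = 0 := by
  induction L generalizing m B with
  | nil => rw [mrun, ← List.append_nil m, h, zero_mul]
  | cons e L ih =>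
    rw [mrun, ih fun l => by rw [List.append_assoc, h], ih fun l => by rw [List.append_assoc, h], add_zero]

theorem Circuit.run_eq_mrun {t : ℕ} {D : Circuit t} {rd : List Bool} {f : Record → ℝ}
    (L : List (ℕ × Role)) (hL : ∀ e ∈ L, e.1 < t) (i : ℕ) (m : Record) (B : Op t)
    (h : ∀ s (hs : s < L.length), ∀ h, D.step (i + s) h rd = (measI L[s]).toInstr t) :
    D.run rd f L.length i m B = mrun t L f m B := by
  induction L generalizing i m B with
  | nil => rfl
  | cons e L ih =>
    have h0 := h 0 (by simp) m.history
    rw [List.getElem_cons_zero, Nat.add_zero] at h0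
    have h1 := toInstr_meas (⟨e.1, hL e (by simp)⟩ : Fin t) e.2
    have h2 := fun m B => ih (fun e he => hL e (by simp [he])) (i + 1) m B fun s hs l => by
      have := h (s + 1) (by simpa using hs) l
      rw [List.getElem_cons_succ, ← Nat.add_assoc, Nat.add_right_comm] at this
      exact this
    rw [List.length_cons, run_meas _ _ _ _ _ _ (h0.trans h1), h2, h2, mrun]

theorem gatesOn_append {N : ℕ} (G G' : List GCode) (B : Op N) :
    gatesOn N (G ++ G') B = gatesOn N G' (gatesOn N G B) := by
  rw [gatesOn, gatesOn, gatesOn, innerRots, innerRots, innerRots, List.flatMap_append, frame_append,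
    Matrix.conjTranspose_mul]
  simp only [mul_assoc]

/-- Gates that avoid a measured line commute with its projector. Therefore all gates of the real
device can be done before all its measurements. -/
theorem gatesOn_pproj {N : ℕ} {kn : ℕ → Bool} {G : List GCode} (hG : GatesOff N kn G) {j : ℕ} (hj : j < N) (hk
    : kn j = true) (b : Bool) (B : Op N) : gatesOn N G (pproj N (Z N j) b * B * pproj N (Z N j) b) =
      pproj N (Z N j) b * gatesOn N G B * pproj N (Z N j) b := by
  have hH := innerRots_herm hG
  have hp := pull_innerRots_Z hG hj hk
  have h1 : pproj N (Z N j) b * frame N (innerRots N G) = frame N (innerRots N G) * pproj N (Z N j) b := by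
    have := op_mul_frame hH (Z N j)
    rw [hp] at this
    simp only [pproj, smul_mul_assoc, mul_smul_comm, add_mul, mul_add, one_mul, mul_one, this]
  have h2 : (frame N (innerRots N G))ᴴ * pproj N (Z N j) b =
      pproj N (Z N j) b * (frame N (innerRots N G))ᴴ := by
    have := star_frame_mul_op hH (Z N j)
    rw [hp] at this
    simp only [pproj, smul_mul_assoc, mul_smul_comm, add_mul, mul_add, one_mul, mul_one, this]
  calc _ = ((frame N (innerRots N G))ᴴ * pproj N (Z N j) b) * B *
        (pproj N (Z N j) b * frame N (innerRots N G)) := by simp only [gatesOn, mul_assoc]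
    _ = _ := by rw [h1, h2]; simp only [gatesOn, mul_assoc]

/-! ### States of the engine which differ in signs only -/

namespace ES
variable {N : ℕ}

structure Same (N : ℕ) (S S' : ES) : Prop where
  ops : List.Forall₂ (fun T T' : PStr => ∀ i < N, T.x i = T'.x i ∧ T.z i = T'.z i) S.ops S'.ops
  kn : ∀ i < N, S.kn i = S'.kn i

theorem forall₂_bits_refl (ops : List PStr) : List.Forall₂ (fun T T' : PStr => ∀ i < N, T.x i = T'.x i ∧ T.z i
    = T'.z i) ops ops := List.forall₂_same.2 fun _ _ _ _ => ⟨rfl, rfl⟩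

theorem Same.refl (S : ES) : S.Same N S := ⟨forall₂_bits_refl _, fun _ _ => rfl⟩

theorem pull_bits {ops ops' : List PStr} (h : List.Forall₂ (fun T T' : PStr => ∀ i < N, T.x i = T'.x i ∧
    T.z i = T'.z i) ops ops') {R R' : PStr} (hR : ∀ i < N, R.x i = R'.x i ∧ R.z i = R'.z i) :
    ∀ i < N, (pull N ops R).x i = (pull N ops' R').x i ∧ (pull N ops R).z i = (pull N ops' R').z i := by
  induction h generalizing R R' with
  | nil => exact hR
  | cons hT _ ih => exact ih (rotConj_bits_congr hT hR).2

variable {S S' : ES} {e : ℕ × Role}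

theorem Same.pull (h : S.Same N S') (q : ℕ) : ∀ i < N, Ẑ[N, S, q].x i = (EGK.pull N S'.ops (Z N q)).x i ∧
    (EGK.pull N S.ops (Z N q)).z i = (EGK.pull N S'.ops (Z N q)).z i := pull_bits h.ops fun _ _ => ⟨rfl, rfl⟩

theorem Same.antiL (h : S.Same N S') (q : ℕ) :
    S.antiL N (EGK.pull N S.ops (Z N q)) = S'.antiL N (EGK.pull N S'.ops (Z N q)) :=
  List.filter_congr fun i hi => by
    rw [List.mem_range] at hi
    rw [h.kn i hi, (h.pull q i hi).1]

theorem Same.realL (h : S.Same N S') (q : ℕ) :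
    S.realL N (EGK.pull N S.ops (Z N q)) = S'.realL N (EGK.pull N S'.ops (Z N q)) :=
  List.filter_congr fun i hi => by
    rw [List.mem_range] at hi
    rw [h.kn i hi, (h.pull q i hi).1, (h.pull q i hi).2]

/-- The choice of line and gates reads only the bits of the pulled-back operator and which lines are
known. The exception is the flip for a postselected measurement, which depends on a sign. -/
theorem Same.plan (h : S.Same N S') (hr : e.2.isPost = false) :
    S.plan N (measI e) = S'.plan N (measI e) := by
  have hG : ∀ j, S.realGates N e.1 e.2 j = S'.realGates N e.1 e.2 j := fun j => by
    have hk : ∀ i < N, (S.ln.getD i (false, false)).1 = (S'.ln.getD i (false, false)).1 := h.kn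
    rw [realGates, realGates, hr, Bool.false_and, Bool.false_and, cond_false]
    congr 1
    rw [reduceGates, reduceGates]
    congr 1
    all_goals
      refine List.flatMap_congr fun i hi => ?_
      rw [List.mem_range] at hi
      rw [hk i hi, (h.pull e.1 i hi).1, (h.pull e.1 i hi).2]
  rw [measI, plan_meas_eq, plan_meas_eq, h.antiL, h.realL, hG]

theorem Same.pass (h : S.Same N S') (b b' : Bool) :
    (S.pass N (measI e) b).Same N (S'.pass N (measI e) b') := by
  refine ⟨?_, fun i hi => by rw [pass_kn, pass_kn, h.kn i hi]⟩
  rw [measI, pass_meas_eq, pass_meas_eq, h.antiL]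
  cases (S'.antiL N (EGK.pull N S'.ops (Z N e.1))).isEmpty
  · refine List.rel_append h.ops (.cons (fun i hi => ?_) .nil)
    have := h.pull e.1 i hi
    have hc : ∀ (S : ES) (Q : PStr) (j : ℕ) (b : Bool), (S.coinRot N Q j b).x i = (Q.mul N (Z N j)).x i ∧
        (S.coinRot N Q j b).z i = (Q.mul N (Z N j)).z i := fun S Q j b => by
      rw [coinRot]; cases (b ^^ S.vl j) <;> exact ⟨rfl, rfl⟩
    rw [(hc ..).1, (hc ..).1, (hc ..).2, (hc ..).2]
    simp only [PStr.mul, mk'_x hi, mk'_z hi, this.1, this.2, and_self]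
  · exact h.ops

theorem Same.take (h : S.Same N S') (p : Plan) (m m' : Bool) :
    (S.take N (measI e) p m).Same N (S'.take N (measI e) p m') :=
  ⟨List.rel_append h.ops (forall₂_bits_refl _), fun i hi => by rw [take_kn _ _ hi, take_kn _ _ hi, h.kn i hi]⟩

/-! ### The real measurements for a list of measurements -/

/-- The real measurements which are needed for the measurements of a list. -/
def plans (N : ℕ) : List (ℕ × Role) → ES → List Plan
  | [], _ => []
  | e :: ms, S =>
    match S.plan N (measI e) with
    | [] => plans N ms (S.pass N (measI e) false)
    | p :: _ => p :: plans N ms (S.take N (measI e) p false)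

/-- A measurement, with a random string and with all real outcomes. -/
def next (N : ℕ) (w h : List Bool) (S : ES) (e : ℕ × Role) : ES := cond (S.plan N (measI e)).isEmpty (S.pass N
  (measI e) (!e.2.isPost && w.getD S.log.length false)) (S.take N (measI e) ((S.plan N (measI e)).headD ([],
  0, .output)) (h.getD S.piv.length false))

def walk (N : ℕ) (w h : List Bool) (ms : List (ℕ × Role)) (S : ES) : ES := ms.foldl (next N w h) S

theorem plans_eq_walk (ms : List (ℕ × Role)) (S : ES) :
    (walk N [] [] ms S).gts = S.gts ++ (plans N ms S).flatMap Prod.fst ∧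
    (walk N [] [] ms S).piv = S.piv ++ (plans N ms S).map Prod.snd := by
  induction ms generalizing S with
  | nil => simp [walk, plans]
  | cons e ms ih =>
    rw [walk, List.foldl_cons, ← walk, plans]
    cases hp : S.plan N (measI e) with
    | nil =>
      simp only [next, hp, List.isEmpty_nil, cond_true, List.getD_nil, Bool.and_false]
      rw [(ih _).1, (ih _).2, (pass_fields _).2.1, (pass_fields _).2.2.2]
      exact ⟨rfl, rfl⟩
    | cons p l =>
      simp only [next, hp, List.isEmpty_cons, cond_false, List.getD_nil, List.headD_cons]
      rw [(ih _).1, (ih _).2, (take_fields _ _).2.1, (take_fields _ _).2.2.2]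
      simp

/-- Random bits and outcomes only affect signs and values, so for output measurements the whole list
of gates and lines is fixed in advance. -/
theorem plans_congr {ms : List (ℕ × Role)} (hr : ∀ e ∈ ms, e.2.isPost = false) {S S' : ES}
    (h : S.Same N S') : plans N ms S = plans N ms S' := by
  induction ms generalizing S S' with
  | nil => rfl
  | cons e ms ih =>
    have ih := fun {S S'} => ih (fun e he => hr e (by simp [he])) (S := S) (S' := S')
    rw [plans, plans, h.plan (hr e (by simp))]
    cases S'.plan N (measI e) with
    | nil => exact ih (h.pass _ _)
    | cons p l => exact congrArg _ (ih (h.take _ _ _))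

theorem plan_measI {e : ℕ × Role} (he : e.1 < N) {p : Plan} {l : List Plan} (hp : S.plan N (measI e) = p :: l) :
    GatesOff N S.kn p.1 ∧ p.2.1 < N ∧ S.kn p.2.1 = false ∧ p.2.2 = e.2 := by
  obtain ⟨j, ha, hr, rfl, -⟩ := plan_meas (q := ⟨e.1, he⟩) hp
  have := hr
  rw [Bool.and_eq_true, Bool.not_eq_true'] at this
  exact ⟨(realGates_spec j.2 ha hr).1, j.2, this.1, rfl⟩

theorem plans_spec {ms : List (ℕ × Role)} (hq : ∀ e ∈ ms, e.1 < N) (S : ES) :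
    (∀ p ∈ plans N ms S, GatesOff N S.kn p.1 ∧ p.2.1 < N ∧ S.kn p.2.1 = false ∧ ∃ e ∈ ms, p.2.2 = e.2) ∧
    ((plans N ms S).map fun p => p.2.1).Nodup := by
  induction ms generalizing S with
  | nil => exact ⟨fun p hp => by simp [plans] at hp, List.nodup_nil⟩
  | cons e ms ih =>
    have ih := ih fun e he => hq e (by simp [he])
    rw [plans]
    cases hp : S.plan N (measI e) with
    | nil =>
      refine ⟨fun p hp => ?_, (ih _).2⟩
      obtain ⟨h1, h2, h3, e', h4, h5⟩ := (ih _).1 p hp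
      have hk : (S.pass N (measI e) false).kn = S.kn := funext fun i => pass_kn _ _
      rw [hk] at h1 h3
      exact ⟨h1, h2, h3, e', by simp [h4], h5⟩
    | cons p l =>
      obtain ⟨h1, h2, h3, h4⟩ := plan_measI (hq e (by simp)) hp
      have hk : ∀ i < N, (S.take N (measI e) p false).kn i = false → S.kn i = false ∧ i ≠ p.2.1 := by
        intro i hi h
        rw [take_kn _ _ hi] at h
        simpa [and_comm] using h
      constructor
      · intro p' hp'
        rcases List.mem_cons.1 hp' with rfl | hp'
        · exact ⟨h1, h2, h3, e, by simp, h4⟩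
        · obtain ⟨g1, g2, g3, e', g4, g5⟩ := (ih _).1 p' hp'
          refine ⟨fun g hg => ?_, g2, (hk _ g2 g3).1, e', by simp [g4], g5⟩
          obtain ⟨a, b, c⟩ := g1 g hg
          exact ⟨a, (hk _ a.1 b).1, (hk _ a.2.1 c).1⟩
      · rw [List.map_cons, List.nodup_cons]
        refine ⟨fun h => ?_, (ih _).2⟩
        obtain ⟨p', hp', e'⟩ := List.mem_map.1 h
        obtain ⟨-, g2, g3, -⟩ := (ih _).1 p' hp'
        exact (hk _ g2 g3).2 e'

end ES

/-! ### The weight of a list of postselected and output measurements -/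

namespace ES
variable {N : ℕ} {S : ES} {B : Op N}

/-- The flip is inserted exactly if real and simulated outcome would differ. So a real postselection
to `+1` is a simulated one to `+1`. -/
theorem take_log_post (h : AllHerm N S.ops) {e : ℕ × Role} (hq : e.1 < N) (he : e.2 = .postselected)
    {p : Plan} {l : List Plan} (hp : S.plan N (measI e) = p :: l) (m : Bool) :
    (S.take N (measI e) p m).log = S.log ++ [(.postselected, m)] := by
  obtain ⟨q, role⟩ := e
  subst he
  obtain ⟨j, ha, hr, rfl, -⟩ := plan_meas (q := ⟨q, hq⟩) hp
  have hk := hr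
  rw [Bool.and_eq_true, Bool.not_eq_true'] at hk
  have hb := (realGates_spec (role := .output) j.2 ha hr).2 _ rfl j j.2
  have hoff := reduceGates_off (N := N) S.ln Ẑ[N, S, q] j.2 hk.1
  rw [realGates, show (Role.output.isPost && _) = false from rfl, cond_false, List.append_nil] at hb
  show S.log ++ [(Role.postselected, (S.real N (S.realGates N q .postselected j) j m .postselected).outc N
    (pull N (S.ops ++ innerRots N (S.realGates N q .postselected j)) (Z N q)))] = _
  rw [realGates]
  generalize reduceGates N S.ln Ẑ[N, S, q] j = G at *
  have hz : (pull N (S.ops ++ innerRots N G) (Z N q)).z j = true := (hb.2.1 hk.1).trans (by simp)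
  have hRh : (pull N (S.ops ++ innerRots N G) (Z N q)).Herm N :=
    pull_herm (h.append (innerRots_herm hoff)) (herm_Z N q)
  have h0 := outc_real (S := S) (G := G) j.2 (role := .postselected) hz m
  congr 3
  cases hc : (S.real N G j false .postselected).outc N (pull N (S.ops ++ innerRots N G) (Z N q))
  · rw [hc, Bool.false_xor] at h0
    rw [show (Role.postselected.isPost && false) = false from rfl, cond_false, List.append_nil]
    exact h0
  · rw [hc, Bool.true_xor] at h0
    have e : pull N (S.ops ++ innerRots N (G ++ flipGates j)) (Z N q) =
        pull N (innerRots N (flipGates j)) (pull N (S.ops ++ innerRots N G) (Z N q)) := by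
      rw [pull_append, pull_append, pull_innerRots_append]
    rw [show (Role.postselected.isPost && true) = true from rfl, cond_true, e]
    generalize pull N (S.ops ++ innerRots N G) (Z N q) = R at *
    have hv : par N (fun i => (pull N (innerRots N (flipGates j)) R).z i && (S.real N (G ++ flipGates j) j m
        .postselected).vl i) = par N fun i => R.z i && (S.real N G j m .postselected).vl i :=
      par_congr fun i hi => by rw [(flipGates_bits j.2 R i hi).2]; rfl
    rw [outc] at h0 ⊢
    rw [hv, flip_hi hRh hz, Bool.not_xor, h0, Bool.not_not]

theorem ok_append {m : Record} (h : m.ok = false) (l : Record) : Record.ok (m ++ l) = false := by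
  rw [← Bool.not_eq_true, Record.ok_iff] at h ⊢
  rw [Record.accepted_append]
  exact fun h' => h h'.1

theorem sim_eq_zero {us : ℕ → Record → ICode} {E : Set (List Bool)} {k i : ℕ} {r : List Bool}
    (h : S.log.ok = false) : sim N us (ind E) k i S B r = 0 := by
  induction k generalizing i S B r with
  | zero => rw [sim, ind_of_not_ok h, zero_mul]
  | succ k ih =>
    rw [sim]
    cases S.plan N (us i S.log) with
    | nil =>
      obtain ⟨l, hl, -⟩ := pass_log (N := N) (S := S) (u := us i S.log) (b := r.headD false)
      exact ih (by rw [hl]; exact ok_append h l)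
    | cons p _ =>
      have h1 : ∀ m B, sim N us (ind E) k (i + 1) (S.take N (us i S.log) p m) B r.tail = 0 := fun m B => by
        obtain ⟨l, hl, -⟩ := take_log (N := N) (S := S) (u := us i S.log) (p := p) (m := m)
        exact ih (by rw [hl]; exact ok_append h l)
      dsimp only
      rw [h1, h1, add_zero]

/-- The value of a run of the real device with record `m`. -/
def value (N : ℕ) (ms : List (ℕ × Role)) (S : ES) (E : Set (List Bool)) (w : List Bool) (m : Record) : ℝ :=
  cond m.ok (ind E (walk N w m.history ms S).log) 0

theorem mrun_value_eq_zero {ms : List (ℕ × Role)} {E : Set (List Bool)} {w : List Bool} {m : Record}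
    (hm : m.ok = false) (L : List (ℕ × Role)) : mrun N L (value N ms S E w) m B = 0 := by
  refine mrun_eq_zero _ (fun l => ?_) _
  rw [value, ok_append hm]; rfl

/-- `w` consists of the random bits of the steps so far, one per step even if it was not read; so
the length of the log is the position of the next bit. -/
structure Ready (N : ℕ) (us : ℕ → Record → ICode) (i : ℕ) (ms : List (ℕ × Role)) (S : ES) (B : Op N)
    (w : List Bool) (m : Record) : Prop where
  step : ∀ j (hj : j < ms.length), ∀ l, us (i + j) l = measI ms[j]
  inv : S.Inv N B
  log : S.log.length = w.length
  piv : S.piv.length = m.length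
  ok : m.ok = true

section
variable {us : ℕ → Record → ICode} {i : ℕ} {e : ℕ × Role} {ms : List (ℕ × Role)} {w : List Bool} {m : Record}

theorem pass_log_length (b : Bool) : (S.pass N (measI e) b).log.length = S.log.length + 1 := by
  rw [measI, pass_meas_eq]
  cases (S.antiL N Ẑ[N, S, e.1]).isEmpty <;> exact List.length_append

theorem Ready.pass (h : Ready N us i (e :: ms) S B w m) (hq : e.1 < N) (hp : S.plan N (measI e) = [])
    (b c : Bool) : Ready N us (i + 1) ms (S.pass N (measI e) b) B (w ++ [c]) m :=
  ⟨fun j hj l => by rw [Nat.add_assoc, Nat.add_comm 1]; exact h.step (j + 1) (by simpa using hj) l,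
    h.inv.pass (.meas ⟨e.1, hq⟩ e.2) hp b, by simp [pass_log_length, h.log],
    by rw [(pass_fields b).2.1, h.piv], h.ok⟩

theorem Ready.take (h : Ready N us i (e :: ms) S B w m) (hq : e.1 < N) {p : Plan} {l : List Plan}
    (hp : S.plan N (measI e) = p :: l) (b : Bool) {c : Bool} (hc : e.2 = .postselected → c = false) :
    Ready N us (i + 1) ms (S.take N (measI e) p c) (realOn N p.1 p.2.1 c B) (w ++ [b]) (m ++ [(e.2, c)]) :=
  ⟨fun j hj l => by rw [Nat.add_assoc, Nat.add_comm 1]; exact h.step (j + 1) (by simpa using hj) l,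
    h.inv.take (u := .meas ⟨e.1, hq⟩ e.2) hp c, by rw [List.length_append, ← h.log]; exact List.length_append,
    by simp [(take_fields p c).2.1, h.piv], by
      have := h.ok
      rw [Record.ok_iff] at this ⊢
      rw [Record.accepted_append]
      exact ⟨this, fun e' he' => by rw [List.mem_singleton.1 he']; exact hc⟩⟩

end

/-- Each postselected measurement with a coin as its outcome contributes a factor 1/2 to `κ`,
because only one value of the coin is accepted. With the postselected measurements first, only the
continuation with `+1` matters for them, and afterwards the plans no longer depend on outcomes. `κ`
is chosen before the event and the state. -/
theorem exists_avgL_sim_eq {ms : List (ℕ × Role)} (hq : ∀ e ∈ ms, e.1 < N)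
    (hr : ms.Pairwise fun e e' => e.2 = .output → e'.2 = .output)
    (hr' : ∀ e ∈ ms, e.2 ≠ .internal) (S : ES) :
    ∃ κ : ℝ, 0 < κ ∧ ((∀ e ∈ ms, e.2 = .output) → κ = 1) ∧
      ∀ us i (E : Set (List Bool)) B w' m, Ready N us i ms S B w' m →
      avgL ms.length (sim N us (ind E) ms.length i S B) = κ * avgL ms.length fun w =>
        mrun N ((plans N ms S).map Prod.snd) (value N ms S E (w' ++ w)) m
          (gatesOn N ((plans N ms S).flatMap Prod.fst) B) := by
  induction ms generalizing S with
  | nil =>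
    refine ⟨1, one_pos, fun _ => rfl, fun us i E B w' m h => ?_⟩
    simp [avgL, sim, plans, mrun, value, h.ok, gatesOn, walk]
  | cons e ms ih =>
    have hq1 := hq e (by simp)
    obtain ⟨hr1, hr2⟩ := List.pairwise_cons.1 hr
    have ih := ih (fun e he => hq e (by simp [he])) hr2 fun e he => hr' e (by simp [he])
    have ho : e.2 = .output ∨ e.2 = .postselected := by
      have := hr' e (by simp)
      revert this; cases e.2 <;> simp
    have hus : ∀ {us i B w' m}, Ready N us i (e :: ms) S B w' m → us i S.log = measI e :=
      fun h => h.step 0 (by simp) _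
    cases hp : S.plan N (measI e) with
    | nil =>
      have hpl : plans N (e :: ms) S = plans N ms (S.pass N (measI e) false) := by rw [plans, hp]
      have hval : ∀ E w, value N (e :: ms) S E w = value N ms (S.pass N (measI e)
          (!e.2.isPost && w.getD S.log.length false)) E w := fun E w => by
        funext m
        rw [value, value, walk, List.foldl_cons, next, hp]; rfl
      rcases ho with ho | ho
      · have hall : ∀ e ∈ ms, e.2 = .output := fun e he => hr1 e he ho
        refine ⟨1, one_pos, fun _ => rfl, fun us i E B w' m hR => ?_⟩
        have hb : ∀ b, avgL ms.length (fun w => sim N us (ind E) ms.length (i + 1)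
            (S.pass N (measI e) b) B w) = avgL ms.length fun w =>
            mrun N ((plans N (e :: ms) S).map Prod.snd) (value N (e :: ms) S E (w' ++ b :: w)) m
              (gatesOn N ((plans N (e :: ms) S).flatMap Prod.fst) B) := fun b => by
          obtain ⟨κ', -, hκ', h'⟩ := ih (S.pass N (measI e) b)
          have := h' _ _ E _ _ _ (hR.pass hq1 hp b b)
          rw [hκ' hall, one_mul] at this
          refine this.trans ?_
          -- The plans after the bit `b` are those after the bit `false`, which the device has
          -- fixed.
          rw [hpl, plans_congr (fun e he => by rw [hall e he]; rfl) (Same.pass (.refl S) false b)]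
          refine avgL_congr fun w _ => ?_
          rw [hval, ho, hR.log, List.append_assoc, List.singleton_append,
            List.getD_append_right _ _ _ _ le_rfl, Nat.sub_self, List.getD_cons_zero]
          rfl
        rw [one_mul, List.length_cons, avgL, avgL]
        simp only [sim, hus hR, hp, List.headD, List.tail_cons, hb]
      · obtain ⟨κ, hκ, -, h⟩ := ih (S.pass N (measI e) false)
        have hf : ∀ {us i E B w' m}, Ready N us i (e :: ms) S B w' m → ∀ b,
            avgL ms.length (fun w => sim N us (ind E) ms.length (i + 1)
              (S.pass N (measI e) false) B w) = κ * avgL ms.length fun w =>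
              mrun N ((plans N (e :: ms) S).map Prod.snd) (value N (e :: ms) S E (w' ++ b :: w)) m
              (gatesOn N ((plans N (e :: ms) S).flatMap Prod.fst) B) := fun hR b => by
          refine (h _ _ _ _ _ _ (hR.pass hq1 hp false b)).trans ?_
          rw [hpl]
          congr 1
          refine avgL_congr fun w _ => ?_
          rw [hval, ho, List.append_assoc, List.singleton_append]
          rfl
        -- Either the outcome is determined and the bit is not read, or it is a coin and the value
        -- `-1` is rejected.
        have hpass : S.pass N (measI e) true = S.pass N (measI e) false ∨
            (S.pass N (measI e) true).log.ok = false := by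
          rw [measI, pass_meas_eq, pass_meas_eq]
          cases (S.antiL N Ẑ[N, S, e.1]).isEmpty
          · refine Or.inr ?_
            rw [← Bool.not_eq_true, Record.ok_iff]
            intro h
            simpa using h (e.2, true) (by simp [coin]) ho
          · exact Or.inl rfl
        rcases hpass with hpass | hpass
        · refine ⟨κ, hκ, fun h => by simpa [ho] using h e, fun us i E B w' m hR => ?_⟩
          rw [List.length_cons, avgL, avgL]
          simp only [sim, hus hR, hp, List.headD, List.tail_cons, hpass]
          rw [mul_add, mul_left_comm, ← hf hR, mul_left_comm, ← hf hR]
        · refine ⟨2⁻¹ * κ, by positivity, fun h => by simpa [ho] using h e, fun us i E B w' m hR => ?_⟩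
          rw [List.length_cons, avgL, avgL]
          simp only [sim, hus hR, hp, List.headD, List.tail_cons, sim_eq_zero hpass, avgL_const]
          linear_combination 4⁻¹ * hf hR false + 4⁻¹ * hf hR true
    | cons p l =>
      obtain ⟨hG, hj, hk, hp2⟩ := plan_measI hq1 hp
      have hpl : plans N (e :: ms) S = p :: plans N ms (S.take N (measI e) p false) := by rw [plans, hp]
      have hval : ∀ E w m, value N (e :: ms) S E w m = cond m.ok (ind E (walk N w m.history ms
          (S.take N (measI e) p (m.history.getD S.piv.length false))).log) 0 := fun E w m => by
        rw [value, walk, List.foldl_cons, next, hp]; rfl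
      obtain ⟨hoff, -⟩ := plans_spec (fun e' he => hq e' (List.mem_cons_of_mem _ he)) (S.take N (measI e) p false)
      have hm' : ∀ b (m : Record) B, S.piv.length = m.length → ∀ E w L, mrun N L (value N (e :: ms) S E w) (m
          ++ [(e.2, b)]) B = mrun N L (value N ms (S.take N (measI e) p b) E w) (m ++ [(e.2, b)]) B :=
        fun b m B hv E w L => mrun_congr _ (fun l _ => by
          have : (Record.history (m ++ [(e.2, b)] ++ l)).getD S.piv.length false = b := by
            rw [hv, ← List.length_map (f := Prod.snd), Record.history, List.append_assoc, List.map_append,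
              List.getD_append_right _ _ _ _ le_rfl, Nat.sub_self]; rfl
          rw [hval, value, this]) _
      have hsplit : ∀ E w (m : Record) B, mrun N ((plans N (e :: ms) S).map Prod.snd) (value N (e :: ms) S E
          w) m (gatesOn N ((plans N (e :: ms) S).flatMap Prod.fst) B) = mrun N ((plans N ms (S.take N (measI
          e) p false)).map Prod.snd) (value N (e :: ms) S E w) (m ++ [(e.2, false)]) (gatesOn N ((plans N ms
          (S.take N (measI e) p false)).flatMap Prod.fst) (realOn N p.1 p.2.1 false B)) + mrun N ((plans N ms
          (S.take N (measI e) p false)).map Prod.snd) (value N (e :: ms) S E w) (m ++ [(e.2, true)]) (gatesOn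
          N ((plans N ms (S.take N (measI e) p false)).flatMap Prod.fst)
              (realOn N p.1 p.2.1 true B)) := fun E w m B => by
        -- Line `p.2.1` has become known, so the later gates avoid it and can be moved in front of
        -- its measurement.
        have hkt : (S.take N (measI e) p false).kn p.2.1 = true := by rw [take_kn _ _ hj]; simp
        have hGr : GatesOff N (S.take N (measI e) p false).kn
            ((plans N ms (S.take N (measI e) p false)).flatMap Prod.fst) := fun g hg => by
          obtain ⟨p', hp', hg⟩ := List.mem_flatMap.1 hg
          exact (hoff p' hp').1 g hg
        rw [hpl, List.map_cons, List.flatMap_cons, mrun, gatesOn_append, hp2, realOn, realOn,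
          gatesOn_pproj hGr hj hkt, gatesOn_pproj hGr hj hkt]
      rcases ho with ho | ho
      · have hall : ∀ e ∈ ms, e.2 = .output := fun e he => hr1 e he ho
        refine ⟨1, one_pos, fun _ => rfl, fun us i E B w' m hR => ?_⟩
        have hb : ∀ b c, avgL ms.length (fun w => sim N us (ind E) ms.length (i + 1)
            (S.take N (measI e) p c) (realOn N p.1 p.2.1 c B) w) = avgL ms.length fun w =>
            mrun N ((plans N ms (S.take N (measI e) p false)).map Prod.snd) (value N (e :: ms) S E (w' ++ b ::
              w)) (m ++ [(e.2, c)]) (gatesOn N ((plans N ms (S.take N (measI e) p false)).flatMap Prod.fst)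
              (realOn N p.1 p.2.1 c B)) := fun b c => by
          obtain ⟨κ', -, hκ', h'⟩ := ih (S.take N (measI e) p c)
          have := h' _ _ E _ _ _ (hR.take hq1 hp b fun h => by simp [h] at ho)
          rw [hκ' hall, one_mul] at this
          refine this.trans ?_
          rw [plans_congr (fun e he => by rw [hall e he]; rfl) (Same.take (.refl S) p false c)]
          refine avgL_congr fun w _ => ?_
          rw [hm' c m _ hR.piv, List.append_assoc, List.singleton_append]
        rw [one_mul, List.length_cons, avgL, avgL]
        simp only [sim, hus hR, hp, List.headD, List.tail_cons, avgL_add, hsplit]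
        linear_combination 2⁻¹ * hb false false + 2⁻¹ * hb false true + 2⁻¹ * hb true false +
          2⁻¹ * hb true true
      · obtain ⟨κ, hκ, -, h⟩ := ih (S.take N (measI e) p false)
        refine ⟨κ, hκ, fun h => by simpa [ho] using h e, fun us i E B w' m hR => ?_⟩
        have hno : ∀ m : Record, (m ++ [(.postselected, true)] : Record).ok = false := fun m => by
          rw [← Bool.not_eq_true, Record.ok_iff]
          intro h
          simpa using h (.postselected, true) (by simp) rfl
        have hb : ∀ b, avgL ms.length (fun w => sim N us (ind E) ms.length (i + 1)
            (S.take N (measI e) p false) (realOn N p.1 p.2.1 false B) w) = κ * avgL ms.length fun w =>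
            mrun N ((plans N (e :: ms) S).map Prod.snd) (value N (e :: ms) S E (w' ++ b :: w)) m
              (gatesOn N ((plans N (e :: ms) S).flatMap Prod.fst) B) := fun b => by
          refine (h _ _ E _ _ _ (hR.take hq1 hp b fun _ => rfl)).trans ?_
          congr 1
          refine avgL_congr fun w _ => ?_
          rw [hsplit, hm' false m _ hR.piv, ho, mrun_value_eq_zero (hno m), add_zero, List.append_assoc,
            List.singleton_append]
        -- The real outcome `-1` is logged as a postselected `-1`, so this branch has no weight.
        have hzero : ∀ w, sim N us (ind E) ms.length (i + 1) (S.take N (measI e) p true)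
            (realOn N p.1 p.2.1 true B) w = 0 := fun w =>
          sim_eq_zero (by rw [take_log_post hR.inv.herm hq1 ho hp]; exact hno _)
        rw [List.length_cons, avgL, avgL]
        simp only [sim, hus hR, hp, List.headD, List.tail_cons, hzero, add_zero]
        rw [mul_add, mul_left_comm, ← hb, mul_left_comm, ← hb]

end ES

theorem mrun_mul {N : ℕ} (L : List (ℕ × Role)) (c : ℝ) (f : Record → ℝ) (m : Record) (B : Op N) :
    mrun N L (fun m => c * f m) m B = c * mrun N L f m B := by
  induction L generalizing m B with
  | nil => exact mul_assoc _ _ _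
  | cons e L ih => rw [mrun, mrun, ih, ih, mul_add]

theorem mrun_tensor {n t : ℕ} (L : List (ℕ × Role)) (hL : ∀ e ∈ L, n ≤ e.1) (f : Record → ℝ) (m : Record)
    (v : ℕ → Bool) (B : Op t) : mrun (n + t) L f m (tensor (ket n v) B) =
      mrun t (L.map fun e => (e.1 - n, e.2)) f m B := by
  induction L generalizing m B with
  | nil => rw [mrun, List.map_nil, mrun, tensor_trace, trace_ket, one_mul]
  | cons e L ih =>
    have h : ∀ b, pproj (n + t) (Z (n + t) e.1) b * tensor (ket n v) B * pproj (n + t) (Z (n + t) e.1) b =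
        tensor (ket n v) (pproj t (Z t (e.1 - n)) b * B * pproj t (Z t (e.1 - n)) b) := fun b => by
      have := realOn_tensor (n := n) (t := t) (G := []) (by simp) (ket n v) B (hL e (by simp)) b
      simpa [realOn, gatesOn] using this
    have ih := ih fun e he => hL e (by simp [he])
    rw [mrun, h, h, ih, ih, List.map_cons, mrun]

/-! ### Unitary circuits given by codes -/

namespace Circuit

def ofCodes (t : ℕ) (cs : List ICode) : Circuit t := ⟨cs.length, 0, fun i _ _ => (cs.getD i idleI).toInstr t⟩

theorem ofUnitary_atMostMeas {t : ℕ} {D : Circuit t} (hD : D.IsUnitary) : D.AtMostMeas t := by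
  obtain ⟨gates, final, h1, -, rfl⟩ := hD
  have hf : final.length ≤ t := by
    rw [← List.length_map (f := Prod.fst)]
    exact h1.length_le_card.trans (Fintype.card_fin t).le
  intro r α
  have key : ∀ i, ∀ b ∈ (ofUnitary gates final).branches (List.ofFn r) α i, b.1.length ≤ i - gates.length := by
    intro i
    induction i with
    | zero => intro b hb; simp [branches] at hb; simp [hb]
    | succ i ih =>
      intro b hb
      rw [branches, List.mem_flatMap] at hb
      obtain ⟨c, hc, hb⟩ := hb
      have hl := ih c hc
      cases hs : (ofUnitary gates final).step i c.1.history (List.ofFn r) with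
      | idle => rw [hs] at hb; simp only [Instr.apply, List.mem_singleton] at hb; rw [hb]; dsimp only; omega
      | gate u => rw [hs] at hb; simp only [Instr.apply, List.mem_singleton] at hb; rw [hb]; dsimp only; omega
      | meas q role =>
        have hi : gates.length ≤ i := by
          by_contra hlt
          rw [not_le] at hlt
          simp [ofUnitary, List.getElem?_append, hlt] at hs
        rw [hs] at hb
        simp only [Instr.apply, List.mem_map] at hb
        obtain ⟨_, _, rfl⟩ := hb
        rw [List.length_append, List.length_singleton]; omega
  intro b hb
  have := key _ b hb
  simp only [ofUnitary] at this
  omega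

variable {t : ℕ} {G : List GCode} {L : List (ℕ × Role)}

theorem ofCodes_isUnitary (hG : ∀ g ∈ G, g.Valid t) (hL : ∀ e ∈ L, e.1 < t) (hn : (L.map Prod.fst).Nodup)
    (hr : ∀ e ∈ L, e.2 ≠ .internal) :
    (ofCodes t (G.map gateI ++ L.map measI)).IsUnitary := by
  have h1 : ∃ gates : List (Gate t), gates.map Instr.gate = (G.map gateI).map (ICode.toInstr t) := by
    induction G with
    | nil => exact ⟨[], rfl⟩
    | cons g G ih =>
      obtain ⟨gates, h⟩ := ih fun g hg => hG g (by simp [hg])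
      obtain ⟨u, hu, -⟩ := toInstr_gate (hG g (by simp))
      exact ⟨u :: gates, by simp [h, hu]⟩
  have h2 : ∃ final : List (Fin t × Role), final.map (fun e => (e.1.1, e.2)) = L := by
    clear hn hr
    induction L with
    | nil => exact ⟨[], rfl⟩
    | cons e L ih =>
      obtain ⟨final, h⟩ := ih fun e he => hL e (by simp [he])
      exact ⟨(⟨e.1, hL e (by simp)⟩, e.2) :: final, by simp [h]⟩
  obtain ⟨gates, h1⟩ := h1
  obtain ⟨final, rfl⟩ := h2
  refine ⟨gates, final, ?_, fun e he => hr (e.1.1, e.2) (List.mem_map_of_mem he), ?_⟩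
  · rw [List.map_map] at hn
    refine List.Nodup.of_map (fun q : Fin t => q.1) ?_
    rwa [List.map_map]
  · have h3 := congrArg List.length h1
    simp only [List.length_map] at h3
    have h4 : (fun e : Fin t × Role => Instr.meas e.1 e.2) = fun e => (measI (e.1.1, e.2)).toInstr t :=
      funext fun e => (toInstr_meas e.1 e.2).symm
    rw [ofCodes, ofUnitary, h1, h4]
    congr 1
    · simp [h3]
    · funext i _ _
      have h5 : final.map (fun e => (measI (e.1.1, e.2)).toInstr t) =
          ((final.map fun e => (e.1.1, e.2)).map measI).map (ICode.toInstr t) := by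
        rw [List.map_map, List.map_map]; rfl
      rw [h5, ← List.map_append, List.getElem?_map, List.getD_eq_getElem?_getD, ← toInstr_idle t,
        Option.getD_map]

theorem weight_ofCodes (hG : ∀ g ∈ G, g.Valid t) (hL : ∀ e ∈ L, e.1 < t) (ρ : Op t) (E : Set (List Bool)) :
    (ofCodes t (G.map gateI ++ L.map measI)).weight ρ E =
      mrun t L (ind E) [] (gatesOn t G ρ) := by
  rw [weight_eq]
  have h1 : (ofCodes t (G.map gateI ++ L.map measI)).length = G.length + L.length := by
    simp [ofCodes]
  rw [h1, show (ofCodes t (G.map gateI ++ L.map measI)).coins = 0 from rfl, avgL,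
    run_gates hG _ _ _ _ fun s hs => ?_, run_eq_mrun L hL _ _ _ fun s hs h => ?_]
  · simp only [ofCodes]
    congr 1
    rw [List.getD_append_right _ _ _ _ (by simp)]
    simp [hs]
  · simp only [ofCodes]
    congr 1
    rw [Nat.zero_add, List.getD_append _ _ _ _ (by simpa using hs)]
    simp [List.getD_eq_getElem?_getD, hs]

end Circuit

/-! ### Deferred measurements -/

section
variable {A N K n t : ℕ}

theorem blk_pproj (h : K = A + N) {a : ℕ} (ha : a < A) (b : Bool) (v : Fin A → Bool) (B : Op K) :
    blk h v v (pproj K (Z K a) b * B * pproj K (Z K a) b) = if bitOf v a = b then blk h v v B else 0 := by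
  ext x y
  have h1 := pproj_Z_diag (⟨a, by omega⟩ : Fin K) b
  dsimp only at h1
  have h2 : ∀ x, jn h v x ⟨a, by omega⟩ = bitOf v a := fun x => by
    rw [jn, bitOf, dif_pos ha, dif_pos ha]
  rw [blk, h1, diag_sandwich_apply, h2, h2]
  split_ifs <;> simp [blk]

theorem mrun_eq_sum_blk (h : K = A + N) (L : List (ℕ × Role)) (hL : ∀ e ∈ L, e.1 < A) (f : Record → ℝ)
    (m : Record) (B : Op K) : mrun K L f m B =
      ∑ v : Fin A → Bool, f (m ++ L.map fun e => (e.2, bitOf v e.1)) * (blk h v v B).trace.re := by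
  induction L generalizing m B with
  | nil =>
    simp only [mrun, List.map_nil, List.append_nil]
    rw [trace_eq_sum_blk h, ← Finset.mul_sum, Complex.re_sum]
  | cons e L ih =>
    have ih := ih fun e he => hL e (by simp [he])
    rw [mrun, ih, ih, ← Finset.sum_add_distrib]
    refine Finset.sum_congr rfl fun v _ => ?_
    rw [blk_pproj h (hL e (by simp)), blk_pproj h (hL e (by simp))]
    simp only [List.append_assoc, List.singleton_append, List.map_cons]
    cases bitOf v e.1 <;> simp

/-- The measurements of the steps `0, …, i - 1`, as measurements of ancillas. -/
def measL (n : ℕ) (us : ℕ → ICode) (i : ℕ) : List (ℕ × Role) :=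
  (List.range i).flatMap fun j => cond (decide ((us j).1 = 2)) [(n + j, (us j).2.2)] []

theorem recTo_eq (n : ℕ) (us : ℕ → ICode) (v : ℕ → Bool) (i : ℕ) :
    recTo n us v i = (measL n us i).map fun e => (e.2, v e.1) := by
  rw [recTo, measL, List.map_flatMap]
  refine List.flatMap_congr fun j _ => ?_
  cases decide ((us j).1 = 2) <;> rfl

theorem measL_length (n : ℕ) (us : ℕ → ICode) (i : ℕ) : (measL n us i).length ≤ i := by
  rw [← List.length_map (f := fun e => (e.2, false))]
  exact (congrArg _ (recTo_eq n us (fun _ => false) i)).symm.le.trans (length_recTo_le ..)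

theorem measL_lt {us : ℕ → ICode} {i : ℕ} (hA : n + i ≤ A) : ∀ e ∈ measL n us i, e.1 < A := by
  intro e he
  obtain ⟨j, hj, he⟩ := List.mem_flatMap.1 he
  rw [List.mem_range] at hj
  cases h : decide ((us j).1 = 2) <;> rw [h] at he
  · simp at he
  · rw [List.mem_singleton.1 he]; dsimp only; omega

def posts (L : List (ℕ × Role)) : List (ℕ × Role) := L.filter fun e => e.2.isPost
def outs (L : List (ℕ × Role)) : List (ℕ × Role) := L.filter fun e => e.2.isOut

/-- Acceptance depends only on the postselected entries, and the output only on the output entries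
in their order. Internal measurements can be dropped. -/
theorem ind_reorder (L : List (ℕ × Role)) (v : ℕ → Bool) (E : Set (List Bool)) :
    ind E (L.map fun e => (e.2, v e.1)) = ind E ((posts L ++ outs L).map fun e => (e.2, v e.1)) := by
  have h1 : Record.Accepted (L.map fun e => (e.2, v e.1)) ↔
      Record.Accepted ((posts L ++ outs L).map fun e => (e.2, v e.1)) := by
    simp only [Record.Accepted, posts, outs, List.mem_map, List.mem_append, List.mem_filter]
    constructor
    · rintro h _ ⟨e, he | he, rfl⟩
      exacts [h _ ⟨e, he.1, rfl⟩, h _ ⟨e, he.1, rfl⟩]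
    · rintro h _ ⟨e, he, rfl⟩ hp
      exact h _ ⟨e, Or.inl ⟨he, by dsimp only at hp; rw [hp]; rfl⟩, rfl⟩ hp
  have h2 : Record.output (L.map fun e => (e.2, v e.1)) =
      Record.output ((posts L ++ outs L).map fun e => (e.2, v e.1)) := by
    rw [Record.output_eq, Record.output_eq, List.filter_map, List.filter_map, posts, outs, List.filter_append,
      List.filter_filter, List.filter_filter]
    congr 2
    have h3 : ∀ r : Role, (r.isOut && r.isPost) = false := fun r => by cases r <;> rfl
    simp [Function.comp_def, h3]
  rw [ind, ind, h1, h2]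

theorem run_defer (h : K = A + (n + t)) {L : List (SPauli n)} (hL : IsStabGens L) (ρ : Op t) {C : Circuit (n +
    t)} {rd : List Bool} (E : Set (List Bool)) (us : ℕ → ICode) (s : ℕ → Instr (n + t)) (hs : ∀ i < C.length,
    us i = (s i).code) (hC : ∀ i < C.length, ∀ m : List Bool, m.length ≤ i → C.step i m rd = s i) (hA : n +
    C.length ≤ A) {B₀ : Op K} (h0 : ∀ a : Fin A, ZeroAt h a B₀) (hB : ∑ u, blk h u u B₀ = tensor (ket n
    (engineOf L).vl) ρ) : C.run rd (ind E) C.length 0 [] (tensor (stabState L) ρ) = mrun K (posts (measL n us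
    C.length) ++ outs (measL n us C.length)) (ind E) [] (conjOn K
        (opsTo A (n + t) n us (baseRots A n t (engineOf L)) C.length) B₀) := by
  subst h
  obtain ⟨h1, h2⟩ := sum_blk_baseRots hL ρ (by omega) h0 hB
  rw [mrun_eq_sum_blk rfl _ fun e he => ?_, ← h2, Circuit.run_sum,
    sum_run_defer (ind E) us s hs hC hA fun j hj => h1 _ (Nat.le_add_right _ _) hj]
  · refine Finset.sum_congr rfl fun v _ => ?_
    rw [recTo_eq, ind_reorder, List.nil_append]
  · have := measL_lt (us := us) hA e
    rw [List.mem_append, posts, outs, List.mem_filter, List.mem_filter] at he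
    exact this (he.elim And.left And.left)

end

/-! ### The simulation of non-adaptive circuits -/

section herm
variable {A n t K : ℕ}

theorem opsTo_herm (h : K = A + (n + t)) {base : List PStr} (hb : AllHerm K base) {us : ℕ → ICode}
    {s : ℕ → Instr (n + t)} {i : ℕ} (hs : ∀ j < i, us j = (s j).code) (hA : n + i ≤ A) :
    AllHerm K (opsTo A (n + t) n us base i) := by
  induction i with
  | zero => exact hb
  | succ i ih =>
    refine AllHerm.append ?_ (ih (fun j hj => hs j (by omega)) (by omega))
    rw [hs i (by omega)]
    cases s i with
    | idle => intro T hT; simp [stepRots, Instr.code] at hT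
    | gate u =>
      intro T hT
      obtain ⟨T', hT', rfl⟩ := List.mem_map.1 (show T ∈ (gateRots (n + t) u.code).map (up A) from hT)
      exact herm_up h (gateRots_herm (Gate.code_valid u).2.2 T' hT')
    | meas q role =>
      subst h
      exact gateRots_herm (g := (2, A + q, n + i)) (Or.inr (Or.inr (by dsimp only; omega)))

theorem baseRots_herm (h : K = A + (n + t)) {L : List (SPauli n)} {S : ES} (hS : Repr L S) (hA : n ≤ A) :
    AllHerm K (baseRots A n t S) := by
  have hmix : ∀ k ≤ n, AllHerm K (mixRots A (n + t) S.kn k) := by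
    intro k hk
    induction k with
    | zero => intro T hT; simp [mixRots] at hT
    | succ k ih =>
      refine AllHerm.append ?_ (ih (by omega))
      cases S.kn k
      · refine AllHerm.append ?_ fun T hT => ?_
        · subst h
          exact gateRots_herm (g := (2, A + k, k)) (Or.inr (Or.inr (by dsimp only; omega)))
        · rw [List.map_singleton, List.mem_singleton] at hT
          rw [hT]
          exact herm_up h (herm_X (n + t) k)
      · intro T hT; simp at hT
  refine AllHerm.append (fun T hT => ?_) (hmix n le_rfl)
  obtain ⟨T', hT', rfl⟩ := List.mem_map.1 hT
  exact herm_up h (herm_short (hS.short T' hT') (hS.herm T' hT'))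

end herm

/-! ### The initial state with ancillas -/

section ket
variable {A n t : ℕ} {v : ℕ → Bool} {ρ : Op t}

/-- The values of the lines `0, …, A + n - 1` at the start, when there are `A` ancillas. -/
def padVal (A : ℕ) (v : ℕ → Bool) (i : ℕ) : Bool := decide (A ≤ i) && v (i - A)

theorem blk_ket (h : A + n + t = A + (n + t)) (u : Fin A → Bool) :
    blk h u u (tensor (ket (A + n) (padVal A v)) ρ) = if u = fun _ => false then tensor (ket n v) ρ else 0 := by
  classical
  have h1 : ∀ x : Fin (n + t) → Bool, (fun i : Fin t => jn h u x (Fin.natAdd (A + n) i)) =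
      fun i => x (Fin.natAdd n i) := fun x => by
    funext i
    rw [jn, dif_neg (by simp; omega)]
    congr 1; ext; simp; omega
  have h2 : ∀ x : Fin (n + t) → Bool, (fun i : Fin (A + n) => jn h u x (Fin.castAdd t i)) =
      fun i => Fin.append u (fun i => x (Fin.castAdd t i)) i := fun x => by
    funext i
    refine Fin.addCases (fun i => ?_) (fun i => ?_) i
    · rw [jn, dif_pos (by simp)]; simp
    · rw [jn, dif_neg (by simp), Fin.append_right]
      congr 1; ext; simp
  have h3 : ∀ a b : Fin n → Bool, ket (A + n) (padVal A v) (Fin.append u a) (Fin.append u b) =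
      if u = fun _ => false then ket n v a b else 0 := fun a b => by
    have h4 : ∀ c, Fin.append u a = Fin.append u c ↔ a = c := fun c => by
      rw [append_inj]; simp
    have h5 : (∀ i : Fin (A + n), Fin.append u a i = padVal A v i) ↔ (u = fun _ => false) ∧
        ∀ i : Fin n, a i = v i := by
      rw [Fin.forall_fin_add, funext_iff]
      refine and_congr (forall_congr' fun i => ?_) (forall_congr' fun i => ?_)
      · rw [Fin.append_left, padVal, decide_eq_false (by simp)]; rfl
      · rw [Fin.append_right, padVal]; simp
    simp only [ket, Matrix.diagonal_apply, h4, h5]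
    split_ifs <;> simp_all
  ext x y
  rw [blk, tensor, h1, h1, h2, h2, h3]
  split_ifs <;> simp [tensor]

theorem zeroAt_ket (h : A + n + t = A + (n + t)) (a : Fin A) :
    ZeroAt h a (tensor (ket (A + n) (padVal A v)) ρ) := by
  intro u u' hu
  ext x y
  by_contra hne
  have h1 := ket_ne_zero (left_ne_zero_of_mul hne) ⟨a, by omega⟩
  have h2 : padVal A v a = false := by simp [padVal]
  dsimp only at h1
  rw [h2] at h1
  simp [jn] at h1
  rcases hu with hu | hu <;> simp [hu] at h1

end ket

/-- The engine at the start, for the steps `cs` of a circuit, with `A` ancillas. -/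
def fixedStart (n t A : ℕ) (S : ES) (cs : List ICode) : ES :=
  ⟨opsTo A (n + t) n (fun i => cs.getD i idleI) (baseRots A n t S) cs.length,
    tab (A + n + t) fun i => (decide (i < A + n), padVal A S.vl i), [], [], [], []⟩

/-- The measurements of the circuit with the steps `cs`. -/
def fixedMeas (n : ℕ) (cs : List ICode) : List (ℕ × Role) :=
  measL n (fun i => cs.getD i idleI) cs.length

/-- The engine after the postselected measurements. -/
def fixedPosts (n t A : ℕ) (S : ES) (cs : List ICode) : ES :=
  walk (A + n + t) [] [] (posts (fixedMeas n cs)) (fixedStart n t A S cs)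

/-- The engine at the end, with the random string `w` and the outcomes `m`. -/
def fixedEnd (n t A : ℕ) (S : ES) (cs : List ICode) (w m : List Bool) : ES :=
  walk (A + n + t) w (List.replicate (fixedPosts n t A S cs).piv.length false ++ m)
    (outs (fixedMeas n cs)) (fixedPosts n t A S cs)

/-- A reference run with all random bits and real outcomes `false`, from which the gates and lines
of the unitary device are read off. -/
def fixedReal (n t A : ℕ) (S : ES) (cs : List ICode) : ES :=
  walk (A + n + t) [] [] (posts (fixedMeas n cs) ++ outs (fixedMeas n cs)) (fixedStart n t A S cs)

def fixedCodes (n t A : ℕ) (S : ES) (cs : List ICode) : List ICode := ((fixedReal n t A S cs).gts.map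
  (GCode.down (A + n))).map gateI ++ ((fixedReal n t A S cs).piv.map fun e => (e.1 - (A + n), e.2)).map measI

namespace ES
variable {N : ℕ} {S : ES}

theorem plans_append (ms ms' : List (ℕ × Role)) (S : ES) :
    plans N (ms ++ ms') S = plans N ms S ++ plans N ms' (walk N [] [] ms S) := by
  induction ms generalizing S with
  | nil => rfl
  | cons e ms ih =>
    rw [List.cons_append, plans, plans, walk, List.foldl_cons, ← walk]
    cases hp : S.plan N (measI e) <;> simpa [next, hp] using ih _

/-- Postselected measurements read no random bit and have the real outcome `+1`, so the engine
passes through them in one way only. -/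
theorem walk_forced {ms : List (ℕ × Role)} (hp : ∀ e ∈ ms, e.2.isPost = true) {w h : List Bool}
    (hh : ∀ i < (walk N [] [] ms S).piv.length, h.getD i false = false) :
    walk N w h ms S = walk N [] [] ms S := by
  induction ms generalizing S with
  | nil => rfl
  | cons e ms ih =>
    have h1 : next N w h S e = next N [] [] S e := by
      have hlt : S.plan N (measI e) ≠ [] → S.piv.length < (walk N [] [] (e :: ms) S).piv.length := by
        intro hne
        rw [(plans_eq_walk _ S).2, plans]
        cases hp : S.plan N (measI e) with
        | nil => exact absurd hp hne
        | cons p l => simp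
      rw [next, next, hp e (by simp)]
      cases hp : S.plan N (measI e) with
      | nil => rfl
      | cons p l => rw [hh _ (hlt (by rw [hp]; simp))]; rfl
    rw [walk, List.foldl_cons, h1, ← walk]
    rw [walk, List.foldl_cons, ← walk] at hh
    exact ih (fun e he => hp e (by simp [he])) hh

theorem walk_log {w h : List Bool} (ms : List (ℕ × Role)) (S : ES) :
    ∃ l : Record, (walk N w h ms S).log = S.log ++ l ∧ ∀ e ∈ l, ∃ e' ∈ ms, e.1 = e'.2 := by
  induction ms generalizing S with
  | nil => exact ⟨[], by simp [walk], by simp⟩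
  | cons e ms ih =>
    obtain ⟨l, h1, h2⟩ := ih (next N w h S e)
    have h3 : ∃ l : Record, (next N w h S e).log = S.log ++ l ∧ ∀ e' ∈ l, e'.1 = e.2 := by
      rw [next]
      cases (S.plan N (measI e)).isEmpty
      · obtain ⟨l, h1, -, h2⟩ := take_log (N := N) (S := S) (u := measI e)
        exact ⟨l, h1, h2⟩
      · obtain ⟨l, h1, -, h2⟩ := pass_log (N := N) (S := S) (u := measI e)
        exact ⟨l, h1, h2⟩
    obtain ⟨l', h3, h4⟩ := h3
    refine ⟨l' ++ l, by rw [walk, List.foldl_cons, ← walk, h1, h3, List.append_assoc], fun e' he' => ?_⟩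
    rcases List.mem_append.1 he' with he' | he'
    · exact ⟨e, by simp, h4 _ he'⟩
    · obtain ⟨e'', h5, h6⟩ := h2 _ he'
      exact ⟨e'', by simp [h5], h6⟩

theorem role_of_plans {ps : List (ℕ × Role)} {r : Role} (hr : ∀ e ∈ ps, e.2 = r) (hq : ∀ e ∈ ps, e.1 < N)
    {l : Record} (hl : l.map Prod.fst = ((plans N ps S).map Prod.snd).map Prod.snd) : ∀ e ∈ l, e.1 = r :=
  fun e he => by
    have : e.1 ∈ l.map Prod.fst := List.mem_map_of_mem he
    rw [hl, List.map_map] at this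
    obtain ⟨p, hp, h⟩ := List.mem_map.1 this
    obtain ⟨-, -, -, e', he', h'⟩ := (plans_spec hq S).1 p hp
    rw [← h, Function.comp, h', hr e' he']

/-- Acceptance splits into that of the real postselections, checked by the device, and that of the
simulated ones. The latter is decided before any random bit or output is read, so it is a constant
factor. -/
theorem value_eq {ps os : List (ℕ × Role)} (hps : ∀ e ∈ ps, e.2 = .postselected) (hos : ∀ e ∈ os, e.2 = .output)
    (hqp : ∀ e ∈ ps, e.1 < N) (hqo : ∀ e ∈ os, e.1 < N) (h0 : S.piv = []) (E : Set (List Bool)) (w : List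
    Bool) (l : Record) (hl : l.map Prod.fst = ((plans N (ps ++ os) S).map Prod.snd).map Prod.snd) : value N
    (ps ++ os) S E w l = (cond (walk N [] [] ps S).log.ok 1 0) *
      ind {m | (walk N w (List.replicate (walk N [] [] ps S).piv.length false ++ m) os
        (walk N [] [] ps S)).log.output ∈ E} l := by
  rw [plans_append, List.map_append, List.map_append, List.map_eq_append_iff] at hl
  obtain ⟨l₁, l₂, rfl, hl₁, hl₂⟩ := hl
  have hlen : l₁.length = (walk N [] [] ps S).piv.length := by
    have := congrArg List.length hl₁
    rw [(plans_eq_walk ps S).2, h0, List.nil_append]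
    simpa using this
  have hr₁ := role_of_plans hps hqp hl₁
  cases hok : Record.ok (l₁ ++ l₂)
  · rw [value, hok, cond_false, ind_of_not_ok hok, mul_zero]
  have hacc := (Record.ok_iff _).1 hok
  have hf : Record.history l₁ = List.replicate (walk N [] [] ps S).piv.length false := by
    rw [← hlen, List.eq_replicate_iff]
    refine ⟨List.length_map _, fun b hb => ?_⟩
    obtain ⟨e, he, rfl⟩ := List.mem_map.1 hb
    exact hacc e (List.mem_append_left _ he) (hr₁ e he)
  have hout : Record.output (l₁ ++ l₂) = Record.history l₂ := by
    have : Record.output l₁ = [] := by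
      rw [Record.output_eq, List.map_eq_nil_iff, List.filter_eq_nil_iff]
      intro e he
      rw [hr₁ e he]; simp [Role.isOut]
    rw [Record.output_append, (Record.output_of_all (role_of_plans hos hqo hl₂)).1, this, List.nil_append]
  have hw : walk N w (Record.history (l₁ ++ l₂)) (ps ++ os) S = walk N w (List.replicate
      (walk N [] [] ps S).piv.length false ++ Record.history l₂) os (walk N [] [] ps S) := by
    rw [walk, List.foldl_append, ← walk, ← hf, ← walk]
    refine (congrArg (walk N w _ os) (walk_forced (fun e he => by rw [hps e he]; rfl) fun i hi => ?_)).trans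
      (by rw [Record.history, List.map_append]; rfl)
    rw [Record.history, List.map_append, ← Record.history, hf, List.getD_append _ _ _ _ (by simpa using hi),
      List.getD_replicate _ hi]
  rw [value, hok, cond_true, hw]
  generalize walk N [] [] ps S = T
  obtain ⟨l', hl', hr'⟩ := walk_log (N := N) (w := w) (h := List.replicate T.piv.length false ++ Record.history l₂) os T
  have ha' : Record.Accepted l' := (Record.output_of_all fun e he => by
    obtain ⟨e', he', h⟩ := hr' e he
    rw [h, hos e' he']).2
  rw [ind, ind, hout]
  simp only [Set.mem_ofPred_eq]
  set T' := walk N w (List.replicate T.piv.length false ++ Record.history l₂) os T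
  have : T'.log.Accepted ↔ T.log.ok = true := by
    rw [hl', Record.accepted_append, Record.ok_iff]
    exact and_iff_left ha'
  rw [this]
  cases T.log.ok
  · simp
  · by_cases hx : T'.log.output ∈ E
    · rw [if_pos ⟨rfl, hx⟩, if_pos ⟨hacc, hx⟩, cond_true, one_mul]
    · rw [if_neg fun h => hx h.2, if_neg fun h => hx h.2, mul_zero]

end ES

section fixed
variable {n t A : ℕ} {S : ES} {cs : List ICode}

theorem fixedStart_kn {i : ℕ} (hi : i < A + n + t) : (fixedStart n t A S cs).kn i = decide (i < A + n) := by
  rw [kn, fixedStart, getD_tab hi]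

/-- All measurements, the postselected ones first. -/
def fixedOrder (n : ℕ) (cs : List ICode) : List (ℕ × Role) := posts (fixedMeas n cs) ++ outs (fixedMeas n cs)

theorem posts_role {l : List (ℕ × Role)} : ∀ e ∈ posts l, e.2 = .postselected := fun e he => by
  have := (List.mem_filter.1 he).2
  revert this; cases e.2 <;> simp [Role.isPost]

theorem outs_role {l : List (ℕ × Role)} : ∀ e ∈ outs l, e.2 = .output := fun e he => by
  have := (List.mem_filter.1 he).2
  revert this; cases e.2 <;> simp [Role.isOut]

theorem fixedOrder_spec (hA : n + cs.length ≤ A) : (∀ e ∈ fixedOrder n cs, e.1 < A) ∧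
    (∀ e ∈ fixedOrder n cs, e.2 ≠ .internal) ∧
    (fixedOrder n cs).Pairwise (fun e e' => e.2 = .output → e'.2 = .output) := by
  refine ⟨fun e he => ?_, fun e he => ?_, ?_⟩
  · exact measL_lt hA e ((List.mem_append.1 he).elim (fun h => (List.mem_filter.1 h).1)
      fun h => (List.mem_filter.1 h).1)
  · rcases List.mem_append.1 he with he | he
    · simp [posts_role e he]
    · simp [outs_role e he]
  · refine List.pairwise_append.2 ⟨?_, ?_, fun _ _ b hb _ => outs_role b hb⟩
    · exact List.pairwise_of_forall_mem_list fun a ha _ _ h => by simp [posts_role a ha] at h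
    · exact List.pairwise_of_forall_mem_list fun _ _ b hb _ => outs_role b hb

/-- The gates and measurements of the real device, with the numbering of the engine. -/
def fixedPlans (n t A : ℕ) (S : ES) (cs : List ICode) : List Plan :=
  plans (A + n + t) (fixedOrder n cs) (fixedStart n t A S cs)

theorem fixedCodes_eq : fixedCodes n t A S cs =
    (((fixedPlans n t A S cs).flatMap Prod.fst).map (GCode.down (A + n))).map gateI ++
    (((fixedPlans n t A S cs).map Prod.snd).map fun e => (e.1 - (A + n), e.2)).map measI := by
  obtain ⟨h1, h2⟩ := plans_eq_walk (N := A + n + t) (fixedOrder n cs) (fixedStart n t A S cs)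
  rw [fixedCodes, fixedReal, ← fixedOrder, h1, h2]
  rfl

theorem fixedPlans_spec (hA : n + cs.length ≤ A) : (∀ g ∈ (fixedPlans n t A S cs).flatMap Prod.fst, ((g.1 = 0
    ∨ g.1 = 1 ∨ g.2.1 ≠ g.2.2) ∧ A + n ≤ g.2.1 ∧ A + n ≤ g.2.2) ∧ (g.down (A + n)).Valid t) ∧ (∀ e ∈
    (fixedPlans n t A S cs).map Prod.snd, A + n ≤ e.1 ∧ e.1 < A + n + t ∧ ∃ e' ∈ fixedOrder n cs, e.2 = e'.2)
    ∧
    (((fixedPlans n t A S cs).map Prod.snd).map Prod.fst).Nodup := by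
  obtain ⟨h1, h2⟩ := plans_spec (N := A + n + t) (fun e he => ((fixedOrder_spec hA).1 e he).trans_le
    (by omega)) (fixedStart n t A S cs)
  refine ⟨fun g hg => ?_, fun e he => ?_, by rw [List.map_map]; exact h2⟩
  · obtain ⟨p, hp, hg⟩ := List.mem_flatMap.1 hg
    exact off_down (h1 p hp).1 (fun k hk => by
      rw [fixedStart_kn (by omega)]; simpa using hk) g hg
  · obtain ⟨p, hp, rfl⟩ := List.mem_map.1 he
    obtain ⟨-, h3, h4, h5⟩ := h1 p hp
    rw [fixedStart_kn h3, decide_eq_false_iff_not] at h4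
    exact ⟨by omega, h3, h5⟩

theorem fixedReal_lines (hA : n + cs.length ≤ A) :
    (∀ g ∈ ((fixedPlans n t A S cs).flatMap Prod.fst).map (GCode.down (A + n)), g.Valid t) ∧
    ∀ e ∈ ((fixedPlans n t A S cs).map Prod.snd).map fun e => (e.1 - (A + n), e.2), e.1 < t ∧
      ∃ e' ∈ fixedOrder n cs, e.2 = e'.2 := by
  obtain ⟨h1, h2, -⟩ := fixedPlans_spec (t := t) (S := S) hA
  refine ⟨fun g hg => ?_, fun e he => ?_⟩
  · obtain ⟨g', hg', rfl⟩ := List.mem_map.1 hg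
    exact (h1 g' hg').2
  · obtain ⟨e', he', rfl⟩ := List.mem_map.1 he
    obtain ⟨h3, h4, h5⟩ := h2 e' he'
    exact ⟨by dsimp only; omega, h5⟩

theorem fixed_isUnitary (hA : n + cs.length ≤ A) :
    (Circuit.ofCodes t (fixedCodes n t A S cs)).IsUnitary := by
  obtain ⟨h1, h2⟩ := fixedReal_lines (t := t) (S := S) hA
  rw [fixedCodes_eq]
  refine Circuit.ofCodes_isUnitary h1 (fun e he => (h2 e he).1) ?_ fun e he => ?_
  · rw [List.map_map, List.map_map, List.nodup_map_iff_inj_on (List.Nodup.of_map _ (by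
      have := (fixedPlans_spec (t := t) (S := S) hA).2.2
      rwa [List.map_map] at this))]
    intro p hp p' hp' h
    obtain ⟨-, h3, h4⟩ := fixedPlans_spec (t := t) (S := S) hA
    have e1 := (h3 _ (List.mem_map_of_mem hp)).1
    have e2 := (h3 _ (List.mem_map_of_mem hp')).1
    rw [List.map_map] at h4
    refine List.inj_on_of_nodup_map h4 hp hp' ?_
    simp only [Function.comp] at h ⊢
    omega
  · obtain ⟨e', he', h⟩ := (h2 e he).2
    rw [h]
    exact (fixedOrder_spec hA).2.1 e' he'

theorem fixed_noPost (hA : n + cs.length ≤ A) (h : posts (fixedMeas n cs) = []) :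
    (Circuit.ofCodes t (fixedCodes n t A S cs)).NoPost := by
  intro i hi _ _ _ _ q hq
  have hr : (fixedCodes n t A S cs)[i].2.2 = .postselected := by
    dsimp only [Circuit.ofCodes] at hq hi
    rw [List.getD_eq_getElem _ _ hi] at hq
    generalize (fixedCodes n t A S cs)[i] = u at hq
    simp only [ICode.toInstr] at hq
    split_ifs at hq
    simpa using (congrArg (fun s : Instr t => match s with | .meas _ r => r | _ => .output) hq)
  have hm : (fixedCodes n t A S cs)[i] ∈ fixedCodes n t A S cs := List.getElem_mem _
  generalize (fixedCodes n t A S cs)[i] = u at hr hm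
  rw [fixedCodes_eq] at hm
  rcases List.mem_append.1 hm with hm | hm
  · obtain ⟨g, -, rfl⟩ := List.mem_map.1 hm
    simp [gateI] at hr
  · obtain ⟨e, he, rfl⟩ := List.mem_map.1 hm
    obtain ⟨e', he', h'⟩ := ((fixedReal_lines (t := t) (S := S) hA).2 e he).2
    rw [fixedOrder, h, List.nil_append] at he'
    have h2 := outs_role e' he'
    rw [← h', show e.2 = .postselected from hr] at h2
    cases h2

end fixed

/-- The empty history may stand for any other one, since the steps do not depend on it. -/
def stepCodes {N : ℕ} (C : Circuit N) (rd : List Bool) : List ICode :=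
  (List.range C.length).map fun i => (C.step i [] rd).code

section
variable {n t A : ℕ} {C : Circuit (n + t)} {rd : List Bool}

theorem stepCodes_getD {i : ℕ} (hi : i < C.length) :
    (stepCodes C rd).getD i idleI = (C.step i [] rd).code := by
  simp [stepCodes, hi]

theorem stepCodes_length : (stepCodes C rd).length = C.length := by simp [stepCodes]

theorem posts_eq_nil (hC : C.NoPost) (hr : rd.length = C.coins) : posts (fixedMeas n (stepCodes C rd)) = [] := by
  rw [posts, List.filter_eq_nil_iff]
  intro e he hp
  obtain ⟨j, hj, he⟩ := List.mem_flatMap.1 he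
  rw [stepCodes_length, List.mem_range] at hj
  simp only [stepCodes_getD hj] at he
  have := hC j hj [] rd (by simp) hr
  cases hs : C.step j [] rd with
  | idle | gate => rw [hs] at he; simp [Instr.code] at he
  | meas q role =>
    rw [hs] at he
    have he : e = (n + j, role) := by simpa [Instr.code] using he
    rw [he] at hp
    cases role
    case postselected => exact this q hs
    all_goals cases hp

/-- The circuit is replaced by its deferred version, whose final measurements of ancillas are
simulated by the engine on a state with the `A + n` first lines known. The constant `γ` is the
product of the coin factors, or 0 if a simulated postselection fails; it depends neither on `ρ` nor
on the event. -/
theorem exists_run_eq_fixed {L : List (SPauli n)} (hL : IsStabGens L) (hC : C.NonAdaptive)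
    (hr : rd.length = C.coins) (hA : n + C.length ≤ A) :
    ∃ γ : ℝ, 0 ≤ γ ∧ (C.NoPost → γ = 1) ∧ ∀ (ρ : Op t) (E : Set (List Bool)),
      C.run rd (ind E) C.length 0 [] (tensor (stabState L) ρ) =
      γ * avgL (fixedOrder n (stepCodes C rd)).length fun w =>
        (Circuit.ofCodes t (fixedCodes n t A (engineOf L) (stepCodes C rd))).weight ρ
          {m | (fixedEnd n t A (engineOf L) (stepCodes C rd) w m).log.output ∈ E} := by
  have hS := absorbAll_repr L hL
  have hA' : n + (stepCodes C rd).length ≤ A := by rw [stepCodes_length]; exact hA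
  obtain ⟨hq, hr', hpw⟩ := fixedOrder_spec hA'
  have hK : A + n + t = A + (n + t) := Nat.add_assoc ..
  have hN : ∀ e ∈ fixedOrder n (stepCodes C rd), e.1 < A + n + t := fun e he => by
    have := hq e he; omega
  have hus : ∀ i < C.length, (stepCodes C rd).getD i idleI = (C.step i [] rd).code := fun i hi =>
    stepCodes_getD hi
  generalize hSS : engineOf L = S₀ at hS
  generalize hcs : stepCodes C rd = cs at *
  obtain ⟨κ, hκ, hκ1, h⟩ := exists_avgL_sim_eq hN hpw hr' (fixedStart n t A S₀ cs)
  refine ⟨κ * cond (fixedPosts n t A S₀ cs).log.ok 1 0, ?_, fun hP => ?_, fun ρ E => ?_⟩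
  · cases (fixedPosts n t A S₀ cs).log.ok
    · simp
    · simpa using hκ.le
  · have hnil : posts (fixedMeas n cs) = [] := by rw [← hcs]; exact posts_eq_nil hP hr
    rw [fixedPosts, hnil, hκ1, one_mul]
    · rfl
    · rw [fixedOrder, hnil]
      exact outs_role
  set B₀ : Op (A + n + t) := tensor (ket (A + n) (padVal A S₀.vl)) ρ with hB₀
  have hlen : cs.length = C.length := by rw [← hcs, stepCodes_length]
  have hinv : (fixedStart n t A S₀ cs).Inv (A + n + t) B₀ := by
    refine ⟨?_, fun a b hab i hi => ?_⟩
    · refine opsTo_herm hK (baseRots_herm hK hS (by omega)) (s := fun i => C.step i [] rd) (fun j hj => ?_) hA'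
      exact hus j (hlen ▸ hj)
    · rw [fixedStart_kn i.2, decide_eq_true_eq] at hi
      rw [vl, fixedStart, getD_tab i.2]
      exact ket_ne_zero (left_ne_zero_of_mul hab) ⟨i, hi⟩
  have hsum : ∑ u, blk hK u u B₀ = tensor (ket n S₀.vl) ρ := by
    simp only [hB₀, blk_ket hK]
    simp
  have h1 := run_defer hK hL ρ E (fun i => cs.getD i idleI) (fun i => C.step i [] rd) hus
    (fun i hi m hm => hC i hi m [] rd hm (by simp) hr) hA (zeroAt_ket hK) (by rw [hSS]; exact hsum)
  rw [hSS, ← hlen] at h1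
  rw [← hlen, h1]
  -- An auxiliary circuit consisting of the deferred measurements alone, to which the general
  -- simulation applies.
  let D : Circuit (A + n + t) := Circuit.ofCodes _ ((fixedOrder n cs).map measI)
  have hDl : D.length = (fixedOrder n cs).length := List.length_map _
  have hD : ∀ (s : ℕ) (hs : s < (fixedOrder n cs).length) (h : List Bool), D.step s h [] =
      (measI (fixedOrder n cs)[s]).toInstr (A + n + t) := fun s hs h => by
    simp [D, Circuit.ofCodes, List.getD_eq_getElem?_getD, hs]
  have h2 := Circuit.run_eq_mrun (D := D) (rd := []) (f := ind E) (fixedOrder n cs) hN 0 []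
    (conjOn (A + n + t) (fixedStart n t A S₀ cs).ops B₀) fun s hs h => by rw [Nat.zero_add]; exact hD s hs h
  let us (i : ℕ) (_ : Record) : ICode := if hi : i < (fixedOrder n cs).length then
    measI (fixedOrder n cs)[i] else padCode
  have h3 := run_eq_avgL_sim D [] (ind E) us (fun i hi m => by
    rw [hDl] at hi
    have := toInstr_meas ⟨_, hN _ (List.getElem_mem hi)⟩ (fixedOrder n cs)[i].2
    rw [hD i hi, this]
    simp only [us, dif_pos hi]
    rfl) (fun i hi m => by
    rw [hDl] at hi
    simp [us, Nat.not_lt.2 hi]) (fixedOrder n cs).length 0 (by rw [hDl, Nat.zero_add]) _ B₀ hinv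
  have h4 := h us 0 E B₀ [] [] ⟨fun j hj l => by simp [us, hj], hinv, rfl, rfl, rfl⟩
  rw [Nat.sub_zero, hDl] at h3
  have h5 : conjOn (A + n + t) (fixedStart n t A S₀ cs).ops B₀ = (fixedStart n t A S₀ cs).den (A + n + t) B₀ := rfl
  refine (h2.symm.trans ((congrArg _ h5).trans (h3.trans h4))).trans ?_
  rw [mul_assoc, ← avgL_mul (fixedOrder n cs).length (cond _ _ _)]
  congr 1
  refine avgL_congr fun w _ => ?_
  obtain ⟨g1, g2, -⟩ := fixedPlans_spec (t := t) (S := S₀) hA'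
  obtain ⟨g3, g4⟩ := fixedReal_lines (t := t) (S := S₀) hA'
  rw [fixedCodes_eq, Circuit.weight_ofCodes g3 fun e he => (g4 e he).1, List.nil_append]
  refine (congrArg _ (gatesOn_tensor (fun g hg => (g1 g hg).1) _ _)).trans ?_
  refine (mrun_tensor _ (fun e he => (g2 e he).1) _ _ _ _).trans ?_
  rw [← mrun_mul]
  refine mrun_congr _ (fun l hl => ?_) _
  rw [List.nil_append]
  refine value_eq posts_role outs_role (fun e he => hN e (List.mem_append_left _ he))
    (fun e he => hN e (List.mem_append_right _ he)) rfl E w l ?_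
  rw [hl, List.map_map, List.map_map, List.map_map]
  rfl

end

/-- The number of random outcomes may depend on the random bits of the circuit, which come first in
the string. -/
theorem avgL_split {k l : ℕ} (hk : k ≤ l) {M : List Bool → ℕ} (h : ∀ w, w.length = k → k + M w ≤ l)
    (F : List Bool → List Bool → ℝ) : avgL l (fun w => F (w.take k) ((w.drop k).take (M (w.take k)))) =
      avgL k fun w => avgL (M w) (F w) := by
  obtain ⟨c, rfl⟩ := Nat.exists_eq_add_of_le hk
  rw [avgL_append]
  refine avgL_congr fun w hw => ?_
  rw [← avgL_take (show M w ≤ c by have := h w hw; omega)]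
  refine avgL_congr fun w' _ => ?_
  rw [← hw, List.take_left, List.drop_left]

theorem fixedOrder_length (n : ℕ) (cs : List ICode) : (fixedOrder n cs).length ≤ cs.length := by
  have h1 : (fixedOrder n cs).length ≤ (fixedMeas n cs).length := by
    rw [fixedOrder, List.length_append, posts, outs]
    generalize fixedMeas n cs = L
    induction L with
    | nil => simp
    | cons e L ih => cases h : e.2 <;> simp [Role.isPost, Role.isOut, h] at ih ⊢ <;> omega
  exact h1.trans (measL_length ..)

/-- The description of the unitary circuit for the real device, for the description `x` of the job
and the steps `cs` of the circuit. -/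
def fixedCodesOf (x : Raw) (cs : List ICode) : List ICode :=
  fixedCodes x.1 (x.2.2.1 - x.1) (x.1 + cs.length) (absorbAll x.1 x.2.1) cs

def fixedOut (x : Raw) (cs : List ICode) (w m : List Bool) : List Bool := (fixedEnd x.1 (x.2.2.1 - x.1) (x.1 +
  cs.length) (absorbAll x.1 x.2.1) cs ((w.drop x.2.2.2.2.1).take (fixedOrder x.1 cs).length) m).log.output

section
variable {P : Prog} {p : Polynomial ℕ}

namespace Job
variable (x : Job P p) (w : List Bool)

/-- The steps of the circuit, if it is not adaptive. -/
def codes : List ICode := stepCodes x.C (w.take x.C.coins)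

def fixed : Circuit x.t := .ofCodes x.t (fixedCodesOf x.raw (x.codes w))

theorem fixedCodesOf_eq (cs : List ICode) : fixedCodesOf x.raw cs =
    fixedCodes x.n x.t (x.n + cs.length) (engineOf x.g) cs := by
  show fixedCodes x.n (x.n + x.t - x.n) _ _ _ = _
  rw [Nat.add_sub_cancel_left]; rfl

theorem fixed_isUnitary : (x.fixed w).IsUnitary := by
  rw [fixed, fixedCodesOf_eq]
  exact EGK.fixed_isUnitary le_rfl

variable {w}

theorem fixed_noPost (hC : x.C.NoPost) (hw : x.C.coins ≤ w.length) : (x.fixed w).NoPost := by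
  rw [fixed, fixedCodesOf_eq]
  exact EGK.fixed_noPost le_rfl (posts_eq_nil hC (by rw [List.length_take]; omega))

theorem coins_le : x.C.coins ≤ p.eval x.N := x.desc.2.1

/-- The weight of the output set `E` in the simulation with the random bits `rd` for the circuit and
`w` for the engine. -/
def val (x : Job P p) (ρ : Op x.t) (E : Set (List Bool)) (rd w : List Bool) : ℝ := (Circuit.ofCodes x.t
  (fixedCodes x.n x.t (x.n + (stepCodes x.C rd).length) (engineOf x.g) (stepCodes x.C rd))).weight ρ
    {m | (fixedEnd x.n x.t (x.n + (stepCodes x.C rd).length) (engineOf x.g)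
      (stepCodes x.C rd) w m).log.output ∈ E}

theorem fixed_weight (ρ : Op x.t) (E : Set (List Bool)) :
    (x.fixed w).weight ρ {m | fixedOut x.raw (x.codes w) w m ∈ E} = x.val ρ E (w.take x.C.coins)
      ((w.drop x.C.coins).take (fixedOrder x.n (stepCodes x.C (w.take x.C.coins))).length) := by
  have h : x.raw.2.2.1 - x.raw.1 = x.t := Nat.add_sub_cancel_left ..
  rw [fixed, fixedCodesOf_eq, val]
  simp only [fixedOut, h]
  rfl

theorem exists_run_eq (hC : x.C.NonAdaptive) {rd : List Bool} (hr : rd.length = x.C.coins) : ∃ γ : ℝ, 0 ≤ γ ∧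
    (x.C.NoPost → γ = 1) ∧ ∀ (ρ : Op x.t) (E : Set (List Bool)), x.C.run rd (ind E) x.C.length 0 [] (tensor
    (stabState x.g) ρ) = γ * avgL (fixedOrder x.n (stepCodes x.C rd)).length (x.val ρ E rd) :=
  exists_run_eq_fixed x.gens hC hr (by rw [stepCodes_length])

theorem avgL_fixed_weight {l : ℕ} (hl : x.C.coins + x.C.length ≤ l) (ρ : Op x.t) (E : Set (List Bool)) :
    avgL l (fun w => (x.fixed w).weight ρ {m | fixedOut x.raw (x.codes w) w m ∈ E}) =
      avgL x.C.coins fun rd => avgL (fixedOrder x.n (stepCodes x.C rd)).length (x.val ρ E rd) := by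
  simp only [fixed_weight]
  refine avgL_split (by omega) (M := fun rd => (fixedOrder x.n (stepCodes x.C rd)).length) (fun w _ => ?_) _
  have := fixedOrder_length x.n (stepCodes x.C w)
  rw [stepCodes_length] at this
  omega

theorem sameOutput_fixed (hC : x.C.NoPost) (hC' : x.C.NonAdaptive) {l : ℕ} (hl : x.C.coins + x.C.length ≤ l)
    {ρ : Op x.t} (hρ : IsState ρ) : SameOutput x.C (tensor (stabState x.g) ρ) (fun r : Fin l → Bool => x.fixed
    (List.ofFn r)) ρ
      fun r => fixedOut x.raw (x.codes (List.ofFn r)) (List.ofFn r) := by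
  intro y
  have h1 := x.avgL_fixed_weight hl ρ {y}
  rw [Circuit.outProb, Circuit.weight_univ hC, trace_tensor_stabState x.gens, hρ.2, Complex.one_re, div_one,
    Circuit.weight_eq]
  rw [avgL_eq] at h1
  refine Eq.trans (avgL_congr fun rd hr => ?_) (h1.symm.trans ?_)
  · obtain ⟨γ, -, h2, h3⟩ := x.exists_run_eq hC' hr
    rw [h3, h2 hC, one_mul]
  · congr 1
    refine Finset.sum_congr rfl fun r _ => ?_
    rw [Circuit.outProb, Circuit.weight_univ (x.fixed_noPost hC (by rw [List.length_ofFn]; omega)), hρ.2,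
      Complex.one_re, div_one]
    rfl

/-- The weight of the circuit is `γ` times the mean of the weights of one fixed device under varying
`post`. Hence `γ` cancels, and the normalisation is the same for all random strings. -/
theorem sameOutput_fixed_of_coins (h0 : x.C.coins = 0) (hC : x.C.NonAdaptive) {l : ℕ} (hl : x.C.length ≤ l) {ρ
    : Op x.t} (hpos : 0 < x.C.weight (tensor (stabState x.g) ρ) Set.univ) : (∀ w, 0 < (x.fixed w).weight ρ
    Set.univ) ∧ SameOutput x.C (tensor (stabState x.g) ρ) (fun r : Fin l → Bool => x.fixed (List.ofFn r)) ρ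
      fun r => fixedOut x.raw (x.codes (List.ofFn r)) (List.ofFn r) := by
  obtain ⟨γ, h1, -, h2⟩ := x.exists_run_eq (rd := []) hC h0.symm
  have hw : ∀ E, x.C.weight (tensor (stabState x.g) ρ) E =
      γ * avgL l fun w => (x.fixed w).weight ρ {m | fixedOut x.raw (x.codes w) w m ∈ E} := fun E => by
    rw [x.avgL_fixed_weight (by omega), Circuit.weight_eq, h0]
    exact h2 ρ E
  -- Without random bits of the circuit the device does not depend on the random string, so
  -- postselection does not condition `r`.
  have hD : ∀ w, x.fixed w = x.fixed [] := fun w => by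
    simp only [fixed, codes, h0, List.take_zero]
  have hu := hw Set.univ
  simp only [hD, Set.mem_univ, Set.ofPred_true, avgL_const] at hu
  have hne : 0 < γ := lt_of_le_of_ne h1 fun e => by rw [hu, ← e, zero_mul] at hpos; exact hpos.false
  have hp : 0 < (x.fixed []).weight ρ Set.univ := by
    rw [hu] at hpos
    exact (mul_pos_iff_of_pos_left hne).1 hpos
  have hy : ∀ (y : List Bool) (w : List Bool),
      (x.fixed w).weight ρ {m | fixedOut x.raw (x.codes w) w m ∈ ({y} : Set (List Bool))} =
      (x.fixed []).weight ρ Set.univ * (x.fixed w).outProb ρ {m | fixedOut x.raw (x.codes w) w m = y} := by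
    intro y w
    rw [Circuit.outProb, hD w, mul_div_cancel₀ _ hp.ne']
    rfl
  refine ⟨fun w => by rw [hD]; exact hp, ?_⟩
  intro y
  rw [Circuit.outProb, hu, hw, mul_div_mul_left _ _ hne.ne']
  simp only [hy]
  rw [avgL_mul, mul_div_cancel_left₀ _ hp.ne', avgL_eq]

end Job
end

/-! ### The programs of the simulation of non-adaptive circuits -/

/-- The recursive definition is rewritten with list operations that are already known to be
computable in polynomial time. -/
theorem opsTo_eq (A N n : ℕ) (us : ℕ → ICode) (base : List PStr) (i : ℕ) : opsTo A N n us base i =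
    ((List.range i).reverse.flatMap fun j => stepRots A N (us j) (n + j)) ++ base := by
  induction i with
  | zero => rfl
  | succ i ih => rw [opsTo, ih, List.range_succ, List.reverse_append]; simp

theorem mixRots_eq (A N : ℕ) (kn : ℕ → Bool) (i : ℕ) : mixRots A N kn i =
    (List.range i).reverse.flatMap fun j => cond (kn j) [] (copyRots (A + N) A j j ++ [X N j].map (up A)) := by
  induction i with
  | zero => rfl
  | succ i ih => rw [mixRots, ih, List.range_succ, List.reverse_append]; simp

theorem sz_next (N : ℕ) (w h : List Bool) (S : ES) (e : ℕ × Role) :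
    sz (next N w h S e) ≤ sz S + growth N := by
  rw [next]
  cases hp : S.plan N (measI e) with
  | nil =>
    rw [List.isEmpty_nil, cond_true]
    exact sz_pass ..
  | cons p l =>
    rw [List.isEmpty_cons, cond_false, List.headD_cons]
    exact sz_take (by rw [hp]; simp) _

section
variable {α : Type} [Encode α] {n t A N : α → ℕ} {S : α → ES} {cs : α → List ICode} {w m : α → List Bool}

@[fun_prop] theorem FP.up {T : α → PStr} (hA : FP A) (hT : FP T) : FP fun a => up (A a) (T a) := by
  unfold EGK.up; fun_prop

@[fun_prop] theorem FP.opsTo {i : α → ℕ} {base : α → List PStr} {u : α → ℕ → ICode} (hA : FP A) (hN : FP N)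
    (hn : FP n) (hu : FP fun p : α × ℕ => u p.1 p.2) (hb : FP base) (hi : FP i) :
    FP fun a => opsTo (A a) (N a) (n a) (u a) (base a) (i a) := by
  simp only [opsTo_eq, stepRots, copyRots]; fun_prop

@[fun_prop] theorem FP.baseRots (hA : FP A) (hn : FP n) (ht : FP t) (hS : FP S) :
    FP fun a => baseRots (A a) (n a) (t a) (S a) := by
  unfold EGK.baseRots
  simp only [mixRots_eq, copyRots]; fun_prop

@[fun_prop] theorem FP.fixedStart (hn : FP n) (ht : FP t) (hA : FP A) (hS : FP S) (hc : FP cs) :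
    FP fun a => fixedStart (n a) (t a) (A a) (S a) (cs a) := by
  unfold EGK.fixedStart padVal; fun_prop

@[fun_prop] theorem FP.fixedMeas (hn : FP n) (hc : FP cs) : FP fun a => fixedMeas (n a) (cs a) := by
  unfold EGK.fixedMeas measL; fun_prop

@[fun_prop] theorem FP.posts {L : α → List (ℕ × Role)} (hL : FP L) : FP fun a => posts (L a) := by
  unfold EGK.posts; fun_prop

@[fun_prop] theorem FP.outs {L : α → List (ℕ × Role)} (hL : FP L) : FP fun a => outs (L a) := by
  unfold EGK.outs; fun_prop

@[fun_prop] theorem FP.walk {L : α → List (ℕ × Role)} {h : α → List Bool} (hN : FP N) (hw : FP w) (hh : FP h)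
    (hL : FP L) (hS : FP S) : FP fun a => walk (N a) (w a) (h a) (L a) (S a) := by
  unfold ES.walk
  obtain ⟨q, hq⟩ := exists_bound_sz hN
  refine .foldl hL hS (by unfold ES.next; fun_prop) ⟨q, fun a b d => (sz_next ..).trans ?_⟩
  have := eval_mono q (Nat.le_add_right (sz a) (sz d))
  have := hq a
  omega

@[fun_prop] theorem FP.fixedEnd (hn : FP n) (ht : FP t) (hA : FP A) (hS : FP S) (hc : FP cs) (hw : FP w)
    (hm : FP m) : FP fun a => fixedEnd (n a) (t a) (A a) (S a) (cs a) (w a) (m a) := by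
  unfold EGK.fixedEnd fixedPosts; fun_prop

@[fun_prop] theorem FP.fixedCodes (hn : FP n) (ht : FP t) (hA : FP A) (hS : FP S) (hc : FP cs) :
    FP fun a => fixedCodes (n a) (t a) (A a) (S a) (cs a) := by
  unfold EGK.fixedCodes fixedReal; fun_prop

end

section
variable {P : Prog} {p : Polynomial ℕ}

/-- The loop collects the first `k` codes. Each one is the answer of a call of `P` and hence
polynomially bounded in size. -/
theorem PT.codes {ι : Type*} {x : ι → Job P p} {w h : ι → List Bool} (hw : ∀ i, p.eval (x i).N ≤ (w i).length)
    (hw' : Job.Bdd x fun i => (w i).length) (hh : Job.Bdd x fun i => (h i).length) :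
    PT (fun i => (x i).N) (fun i => ((x i).raw, w i, h i)) fun i => (x i).codes (w i) := by
  have hin := polyBdd_sz_input hw' hh
  have hlen : Job.Bdd x fun i => (x i).C.length := (PolyBdd.self.eval p).mono fun i => (x i).desc.1
  have hstep : PT (fun y : Steps x => (x y.1).N) (fun y => (((x y.1).raw, w y.1, h y.1), (y.2 : ℕ)))
      fun y => ((x y.1).C.step y.2 [] ((w y.1).take (x y.1).C.coins)).code := by
    have h1 := PT.refl (s := fun y : Steps x => (x y.1).N) (a := fun y => (((x y.1).raw, w y.1, h y.1), (y.2 :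
      ℕ))) ((((hin.comap Sigma.fst).add ((PolyBdd.const 2).mul (hlen.comap Sigma.fst))).add (.const 2)).mono
        fun y => by rw [sz_pair _ (y.2 : ℕ), sz_nat]; omega)
    have h2 : FP fun z : (Raw × List Bool × List Bool) × ℕ =>
        (z.1.1.2.2, z.2, ([] : List Bool), z.1.2.1.take z.1.1.2.2.2.2.1) := by fun_prop
    have h3 : PT (fun y : Steps x => (x y.1).N)
        (fun y => ((x y.1).raw.2.2, (y.2 : ℕ), ([] : List Bool), (w y.1).take (x y.1).C.coins))
        fun y => Encode.enc ((x y.1).C.step y.2 [] ((w y.1).take (x y.1).C.coins)) :=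
      ⟨P, p, fun y => (x y.1).desc.2.2.2 y.2 y.2.2 _ _ (Nat.zero_le _) (by
        have := hw y.1
        have := (x y.1).coins_le
        rw [List.length_take]
        omega)⟩
    exact (((h1.fp h2).comp h3).fp (f := Instr.read) (by fun_prop)).congr (fun _ => rfl) fun y => by
      rw [Instr.read_enc]
  obtain ⟨q, hq⟩ := hstep.bdd_right
  have hf : FP fun _ : Raw × List Bool × List Bool => ([] : List ICode) := by fun_prop
  refine (PT.iterate (T := fun i k => ((x i).codes (w i)).take k) hin hf (fun _ => rfl)
    ((hlen.mul ((PolyBdd.self.eval q).add (.const 1))).add (.const 1)) (fun i k _ => ?_) fun h1 => ?_).congr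
    (fun _ => rfl) fun i => by rw [List.take_of_length_le]; exact stepCodes_length.le
  · refine (sz_le_of_all fun c hc => ?_).trans (Nat.add_le_add_right (Nat.mul_le_mul_right _
      ((List.length_take_le' _ _).trans stepCodes_length.le)) _)
    obtain ⟨j, hj, rfl⟩ := List.mem_map.1 (List.mem_of_mem_take hc)
    exact hq ⟨i, j, List.mem_range.1 hj⟩
  · have h2 : FP fun z : (Raw × List Bool × List Bool) × ℕ × List ICode => (z.1, z.2.1) := by fun_prop
    have h3 : FP fun z : ((Raw × List Bool × List Bool) × ℕ × List ICode) × ICode => z.1.2.2 ++ [z.2] := by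
      fun_prop
    refine ((h1.pair ((h1.fp h2).comp hstep)).fp h3).congr (fun _ => rfl) fun y => ?_
    have hlt : (y.2 : ℕ) < ((x y.1).codes (w y.1)).length := y.2.2.trans_eq stepCodes_length.symm
    rw [← List.take_concat_get' _ _ hlt]
    congr 3
    simp [Job.codes, stepCodes]

end

section
variable {P : Prog} {p : Polynomial ℕ}

theorem PT.fixedCodes : PT (fun i : Σ x : Job P p, x.Seed => i.1.N) (fun i => (i.1.raw, i.2.1))
    fun i => fixedCodesOf i.1.raw (i.1.codes i.2.1) := by
  have hw : PolyBdd (fun i : Σ x : Job P p, x.Seed => i.1.N) fun i => i.2.1.length := polyBdd_seed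
  have hin := polyBdd_sz_input (x := fun i : Σ x : Job P p, x.Seed => i.1) (w := fun i => i.2.1)
    (h := fun _ => []) hw (.const 0)
  have h1 := PT.refl (a := fun i : Σ x : Job P p, x.Seed => (i.1.raw, i.2.1))
    (hin.mono fun i => by rw [sz_pair i.1.raw, sz_pair i.1.raw, sz_pair i.2.1]; omega)
  have h2 : FP fun z : Raw × List Bool => (z.1, z.2, ([] : List Bool)) := by fun_prop
  have h3 : FP fun z : (Raw × List Bool) × List ICode => fixedCodesOf z.1.1 z.2 := by
    unfold fixedCodesOf; fun_prop
  exact (h1.pair ((h1.fp h2).comp (PT.codes (fun i => seed_le i.2) hw (.const 0)))).fp h3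

/-- Here the translation does all the work: the description of the device is the complete list of
its instructions, and the control program only looks up an entry. -/
theorem exists_fixed_translate : ∃ (Tr : Prog) (q : Polynomial ℕ), ∀ (x : Job P p) (w : x.Seed),
    Tr.Computes (x.raw, w.1) ((x.fixed w.1).code (Encode.enc (fixedCodesOf x.raw (x.codes w.1))))
      (q.eval x.N) := by
  have h1 : FP fun z : (Raw × List Bool) × List ICode =>
      (z.1.1.2.2.1 - z.1.1.1, z.2.length, 0, Encode.enc z.2) := by fun_prop
  obtain ⟨Tr, q, h⟩ := ((PT.refl (PT.fixedCodes (P := P) (p := p)).bdd_left).pair PT.fixedCodes).fp h1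
  refine ⟨Tr, q, fun x w => (h ⟨x, w⟩).congr rfl ?_ le_rfl⟩
  show Encode.enc (x.t, _, 0, _) = Encode.enc (x.n + x.t - x.n, _, 0, _)
  rw [Nat.add_sub_cancel_left]
  rfl

theorem exists_fixed_control : ∃ (Ctl : Prog) (q : Polynomial ℕ), ∀ (x : Job P p) (w : x.Seed),
    (x.fixed w.1).DescribedBy Ctl (Encode.enc (fixedCodesOf x.raw (x.codes w.1))) (q.eval x.N) := by
  let codes (x : Job P p) (w : x.Seed) := fixedCodesOf x.raw (x.codes w.1)
  let ι : Type := Σ x : Job P p, Σ w : x.Seed, {y : ℕ × List Bool // y.2.length ≤ y.1 ∧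
    y.1 < (codes x w).length}
  obtain ⟨q₁, hq₁⟩ := (PT.fixedCodes (P := P) (p := p)).bdd_right
  have hc : PolyBdd (fun i : ι => i.1.N) fun i => sz (codes i.1 i.2.1) := ⟨q₁, fun i => hq₁ ⟨i.1, i.2.1⟩⟩
  have h1 := PT.refl (s := fun i : ι => i.1.N) (a := fun i : ι => ((i.1.t, (codes i.1 i.2.1).length, 0,
      codes i.1 i.2.1), i.2.2.1.1, i.2.2.1.2, ([] : List Bool)))
    ((((PolyBdd.mul (.const 9) hc).add (.mul (.const 2) .self)).add (.const 20)).mono fun i => by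
      have e1 := i.2.2.2.1
      have e2 := i.2.2.2.2
      have e3 := sz_boolList i.2.2.1.2
      have e4 := length_lt_sz (codes i.1 i.2.1)
      have e5 : i.1.t ≤ i.1.N := Nat.le_add_left _ _
      simp only [sz_pair, sz_nat, sz_nil]
      omega)
  have h2 : FP fun z : (ℕ × ℕ × ℕ × List ICode) × ℕ × List Bool × List Bool =>
      ICode.data z.1.1 (z.1.2.2.2.getD z.2.1 idleI) := by fun_prop
  obtain ⟨Ctl, q, hq⟩ := h1.fp h2
  refine ⟨Ctl, q + q₁, fun x w => ⟨?_, Nat.zero_le _, ?_, fun i hi h r hh hr => ?_⟩⟩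
  · have := hq₁ ⟨x, w⟩
    rw [Polynomial.eval_add]
    exact (length_lt_sz _).le.trans (this.trans (Nat.le_add_left _ _))
  · have := hq₁ ⟨x, w⟩
    rw [Polynomial.eval_add]
    exact this.trans (Nat.le_add_left _ _)
  · have hr' : r = [] := List.length_eq_zero_iff.1 hr
    subst hr'
    exact (hq ⟨x, w, (i, h), hh, hi⟩).congr rfl (ICode.enc_toInstr ..) 
      (by rw [Polynomial.eval_add]; exact Nat.le_add_right _ _)

theorem exists_fixed_post : ∃ (Post : Prog) (q : Polynomial ℕ), ∀ (x : Job P p) (w : x.Seed) (m : List Bool),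
    m.length ≤ x.t → Post.Computes (x.raw, w.1, m) (fixedOut x.raw (x.codes w.1) w.1 m) (q.eval x.N) := by
  let ι : Type := Σ x : Job P p, x.Seed × {m : List Bool // m.length ≤ x.t}
  have hw : PolyBdd (fun i : ι => i.1.N) fun i => i.2.1.1.length :=
    polyBdd_seed (x := fun i : ι => i.1) (w := fun i => i.2.1)
  have hh : PolyBdd (fun i : ι => i.1.N) fun i => i.2.2.1.length :=
    PolyBdd.self.mono fun i => i.2.2.2.trans (Nat.le_add_left _ _)
  have h1 : FP fun z : (Raw × List Bool × List Bool) × List ICode => fixedOut z.1.1 z.2 z.1.2.1 z.1.2.2 := by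
    unfold fixedOut fixedOrder; fun_prop
  obtain ⟨Post, q, h⟩ := ((PT.refl (polyBdd_sz_input hw hh)).pair
    (PT.codes (x := fun i : ι => i.1) (fun i => seed_le i.2.1) hw hh)).fp h1
  exact ⟨Post, q, fun x w m hm => h ⟨x, w, m, hm⟩⟩

theorem exists_fixed_compiles (P : Prog) (p : Polynomial ℕ) : ∃ (Tr Ctl Post : Prog) (q : Polynomial ℕ), ∀ (x
    : Job P p) (l : ℕ), l = p.eval x.N + x.N + (p.eval x.N + x.N) → Compiles Tr Ctl Post (q.eval x.N) l x.g
    x.C x.d (fun r => x.fixed (List.ofFn r))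
        fun r => fixedOut x.raw (x.codes (List.ofFn r)) (List.ofFn r) := by
  obtain ⟨Tr, q₁, h₁⟩ := exists_fixed_translate (P := P) (p := p)
  obtain ⟨Ctl, q₂, h₂⟩ := exists_fixed_control (P := P) (p := p)
  obtain ⟨Post, q₃, h₃⟩ := exists_fixed_post (P := P) (p := p)
  exact ⟨Tr, Ctl, Post, q₁ + q₂ + q₃, fun x l hl => x.compiles (D := x.fixed) (d' := fun w => Encode.enc
    (fixedCodesOf x.raw (x.codes w))) (post := fun w => fixedOut x.raw (x.codes w) w) (h₁ x) (h₂ x) (h₃ x)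
    (fun w => Circuit.ofUnitary_atMostMeas (x.fixed_isUnitary w)) hl⟩

end

end EGK

end

open EGK in
theorem mainTheorem1 (P : Prog) (p : Polynomial ℕ) :
    -- (i)
    (∃ (Tr Ctl Post : Prog) (q l : Polynomial ℕ), ∀ (n t : ℕ) (g : List (SPauli n)) (C : Circuit (n + t)) (d :
      Data), IsStabGens g → C.DescribedBy P d (p.eval (n + t)) → C.NoPost → ∃ (D : (Fin (l.eval (n + t)) →
      Bool) → Circuit t) (post : (Fin (l.eval (n + t)) → Bool) → List Bool → List Bool), Compiles Tr Ctl Post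
      (q.eval (n + t)) (l.eval (n + t)) g C d D post ∧ (∀ r, (D r).NoPost) ∧ ∀ ρ : Op t, IsState ρ →
      SameOutput C (tensor (stabState g) ρ) D ρ post) ∧
    -- (ii)
    (∃ (Tr Ctl Post : Prog) (q l : Polynomial ℕ), ∀ (n t : ℕ) (g : List (SPauli n)) (C : Circuit (n + t)) (d :
      Data), IsStabGens g → C.DescribedBy P d (p.eval (n + t)) → C.NoPost → C.NonAdaptive → ∃ (D : (Fin
      (l.eval (n + t)) → Bool) → Circuit t) (post : (Fin (l.eval (n + t)) → Bool) → List Bool → List Bool),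
      Compiles Tr Ctl Post (q.eval (n + t)) (l.eval (n + t)) g C d D post ∧ (∀ r, (D r).NoPost ∧ (D
      r).IsUnitary) ∧ ∀ ρ : Op t, IsState ρ → SameOutput C (tensor (stabState g) ρ) D ρ post) ∧
    -- (iii), adaptive circuits
    (∃ (Tr Ctl Post : Prog) (q l : Polynomial ℕ), ∀ (n t : ℕ) (g : List (SPauli n)) (C : Circuit (n + t)) (d :
      Data), IsStabGens g → C.DescribedBy P d (p.eval (n + t)) → ∃ (D : (Fin (l.eval (n + t)) → Bool) →
      Circuit t) (post : (Fin (l.eval (n + t)) → Bool) → List Bool → Option (List Bool)), Compiles Tr Ctl Post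
      (q.eval (n + t)) (l.eval (n + t)) g C d D post ∧ (2 ≤ t → ∀ r m, post r m ≠ none) ∧ ∀ ρ : Op t, IsState
      ρ → 0 < C.weight (tensor (stabState g) ρ) Set.univ → SamePostselectedOutput C (tensor (stabState g) ρ) D
      ρ post) ∧
    -- (iii), non-adaptive circuits
    (∃ (Tr Ctl Post : Prog) (q l : Polynomial ℕ), ∀ (n t : ℕ) (g : List (SPauli n)) (C : Circuit (n + t)) (d :
      Data), IsStabGens g → C.DescribedBy P d (p.eval (n + t)) → C.NonAdaptive → C.coins = 0 → ∃ (D : (Fin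
      (l.eval (n + t)) → Bool) → Circuit t) (post : (Fin (l.eval (n + t)) → Bool) → List Bool → List Bool),
      Compiles Tr Ctl Post (q.eval (n + t)) (l.eval (n + t)) g C d D post ∧ (∀ r, (D r).IsUnitary) ∧ ∀ ρ : Op
      t, IsState ρ → 0 < C.weight (tensor (stabState g) ρ) Set.univ → (∀ r, 0 < (D r).weight ρ Set.univ) ∧
            SameOutput C (tensor (stabState g) ρ) D ρ post) := by
  obtain ⟨T₁, C₁, P₁, q₁, h₁⟩ := exists_compiles _ (fun z => z.2.log.output) (by fun_prop) false P p
  obtain ⟨T₂, C₂, P₂, q₂, h₂⟩ := exists_compiles (Option (List Bool)) (fun z => cond z.2.log.ok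
    (some z.2.log.output) (cond (decide (2 ≤ z.1)) (some []) none)) (by fun_prop) true P p
  obtain ⟨T₃, C₃, P₃, q₃, h₃⟩ := exists_fixed_compiles P p
  -- `p` bits for the random bits of the circuit, `n + t` for the values of the lines of the
  -- stabiliser state, and one for each of the `p + (n + t)` steps of the engine, padding included.
  -- The unitary devices need only a bit per step after the bits of the circuit.
  have hl : ∀ n : ℕ, (p + .X + (p + .X) : Polynomial ℕ).eval n = p.eval n + n + (p.eval n + n) := by simp
  refine ⟨⟨T₁, C₁, P₁, q₁, p + .X + (p + .X), fun n t g C d hg hC hP => ?_⟩, ⟨T₃, C₃, P₃, q₃, p + .X + (p +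
    .X), fun n t g C d hg hC hP hA => ?_⟩, ⟨T₂, C₂, P₂, q₂, p + .X + (p + .X), fun n t g C d hg hC => ?_⟩,
    ⟨T₃, C₃, P₃, q₃, p + .X + (p + .X), fun n t g C d hg hC hA h0 => ?_⟩⟩ <;>
  let x : Job P p := ⟨n, t, g, C, d, hg, hC⟩ <;> specialize hl (n + t) <;>
  have h4 : C.length ≤ p.eval (n + t) := hC.1 <;> have h5 : C.coins ≤ p.eval (n + t) := hC.2.1
  · exact ⟨_, _, h₁ x _ hl, fun r => device_noPost _, fun ρ hρ => sameOutput_device hg hP h4 h5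
      (Nat.le_add_right _ _) (Nat.le_add_left _ _) hl rfl hρ⟩
  · exact ⟨_, _, h₃ x _ hl, fun r => ⟨x.fixed_noPost hP (by rw [List.length_ofFn]; exact h5.trans (by omega)),
      x.fixed_isUnitary _⟩, fun ρ hρ => x.sameOutput_fixed hP hA (show C.coins + C.length ≤ _ by omega) hρ⟩
  · exact ⟨_, _, h₂ x _ hl, fun ht r m => postOptOf_ne_none ht _ _, fun ρ _ hpos =>
      samePostselectedOutput_device hg h4 h5 (Nat.le_add_right _ _) (Nat.le_add_left _ _) hl rfl hpos⟩
  · refine ⟨_, _, h₃ x _ hl, fun r => x.fixed_isUnitary _, fun ρ _ hpos => ?_⟩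
    obtain ⟨h6, h7⟩ := x.sameOutput_fixed_of_coins h0 hA (l := (p + .X + (p + .X) : Polynomial ℕ).eval (n + t))
      (show C.length ≤ _ by omega) hpos
    exact ⟨fun r => h6 _, h7⟩
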